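/- **Setting.** Base stations (BSs) form a homogeneous Poisson process of density $\lambda_{BS}>0$ in $\mathbb R^2$; $\lambda_{UE}>0$ is the user density and $\rho=\lambda_{UE}/\lambda_{BS}$. The typical user is at the origin. A link of length at most $D>0$ is LOS with probability $p_{LOS}\in[0,1]$, independently; all other links are NLOS. A link of type $j\in\{L,N\}$ and length $r$ has path loss (in dB) $\beta+10\alpha_j\log_{10}r+S$ with $\beta=20\log_{10}(4\pi/\lambda_c)$, $S\sim N(0,\xi_j^2)$, $\alpha_j,\xi_j>0$, and has $\eta_j\ge1$ paths with independent complex normal gains of zero mean and unit variance. $L(y,0)$ is the path loss from BS $y$ in linear scale. The user is served by the BS $x$ with the smallest path loss (tagged BS). Transmit power is $P>0$, noise power $\sigma_n^2>0$, the BSs and users have $N_{BS},N_{UE}\ge1$ antennas, $G=PN_{BS}N_{UE}$, and a BS serves at most $U_M\ge1$ users at a time. The tagged BS serves $U_x=\min(U_M,N_x)$ users and any other BS $y$ serves $U_y=\min(U_M,N_y)$ users, where $$\mathbb P(N_x=n)=\tfrac{3.5^{3.5}}{(n-1)!}\tfrac{\Gamma(n+3.5)}{\Gamma(3.5)}\rho^{n-1}(3.5+\rho)^{-n-3.5}\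 (n\ge1),\qquad \mathbb P(N_y=n)=\tfrac{3.5^{3.5}}{n!}\tfrac{\Gamma(n+3.5)}{\Gamma(3.5)}\rho^{n}(3.5+\rho)^{-n-3.5}\ (n\ge0);$$ $\tilde p$ is the probability mass function of $U_y$. Virtual angles are quantized to $\{1,\dots,N_a\}$, $a\in\{BS,UE\}$, with probabilities $q_{a,i}=\frac1\pi\left(\arcsin(-1+\frac{2i+1}{N_a})-\arcsin(-1+\frac{2i-1}{N_a})\right)$ for $i<N_a$ and $q_{a,N_a}=1-\sum_{i<N_a}q_{a,i}$. The *zero forcing success probability* is $$\zeta(\eta,U)=\sum_{j=1}^{N_{BS}}q_{BS,j}B_j(\eta,U)\left(p_{LOS}A_j(\eta_L)+(1-p_{LOS})A_j(\eta_N)\right)^{U-1},$$ with $C(\eta)=\sum_i q_{UE,i}(1-q_{UE,i})^{\eta-1}$, $A_j(\eta)=C(\eta)+(1-q_{BS,j})^{\eta-1}(1-C(\eta))$, $B_j(\eta,U)=C(\eta)(1-q_{BS,j})^{U-1}+D_j(\eta,U)(1-C(\eta))$, $D_j(\eta,U)=\sum_{i_1,\dots,i_{\eta-1}=1}^{N_{BS}-1}\prod_n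 l_{i_n,j}\left(1-\sum_{i\in\{i_1,\dots,i_{\eta-1}\}}l_{i,j}\right)^{U-1}$ (the inner sum is over distinct values), where $l_{n,j}=q_{BS,n}/(1-q_{BS,j})$ for $n<j$ and $l_{n,j}=q_{BS,n+1}/(1-q_{BS,j})$ for $n\ge j$. *SINR model.* With sidelobe parameters $\rho_{BS},\rho_{UE}\in[0,1)$ the out-of-cell interference is $$I_0=\sum_{y\ne x}\frac{G\,L(y,0)^{-1}}{\eta_yU_y}\sum_{w=1}^{U_y}\Big|\sum_{j=1}^{\eta_y}\gamma_{j,y}\chi_{j,w,y}\Big|^2$$ (BSs with $U_y=0$ contribute $0$), where $\eta_y$ is the number of paths of the link from $y$, $\gamma_{j,y}$ are the path gains, and $\chi_{j,w,y}$ is the product of $1$ or $\rho_{UE}$, according to whether or not the combining angle $\phi_y$ of the user equals the angle of arrival $\phi_{j,y}$, and of $1$ or $\rho_{BS}$, according to whether or not the precoding angle $\theta_{y,w}$ equals the angle of departure $\theta_{j,y}$. All these angles are independent with laws $q_{UE}$ and $q_{BS}$; in particular the $\phi_y$ are independent for different $y$. For a penalty variable $Z$ put $$\mathrm{SINR}_Z=\frac{\frac{G}{\eta_xU_x}\max_{i\le\eta_x}|\gamma_{i,x}|^2\,L(x,0)^{-1}Z}{\sigma_n^2+I_0}.$$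 Given the type $j$ of the link to $x$ and $U_x=U$, $p_{MU}$ is Bernoulli with success probability $\zeta(\eta_j,U)$, and $p_{ZF}$ is any variable that stochastically dominates it. Both are independent of everything else, and apart from the dependences stated all sources of randomness are independent. *Formulas.* Let $Q$ be the standard normal tail, $m=-0.1\beta\ln10$, $\sigma_j=0.1\xi_j\ln10$, $\Upsilon_j(t)=(\ln(D^{\alpha_j}/t)-m)/\sigma_j$, $e_j=\exp(2\sigma_j^2/\alpha_j^2+2m/\alpha_j)$, $$M_L(t)=\pi p_{LOS}\left[D^2Q(\Upsilon_L(t))+t^{2/\alpha_L}e_LQ(\tfrac{2\sigma_L}{\alpha_L}-\Upsilon_L(t))\right],$$ $$M_N(t)=-\pi p_{LOS}D^2Q(\Upsilon_N(t))+\pi t^{2/\alpha_N}e_N\left[1-p_{LOS}Q(\tfrac{2\sigma_N}{\alpha_N}-\Upsilon_N(t))\right],$$ $B_L=1-e^{-\lambda_{BS}\pi p_{LOS}D^2}$, $B_N=1$, $f_j=\lambda_{BS}e^{-\lambda_{BS}M_j}M_j'/B_j$ (a term with $B_j=0$ is $0$), $\Lambda_j(dt)=\lambda_{BS}M_j'(t)\,dt$,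 $\Lambda=\Lambda_L+\Lambda_N$. Let $L_{I_0,l}(s)=\mathbb E[e^{-sI_0}\mid L(x,0)=l]$ be the conditional Laplace transform, and, with $\bar L=N$, $\bar N=L$, $$\mathcal S(\tau,U)=\sum_{j\in\{L,N\}}B_j\,\zeta(\eta_j,U)\sum_{n=1}^{\eta_j}(-1)^{n+1}\binom{\eta_j}{n}\int_0^\infty \exp\Big(-\frac{\eta_j\tau nUl\sigma_n^2}{G}-\lambda_{BS}M_{\bar j}(l)\Big)f_j(l)\,L_{I_0,l}\Big(\frac{\eta_j\tau nUl}{G}\Big)\,dl .$$ **Theorem.** 1. For every $\tau>0$ and $1\le U\le U_M$ the integrals in $\mathcal S(\tau,U)$ converge and $$\mathbb P(\mathrm{SINR}_{p_{MU}}>\tau\mid U_x=U)=\mathcal S(\tau,U)\le\mathbb P(\mathrm{SINR}_{p_{ZF}}>\tau\mid U_x=U),$$ and hence $\mathbb P(\mathrm{SINR}_{p_{MU}}>\tau)=\mathbb E[\mathcal S(\tau,U_x)]\le\mathbb P(\mathrm{SINR}_{p_{ZF}}>\tau)$. 2. If $\eta_L=\eta_N=1$, then for almost every value $l$ of $L(x,0)$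 and all $s\ge0$, with $\mu=\sum_iq_{UE,i}^2$ and $J(g)=\int_l^\infty\frac{\Lambda(dt)}{1+t/(sGg)}$ (which is $0$ if $sg=0$), $$L_{I_0,l}(s)=\exp\Big(-\sum_{n=1}^{U_M}\tilde p(n)\sum_{k=0}^n\binom nk\sum_{i=1}^{N_{BS}}q_{BS,i}^{k+1}(1-q_{BS,i})^{n-k}\Big\{\mu J\Big(\tfrac{k+(n-k)\rho_{BS}^2}{n}\Big)+(1-\mu)J\Big(\rho_{UE}^2\tfrac{k+(n-k)\rho_{BS}^2}{n}\Big)\Big\}\Big).$$ 3. For any $\eta_L,\eta_N\ge 1$, for almost every value $l$ of $L(x,0)$ and all $s\ge0$, $$\prod_{j\in\{L,N\}}\exp\Big(-\int_l^\infty(1-\mathbb E[\Psi_{t,j}])\Lambda_j(dt)\Big)\le L_{I_0,l}(s)\le\exp\Big(-(1-\tilde p(0))\int_l^\infty\frac{\Lambda(dt)}{1+\frac{t}{sG\rho_{BS}^2\rho_{UE}^2}}\Big),$$ where $\Psi_{t,j}=\Big(1+\frac{sG}{t\,\eta_jU_y}\sum_{w=1}^{U_y}\sum_{i=1}^{\eta_j}\chi_{i,w,y}^2\Big)^{-\eta_j}$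 (equal to $1$ if $U_y=0$), the expectation is over $U_y$ and the angles, and the right-hand side is $1$ if $s\rho_{BS}\rho_{UE}=0$. -/

import Mathlib

open MeasureTheory ProbabilityTheory
open scoped ENNReal

namespace MmWave

noncomputable section

/-- A link is either line of sight (LOS) or not (NLOS). -/
inductive Link
  | los
  | nlos

/-- The opposite type of link. -/
def Link.other : Link → Link
  | .los => .nlos
  | .nlos => .los

/-- The plane in which base stations (BSs) and users live. -/
abbrev Plane : Type := EuclideanSpace ℝ (Fin 2)

/-- The deterministic parameters of the network. -/
structure Params where
  /-- BS density -/
  lamBS : ℝ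
  /-- user density -/
  lamUE : ℝ
  /-- carrier wavelength, in meters -/
  wavelength : ℝ
  /-- probability that a link of length at most `D` is LOS -/
  pLOS : ℝ
  /-- links longer than `D` are NLOS -/
  D : ℝ
  /-- path loss exponents -/
  α : Link → ℝ
  /-- standard deviations of the shadowing in dB -/
  ξ : Link → ℝ
  /-- numbers of paths -/
  η : Link → ℕ
  /-- number of BS antennas -/
  NBS : ℕ
  /-- number of user antennas -/
  NUE : ℕ
  /-- maximal number of users that a BS serves simultaneously -/
  UM : ℕ
  /-- transmit power of a BS -/
  power : ℝ
  /-- noise power -/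
  noise : ℝ
  /-- sidelobe parameter at the BSs -/
  rhoBS : ℝ
  /-- sidelobe parameter at the users -/
  rhoUE : ℝ
  lamBS_pos : 0 < lamBS
  lamUE_pos : 0 < lamUE
  wavelength_pos : 0 < wavelength
  pLOS_nonneg : 0 ≤ pLOS
  pLOS_le_one : pLOS ≤ 1
  D_pos : 0 < D
  α_pos : ∀ a, 0 < α a
  ξ_pos : ∀ a, 0 < ξ a
  η_pos : ∀ a, 1 ≤ η a
  NBS_pos : 1 ≤ NBS
  NUE_pos : 1 ≤ NUE
  UM_pos : 1 ≤ UM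
  power_pos : 0 < power
  noise_pos : 0 < noise
  rhoBS_nonneg : 0 ≤ rhoBS
  rhoBS_lt_one : rhoBS < 1
  rhoUE_nonneg : 0 ≤ rhoUE
  rhoUE_lt_one : rhoUE < 1

/-- `x ↦ exp (-x)` on `[0, ∞]`, with value `0` at `∞`. -/
def negExp (x : ℝ≥0∞) : ℝ := if x = ∞ then 0 else Real.exp (-x.toReal)

/-- The tail of the standard normal distribution. -/
def Q (x : ℝ) : ℝ := (gaussianReal 0 1).real (Set.Ioi x)

/-- The law of the quantized virtual angle of a uniform linear array with `N` antennas: the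
probability of the `i`-th angle, `1 ≤ i ≤ N`. -/
def angleProb (N i : ℕ) : ℝ :=
  if i = N then
    1 - ∑ j ∈ Finset.Icc 1 (N - 1),
      (Real.arcsin (-1 + (2 * j + 1) / N) - Real.arcsin (-1 + (2 * j - 1) / N)) / Real.pi
  else (Real.arcsin (-1 + (2 * i + 1) / N) - Real.arcsin (-1 + (2 * i - 1) / N)) / Real.pi

namespace Params

variable (p : Params)

/-- `G = P N_BS N_UE`. -/
def G : ℝ := p.power * p.NBS * p.NUE

/-- Reference path loss in dB at one meter. -/
def β : ℝ := 20 * Real.logb 10 (4 * Real.pi / p.wavelength)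

def m : ℝ := -0.1 * p.β * Real.log 10

def σ (a : Link) : ℝ := 0.1 * p.ξ a * Real.log 10

def Υ (a : Link) (t : ℝ) : ℝ := (Real.log (p.D ^ p.α a / t) - p.m) / p.σ a

/-- The probabilities of the virtual angles at a BS. -/
def qBS (i : ℕ) : ℝ := angleProb p.NBS i

/-- The probabilities of the virtual angles at a user. -/
def qUE (i : ℕ) : ℝ := angleProb p.NUE i

/-! ### The success probability `ζ` of the zero forcing penalty -/

def C (η : ℕ) : ℝ := ∑ i ∈ Finset.Icc 1 p.NUE, p.qUE i * (1 - p.qUE i) ^ (η - 1)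

def A (j η : ℕ) : ℝ :=
  p.C η + (1 - p.qBS j) ^ (η - 1) - (1 - p.qBS j) ^ (η - 1) * p.C η

def ell (n j : ℕ) : ℝ :=
  if n < j then p.qBS n / (1 - p.qBS j) else p.qBS (n + 1) / (1 - p.qBS j)

def Dcoef (j η U : ℕ) : ℝ :=
  ∑ i ∈ Fintype.piFinset (fun _ : Fin (η - 1) => Finset.Icc 1 (p.NBS - 1)),
    (∏ n, p.ell (i n) j) * (1 - ∑ v ∈ Finset.univ.image i, p.ell v j) ^ (U - 1)

def B (j η U : ℕ) : ℝ :=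
  p.C η * (1 - p.qBS j) ^ (U - 1) + p.Dcoef j η U - p.Dcoef j η U * p.C η

def ζ (η U : ℕ) : ℝ :=
  ∑ j ∈ Finset.Icc 1 p.NBS, p.qBS j * p.B j η U *
    (p.pLOS * p.A j (p.η .los) + (1 - p.pLOS) * p.A j (p.η .nlos)) ^ (U - 1)

/-! ### Loads -/

/-- Users per BS. -/
def load : ℝ := p.lamUE / p.lamBS

/-- The probability mass function of the number of users of the tagged BS. -/
def κServing (n : ℕ) : ℝ :=
  if n = 0 then 0 else
    (3.5 : ℝ) ^ (3.5 : ℝ) / (n - 1).factorial * (Real.Gamma (n + 3.5) / Real.Gamma 3.5) *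
      p.load ^ (n - 1) * (3.5 + p.load) ^ (-(n : ℝ) - 3.5)

/-- The probability mass function of the number of users of any other BS. -/
def κInterf (n : ℕ) : ℝ :=
  (3.5 : ℝ) ^ (3.5 : ℝ) / n.factorial * (Real.Gamma (n + 3.5) / Real.Gamma 3.5) *
    p.load ^ n * (3.5 + p.load) ^ (-(n : ℝ) - 3.5)

/-- The probability mass function of the number `min (U_M, N_y)` of users that a BS other than
the tagged one serves. -/
def pTilde (n : ℕ) : ℝ :=
  if n < p.UM then p.κInterf n
  else if n = p.UM then 1 - ∑ i ∈ Finset.range p.UM, p.κInterf i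
  else 0

/-! ### Propagation losses -/

/-- `e_a = exp (2 σ_a² / α_a² + 2 m / α_a)`. -/
def expConst (a : Link) : ℝ := Real.exp (2 * p.σ a ^ 2 / p.α a ^ 2 + 2 * p.m / p.α a)

/-- `lamBS * M a t` is the expected number of BSs of type `a` with propagation loss below `t`. -/
def M (a : Link) (t : ℝ) : ℝ :=
  match a with
  | .los => Real.pi * p.pLOS * (p.D ^ 2 * Q (p.Υ .los t) +
      t ^ (2 / p.α .los) * p.expConst .los *
        Q (2 * p.σ .los ^ 2 / (p.α .los * p.σ .los) - p.Υ .los t))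
  | .nlos => -Real.pi * p.pLOS * p.D ^ 2 * Q (p.Υ .nlos t) +
      Real.pi * t ^ (2 / p.α .nlos) * p.expConst .nlos *
        (1 - p.pLOS * Q (2 * p.σ .nlos ^ 2 / (p.α .nlos * p.σ .nlos) - p.Υ .nlos t))

/-- The derivative of `M a`, in closed form. -/
def M' (a : Link) (t : ℝ) : ℝ :=
  match a with
  | .los => Real.pi * p.pLOS *
      (p.expConst .los * t ^ (2 / p.α .los - 1) *
        (2 / p.α .los * Q (2 * p.σ .los ^ 2 / (p.α .los * p.σ .los) - p.Υ .los t) -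
          1 / √(2 * Real.pi * p.σ .los ^ 2) *
            Real.exp (-(√2 * p.σ .los / p.α .los - p.Υ .los t / √2) ^ 2)) +
        p.D ^ 2 / (√(2 * Real.pi) * t * p.σ .los) * Real.exp (-p.Υ .los t ^ 2 / 2))
  | .nlos => Real.pi *
      (p.expConst .nlos * t ^ (2 / p.α .nlos - 1) *
        (2 / p.α .nlos -
          p.pLOS * (2 / p.α .nlos) *
            Q (2 * p.σ .nlos ^ 2 / (p.α .nlos * p.σ .nlos) - p.Υ .nlos t) +
          p.pLOS * (1 / √(2 * Real.pi * p.σ .nlos ^ 2)) *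
            Real.exp (-(√2 * p.σ .nlos / p.α .nlos - p.Υ .nlos t / √2) ^ 2)) -
        p.pLOS * p.D ^ 2 / (√(2 * Real.pi) * t * p.σ .nlos) * Real.exp (-p.Υ .nlos t ^ 2 / 2))

/-- The probability that there is a BS of type `a`. -/
def Bprob (a : Link) : ℝ :=
  match a with
  | .los => 1 - Real.exp (-p.lamBS * Real.pi * p.pLOS * p.D ^ 2)
  | .nlos => 1

/-- The density of the smallest propagation loss of a BS of type `a`, given that there is one. -/
def f (a : Link) (t : ℝ) : ℝ :=
  p.lamBS * Real.exp (-p.lamBS * p.M a t) * p.M' a t / p.Bprob a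

/-- The density of the intensity measure `Λ_a` of the propagation losses of type `a`. -/
def intensity (a : Link) (t : ℝ) : ℝ := p.lamBS * p.M' a t

/-! ### Coverage and interference formulas -/

/-- The integrand of the coverage formula. Here `L s l` stands for the Laplace transform of the
out-of-cell interference at `s`, given that the propagation loss from the tagged BS is `l`. -/
def coverageIntegrand (L : ℝ → ℝ → ℝ) (τ : ℝ) (U : ℕ) (a : Link) (n : ℕ) (l : ℝ) : ℝ :=
  Real.exp (-(p.η a * τ * n * U * l * p.noise / p.G) - p.lamBS * p.M a.other l) *
    p.f a l * L (p.η a * τ * n * U * l / p.G) l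

/-- The contribution of tagged BSs of type `a` to the coverage formula. -/
def coverageTerm (L : ℝ → ℝ → ℝ) (τ : ℝ) (U : ℕ) (a : Link) : ℝ :=
  p.Bprob a * p.ζ (p.η a) U *
    ∑ n ∈ Finset.Icc 1 (p.η a), (-1) ^ (n + 1) * ((p.η a).choose n : ℝ) *
      ∫ l in Set.Ioi 0, p.coverageIntegrand L τ U a n l

/-- The coverage formula for a tagged BS that serves `U` users. -/
def S (L : ℝ → ℝ → ℝ) (τ : ℝ) (U : ℕ) : ℝ :=
  p.coverageTerm L τ U .los + p.coverageTerm L τ U .nlos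

/-- `∫_{t ≥ l} Λ(dt) / (1 + (s G g / t)⁻¹)`, where `Λ = Λ_L + Λ_N`. -/
def lossIntegral (s l g : ℝ) : ℝ≥0∞ :=
  ∫⁻ t in Set.Ici l, ENNReal.ofReal
    ((p.intensity .los t + p.intensity .nlos t) * ((s * p.G * g / t) / (1 + s * p.G * g / t)))

/-- The probability that two independent virtual angles at a user coincide. -/
def matchUE : ℝ := ∑ i ∈ Finset.Icc 1 p.NUE, p.qUE i ^ 2

/-- The Laplace transform of the interference for single-path channels. A BS without scheduled
users does not interfere, so that the sum starts at `n = 1`. -/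
def laplaceSinglePath (s l : ℝ) : ℝ :=
  negExp (∑ n ∈ Finset.Icc 1 p.UM, ENNReal.ofReal (p.pTilde n) *
    ∑ k ∈ Finset.range (n + 1),
      ENNReal.ofReal ((n.choose k : ℝ) *
        ∑ i ∈ Finset.Icc 1 p.NBS, p.qBS i ^ (k + 1) * (1 - p.qBS i) ^ (n - k)) *
      (ENNReal.ofReal p.matchUE *
          p.lossIntegral s l ((k + (n - k) * p.rhoBS ^ 2) / n) +
        ENNReal.ofReal (1 - p.matchUE) *
          p.lossIntegral s l (p.rhoUE ^ 2 * (k + (n - k) * p.rhoBS ^ 2) / n)))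

/-- The upper bound for the Laplace transform of the interference: the interference is at least
that of the active BSs, all of whose beams see sidelobes only. -/
def laplaceUpper (s l : ℝ) : ℝ :=
  negExp (ENNReal.ofReal (1 - p.pTilde 0) *
    p.lossIntegral s l (p.rhoBS ^ 2 * p.rhoUE ^ 2))

/-- The product of the two inner products of beam steering vectors: `φ, φ'` are angles at the
user, `θ, θ'` are angles at the BS. -/
def gain (φ φ' θ θ' : ℕ) : ℝ :=
  (if φ = φ' then 1 else p.rhoUE) * (if θ = θ' then 1 else p.rhoBS)

/-- The expectation of `(1 + s G / (t η n) ∑_w ∑_j χ_{j,w}²)^(-η)` over the independent angles, for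
a BS with propagation loss `t` and link type `a` that serves `n` users. -/
def ΨGiven (a : Link) (s t : ℝ) (n : ℕ) : ℝ :=
  ∑ φ₀ ∈ Finset.Icc 1 p.NUE,
    ∑ φ ∈ Fintype.piFinset (fun _ : Fin (p.η a) => Finset.Icc 1 p.NUE),
      ∑ θ ∈ Fintype.piFinset (fun _ : Fin (p.η a) => Finset.Icc 1 p.NBS),
        ∑ b ∈ Fintype.piFinset (fun _ : Fin n => Finset.Icc 1 p.NBS),
          (p.qUE φ₀ * (∏ j, p.qUE (φ j)) * (∏ j, p.qBS (θ j)) * ∏ w, p.qBS (b w)) *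
            ((1 + s * p.G / (t * p.η a * n) *
              ∑ w, ∑ j, p.gain φ₀ (φ j) (b w) (θ j) ^ 2) ^ p.η a)⁻¹

/-- The expectation `𝔼[Ψ_{t,a}]` over the number of served users as well. -/
def Ψ (a : Link) (s t : ℝ) : ℝ :=
  ∑ n ∈ Finset.range (p.UM + 1), p.pTilde n * p.ΨGiven a s t n

/-- The lower bound for the Laplace transform of the interference. -/
def laplaceLower (s l : ℝ) : ℝ :=
  negExp (∫⁻ t in Set.Ici l, ENNReal.ofReal ((1 - p.Ψ .los s t) * p.intensity .los t)) *
  negExp (∫⁻ t in Set.Ici l, ENNReal.ofReal ((1 - p.Ψ .nlos s t) * p.intensity .nlos t))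

end Params

/-! ### The random network -/

/-- The independent sources of randomness. BSs are numbered by `y : ℕ`. -/
inductive Source
  /-- the positions of all BSs -/
  | positions
  /-- whether BS `y`, if within distance `D`, is LOS -/
  | losMark (y : ℕ)
  /-- shadowing in dB for BS `y`, if its link is of type `a` -/
  | shadowing (a : Link) (y : ℕ)
  /-- small scale fading on the `j`-th path from BS `y` to the typical user -/
  | fading (y j : ℕ)
  /-- number of users of BS `y`, if it is not the tagged BS -/
  | load (y : ℕ)
  /-- combining direction of the typical user, as seen in the interference from BS `y` -/
  | combiner (y : ℕ)
  /-- angle of arrival of the `j`-th path from BS `y` to the typical user -/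
  | aoa (y j : ℕ)
  /-- angle of departure of the `j`-th path from BS `y` to the typical user -/
  | aod (y j : ℕ)
  /-- precoding direction of BS `y` for its `w`-th user -/
  | precoder (y w : ℕ)
  /-- number of users of the tagged BS -/
  | servingLoad
  /-- Bernoulli model of the zero forcing penalty, for link type `a` and `u` served users -/
  | penaltyMU (a : Link) (u : ℕ)
  /-- zero forcing penalty, for link type `a` and `u` served users -/
  | penaltyZF (a : Link) (u : ℕ)

/-- The space of values of a source. -/
@[reducible] def Source.Space : Source → Type
  | .positions => ℕ → Plane
  | .losMark _ => Bool
  | .shadowing _ _ => ℝ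
  | .fading _ _ => ℂ
  | .load _ => ℕ
  | .combiner _ => ℕ
  | .aoa _ _ => ℕ
  | .aod _ _ => ℕ
  | .precoder _ _ => ℕ
  | .servingLoad => ℕ
  | .penaltyMU _ _ => ℝ
  | .penaltyZF _ _ => ℝ

instance Source.instMeasurableSpace : (s : Source) → MeasurableSpace s.Space
  | .positions => inferInstanceAs (MeasurableSpace (ℕ → Plane))
  | .losMark _ => inferInstanceAs (MeasurableSpace Bool)
  | .shadowing _ _ => inferInstanceAs (MeasurableSpace ℝ)
  | .fading _ _ => inferInstanceAs (MeasurableSpace ℂ)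
  | .load _ => inferInstanceAs (MeasurableSpace ℕ)
  | .combiner _ => inferInstanceAs (MeasurableSpace ℕ)
  | .aoa _ _ => inferInstanceAs (MeasurableSpace ℕ)
  | .aod _ _ => inferInstanceAs (MeasurableSpace ℕ)
  | .precoder _ _ => inferInstanceAs (MeasurableSpace ℕ)
  | .servingLoad => inferInstanceAs (MeasurableSpace ℕ)
  | .penaltyMU _ _ => inferInstanceAs (MeasurableSpace ℝ)
  | .penaltyZF _ _ => inferInstanceAs (MeasurableSpace ℝ)

/-- The number of points of the sequence `x` in `A`. -/
def count {E : Type*} (x : ℕ → E) (A : Set E) : ℕ∞ := {i | x i ∈ A}.encard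

/-- The random points `x ω 0, x ω 1, …` form a Poisson point process with intensity measure `Λ`:
the numbers of points in sets of finite intensity are Poisson distributed, and they are
independent for disjoint sets. -/
structure IsPoissonProcess {Ω E : Type*} [MeasurableSpace Ω] [MeasurableSpace E]
    (x : Ω → ℕ → E) (Λ : Measure E) (P : Measure Ω) : Prop where
  count_law : ∀ A : Set E, MeasurableSet A → Λ A ≠ ∞ → ∀ n : ℕ,
    P {ω | count (x ω) A = n} =
      ENNReal.ofReal (Real.exp (-Λ.real A) * Λ.real A ^ n / n.factorial)
  indep : ∀ (k : ℕ) (A : Fin k → Set E), (∀ i, MeasurableSet (A i)) → (∀ i, Λ (A i) ≠ ∞) →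
    Pairwise (fun i j => Disjoint (A i) (A j)) →
      iIndepFun (fun i ω => count (x ω) (A i)) P

/-- The law of a complex normal random variable with zero mean and unit variance. -/
def complexNormal : Measure ℂ :=
  ((gaussianReal 0 (1 / 2)).prod (gaussianReal 0 (1 / 2))).map
    (fun z : ℝ × ℝ => (⟨z.1, z.2⟩ : ℂ))

section Network

variable {Ω : Type*} (p : Params) (X : (s : Source) → Ω → s.Space)

/-- Position of BS `y`. The typical user is at the origin. -/
def position (y : ℕ) (ω : Ω) : Plane := (X .positions ω : ℕ → Plane) y

def losMark (y : ℕ) (ω : Ω) : Bool := X (.losMark y) ω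

def shadowing (a : Link) (y : ℕ) (ω : Ω) : ℝ := X (.shadowing a y) ω

def fading (y j : ℕ) (ω : Ω) : ℂ := X (.fading y j) ω

def load (y : ℕ) (ω : Ω) : ℕ := X (.load y) ω

def combiner (y : ℕ) (ω : Ω) : ℕ := X (.combiner y) ω

def aoa (y j : ℕ) (ω : Ω) : ℕ := X (.aoa y j) ω

def aod (y j : ℕ) (ω : Ω) : ℕ := X (.aod y j) ω

def precoder (y w : ℕ) (ω : Ω) : ℕ := X (.precoder y w) ω

def servingLoad (ω : Ω) : ℕ := X .servingLoad ω

def penaltyMU (a : Link) (u : ℕ) (ω : Ω) : ℝ := X (.penaltyMU a u) ω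

def penaltyZF (a : Link) (u : ℕ) (ω : Ω) : ℝ := X (.penaltyZF a u) ω

/-- The sources are independent and have the laws of the model. -/
structure IsNetwork [MeasurableSpace Ω] (P : Measure Ω) : Prop where
  measurable : ∀ s, Measurable (X s)
  indep : iIndepFun X P
  positions_law : IsPoissonProcess (fun ω y => position X y ω)
    (ENNReal.ofReal p.lamBS • (volume : Measure Plane)) P
  losMark_law : ∀ y, P {ω | losMark X y ω = true} = ENNReal.ofReal p.pLOS
  shadowing_law : ∀ a y, P.map (shadowing X a y) = gaussianReal 0 (p.ξ a ^ 2).toNNReal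
  fading_law : ∀ y j, P.map (fading X y j) = complexNormal
  load_law : ∀ y n, P {ω | load X y ω = n} = ENNReal.ofReal (p.κInterf n)
  combiner_law : ∀ y, ∀ i ∈ Finset.Icc 1 p.NUE,
    P {ω | combiner X y ω = i} = ENNReal.ofReal (p.qUE i)
  aoa_law : ∀ y j, ∀ i ∈ Finset.Icc 1 p.NUE,
    P {ω | aoa X y j ω = i} = ENNReal.ofReal (p.qUE i)
  aod_law : ∀ y j, ∀ i ∈ Finset.Icc 1 p.NBS,
    P {ω | aod X y j ω = i} = ENNReal.ofReal (p.qBS i)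
  precoder_law : ∀ y w, ∀ i ∈ Finset.Icc 1 p.NBS,
    P {ω | precoder X y w ω = i} = ENNReal.ofReal (p.qBS i)
  servingLoad_law : ∀ n, P {ω | servingLoad X ω = n} = ENNReal.ofReal (p.κServing n)
  /-- `p_MU` is a Bernoulli variable with success probability `ζ`. -/
  penaltyMU_law_one : ∀ a u, 1 ≤ u →
    P {ω | penaltyMU X a u ω = 1} = ENNReal.ofReal (p.ζ (p.η a) u)
  penaltyMU_law_zero : ∀ a u, 1 ≤ u →
    P {ω | penaltyMU X a u ω = 0} = ENNReal.ofReal (1 - p.ζ (p.η a) u)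
  /-- `p_ZF` stochastically dominates `p_MU`. -/
  penaltyZF_dominates : ∀ a u, 1 ≤ u → ∀ z : ℝ,
    P {ω | z < penaltyMU X a u ω} ≤ P {ω | z < penaltyZF X a u ω}

open Classical in
/-- The type of the link from BS `y` to the typical user. -/
def linkType (y : ℕ) (ω : Ω) : Link :=
  if ‖position X y ω‖ ≤ p.D ∧ losMark X y ω = true then .los else .nlos

/-- The number of paths from BS `y` to the typical user. -/
def paths (y : ℕ) (ω : Ω) : ℕ := p.η (linkType p X y ω)

/-- The path loss from BS `y` to the typical user, in dB. -/
def pathLossDB (y : ℕ) (ω : Ω) : ℝ :=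
  p.β + 10 * p.α (linkType p X y ω) * Real.logb 10 ‖position X y ω‖ +
    shadowing X (linkType p X y ω) y ω

/-- The path loss from BS `y` to the typical user, in linear scale. -/
def pathLoss (y : ℕ) (ω : Ω) : ℝ := (10 : ℝ) ^ (pathLossDB p X y ω / 10)

open Classical in
/-- The tagged BS: the one with the smallest path loss (it exists almost surely). -/
def tagged (ω : Ω) : ℕ :=
  if h : ∃ y, ∀ z, pathLoss p X y ω ≤ pathLoss p X z ω then Nat.find h else 0

/-- The path loss from the tagged BS. -/
def servingLoss (ω : Ω) : ℝ := pathLoss p X (tagged p X ω) ω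

/-- The number of users served by the tagged BS. -/
def servedUsers (ω : Ω) : ℕ := min p.UM (servingLoad X ω)

/-- The number of users served by BS `y`, if it is not the tagged BS. -/
def users (y : ℕ) (ω : Ω) : ℕ := min p.UM (load X y ω)

/-- The attenuation `χ_{j,w}` of the `j`-th path from BS `y`, for the beam to its `w`-th user. -/
def chi (y j w : ℕ) (ω : Ω) : ℝ :=
  p.gain (combiner X y ω) (aoa X y j ω) (precoder X y w ω) (aod X y j ω)

/-- The interference from BS `y` at the typical user. -/
def interferenceFrom (y : ℕ) (ω : Ω) : ℝ :=
  p.G * (pathLoss p X y ω)⁻¹ / (paths p X y ω * users p X y ω) *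
    ∑ w ∈ Finset.range (users p X y ω),
      ‖∑ j ∈ Finset.range (paths p X y ω), fading X y j ω * (chi p X y j w ω : ℂ)‖ ^ 2

/-- The out-of-cell interference `I_0` at the typical user. -/
def interference (ω : Ω) : ℝ≥0∞ :=
  ∑' y, if y = tagged p X ω then 0 else ENNReal.ofReal (interferenceFrom p X y ω)

/-- The power that the typical user receives from the tagged BS `x`, when the zero forcing penalty
is `pen`. -/
def signal (pen : Link → ℕ → Ω → ℝ) (ω : Ω) : ℝ :=
  p.G / (paths p X (tagged p X ω) ω * servedUsers p X ω) *
    (⨆ j : Fin (paths p X (tagged p X ω) ω), ‖fading X (tagged p X ω) j ω‖ ^ 2) *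
    (servingLoss p X ω)⁻¹ * pen (linkType p X (tagged p X ω) ω) (servedUsers p X ω) ω

/-- The SINR of the typical user, when the zero forcing penalty is `pen`. -/
def sinr (pen : Link → ℕ → Ω → ℝ) (ω : Ω) : ℝ≥0∞ :=
  ENNReal.ofReal (signal p X pen ω) / (ENNReal.ofReal p.noise + interference p X ω)

/-- The event that the typical user is covered at the SINR threshold `τ`. -/
def covered (pen : Link → ℕ → Ω → ℝ) (τ : ℝ) : Set Ω :=
  {ω | ENNReal.ofReal τ < sinr p X pen ω}

/-- The conditional Laplace transform `L_{I_0,l}(s) = 𝔼[exp (-s I_0) | L(x,0) = l]` of the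
out-of-cell interference, given that the path loss from the tagged BS is `l`. -/
def laplace [MeasurableSpace Ω] (P : Measure Ω) [IsFiniteMeasure P] (s l : ℝ) : ℝ :=
  ∫ i, negExp (ENNReal.ofReal s * i)
    ∂(condDistrib (interference p X) (servingLoss p X) P l)

end Network

end

end MmWave

/-! The typical user sees base stations only through points made of a path loss, a link type and
further marks. Independent marking and mapping preserve the Poisson property (`IsPoissonSeq.mark`,
`IsPoissonSeq.map`), so these points form a Poisson process. Averaging disk areas over the Gaussian
shadowing (`lossMeasure_Iic`) shows that its losses of type `a` have density `lamBS * M' a`.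
Throughout, a Poisson process is used through its Laplace functional E exp(-∑ g) = exp(-∫ (1 -
exp(-g)) dΛ). This follows from the counts by simple functions.

The tagged station is the point with the smallest loss ℓ. Its law has density exp(-Λ{ℓ ≤ ℓ(y)}) with
respect to Λ, and given it the other points are the process restricted to {ℓ > ℓ(y)}
(`lintegral_nearestFunctional`). To see this, the range of ℓ is cut into thin cells. The event that
a cell holds exactly one point, with nothing else below its end, is isolated by differentiating the
Laplace functional in the weight given to the cell (`lintegral_one_point`). Because a finite measure
on [0, ∞] is determined by its Laplace transform (`measure_ext_of_laplace`), this yields the joint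
law of the tagged point and the interference (`map_nearest`) and hence the conditional law. The
conditional Laplace transform is therefore exp(-∫ (1 - m) dΛ) over losses above l, where m is the
mean of exp(-s · interference) for one station (`ae_laplace_eq`).

The closed form and the bounds are statements about m. Given the angles, the combined fading along
one beam is complex normal, and its squared modulus is a multiple of an exponential variable. With a
single path all beams share that variable and m is explicit. With several paths, Cauchy–Schwarz
bounds the interference from above, and Jensen's inequality over the beams together with the
sidelobe level bounds m from above.

For coverage, condition on the tagged loss and the interference. The strongest of η exponential
variables exceeds x with probability 1 - (1 - exp(-x))^η. After binomial expansion, averaging over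
the interference turns each term into a Laplace transform, and integrating against the density of
the tagged loss gives `S`. The Bernoulli penalty contributes the factor ζ. For a dominating penalty,
coverage is a strict inequality and so survives penalties slightly below 1, where stochastic
dominance applies to a half-line. -/

namespace MmWave

noncomputable section

open Filter Topology

/-! ### The exponential `x ↦ exp (-x)` on `[0, ∞]` -/

/-- `exp (-x)` for `x ∈ [0, ∞]`, as an extended nonnegative real. -/
def nexp (x : ℝ≥0∞) : ℝ≥0∞ := EReal.exp (-(x : EReal))

@[simp] lemma nexp_zero : nexp 0 = 1 := by simp [nexp]

@[simp] lemma nexp_top : nexp ∞ = 0 := by simp [nexp]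

lemma nexp_ofReal {r : ℝ} (hr : 0 ≤ r) :
    nexp (ENNReal.ofReal r) = ENNReal.ofReal (Real.exp (-r)) := by
  rw [nexp, EReal.coe_ennreal_ofReal, max_eq_left hr, ← EReal.coe_neg, EReal.exp_coe]

lemma nexp_antitone : Antitone nexp := fun a b h => by
  simpa [nexp] using h

lemma nexp_le_one (x : ℝ≥0∞) : nexp x ≤ 1 := by
  simpa using nexp_antitone (bot_le (a := x))

lemma nexp_ne_top (x : ℝ≥0∞) : nexp x ≠ ∞ := ne_top_of_le_ne_top ENNReal.one_ne_top (nexp_le_one x)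

lemma continuous_nexp : Continuous nexp := by
  have h : Continuous fun x : ℝ≥0∞ => -(x : EReal) :=
    continuous_neg.comp continuous_coe_ennreal_ereal
  exact ENNReal.continuous_exp.comp h

@[fun_prop]
lemma measurable_nexp : Measurable nexp := continuous_nexp.measurable

lemma nexp_add (x y : ℝ≥0∞) : nexp (x + y) = nexp x * nexp y := by
  rw [nexp, nexp, nexp, ← EReal.exp_add, EReal.coe_ennreal_add, EReal.neg_add]
  · rfl
  · exact Or.inl (by simp)
  · exact Or.inr (by simp)

lemma nexp_sum {ι : Type*} (s : Finset ι) (f : ι → ℝ≥0∞) :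
    nexp (∑ i ∈ s, f i) = ∏ i ∈ s, nexp (f i) := by
  classical
  induction s using Finset.induction_on with
  | empty => simp
  | insert a s ha ih => rw [Finset.sum_insert ha, Finset.prod_insert ha, nexp_add, ih]

lemma nexp_eq_zero {x : ℝ≥0∞} : nexp x = 0 ↔ x = ∞ := by
  simp [nexp]

lemma nexp_nsmul (n : ℕ) (x : ℝ≥0∞) : nexp (n * x) = nexp x ^ n := by
  induction n with
  | zero => simp
  | succ n ih => rw [Nat.cast_succ, add_mul, one_mul, nexp_add, ih, pow_succ]

lemma tendsto_prod_nexp (f : ℕ → ℝ≥0∞) :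
    Tendsto (fun n => ∏ i ∈ Finset.range n, nexp (f i)) atTop (𝓝 (nexp (∑' i, f i))) := by
  simp_rw [← nexp_sum]
  exact (continuous_nexp.tendsto _).comp (ENNReal.tendsto_nat_tsum f)

/-- The inverse of `nexp` on `[0, 1]`. -/
def nlog (x : ℝ≥0∞) : ℝ≥0∞ := (-(ENNReal.log x)).toENNReal

/-- Every function with values in [0, 1] is thus of the form exp(-g), so it can be fed to a Laplace
functional. The values 0 and ∞ correspond to each other. -/
lemma nexp_nlog {x : ℝ≥0∞} (hx : x ≤ 1) : nexp (nlog x) = x := by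
  have h : 0 ≤ -(ENNReal.log x) := by
    rw [EReal.le_neg, neg_zero]
    exact ENNReal.log_le_zero_iff.2 hx
  rw [nexp, nlog, EReal.coe_toENNReal h, neg_neg, ENNReal.exp_log]

@[fun_prop]
lemma measurable_nlog : Measurable nlog :=
  (ENNReal.measurable_log.neg).ereal_toENNReal

lemma ofReal_negExp (x : ℝ≥0∞) : ENNReal.ofReal (negExp x) = nexp x := by
  unfold negExp
  split_ifs with h
  · simp [h]
  · rw [← nexp_ofReal ENNReal.toReal_nonneg, ENNReal.ofReal_toReal h]

lemma negExp_nonneg (x : ℝ≥0∞) : 0 ≤ negExp x := by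
  unfold negExp
  split_ifs
  · exact le_rfl
  · positivity

lemma negExp_eq_toReal (x : ℝ≥0∞) : negExp x = (nexp x).toReal := by
  rw [← ofReal_negExp, ENNReal.toReal_ofReal (negExp_nonneg x)]

lemma continuous_negExp : Continuous negExp := by
  rw [funext negExp_eq_toReal]
  exact continuous_iff_continuousAt.2 fun x =>
    (ENNReal.tendsto_toReal (nexp_ne_top x)).comp continuous_nexp.continuousAt

lemma negExp_le_one (x : ℝ≥0∞) : negExp x ≤ 1 := by
  rw [negExp_eq_toReal]
  exact ENNReal.toReal_le_of_le_ofReal zero_le_one (by simpa using nexp_le_one x)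

lemma negExp_antitone : Antitone negExp := fun a b h => by
  rw [negExp_eq_toReal, negExp_eq_toReal]
  exact ENNReal.toReal_mono (nexp_ne_top a) (nexp_antitone h)

lemma negExp_add (x y : ℝ≥0∞) : negExp (x + y) = negExp x * negExp y := by
  simp [negExp_eq_toReal, nexp_add]

end

end MmWave

namespace MmWave

noncomputable section

open Filter Topology

/-! ### Poisson sequences -/

/-- The random points `ξ 0, ξ 1, …` have the Laplace functional of a Poisson process with
intensity measure `Λ`. -/
structure IsPoissonSeq {Ω E : Type*} [MeasurableSpace Ω] [MeasurableSpace E]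
    (ξ : ℕ → Ω → E) (Λ : Measure E) (P : Measure Ω) : Prop where
  measurable : ∀ z, Measurable (ξ z)
  laplace : ∀ g : E → ℝ≥0∞, Measurable g →
    ∫⁻ ω, nexp (∑' z, g (ξ z ω)) ∂P = nexp (∫⁻ x, (1 - nexp (g x)) ∂Λ)

section

variable {Ω E F : Type*} [MeasurableSpace Ω] [MeasurableSpace E] [MeasurableSpace F]
  {P : Measure Ω} {Λ : Measure E}

/-- The functional sums over indices and not over a set of points, so points merged by `φ` keep
their multiplicity and no injectivity is needed. -/
lemma IsPoissonSeq.map {ξ : ℕ → Ω → E} (h : IsPoissonSeq ξ Λ P) {φ : E → F}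
    (hφ : Measurable φ) : IsPoissonSeq (fun z ω => φ (ξ z ω)) (Λ.map φ) P where
  measurable z := hφ.comp (h.measurable z)
  laplace g hg := by
    rw [lintegral_map (by fun_prop) hφ]
    exact h.laplace (fun x => g (φ x)) (hg.comp hφ)

/-- Independence factors the finite partial products, and dominated convergence with bound 1 passes
to the limit. Writing the limit as exp(-∑) of logarithms avoids infinite products. -/
lemma lintegral_nexp_tsum_of_iIndepFun [IsProbabilityMeasure P] {m : ℕ → Ω → F}
    (hm : ∀ z, Measurable (m z)) (hi : iIndepFun m P) {f : ℕ → F → ℝ≥0∞}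
    (hf : ∀ z, Measurable (f z)) :
    ∫⁻ ω, nexp (∑' z, f z (m z ω)) ∂P =
      nexp (∑' z, nlog (∫⁻ x, nexp (f z x) ∂(P.map (m z)))) := by
  have hle : ∀ z, ∫⁻ x, nexp (f z x) ∂(P.map (m z)) ≤ 1 := fun z => by
    have : IsProbabilityMeasure (P.map (m z)) := Measure.isProbabilityMeasure_map (hm z).aemeasurable
    calc ∫⁻ x, nexp (f z x) ∂(P.map (m z)) ≤ ∫⁻ _, 1 ∂(P.map (m z)) :=
          lintegral_mono fun x => nexp_le_one _
      _ = 1 := by simp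
  have h1 : Tendsto (fun n => ∫⁻ ω, ∏ z ∈ Finset.range n, nexp (f z (m z ω)) ∂P) atTop
      (𝓝 (∫⁻ ω, nexp (∑' z, f z (m z ω)) ∂P)) := by
    refine tendsto_lintegral_of_dominated_convergence (fun _ => 1) (fun n => ?_) (fun n => ?_)
      (by simp) ?_
    · exact Finset.measurable_fun_prod _ fun z _ =>
        measurable_nexp.comp ((hf z).comp (hm z))
    · exact ae_of_all _ fun ω => Finset.prod_le_one' fun z _ => nexp_le_one _
    · exact ae_of_all _ fun ω => tendsto_prod_nexp _
  have h2 : ∀ n, ∫⁻ ω, ∏ z ∈ Finset.range n, nexp (f z (m z ω)) ∂P =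
      ∏ z ∈ Finset.range n, nexp (nlog (∫⁻ x, nexp (f z x) ∂(P.map (m z)))) := fun n => by
    have hi' : iIndepFun (fun z ω => nexp (f z (m z ω))) P :=
      hi.comp (fun z x => nexp (f z x)) fun z => measurable_nexp.comp (hf z)
    rw [lintegral_prod_eq_prod_lintegral_of_indepFun _ _ hi'
      fun z => measurable_nexp.comp ((hf z).comp (hm z))]
    refine Finset.prod_congr rfl fun z _ => ?_
    rw [nexp_nlog (hle z), lintegral_map (f := fun x => nexp (f z x))
      (measurable_nexp.comp (hf z)) (hm z)]
  simp_rw [h2] at h1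
  exact tendsto_nhds_unique h1 (tendsto_prod_nexp _)

/-- Marking theorem: independent marks turn a Poisson process into a Poisson process. -/
theorem IsPoissonSeq.mark [IsProbabilityMeasure P] [SFinite Λ] {ξ : ℕ → Ω → E}
    (h : IsPoissonSeq ξ Λ P) {m : ℕ → Ω → F} (hm : ∀ z, Measurable (m z)) {ν : Measure F}
    (hν : ∀ z, P.map (m z) = ν) (hi : iIndepFun m P)
    (hξm : IndepFun (fun ω z => ξ z ω) (fun ω z => m z ω) P) :
    IsPoissonSeq (fun z ω => (ξ z ω, m z ω)) (Λ.prod ν) P where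
  measurable z := (h.measurable z).prodMk (hm z)
  laplace g hg := by
    have hνp : IsProbabilityMeasure ν := by
      rw [← hν 0]; exact Measure.isProbabilityMeasure_map (hm 0).aemeasurable
    have hξ' : Measurable fun ω z => ξ z ω := measurable_pi_iff.2 h.measurable
    have hm' : Measurable fun ω z => m z ω := measurable_pi_iff.2 hm
    have hle : ∀ x, ∫⁻ y, nexp (g (x, y)) ∂ν ≤ 1 := fun x =>
      calc ∫⁻ y, nexp (g (x, y)) ∂ν ≤ ∫⁻ _, 1 ∂ν := lintegral_mono fun y => nexp_le_one _
        _ = 1 := by simp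
    have hG : Measurable fun x => ∫⁻ y, nexp (g (x, y)) ∂ν :=
      (measurable_nexp.comp hg).lintegral_prod_right'
    have hH : Measurable fun q : (ℕ → E) × (ℕ → F) => nexp (∑' z, g (q.1 z, q.2 z)) :=
      measurable_nexp.comp (Measurable.tsum fun z =>
        hg.comp (((measurable_pi_apply z).comp measurable_fst).prodMk
          ((measurable_pi_apply z).comp measurable_snd)))
    calc ∫⁻ ω, nexp (∑' z, g (ξ z ω, m z ω)) ∂P
        = ∫⁻ q, nexp (∑' z, g (q.1 z, q.2 z))
            ∂(P.map fun ω => ((fun z => ξ z ω), (fun z => m z ω))) := by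
          rw [lintegral_map hH (hξ'.prodMk hm')]
      _ = ∫⁻ a, ∫⁻ ω, nexp (∑' z, g (a z, m z ω)) ∂P ∂(P.map fun ω z => ξ z ω) := by
          rw [(indepFun_iff_map_prod_eq_prod_map_map hξ'.aemeasurable hm'.aemeasurable).1 hξm,
            lintegral_prod _ hH.aemeasurable]
          refine lintegral_congr fun a => ?_
          rw [lintegral_map (f := fun y : ℕ → F => nexp (∑' z, g (a z, y z)))
            (hH.comp measurable_prodMk_left) hm']
      -- With the points frozen, only the independent marks are random. Averaging over them replaces
      -- `g` by minus the logarithm of the mark average of exp(-g), a function of the points alone.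
      _ = ∫⁻ a, nexp (∑' z, nlog (∫⁻ y, nexp (g (a z, y)) ∂ν)) ∂(P.map fun ω z => ξ z ω) := by
          refine lintegral_congr fun a => ?_
          rw [lintegral_nexp_tsum_of_iIndepFun hm hi
            (f := fun z y => g (a z, y)) fun z => hg.comp measurable_prodMk_left]
          simp_rw [hν]
      _ = ∫⁻ ω, nexp (∑' z, nlog (∫⁻ y, nexp (g (ξ z ω, y)) ∂ν)) ∂P := by
          rw [lintegral_map _ hξ']
          exact measurable_nexp.comp (Measurable.tsum fun z =>
            measurable_nlog.comp (hG.comp (measurable_pi_apply z)))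
      _ = nexp (∫⁻ x, (1 - ∫⁻ y, nexp (g (x, y)) ∂ν) ∂Λ) := by
          rw [h.laplace (fun x => nlog (∫⁻ y, nexp (g (x, y)) ∂ν)) (measurable_nlog.comp hG)]
          simp_rw [nexp_nlog (hle _)]
      _ = nexp (∫⁻ x, (1 - nexp (g x)) ∂(Λ.prod ν)) := by
          rw [lintegral_prod _ (by fun_prop)]
          congr 1
          refine lintegral_congr fun x => ?_
          rw [lintegral_sub (g := fun y => nexp (g (x, y)))
            (measurable_nexp.comp (hg.comp measurable_prodMk_left))
            (ne_top_of_le_ne_top ENNReal.one_ne_top (hle x)) (ae_of_all _ fun y => nexp_le_one _)]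
          simp

end

/-! ### From Poisson counts to the Laplace functional. -/

section FromCounts

variable {Ω E : Type*} [MeasurableSpace Ω] [MeasurableSpace E] {P : Measure Ω} {Λ : Measure E}
  {x : Ω → ℕ → E}

lemma tsum_indicator_const {E : Type*} (a : ℕ → E) (A : Set E) (c : ℝ≥0∞) :
    ∑' z, A.indicator (fun _ => c) (a z) = c * (count a A : ℝ≥0∞) := by
  have h : ∀ z, A.indicator (fun _ => c) (a z) = {i | a i ∈ A}.indicator (fun _ => c) z :=
    fun z => rfl
  simp_rw [h]
  rw [← tsum_subtype, ENNReal.tsum_set_const, mul_comm, count]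

lemma measurable_count (hx : ∀ z, Measurable fun ω => x ω z) {A : Set E}
    (hA : MeasurableSet A) : Measurable fun ω => (count (x ω) A : ℝ≥0∞) := by
  have h : ∀ ω, (count (x ω) A : ℝ≥0∞) = ∑' z, A.indicator (fun _ => 1) (x ω z) := fun ω => by
    rw [tsum_indicator_const, one_mul]
  simp_rw [h]
  exact Measurable.tsum fun z => (measurable_const.indicator hA).comp (hx z)

lemma measurableSet_count_eq (hx : ∀ z, Measurable fun ω => x ω z) {A : Set E}
    (hA : MeasurableSet A) (n : ℕ) : MeasurableSet {ω | count (x ω) A = n} := by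
  have : {ω | count (x ω) A = n} = (fun ω => (count (x ω) A : ℝ≥0∞)) ⁻¹' {(n : ℝ≥0∞)} := by
    ext ω
    simp only [Set.mem_ofPred_eq, Set.mem_preimage, Set.mem_singleton_iff]
    rw [← ENat.toENNReal_coe, ENat.toENNReal_inj]
  rw [this]
  exact measurable_count hx hA (measurableSet_singleton _)

/-- This is the generating function of a Poisson variable, summed over its finite values. Since c ≠
0, an infinite count would contribute exp(-∞) = 0, so nothing is lost without knowing beforehand
that the count is finite. -/
lemma IsPoissonProcess.lintegral_nexp_count (h : IsPoissonProcess x Λ P)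
    (hx : ∀ z, Measurable fun ω => x ω z) {A : Set E} (hA : MeasurableSet A) (hΛ : Λ A ≠ ∞)
    {c : ℝ≥0∞} (hc : c ≠ 0) :
    ∫⁻ ω, nexp (c * (count (x ω) A : ℝ≥0∞)) ∂P = nexp ((1 - nexp c) * Λ A) := by
  have hms := measurableSet_count_eq hx hA
  have hpt : ∀ ω, nexp (c * (count (x ω) A : ℝ≥0∞)) =
      ∑' n : ℕ, {ω | count (x ω) A = n}.indicator (fun _ => nexp c ^ n) ω := fun ω => by
    rcases eq_or_ne (count (x ω) A) ⊤ with ht | ht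
    · simp [ht, ENNReal.mul_top hc, Set.indicator]
    · obtain ⟨k, hk⟩ := ENat.ne_top_iff_exists.1 ht
      rw [tsum_eq_single k]
      · simp [← hk, mul_comm c, nexp_nsmul, Set.indicator]
      · intro n hn
        have : (k : ℕ∞) ≠ n := fun e => hn (by exact_mod_cast e.symm)
        simp [Set.indicator, ← hk, this]
  simp_rw [hpt]
  rw [lintegral_tsum fun n => (measurable_const.indicator (hms n)).aemeasurable]
  simp_rw [lintegral_indicator_const (hms _), h.count_law A hA hΛ]
  set a := Λ.real A with ha
  have ha0 : 0 ≤ a := measureReal_nonneg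
  obtain ⟨r, hr0, hr⟩ : ∃ r : ℝ, 0 ≤ r ∧ nexp c = ENNReal.ofReal r :=
    ⟨(nexp c).toReal, ENNReal.toReal_nonneg, (ENNReal.ofReal_toReal (nexp_ne_top c)).symm⟩
  have hr1 : r ≤ 1 := by
    have := nexp_le_one c
    rw [hr] at this
    exact ENNReal.ofReal_le_one.1 this
  have hterm : ∀ n : ℕ, nexp c ^ n * ENNReal.ofReal (Real.exp (-a) * a ^ n / n.factorial) =
      ENNReal.ofReal (Real.exp (-a) * ((r * a) ^ n / n.factorial)) := fun n => by
    rw [hr, ← ENNReal.ofReal_pow hr0, ← ENNReal.ofReal_mul (by positivity)]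
    congr 1
    rw [mul_pow]; ring
  simp_rw [hterm]
  have hs : HasSum (fun n : ℕ => Real.exp (-a) * ((r * a) ^ n / n.factorial))
      (Real.exp (-a) * Real.exp (r * a)) := by
    have := NormedSpace.expSeries_div_hasSum_exp (𝔸 := ℝ) (r * a)
    rw [← Real.exp_eq_exp_ℝ] at this
    exact this.mul_left _
  rw [← ENNReal.ofReal_tsum_of_nonneg (fun n => by positivity) hs.summable, hs.tsum_eq, hr,
    ← Real.exp_add]
  have hΛA : Λ A = ENNReal.ofReal a := (ENNReal.ofReal_toReal hΛ).symm
  rw [hΛA, ← ENNReal.ofReal_one, ← ENNReal.ofReal_sub _ hr0,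
    ← ENNReal.ofReal_mul (by linarith), nexp_ofReal (by nlinarith)]
  congr 2
  ring

/-- The level sets of the nonzero values are disjoint with finite intensity. Their counts are
independent Poisson variables, and the functional factors over the values. The value 0 is excluded
because its level set may have infinite intensity. -/
lemma IsPoissonProcess.laplace_simpleFunc (h : IsPoissonProcess x Λ P)
    (hx : ∀ z, Measurable fun ω => x ω z) (s : SimpleFunc E ℝ≥0∞)
    (hs : ∀ c, c ≠ 0 → Λ (s ⁻¹' {c}) ≠ ∞) :
    ∫⁻ ω, nexp (∑' z, s (x ω z)) ∂P = nexp (∫⁻ y, (1 - nexp (s y)) ∂Λ) := by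
  classical
  set R := s.range.erase 0 with hR
  -- Applied twice: to the identity inside the sum over points, and to c ↦ 1 - exp(-c) inside the
  -- integral over Λ.
  have hsum : ∀ (f : ℝ≥0∞ → ℝ≥0∞), f 0 = 0 → ∀ y,
      f (s y) = ∑ c ∈ R, (s ⁻¹' {c}).indicator (fun _ => f c) y := fun f hf y => by
    rcases eq_or_ne (s y) 0 with h0 | h0
    · rw [h0, hf]
      refine (Finset.sum_eq_zero fun c hc => ?_).symm
      have : s y ≠ c := by rw [h0]; exact (Finset.ne_of_mem_erase hc).symm
      simp [Set.indicator, this]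
    · rw [Finset.sum_eq_single (s y)]
      · simp [Set.indicator]
      · intro c _ hc
        simp [Set.indicator, hc.symm]
      · intro hc
        exact absurd (Finset.mem_erase.2 ⟨h0, s.mem_range_self y⟩) hc
  have hmeas : ∀ c, MeasurableSet (s ⁻¹' {c}) := fun c => s.measurableSet_preimage _
  let e := R.equivFin
  have hind : iIndepFun (fun i ω => count (x ω) (s ⁻¹' {((e.symm i : R) : ℝ≥0∞)})) P := by
    refine h.indep _ _ (fun i => hmeas _) (fun i => hs _ (Finset.ne_of_mem_erase (e.symm i).2)) ?_
    intro i j hij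
    refine Disjoint.preimage _ ?_
    rw [Set.disjoint_singleton]
    exact fun hh => hij (e.symm.injective (Subtype.ext hh))
  have hind2 := hind.comp (fun i n => nexp (((e.symm i : R) : ℝ≥0∞) * (n : ℝ≥0∞)))
    fun i => Measurable.of_discrete
  calc ∫⁻ ω, nexp (∑' z, s (x ω z)) ∂P
      = ∫⁻ ω, ∏ i, nexp (((e.symm i : R) : ℝ≥0∞) *
          (count (x ω) (s ⁻¹' {((e.symm i : R) : ℝ≥0∞)}) : ℝ≥0∞)) ∂P := by
        refine lintegral_congr fun ω => ?_
        have : ∑' z, s (x ω z) = ∑ c ∈ R, c * (count (x ω) (s ⁻¹' {c}) : ℝ≥0∞) := by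
          simp_rw [← tsum_indicator_const]
          rw [← Summable.tsum_finsetSum fun _ _ => ENNReal.summable]
          exact tsum_congr fun z => hsum id rfl _
        rw [this, nexp_sum, ← Finset.prod_coe_sort, ← Equiv.prod_comp e.symm]
    _ = ∏ i, ∫⁻ ω, nexp (((e.symm i : R) : ℝ≥0∞) *
          (count (x ω) (s ⁻¹' {((e.symm i : R) : ℝ≥0∞)}) : ℝ≥0∞)) ∂P := by
        exact lintegral_prod_eq_prod_lintegral_of_indepFun Finset.univ _ hind2 fun i =>
          measurable_nexp.comp ((measurable_count hx (hmeas _)).const_mul _)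
    _ = ∏ i, nexp ((1 - nexp ((e.symm i : R) : ℝ≥0∞)) *
          Λ (s ⁻¹' {((e.symm i : R) : ℝ≥0∞)})) := by
        refine Finset.prod_congr rfl fun i _ => ?_
        have h0 := Finset.ne_of_mem_erase (e.symm i).2
        exact h.lintegral_nexp_count hx (hmeas _) (hs _ h0) h0
    _ = nexp (∑ c ∈ R, (1 - nexp c) * Λ (s ⁻¹' {c})) := by
        rw [nexp_sum, ← Finset.prod_coe_sort R, ← Equiv.prod_comp e.symm]
    _ = nexp (∫⁻ y, (1 - nexp (s y)) ∂Λ) := by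
        congr 1
        rw [lintegral_congr fun y => hsum (fun c => 1 - nexp c) (by simp) y,
          lintegral_finsetSum _ fun c _ => measurable_const.indicator (hmeas c)]
        simp_rw [lintegral_indicator_const (hmeas _)]

/-- Simple functions increase to `g`; cutting them off to sets of finite intensity makes the simple
case applicable. The left side converges by domination, the exponent on the right by monotonicity.
-/
theorem IsPoissonProcess.isPoissonSeq [IsProbabilityMeasure P] [SigmaFinite Λ]
    (h : IsPoissonProcess x Λ P)
    (hx : ∀ z, Measurable fun ω => x ω z) : IsPoissonSeq (fun z ω => x ω z) Λ P where
  measurable := hx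
  laplace g hg := by
    let S := spanningSets Λ
    let s : ℕ → SimpleFunc E ℝ≥0∞ := fun n => (SimpleFunc.eapprox g n).restrict (S n)
    have hS : ∀ n, MeasurableSet (S n) := measurableSet_spanningSets Λ
    have hs_apply : ∀ n y, s n y = (S n).indicator (SimpleFunc.eapprox g n) y := fun n y =>
      SimpleFunc.restrict_apply _ (hS n) y
    have hmono : Monotone fun n y => s n y := fun n k hnk y => by
      simp only [hs_apply]
      refine (Set.indicator_le_indicator (SimpleFunc.monotone_eapprox g hnk y)).trans ?_
      exact Set.indicator_le_indicator_of_subset (monotone_spanningSets Λ hnk) (fun _ => bot_le) y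
    have hlim : ∀ y, Tendsto (fun n => s n y) atTop (𝓝 (g y)) := fun y => by
      have := SimpleFunc.tendsto_eapprox hg y
      refine this.congr' ?_
      obtain ⟨N, hN⟩ : ∃ N, y ∈ S N := by
        have : y ∈ ⋃ n, S n := by rw [iUnion_spanningSets]; trivial
        simpa using this
      filter_upwards [eventually_ge_atTop N] with n hn
      rw [hs_apply, Set.indicator_of_mem (monotone_spanningSets Λ hn hN)]
    have hfin : ∀ n c, c ≠ 0 → Λ (s n ⁻¹' {c}) ≠ ∞ := fun n c hc => by
      refine ne_top_of_le_ne_top (measure_spanningSets_lt_top Λ n).ne (measure_mono fun y hy => ?_)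
      by_contra hyn
      simp only [Set.mem_preimage, Set.mem_singleton_iff, hs_apply] at hy
      rw [Set.indicator_of_notMem hyn] at hy
      exact hc hy.symm
    have hsum : ∀ ω, Tendsto (fun n => ∑' z, s n (x ω z)) atTop (𝓝 (∑' z, g (x ω z))) := fun ω => by
      simp only [← lintegral_count]
      exact lintegral_tendsto_of_tendsto_of_monotone (fun n => Measurable.of_discrete.aemeasurable)
        (ae_of_all _ fun z n k hnk => hmono hnk _) (ae_of_all _ fun z => hlim _)
    have h1 : Tendsto (fun n => ∫⁻ ω, nexp (∑' z, s n (x ω z)) ∂P) atTop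
        (𝓝 (∫⁻ ω, nexp (∑' z, g (x ω z)) ∂P)) := by
      refine tendsto_lintegral_of_dominated_convergence (fun _ => 1) (fun n => ?_)
        (fun n => ae_of_all _ fun ω => nexp_le_one _) (by simp)
        (ae_of_all _ fun ω => (continuous_nexp.tendsto _).comp (hsum ω))
      exact measurable_nexp.comp (Measurable.tsum fun z =>
        (s n).measurable.comp (hx z))
    have h2 : Tendsto (fun n => nexp (∫⁻ y, (1 - nexp (s n y)) ∂Λ)) atTop
        (𝓝 (nexp (∫⁻ y, (1 - nexp (g y)) ∂Λ))) := by
      refine (continuous_nexp.tendsto _).comp (lintegral_tendsto_of_tendsto_of_monotone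
        (fun n => ?_) (ae_of_all _ fun y n k hnk => ?_) (ae_of_all _ fun y => ?_))
      · exact (measurable_const.sub (measurable_nexp.comp (s n).measurable)).aemeasurable
      · exact tsub_le_tsub_left (nexp_antitone (hmono hnk y)) 1
      · exact ENNReal.Tendsto.sub tendsto_const_nhds ((continuous_nexp.tendsto _).comp (hlim y))
          (Or.inl ENNReal.one_ne_top)
    refine tendsto_nhds_unique h1 (h2.congr fun n => ?_)
    rw [h.laplace_simpleFunc hx (s n) (hfin n)]

end FromCounts

end

end MmWave

namespace MmWave

noncomputable section

open Filter Topology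

/-! ### The nearest point of a Poisson process -/

section OnePoint

variable {Ω E : Type*} [MeasurableSpace Ω] [MeasurableSpace E] {P : Measure Ω} {Λ : Measure E}
  {ξ : ℕ → Ω → E}

/-- For the count N of A and every c > 0, E exp(-c N) is at most P(N < ∞), because exp(-c · ∞) = 0.
As c decreases to 0 the explicit Laplace transform tends to 1. -/
lemma IsPoissonSeq.ae_finite [IsProbabilityMeasure P] (h : IsPoissonSeq ξ Λ P) {A : Set E}
    (hA : MeasurableSet A) (hΛ : Λ A ≠ ∞) : ∀ᵐ ω ∂P, {z | ξ z ω ∈ A}.Finite := by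
  have hN := measurable_count (x := fun ω z => ξ z ω) h.measurable hA
  set N : Ω → ℝ≥0∞ := fun ω => (count (fun z => ξ z ω) A : ℝ≥0∞) with hNdef
  have hS : MeasurableSet {ω | N ω = ∞} := hN (measurableSet_singleton _)
  have hc : ∀ c : ℝ≥0∞, c ≠ 0 → nexp ((1 - nexp c) * Λ A) ≤ P {ω | N ω = ∞}ᶜ := fun c hc => by
    have h1 := h.laplace (A.indicator fun _ => c) (measurable_const.indicator hA)
    have h2 : ∫⁻ y, (1 - nexp (A.indicator (fun _ => c) y)) ∂Λ = (1 - nexp c) * Λ A := by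
      rw [← lintegral_indicator_const hA]
      refine lintegral_congr fun y => ?_
      by_cases hy : y ∈ A <;> simp [hy]
    rw [h2] at h1
    rw [← h1, ← lintegral_indicator_one hS.compl]
    refine lintegral_mono fun ω => ?_
    rw [tsum_indicator_const (fun z => ξ z ω)]
    by_cases hω : N ω = ∞
    · rw [show (count (fun z => ξ z ω) A : ℝ≥0∞) = ∞ from hω, ENNReal.mul_top hc, nexp_top]
      exact bot_le
    · rw [Set.indicator_of_mem (show ω ∈ {ω | N ω = ∞}ᶜ from hω)]
      exact nexp_le_one _
  have hlim : Tendsto (fun n : ℕ => nexp ((1 - nexp ((n : ℝ≥0∞)⁻¹)) * Λ A)) atTop (𝓝 1) := by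
    have h0 : Tendsto (fun n : ℕ => (1 - nexp ((n : ℝ≥0∞)⁻¹)) * Λ A) atTop (𝓝 0) := by
      have : Tendsto (fun n : ℕ => 1 - nexp ((n : ℝ≥0∞)⁻¹)) atTop (𝓝 0) := by
        have h3 : Tendsto (fun n : ℕ => nexp ((n : ℝ≥0∞)⁻¹)) atTop (𝓝 1) := by
          simpa [Function.comp_def] using (continuous_nexp.tendsto 0).comp ENNReal.tendsto_inv_nat_nhds_zero
        simpa using ENNReal.Tendsto.sub tendsto_const_nhds h3 (Or.inl ENNReal.one_ne_top)
      simpa using ENNReal.Tendsto.mul_const this (Or.inr hΛ)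
    simpa [Function.comp_def] using (continuous_nexp.tendsto 0).comp h0
  have hone : 1 ≤ P {ω | N ω = ∞}ᶜ := le_of_tendsto' hlim fun n => hc _ (by simp)
  have : P {ω | N ω = ∞} = 0 := by
    rw [← prob_compl_eq_one_iff hS]
    exact le_antisymm prob_le_one hone
  rw [ae_iff]
  refine measure_mono_null (fun ω hω => ?_) this
  simpa [hNdef, count] using hω

/-- If `g = ∞` on `A`, then the expectation of `exp (-∑ g)` over the points outside `A`, on the
event that there is exactly one point in `A`. -/
theorem IsPoissonSeq.lintegral_one_point [IsProbabilityMeasure P] (h : IsPoissonSeq ξ Λ P)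
    {A : Set E} (hA : MeasurableSet A) (hΛ : Λ A ≠ ∞) {g : E → ℝ≥0∞} (hg : Measurable g)
    (hgA : ∀ y ∈ A, g y = ∞) :
    ∫⁻ ω, {ω | count (fun z => ξ z ω) A = 1}.indicator
      (fun ω => nexp (∑' z, Aᶜ.indicator g (ξ z ω))) ω ∂P =
      Λ A * nexp (∫⁻ y, (1 - nexp (g y)) ∂Λ) := by
  have hN := measurable_count (x := fun ω z => ξ z ω) h.measurable hA
  set Y : Ω → ℝ≥0∞ := fun ω => nexp (∑' z, Aᶜ.indicator g (ξ z ω)) with hY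
  have hYm : Measurable Y := measurable_nexp.comp (Measurable.tsum fun z =>
    (hg.indicator hA.compl).comp (h.measurable z))
  have hms := measurableSet_count_eq (x := fun ω z => ξ z ω) h.measurable hA
  have hm1 : MeasurableSet {ω | count (fun z => ξ z ω) A = 1} := by simpa using hms 1
  have hm0 : MeasurableSet {ω | count (fun z => ξ z ω) A = 0} := by simpa using hms 0
  set c := ∫⁻ y in Aᶜ, (1 - nexp (g y)) ∂Λ with hc
  -- Giving each point of `A` the weight θ produces a generating function in r = exp(-θ). Its
  -- coefficients of order 0 and 1 are `I0` and `I1`.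
  have hJ : ∀ θ : ℝ≥0∞, ∫⁻ ω, nexp (θ * (count (fun z => ξ z ω) A : ℝ≥0∞)) * Y ω ∂P =
      nexp ((1 - nexp θ) * Λ A) * nexp c := fun θ => by
    have h1 := h.laplace (fun y => A.indicator (fun _ => θ) y + Aᶜ.indicator g y)
      ((measurable_const.indicator hA).add (hg.indicator hA.compl))
    have h2 : ∫⁻ y, (1 - nexp (A.indicator (fun _ => θ) y + Aᶜ.indicator g y)) ∂Λ =
        (1 - nexp θ) * Λ A + c := by
      rw [← lintegral_add_compl _ hA]
      congr 1
      · rw [← setLIntegral_const]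
        refine setLIntegral_congr_fun hA fun y hy => ?_
        simp [hy]
      · refine setLIntegral_congr_fun hA.compl fun y hy => ?_
        have : y ∉ A := hy
        simp [this]
    rw [h2, nexp_add] at h1
    rw [← h1]
    refine lintegral_congr fun ω => ?_
    rw [ENNReal.tsum_add, tsum_indicator_const (fun z => ξ z ω), nexp_add]
  -- Since `g` is infinite on `A`, the right-hand functional already contains the factor exp(-Λ A),
  -- the probability that `A` is empty.
  have htot : ∫⁻ y, (1 - nexp (g y)) ∂Λ = Λ A + c := by
    rw [← lintegral_add_compl _ hA]
    congr 1
    rw [← setLIntegral_one]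
    refine setLIntegral_congr_fun hA fun y hy => ?_
    simp [hgA y hy]
  set I0 := ∫⁻ ω, {ω | count (fun z => ξ z ω) A = 0}.indicator Y ω ∂P with hI0
  set I1 := ∫⁻ ω, {ω | count (fun z => ξ z ω) A = 1}.indicator Y ω ∂P with hI1
  have hI0' : I0 = nexp (Λ A) * nexp c := by
    have := hJ ∞
    rw [nexp_top, tsub_zero, one_mul] at this
    rw [← this, hI0]
    refine lintegral_congr fun ω => ?_
    by_cases h0 : count (fun z => ξ z ω) A = 0
    · simp [h0]
    · have : (count (fun z => ξ z ω) A : ℝ≥0∞) ≠ 0 := by simpa using h0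
      simp [h0, ENNReal.top_mul this]
  have hYle : ∀ ω, Y ω ≤ 1 := fun ω => nexp_le_one _
  have hI1le : I1 ≤ 1 := by
    calc I1 ≤ ∫⁻ _, 1 ∂P := lintegral_mono fun ω => Set.indicator_le_self' (fun _ _ => bot_le) ω
          |>.trans (hYle ω)
      _ = 1 := by simp
  have hI1top : I1 ≠ ∞ := ne_top_of_le_ne_top ENNReal.one_ne_top hI1le
  set a := (Λ A).toReal with ha
  have hΛa : Λ A = ENNReal.ofReal a := (ENNReal.ofReal_toReal hΛ).symm
  have ha0 : 0 ≤ a := ENNReal.toReal_nonneg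
  set b := (nexp c).toReal with hb
  have hcb : nexp c = ENNReal.ofReal b := (ENNReal.ofReal_toReal (nexp_ne_top c)).symm
  have hb0 : 0 ≤ b := ENNReal.toReal_nonneg
  -- Counts of at least two contribute at most r² to the generating function. Its difference
  -- quotient at 0 therefore determines `I1` up to an error r, and its limit is the derivative of
  -- exp(-a) b exp(a r) at r = 0.
  have hr : ∀ r : ℝ, 0 < r → r < 1 →
      I1.toReal ≤ Real.exp (-a) * b * ((Real.exp (a * r) - 1) / r) ∧
      Real.exp (-a) * b * ((Real.exp (a * r) - 1) / r) ≤ I1.toReal + r := fun r hr0 hr1 => by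
    set θ := nlog (ENNReal.ofReal r) with hθ
    have hθr : nexp θ = ENNReal.ofReal r := nexp_nlog (by simpa using hr1.le)
    have hθ0 : θ ≠ 0 := fun e => by
      rw [e, nexp_zero] at hθr
      exact hr1.ne (by simpa using hθr.symm)
    have hpt : ∀ ω, {ω | count (fun z => ξ z ω) A = 0}.indicator Y ω +
        ENNReal.ofReal r * {ω | count (fun z => ξ z ω) A = 1}.indicator Y ω ≤
          nexp (θ * (count (fun z => ξ z ω) A : ℝ≥0∞)) * Y ω ∧
        nexp (θ * (count (fun z => ξ z ω) A : ℝ≥0∞)) * Y ω ≤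
        {ω | count (fun z => ξ z ω) A = 0}.indicator Y ω +
          ENNReal.ofReal r * {ω | count (fun z => ξ z ω) A = 1}.indicator Y ω +
          ENNReal.ofReal r ^ 2 := fun ω => by
      rcases eq_or_ne (count (fun z => ξ z ω) A) ⊤ with ht | ht
      · simp [ht, ENNReal.mul_top hθ0]
      obtain ⟨k, hk⟩ := ENat.ne_top_iff_exists.1 ht
      rcases k with _ | _ | k
      · have hk' : count (fun z => ξ z ω) A = 0 := by rw [← hk]; rfl
        simp [hk']
      · have hk' : count (fun z => ξ z ω) A = 1 := by rw [← hk]; rfl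
        simp [hk', hθr]
      · have h0 : count (fun z => ξ z ω) A ≠ 0 := by
          rw [← hk]; exact_mod_cast (by omega : k + 1 + 1 ≠ 0)
        have h1 : count (fun z => ξ z ω) A ≠ 1 := by
          rw [← hk]; exact_mod_cast (by omega : k + 1 + 1 ≠ 1)
        have h3 : nexp (θ * (count (fun z => ξ z ω) A : ℝ≥0∞)) = ENNReal.ofReal r ^ (k + 2) := by
          rw [← hk, mul_comm, ENat.toENNReal_coe, nexp_nsmul, hθr]
        simp only [Set.indicator, Set.mem_ofPred_eq, h0, h1, if_false, h3, mul_zero, add_zero,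
          zero_add]
        refine ⟨bot_le, ?_⟩
        calc ENNReal.ofReal r ^ (k + 2) * Y ω ≤ ENNReal.ofReal r ^ (k + 2) * 1 := by
              gcongr; exact hYle ω
          _ ≤ ENNReal.ofReal r ^ 2 := by
              rw [mul_one]
              exact pow_le_pow_right_of_le_one' (by simpa using hr1.le) (by omega)
    have hJr : ∫⁻ ω, nexp (θ * (count (fun z => ξ z ω) A : ℝ≥0∞)) * Y ω ∂P =
        ENNReal.ofReal (Real.exp (-((1 - r) * a)) * b) := by
      rw [hJ, hθr, hΛa, hcb, ← ENNReal.ofReal_one, ← ENNReal.ofReal_sub _ hr0.le,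
        ← ENNReal.ofReal_mul (by linarith), nexp_ofReal (by nlinarith),
        ← ENNReal.ofReal_mul (by positivity)]
    have hI0r : I0 = ENNReal.ofReal (Real.exp (-a) * b) := by
      rw [hI0', hΛa, hcb, nexp_ofReal ha0, ← ENNReal.ofReal_mul (by positivity)]
    have hI1r : I1 = ENNReal.ofReal I1.toReal := (ENNReal.ofReal_toReal hI1top).symm
    have hi10 : 0 ≤ I1.toReal := ENNReal.toReal_nonneg
    have hlow : I0 + ENNReal.ofReal r * I1 ≤ ENNReal.ofReal (Real.exp (-((1 - r) * a)) * b) := by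
      rw [← hJr, hI0, hI1, ← lintegral_const_mul _ (hYm.indicator hm1),
        ← lintegral_add_left (hYm.indicator hm0)]
      exact lintegral_mono fun ω => (hpt ω).1
    have hupp : ENNReal.ofReal (Real.exp (-((1 - r) * a)) * b) ≤
        I0 + ENNReal.ofReal r * I1 + ENNReal.ofReal r ^ 2 := by
      have : ENNReal.ofReal r ^ 2 = ∫⁻ _, ENNReal.ofReal r ^ 2 ∂P := by simp
      rw [this, ← hJr, hI0, hI1, ← lintegral_const_mul _ (hYm.indicator hm1),
        ← lintegral_add_left (hYm.indicator hm0), ← lintegral_add_right _ measurable_const]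
      exact lintegral_mono fun ω => (hpt ω).2
    rw [hI0r, hI1r, ← ENNReal.ofReal_mul hr0.le, ← ENNReal.ofReal_add (by positivity)
      (by positivity)] at hlow hupp
    rw [← ENNReal.ofReal_pow hr0.le, ← ENNReal.ofReal_add (by positivity) (by positivity)] at hupp
    rw [ENNReal.ofReal_le_ofReal_iff (by positivity)] at hlow hupp
    have he : Real.exp (-((1 - r) * a)) = Real.exp (-a) * Real.exp (a * r) := by
      rw [← Real.exp_add]; congr 1; ring
    rw [he] at hlow hupp
    rw [← mul_div_assoc, le_div_iff₀ hr0, div_le_iff₀ hr0]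
    constructor <;> nlinarith
  have hlim : Tendsto (fun r : ℝ => Real.exp (-a) * b * ((Real.exp (a * r) - 1) / r)) (𝓝[>] 0)
      (𝓝 (Real.exp (-a) * b * a)) := by
    refine Tendsto.const_mul _ ?_
    have hd : HasDerivAt (fun r : ℝ => Real.exp (a * r)) a 0 := by
      have := ((hasDerivAt_id (0 : ℝ)).const_mul a).exp
      simpa using this
    have := hd.tendsto_slope_zero_right
    refine this.congr fun r => ?_
    simp [div_eq_inv_mul]
  have hev : ∀ᶠ r : ℝ in 𝓝[>] 0, 0 < r ∧ r < 1 := by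
    filter_upwards [Ioo_mem_nhdsGT (zero_lt_one' ℝ)] with r hr' using hr'
  have hlim2 : Tendsto (fun r : ℝ => I1.toReal + r) (𝓝[>] 0) (𝓝 I1.toReal) := by
    have : Tendsto (fun r : ℝ => I1.toReal + r) (𝓝 0) (𝓝 (I1.toReal + 0)) :=
      (continuous_const.add continuous_id).tendsto 0
    rw [add_zero] at this
    exact this.mono_left nhdsWithin_le_nhds
  have e1 : I1.toReal ≤ Real.exp (-a) * b * a :=
    ge_of_tendsto hlim (hev.mono fun r hr' => (hr r hr'.1 hr'.2).1)
  have e2 : Real.exp (-a) * b * a ≤ I1.toReal :=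
    le_of_tendsto_of_tendsto hlim hlim2 (hev.mono fun r hr' => (hr r hr'.1 hr'.2).2)
  rw [htot, nexp_add, hΛa, hcb, nexp_ofReal ha0, ← ENNReal.ofReal_mul (by positivity),
    ← ENNReal.ofReal_mul ha0, ← ENNReal.ofReal_toReal hI1top, le_antisymm e1 e2]
  congr 1
  ring

end OnePoint

end

end MmWave

namespace MmWave

noncomputable section

open Filter Topology

/-! ### The process seen from its nearest point, by cutting the range of ℓ into cells. -/

section Nearest

variable {E : Type*}

/-- `a z` is the unique minimum of `ℓ` over the sequence `a`. -/
def IsStrictMin (ℓ : E → ℝ) (a : ℕ → E) (z : ℕ) : Prop := ∀ z', z' ≠ z → ℓ (a z) < ℓ (a z')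

lemma IsStrictMin.eq {ℓ : E → ℝ} {a : ℕ → E} {z z' : ℕ} (h : IsStrictMin ℓ a z)
    (h' : IsStrictMin ℓ a z') : z = z' := by
  by_contra hne
  exact lt_asymm (h z' (Ne.symm hne)) (h' z hne)

open Classical in
/-- `exp (-∑ I)` over all points but the nearest one, if the nearest point is unique and in `T`. -/
def nearestFunctional (ℓ : E → ℝ) (I : E → ℝ≥0∞) (T : Set E) (a : ℕ → E) : ℝ≥0∞ :=
  ∑' z, if a z ∈ T ∧ IsStrictMin ℓ a z then nexp (∑' z', if z' = z then 0 else I (a z')) else 0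

lemma nearestFunctional_of_isStrictMin {ℓ : E → ℝ} {I : E → ℝ≥0∞} {T : Set E} {a : ℕ → E} {z : ℕ}
    (h : IsStrictMin ℓ a z) :
    nearestFunctional ℓ I T a =
      T.indicator (fun _ => nexp (∑' z', if z' = z then 0 else I (a z'))) (a z) := by
  classical
  unfold nearestFunctional
  rw [tsum_eq_single z]
  · by_cases hT : a z ∈ T <;> simp [hT, h]
  · intro z' hz'
    rw [if_neg]
    rintro ⟨-, h'⟩
    exact hz' (h'.eq h)

lemma nearestFunctional_of_not {ℓ : E → ℝ} {I : E → ℝ≥0∞} {T : Set E} {a : ℕ → E}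
    (h : ¬∃ z, a z ∈ T ∧ IsStrictMin ℓ a z) : nearestFunctional ℓ I T a = 0 := by
  unfold nearestFunctional
  rw [ENNReal.tsum_eq_zero]
  intro z
  rw [if_neg fun h' => h ⟨z, h'⟩]

open Classical in
/-- The points with `ℓ ≤ t` are given infinite weight. -/
def barrier (ℓ : E → ℝ) (I : E → ℝ≥0∞) (t : ℝ) (y : E) : ℝ≥0∞ := if ℓ y ≤ t then ∞ else I y

/-- The cell of a partition of `T` by the values of `ℓ`. -/
def cell (ℓ : E → ℝ) (T : Set E) (n : ℕ) (k : ℤ) : Set E := T ∩ {y | ⌊(n + 1) * ℓ y⌋ = k}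

/-- Upper end of a cell. -/
def cellEnd (n : ℕ) (k : ℤ) : ℝ := (k + 1) / (n + 1)

open Classical in
/-- The approximation of `nearestFunctional` by cells. -/
def cellFunctional (ℓ : E → ℝ) (I : E → ℝ≥0∞) (T : Set E) (n : ℕ) (a : ℕ → E) (k : ℤ) : ℝ≥0∞ :=
  if count a (cell ℓ T n k) = 1 then
    nexp (∑' z, (cell ℓ T n k)ᶜ.indicator (barrier ℓ I (cellEnd n k)) (a z)) else 0

lemma lt_cellEnd (n : ℕ) {k : ℤ} {x : ℝ} (h : ⌊(n + 1) * x⌋ = k) : x < cellEnd n k := by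
  have hn : (0 : ℝ) < n + 1 := by positivity
  rw [cellEnd, lt_div_iff₀ hn, mul_comm, ← h]
  exact Int.lt_floor_add_one _

lemma cellEnd_le (n : ℕ) {k : ℤ} {x : ℝ} (h : ⌊(n + 1) * x⌋ = k) :
    cellEnd n k ≤ x + 1 / (n + 1) := by
  have hn : (0 : ℝ) < n + 1 := by positivity
  rw [cellEnd, div_le_iff₀ hn, ← h, add_mul x, one_div_mul_cancel hn.ne']
  have := Int.floor_le ((n + 1) * x)
  linarith

/-- Outside the cell the barrier is infinite up to the end of the cell. A nonzero value thus forces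
all other points above that end, hence strictly above the only point in the cell. -/
lemma cellFunctional_ne_zero {ℓ : E → ℝ} {I : E → ℝ≥0∞} {T : Set E} {n : ℕ} {a : ℕ → E} {k : ℤ}
    (h : cellFunctional ℓ I T n a k ≠ 0) :
    ∃ z, a z ∈ T ∧ IsStrictMin ℓ a z ∧ ⌊(n + 1) * ℓ (a z)⌋ = k := by
  unfold cellFunctional at h
  split_ifs at h with h1
  · obtain ⟨z, hz⟩ := Set.encard_eq_one.1 h1
    have hza : a z ∈ cell ℓ T n k := by
      have : z ∈ {i | a i ∈ cell ℓ T n k} := by rw [hz]; rfl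
      exact this
    refine ⟨z, hza.1, fun z' hz' => ?_, hza.2⟩
    have hz'a : a z' ∉ cell ℓ T n k := fun hc => by
      have : z' ∈ {i | a i ∈ cell ℓ T n k} := hc
      rw [hz] at this
      exact hz' this
    have hsum : ∑' z, (cell ℓ T n k)ᶜ.indicator (barrier ℓ I (cellEnd n k)) (a z) ≠ ∞ :=
      fun e => h (nexp_eq_zero.2 e)
    have hterm := ENNReal.ne_top_of_tsum_ne_top hsum z'
    rw [Set.indicator_of_mem (show a z' ∈ (cell ℓ T n k)ᶜ from hz'a)] at hterm
    unfold barrier at hterm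
    split_ifs at hterm with hle
    · exact absurd rfl hterm
    · exact (lt_cellEnd n hza.2).trans (not_le.1 hle)
  · exact absurd rfl h

lemma tsum_cellFunctional_of_not {ℓ : E → ℝ} {I : E → ℝ≥0∞} {T : Set E} (n : ℕ) {a : ℕ → E}
    (h : ¬∃ z, a z ∈ T ∧ IsStrictMin ℓ a z) : ∑' k, cellFunctional ℓ I T n a k = 0 := by
  rw [ENNReal.tsum_eq_zero]
  intro k
  by_contra hk
  obtain ⟨z, h1, h2, -⟩ := cellFunctional_ne_zero hk
  exact h ⟨z, h1, h2⟩

lemma tsum_cellFunctional_of_isStrictMin {ℓ : E → ℝ} {I : E → ℝ≥0∞} {T : Set E} (n : ℕ)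
    {a : ℕ → E} {z : ℕ} (h : IsStrictMin ℓ a z) :
    ∑' k, cellFunctional ℓ I T n a k = cellFunctional ℓ I T n a ⌊(n + 1) * ℓ (a z)⌋ := by
  refine tsum_eq_single _ fun k hk => ?_
  by_contra hne
  obtain ⟨z', -, h2, h3⟩ := cellFunctional_ne_zero hne
  rw [h2.eq h] at h3
  exact hk h3.symm

lemma cellFunctional_le_one (ℓ : E → ℝ) (I : E → ℝ≥0∞) (T : Set E) (n : ℕ) (a : ℕ → E) (k : ℤ) :
    cellFunctional ℓ I T n a k ≤ 1 := by
  unfold cellFunctional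
  split_ifs
  · exact nexp_le_one _
  · exact zero_le_one

lemma tsum_cellFunctional_le_one (ℓ : E → ℝ) (I : E → ℝ≥0∞) (T : Set E) (n : ℕ) (a : ℕ → E) :
    ∑' k, cellFunctional ℓ I T n a k ≤ 1 := by
  by_cases h : ∃ z, a z ∈ T ∧ IsStrictMin ℓ a z
  · obtain ⟨z, -, hz⟩ := h
    rw [tsum_cellFunctional_of_isStrictMin n hz]
    exact cellFunctional_le_one _ _ _ _ _ _
  · rw [tsum_cellFunctional_of_not n h]
    exact zero_le_one

/-- Only finitely many points lie below t + 1, so those above t keep a positive distance from t.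
This makes the approximations by cells exact once the mesh is small. -/
lemma exists_gap {ℓ : E → ℝ} {a : ℕ → E} (hfin : ∀ b, {z | ℓ (a z) ≤ b}.Finite) (t : ℝ) :
    ∃ δ > 0, ∀ z, t < ℓ (a z) → t + δ ≤ ℓ (a z) := by
  classical
  set Z := (hfin (t + 1)).toFinset.filter fun z => t < ℓ (a z) with hZ
  rcases Z.eq_empty_or_nonempty with h0 | hne
  · refine ⟨1, one_pos, fun z hz => ?_⟩
    by_contra hlt
    have : z ∈ Z := by
      rw [hZ, Finset.mem_filter, Set.Finite.mem_toFinset]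
      exact ⟨(not_le.1 hlt).le, hz⟩
    rw [h0] at this
    simp at this
  · obtain ⟨z0, hz0, hmin⟩ := Z.exists_min_image (fun z => ℓ (a z)) hne
    have hz0' : t < ℓ (a z0) := (Finset.mem_filter.1 hz0).2
    refine ⟨min 1 (ℓ (a z0) - t), lt_min one_pos (sub_pos.2 hz0'), fun z hz => ?_⟩
    by_cases hz1 : ℓ (a z) ≤ t + 1
    · have : z ∈ Z := by
        rw [hZ, Finset.mem_filter, Set.Finite.mem_toFinset]
        exact ⟨hz1, hz⟩
      have := hmin z this
      have := min_le_right 1 (ℓ (a z0) - t)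
      linarith
    · have := min_le_left 1 (ℓ (a z0) - t)
      linarith

lemma eventually_one_div_lt {δ : ℝ} (hδ : 0 < δ) : ∀ᶠ n : ℕ in atTop, 1 / ((n : ℝ) + 1) < δ :=
  tendsto_one_div_add_atTop_nhds_zero_nat.eventually (gt_mem_nhds hδ)

/-- When the mesh is smaller than the gap between the smallest and the next value of ℓ, the cell of
the minimum contains no other point and its barrier hits none. The sequence is then eventually
constant. -/
lemma tendsto_tsum_cellFunctional {ℓ : E → ℝ} {I : E → ℝ≥0∞} {T : Set E} {a : ℕ → E}
    (hfin : ∀ b, {z | ℓ (a z) ≤ b}.Finite) :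
    Tendsto (fun n => ∑' k, cellFunctional ℓ I T n a k) atTop
      (𝓝 (nearestFunctional ℓ I T a)) := by
  by_cases h : ∃ z, a z ∈ T ∧ IsStrictMin ℓ a z
  swap
  · rw [nearestFunctional_of_not h]
    simp_rw [tsum_cellFunctional_of_not _ h]
    exact tendsto_const_nhds
  obtain ⟨z, hzT, hz⟩ := h
  obtain ⟨δ, hδ, hgap⟩ := exists_gap hfin (ℓ (a z))
  refine tendsto_const_nhds.congr' ?_
  filter_upwards [eventually_one_div_lt hδ] with n hn
  rw [tsum_cellFunctional_of_isStrictMin n hz, nearestFunctional_of_isStrictMin hz,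
    Set.indicator_of_mem hzT]
  set k := ⌊(n + 1) * ℓ (a z)⌋ with hk
  have hend : cellEnd n k < ℓ (a z) + δ := (cellEnd_le n hk.symm).trans_lt (by linarith)
  have hout : ∀ z', z' ≠ z → cellEnd n k < ℓ (a z') := fun z' hz' =>
    hend.trans_le (hgap z' (hz z' hz'))
  have hmem : ∀ z', a z' ∈ cell ℓ T n k ↔ z' = z := fun z' => by
    constructor
    · intro hc
      by_contra hne
      exact lt_asymm (hout z' hne) (lt_cellEnd n hc.2)
    · rintro rfl
      exact ⟨hzT, rfl⟩
  have hcount : count a (cell ℓ T n k) = 1 := by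
    rw [count, Set.encard_eq_one]
    exact ⟨z, by ext z'; simp [hmem]⟩
  rw [cellFunctional, if_pos hcount]
  congr 1
  refine tsum_congr fun z' => ?_
  by_cases hz' : z' = z
  · have : a z' ∉ (cell ℓ T n k)ᶜ := by simp [hmem, hz']
    rw [if_pos hz', Set.indicator_of_notMem this]
  · have : a z' ∈ (cell ℓ T n k)ᶜ := by simp [hmem, hz']
    rw [if_neg hz', Set.indicator_of_mem this, barrier, if_neg (not_le.2 (hout z' hz'))]

variable {Ω : Type*} [MeasurableSpace Ω] [MeasurableSpace E] {P : Measure Ω} {Λ : Measure E}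
  {ξ : ℕ → Ω → E}

lemma measurable_barrier {ℓ : E → ℝ} (hℓ : Measurable ℓ) {I : E → ℝ≥0∞} (hI : Measurable I)
    (t : ℝ) : Measurable (barrier ℓ I t) :=
  Measurable.ite (hℓ measurableSet_Iic) measurable_const hI

lemma measurableSet_cell {ℓ : E → ℝ} (hℓ : Measurable ℓ) {T : Set E} (hT : MeasurableSet T)
    (n : ℕ) (k : ℤ) : MeasurableSet (cell ℓ T n k) :=
  hT.inter ((Int.measurable_floor.comp (hℓ.const_mul _)) (measurableSet_singleton k))

lemma tsum_cell_indicator {E : Type*} (ℓ : E → ℝ) (T : Set E) (n : ℕ) (c : ℤ → ℝ≥0∞) (y : E) :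
    ∑' k, (cell ℓ T n k).indicator (fun _ => c k) y =
      T.indicator (fun y => c ⌊(n + 1) * ℓ y⌋) y := by
  by_cases hy : y ∈ T
  · rw [tsum_eq_single ⌊(n + 1) * ℓ y⌋]
    · rw [Set.indicator_of_mem hy,
        Set.indicator_of_mem (show y ∈ cell ℓ T n _ from ⟨hy, rfl⟩)]
    · intro k hk
      rw [Set.indicator_of_notMem]
      exact fun hc => hk hc.2.symm
  · rw [Set.indicator_of_notMem hy, ENNReal.tsum_eq_zero]
    intro k
    rw [Set.indicator_of_notMem]
    exact fun hc => hy hc.1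

/-- The law of a Poisson process seen from its nearest point: given that point, the other points
form the restriction of the process to larger values of `ℓ`. -/
theorem IsPoissonSeq.lintegral_nearestFunctional [IsProbabilityMeasure P]
    (h : IsPoissonSeq ξ Λ P) {ℓ : E → ℝ} (hℓ : Measurable ℓ)
    (hfin : ∀ b, Λ {y | ℓ y ≤ b} ≠ ∞) {I : E → ℝ≥0∞} (hI : Measurable I) {T : Set E}
    (hT : MeasurableSet T) {b : ℝ} (hTb : T ⊆ {y | ℓ y ≤ b}) :
    ∫⁻ ω, nearestFunctional ℓ I T (fun z => ξ z ω) ∂P =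
      ∫⁻ y in T, nexp (Λ {x | ℓ x ≤ ℓ y}) *
        ∫⁻ ω, nexp (∑' z, {x | ℓ y < ℓ x}.indicator I (ξ z ω)) ∂P ∂Λ := by
  have hTfin : Λ T ≠ ∞ := ne_top_of_le_ne_top (hfin b) (measure_mono hTb)
  have hlf : ∀ᵐ ω ∂P, ∀ b : ℝ, {z | ℓ (ξ z ω) ≤ b}.Finite := by
    have : ∀ᵐ ω ∂P, ∀ n : ℕ, {z | ξ z ω ∈ {y | ℓ y ≤ n}}.Finite :=
      ae_all_iff.2 fun n => h.ae_finite (hℓ measurableSet_Iic) (hfin n)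
    filter_upwards [this] with ω hω b
    obtain ⟨n, hn⟩ := exists_nat_ge b
    exact (hω n).subset fun z hz => le_trans hz hn
  -- `H t` is the probability of no point with ℓ ≤ t, times the Laplace functional of `I` over the
  -- points beyond t; `hHsplit` below makes this explicit.
  set H : ℝ → ℝ≥0∞ := fun t => nexp (∫⁻ x, (1 - nexp (barrier ℓ I t x)) ∂Λ) with hH
  have hHP : ∀ t, H t = ∫⁻ ω, nexp (∑' z, barrier ℓ I t (ξ z ω)) ∂P := fun t =>
    (h.laplace _ (measurable_barrier hℓ hI t)).symm
  have hHle : ∀ t, H t ≤ 1 := fun t => nexp_le_one _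
  have hHsplit : ∀ t, H t = nexp (Λ {x | ℓ x ≤ t}) *
      ∫⁻ ω, nexp (∑' z, {x | t < ℓ x}.indicator I (ξ z ω)) ∂P := fun t => by
    have hm : MeasurableSet {x | ℓ x ≤ t} := hℓ measurableSet_Iic
    have hm' : MeasurableSet {x | t < ℓ x} := hℓ measurableSet_Ioi
    rw [h.laplace _ (hI.indicator hm'), ← nexp_add, hH]
    simp only
    congr 1
    rw [← setLIntegral_one {x | ℓ x ≤ t}, ← lintegral_indicator hm, ← lintegral_add_left
      (measurable_const.indicator hm)]
    refine lintegral_congr fun x => ?_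
    by_cases hx : ℓ x ≤ t
    · simp [barrier, hx, Set.indicator, not_lt.2 hx]
    · simp [barrier, hx, Set.indicator, not_le.1 hx]
  have hcell : ∀ n k, MeasurableSet (cell ℓ T n k) := measurableSet_cell hℓ hT
  -- Each cell contributes its intensity times `H` at its end, by `lintegral_one_point`; the barrier
  -- is infinite on the cell, as that lemma requires. The sum over cells is a Riemann sum for the
  -- claimed integral.
  have hL : ∀ n, ∫⁻ ω, ∑' k, cellFunctional ℓ I T n (fun z => ξ z ω) k ∂P =
      ∫⁻ y in T, H (cellEnd n ⌊(n + 1) * ℓ y⌋) ∂Λ := fun n => by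
    have hind : ∀ k, (fun ω => cellFunctional ℓ I T n (fun z => ξ z ω) k) =
        {ω | count (fun z => ξ z ω) (cell ℓ T n k) = 1}.indicator
          (fun ω => nexp (∑' z, (cell ℓ T n k)ᶜ.indicator
            (barrier ℓ I (cellEnd n k)) (ξ z ω))) := fun k => by
      ext ω
      simp [cellFunctional, Set.indicator]
    have hmeas : ∀ k, Measurable fun ω => cellFunctional ℓ I T n (fun z => ξ z ω) k := fun k => by
      rw [hind]
      refine Measurable.indicator ?_ ?_
      · exact measurable_nexp.comp (Measurable.tsum fun z =>
          ((measurable_barrier hℓ hI _).indicator (hcell n k).compl).comp (h.measurable z))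
      · simpa using measurableSet_count_eq (x := fun ω z => ξ z ω) h.measurable (hcell n k) 1
    rw [lintegral_tsum fun k => (hmeas k).aemeasurable, ← lintegral_indicator hT]
    simp_rw [← tsum_cell_indicator ℓ T n (fun k => H (cellEnd n k))]
    rw [lintegral_tsum fun k => (measurable_const.indicator (hcell n k)).aemeasurable]
    refine tsum_congr fun k => ?_
    rw [lintegral_indicator_const (hcell n k), hind, mul_comm]
    refine h.lintegral_one_point (hcell n k) (ne_top_of_le_ne_top hTfin
      (measure_mono Set.inter_subset_left)) (measurable_barrier hℓ hI _) fun y hy => ?_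
    rw [barrier, if_pos (lt_cellEnd n hy.2).le]
  have hlim1 : Tendsto (fun n => ∫⁻ ω, ∑' k, cellFunctional ℓ I T n (fun z => ξ z ω) k ∂P) atTop
      (𝓝 (∫⁻ ω, nearestFunctional ℓ I T (fun z => ξ z ω) ∂P)) := by
    have hmeas : ∀ n, Measurable fun ω => ∑' k, cellFunctional ℓ I T n (fun z => ξ z ω) k := by
      intro n
      refine Measurable.tsum fun k => ?_
      refine Measurable.ite ?_ ?_ measurable_const
      · simpa using measurableSet_count_eq (x := fun ω z => ξ z ω) h.measurable (hcell n k) 1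
      · exact measurable_nexp.comp (Measurable.tsum fun z =>
          ((measurable_barrier hℓ hI _).indicator (hcell n k).compl).comp (h.measurable z))
    refine tendsto_lintegral_of_dominated_convergence (fun _ => 1) hmeas
      (fun n => ae_of_all _ fun ω => tsum_cellFunctional_le_one _ _ _ _ _) (by simp) ?_
    filter_upwards [hlf] with ω hω
    exact tendsto_tsum_cellFunctional hω
  -- This is right-continuity of `H`: by the gap property, almost surely the barriers at ℓ y and at
  -- a slightly larger cell end give the same weights to all points.
  have hHlim : ∀ y, Tendsto (fun n : ℕ => H (cellEnd n ⌊(n + 1) * ℓ y⌋)) atTop (𝓝 (H (ℓ y))) := by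
    intro y
    simp_rw [hHP]
    refine tendsto_lintegral_of_dominated_convergence (fun _ => 1) (fun n => ?_)
      (fun n => ae_of_all _ fun ω => nexp_le_one _) (by simp) ?_
    · exact measurable_nexp.comp (Measurable.tsum fun z =>
        (measurable_barrier hℓ hI _).comp (h.measurable z))
    filter_upwards [hlf] with ω hω
    obtain ⟨δ, hδ, hgap⟩ := exists_gap hω (ℓ y)
    refine tendsto_const_nhds.congr' ?_
    filter_upwards [eventually_one_div_lt hδ] with n hn
    congr 1
    refine tsum_congr fun z => ?_
    have h1 := lt_cellEnd n (x := ℓ y) rfl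
    have h2 := cellEnd_le n (x := ℓ y) rfl
    unfold barrier
    by_cases hz : ℓ (ξ z ω) ≤ ℓ y
    · rw [if_pos hz, if_pos (hz.trans h1.le)]
    · have := hgap z (not_le.1 hz)
      rw [if_neg hz, if_neg (by linarith)]
  have hlim2 : Tendsto (fun n : ℕ => ∫⁻ y in T, H (cellEnd n ⌊(n + 1) * ℓ y⌋) ∂Λ) atTop
      (𝓝 (∫⁻ y in T, H (ℓ y) ∂Λ)) := by
    refine tendsto_lintegral_of_dominated_convergence (fun _ => 1) (fun n => ?_)
      (fun n => ae_of_all _ fun ω => hHle _) (by simpa using hTfin) (ae_of_all _ hHlim)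
    exact (Measurable.of_discrete (f := fun k : ℤ => H (cellEnd n k))).comp
      (Int.measurable_floor.comp (hℓ.const_mul _))
  simp_rw [← hHsplit]
  simp_rw [hL] at hlim1
  exact tendsto_nhds_unique hlim1 hlim2

end Nearest

end

end MmWave

namespace MmWave

noncomputable section

open Filter Topology

/-! ### The Gaussian tail -/

lemma Q_nonneg (x : ℝ) : 0 ≤ Q x := measureReal_nonneg

lemma Q_le_one (x : ℝ) : Q x ≤ 1 := measureReal_le_one

lemma Q_eq_sub_integral (x : ℝ) : Q x = Q 0 - ∫ y in (0 : ℝ)..x, gaussianPDFReal 0 1 y := by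
  have hint : Integrable (gaussianPDFReal 0 1) := integrable_gaussianPDFReal 0 1
  have hQ : ∀ x, Q x = ∫ y in Set.Ioi x, gaussianPDFReal 0 1 y := fun x => by
    rw [Q, measureReal_def, gaussianReal_apply_eq_integral 0 one_ne_zero, ENNReal.toReal_ofReal]
    exact integral_nonneg fun y => gaussianPDFReal_nonneg _ _ _
  rw [hQ, hQ, eq_sub_iff_add_eq, add_comm]
  exact intervalIntegral.integral_interval_add_Ioi hint.integrableOn hint.integrableOn

lemma continuous_gaussianPDFReal_std : Continuous (gaussianPDFReal 0 1) := by
  unfold gaussianPDFReal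
  fun_prop

lemma hasDerivAt_Q (x : ℝ) : HasDerivAt Q (-((√(2 * Real.pi))⁻¹ * Real.exp (-x ^ 2 / 2))) x := by
  have h : HasDerivAt (fun x => ∫ y in (0 : ℝ)..x, gaussianPDFReal 0 1 y)
      (gaussianPDFReal 0 1 x) x :=
    intervalIntegral.integral_hasDerivAt_right
      (continuous_gaussianPDFReal_std.intervalIntegrable _ _)
      (continuous_gaussianPDFReal_std.stronglyMeasurableAtFilter _ _)
      continuous_gaussianPDFReal_std.continuousAt
  have h2 := h.const_sub (Q 0)
  rw [funext Q_eq_sub_integral]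
  refine h2.congr_deriv ?_
  simp [gaussianPDFReal]

lemma continuous_Q : Continuous Q :=
  continuous_iff_continuousAt.2 fun x => (hasDerivAt_Q x).continuousAt

lemma tendsto_Q_atTop : Tendsto Q atTop (𝓝 0) := by
  have h : ∀ x, Q x = 1 - cdf (gaussianReal 0 1) x := fun x => by
    rw [Q, cdf_eq_real, ← Set.compl_Iic, measureReal_compl measurableSet_Iic]
    simp
  rw [funext h]
  simpa using (tendsto_cdf_atTop (gaussianReal 0 1)).const_sub 1

lemma gaussianReal_Ioi (μ s : ℝ) {ξ : ℝ} (hξ : 0 < ξ) :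
    gaussianReal μ (ξ ^ 2).toNNReal (Set.Ioi s) = ENNReal.ofReal (Q ((s - μ) / ξ)) := by
  have h1 : (gaussianReal 0 1).map (fun x => ξ * x + μ) = gaussianReal μ (ξ ^ 2).toNNReal := by
    have : (fun x : ℝ => ξ * x + μ) = (fun x => x + μ) ∘ fun x => ξ * x := rfl
    rw [this, ← Measure.map_map (by fun_prop) (by fun_prop), gaussianReal_map_const_mul,
      gaussianReal_map_add_const]
    congr 1
    · simp
    · ext
      simp [Real.coe_toNNReal _ (sq_nonneg ξ)]
  rw [← h1, Measure.map_apply (by fun_prop) measurableSet_Ioi, Q, ofReal_measureReal]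
  congr 1
  ext x
  simp only [Set.mem_preimage, Set.mem_Ioi]
  rw [div_lt_iff₀ hξ]
  constructor <;> intro h <;> linarith

lemma gaussianReal_Iic {ξ : ℝ} (hξ : 0 < ξ) (s : ℝ) :
    gaussianReal 0 (ξ ^ 2).toNNReal (Set.Iic s) = ENNReal.ofReal (Q (-s / ξ)) := by
  have hv : (ξ ^ 2).toNNReal ≠ 0 := by simpa using hξ.ne'
  have h1 : (gaussianReal 0 (ξ ^ 2).toNNReal).map (fun x => -x) =
      gaussianReal 0 (ξ ^ 2).toNNReal := by
    rw [gaussianReal_map_neg, neg_zero]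
  have := nullSingletonClass_gaussianReal (μ := 0) hv
  rw [← h1, Measure.map_apply (by fun_prop) measurableSet_Iic]
  have h2 : (fun x : ℝ => -x) ⁻¹' Set.Iic s = Set.Ici (-s) := by
    ext x
    simp only [Set.mem_preimage, Set.mem_Iic, Set.mem_Ici]
    exact neg_le
  rw [h2, ← measure_congr (Ioi_ae_eq_Ici), gaussianReal_Ioi 0 _ hξ, sub_zero]

/-- Completing the square: the exponential tilt exp(-c s) moves the mean of a centered normal law by
-c times its variance, at the price of the constant exp(c² ξ² / 2). -/
lemma lintegral_exp_gaussianReal {ξ : ℝ} (hξ : 0 < ξ) (c : ℝ) {A : Set ℝ} (hA : MeasurableSet A) :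
    ∫⁻ s in A, ENNReal.ofReal (Real.exp (-c * s)) ∂(gaussianReal 0 (ξ ^ 2).toNNReal) =
      ENNReal.ofReal (Real.exp (c ^ 2 * ξ ^ 2 / 2)) *
        gaussianReal (-c * ξ ^ 2) (ξ ^ 2).toNNReal A := by
  have hv : (ξ ^ 2).toNNReal ≠ 0 := by simpa using hξ.ne'
  rw [gaussianReal_of_var_ne_zero _ hv, gaussianReal_of_var_ne_zero _ hv,
    setLIntegral_withDensity_eq_setLIntegral_mul _ (measurable_gaussianPDF _ _) (by fun_prop) hA,
    withDensity_apply _ hA, ← lintegral_const_mul _ (measurable_gaussianPDF _ _)]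
  refine lintegral_congr fun s => ?_
  simp only [Pi.mul_apply, gaussianPDF]
  rw [← ENNReal.ofReal_mul (gaussianPDFReal_nonneg _ _ _), ← ENNReal.ofReal_mul (by positivity)]
  congr 1
  simp only [gaussianPDFReal, Real.coe_toNNReal _ (sq_nonneg ξ)]
  rw [mul_assoc, ← Real.exp_add, mul_left_comm, ← Real.exp_add]
  congr 2
  field_simp
  ring

/-! ### The expected number of base stations below a propagation loss -/

namespace Params

variable (p : Params)

lemma σ_pos (a : Link) : 0 < p.σ a := by
  have := p.ξ_pos a
  have := Real.log_pos (by norm_num : (1 : ℝ) < 10)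
  unfold σ
  positivity

lemma lam_nonneg : 0 ≤ p.lamBS := p.lamBS_pos.le

/-- The Gaussian tail in the formula for `M`. -/
def tail (a : Link) (t : ℝ) : ℝ := Q (2 * p.σ a ^ 2 / (p.α a * p.σ a) - p.Υ a t)

lemma tail_nonneg (a : Link) (t : ℝ) : 0 ≤ p.tail a t := Q_nonneg _

lemma tail_le_one (a : Link) (t : ℝ) : p.tail a t ≤ 1 := Q_le_one _

lemma Υ_eq (a : Link) {t : ℝ} (ht : 0 < t) :
    p.Υ a t = (p.α a * Real.log p.D - Real.log t - p.m) / p.σ a := by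
  rw [Υ, Real.log_div (by have := p.D_pos; positivity) ht.ne', Real.log_rpow p.D_pos]

lemma hasDerivAt_Υ (a : Link) {t : ℝ} (ht : 0 < t) :
    HasDerivAt (p.Υ a) (-(1 / (t * p.σ a))) t := by
  have h : HasDerivAt (fun t => (p.α a * Real.log p.D - Real.log t - p.m) / p.σ a)
      (-(1 / (t * p.σ a))) t := by
    have := (((Real.hasDerivAt_log ht.ne').const_sub (p.α a * Real.log p.D)).sub_const
      p.m).div_const (p.σ a)
    refine this.congr_deriv ?_
    have := (p.σ_pos a).ne'
    field_simp
  refine h.congr_of_eventuallyEq ?_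
  filter_upwards [Ioi_mem_nhds ht] with u hu using p.Υ_eq a hu

/-- The two Gaussian terms in the derivative of `M` cancel. -/
lemma gaussian_cancel (a : Link) {t : ℝ} (ht : 0 < t) :
    p.expConst a * t ^ (2 / p.α a) *
        Real.exp (-(2 * p.σ a ^ 2 / (p.α a * p.σ a) - p.Υ a t) ^ 2 / 2) =
      p.D ^ 2 * Real.exp (-p.Υ a t ^ 2 / 2) := by
  have hα := p.α_pos a
  have hσ := p.σ_pos a
  have hD := p.D_pos
  have h1 : t ^ (2 / p.α a) = Real.exp (Real.log t * (2 / p.α a)) := Real.rpow_def_of_pos ht _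
  have h2 : p.D ^ 2 = Real.exp (2 * Real.log p.D) := by
    rw [two_mul, Real.exp_add, Real.exp_log hD, sq]
  rw [h1, h2, expConst, ← Real.exp_add, ← Real.exp_add, ← Real.exp_add]
  congr 1
  have hΥ : p.σ a * p.Υ a t = p.α a * Real.log p.D - Real.log t - p.m := by
    rw [p.Υ_eq a ht]
    field_simp
  have hs : 2 * p.σ a ^ 2 / (p.α a * p.σ a) = 2 * p.σ a / p.α a := by
    field_simp
  rw [hs]
  -- The difference of the two exponents is a multiple of the equation that defines Υ, and therefore
  -- vanishes.
  have h3 : 2 * p.σ a ^ 2 / p.α a ^ 2 + 2 * p.m / p.α a + Real.log t * (2 / p.α a) +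
      -(2 * p.σ a / p.α a - p.Υ a t) ^ 2 / 2 - (2 * Real.log p.D + -p.Υ a t ^ 2 / 2) =
      2 / p.α a * (p.σ a * p.Υ a t - (p.α a * Real.log p.D - Real.log t - p.m)) := by
    field_simp
    ring
  rw [hΥ, sub_self, mul_zero, sub_eq_zero] at h3
  exact h3

/-- Reconciles the exponent written in `M'` with the square of the argument of `Q` in `M`. -/
lemma sqrt_sq_arg (a : Link) (t : ℝ) :
    -(√2 * p.σ a / p.α a - p.Υ a t / √2) ^ 2 =
      -(2 * p.σ a ^ 2 / (p.α a * p.σ a) - p.Υ a t) ^ 2 / 2 := by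
  have hα := p.α_pos a
  have hσ := p.σ_pos a
  have h2 : √2 * √2 = 2 := Real.mul_self_sqrt (by norm_num)
  have h0 : √2 ≠ 0 := by positivity
  have hs : 2 * p.σ a ^ 2 / (p.α a * p.σ a) = 2 * p.σ a / p.α a := by
    field_simp
  have : √2 * p.σ a / p.α a - p.Υ a t / √2 = (2 * p.σ a / p.α a - p.Υ a t) / √2 := by
    field_simp
    rw [Real.sq_sqrt (by norm_num)]
    ring
  rw [this, hs, div_pow, Real.sq_sqrt (by norm_num), neg_div]

lemma sqrt_var (a : Link) : √(2 * Real.pi * p.σ a ^ 2) = √(2 * Real.pi) * p.σ a := by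
  rw [Real.sqrt_mul (by positivity), Real.sqrt_sq (p.σ_pos a).le]

/-- The Gaussian densities produced by the two tails cancel by `gaussian_cancel`. What remains is
the derivative of the power of t times a tail, so its sign is visible. -/
lemma M'_los {t : ℝ} (ht : 0 < t) : p.M' .los t =
    Real.pi * p.pLOS * (p.expConst .los * (2 / p.α .los) * t ^ (2 / p.α .los - 1) *
      p.tail .los t) := by
  have hc := p.gaussian_cancel .los ht
  have hσ := p.σ_pos .los
  have hp : t ^ (2 / p.α .los) = t ^ (2 / p.α .los - 1) * t := by
    rw [← Real.rpow_add_one ht.ne', sub_add_cancel]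
  simp only [M', sqrt_sq_arg, sqrt_var]
  rw [hp] at hc
  have h2 : p.D ^ 2 / (√(2 * Real.pi) * t * p.σ .los) * Real.exp (-p.Υ .los t ^ 2 / 2) =
      (1 / (√(2 * Real.pi) * p.σ .los)) * (p.expConst .los * t ^ (2 / p.α .los - 1) *
      Real.exp (-(2 * p.σ .los ^ 2 / (p.α .los * p.σ .los) - p.Υ .los t) ^ 2 / 2)) := by
    have : √(2 * Real.pi) ≠ 0 := by positivity
    rw [div_mul_eq_mul_div, ← hc]
    field_simp
  rw [h2, tail]
  ring

lemma M'_nlos {t : ℝ} (ht : 0 < t) : p.M' .nlos t =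
    Real.pi * (p.expConst .nlos * (2 / p.α .nlos) * t ^ (2 / p.α .nlos - 1) *
      (1 - p.pLOS * p.tail .nlos t)) := by
  have hc := p.gaussian_cancel .nlos ht
  have hσ := p.σ_pos .nlos
  have hp : t ^ (2 / p.α .nlos) = t ^ (2 / p.α .nlos - 1) * t := by
    rw [← Real.rpow_add_one ht.ne', sub_add_cancel]
  simp only [M', sqrt_sq_arg, sqrt_var]
  rw [hp] at hc
  have h2 : p.pLOS * p.D ^ 2 / (√(2 * Real.pi) * t * p.σ .nlos) *
      Real.exp (-p.Υ .nlos t ^ 2 / 2) =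
      p.pLOS * (1 / (√(2 * Real.pi) * p.σ .nlos)) * (p.expConst .nlos * t ^ (2 / p.α .nlos - 1) *
      Real.exp (-(2 * p.σ .nlos ^ 2 / (p.α .nlos * p.σ .nlos) - p.Υ .nlos t) ^ 2 / 2)) := by
    have : √(2 * Real.pi) ≠ 0 := by positivity
    rw [div_mul_eq_mul_div, mul_assoc, ← hc]
    field_simp
  rw [h2, tail]
  ring

lemma M'_nonneg (a : Link) {t : ℝ} (ht : 0 < t) : 0 ≤ p.M' a t := by
  have h0 := p.pLOS_nonneg
  have h1 := p.pLOS_le_one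
  have h2 := p.tail_nonneg a t
  have h3 := p.tail_le_one a t
  have h4 := p.α_pos a
  have h5 : 0 < p.expConst a := Real.exp_pos _
  cases a with
  | los => rw [p.M'_los ht]; positivity
  | nlos =>
    rw [p.M'_nlos ht]
    have : 0 ≤ 1 - p.pLOS * p.tail .nlos t := by nlinarith
    positivity

lemma hasDerivAt_M (a : Link) {t : ℝ} (ht : 0 < t) : HasDerivAt (p.M a) (p.M' a t) t := by
  have hσ := p.σ_pos a
  have h1 : HasDerivAt (fun t => Q (p.Υ a t)) _ t := (hasDerivAt_Q _).comp t (p.hasDerivAt_Υ a ht)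
  have h2 : HasDerivAt (fun t => Q (2 * p.σ a ^ 2 / (p.α a * p.σ a) - p.Υ a t)) _ t :=
    (hasDerivAt_Q _).comp t ((p.hasDerivAt_Υ a ht).const_sub _)
  have h3 : HasDerivAt (fun t : ℝ => t ^ (2 / p.α a)) _ t :=
    Real.hasDerivAt_rpow_const (Or.inl ht.ne')
  have hp : t ^ (2 / p.α a) = t ^ (2 / p.α a - 1) * t := by
    rw [← Real.rpow_add_one ht.ne', sub_add_cancel]
  have hs : √(2 * Real.pi) ≠ 0 := by positivity
  cases a with
  | los =>
    have h := ((h1.const_mul (p.D ^ 2)).add ((h3.mul_const (p.expConst .los)).mul h2)).const_mul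
      (Real.pi * p.pLOS)
    refine HasDerivAt.congr_deriv h ?_
    simp only [M', sqrt_sq_arg, sqrt_var]
    rw [hp]
    field_simp
    ring
  | nlos =>
    have h := (h1.const_mul (-Real.pi * p.pLOS * p.D ^ 2)).add
      (((h3.const_mul Real.pi).mul_const (p.expConst .nlos)).mul
        ((h2.const_mul p.pLOS).const_sub 1))
    refine HasDerivAt.congr_deriv h ?_
    simp only [M', sqrt_sq_arg, sqrt_var]
    rw [hp]
    field_simp
    ring

lemma tendsto_Υ_zero (a : Link) : Tendsto (p.Υ a) (𝓝[>] 0) atTop := by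
  have h : Tendsto (fun t => (p.α a * Real.log p.D - Real.log t - p.m) / p.σ a) (𝓝[>] 0)
      atTop := by
    refine Tendsto.atTop_div_const (p.σ_pos a) ?_
    refine tendsto_atTop_add_const_right _ _ ?_
    exact tendsto_atTop_add_const_left _ _ (tendsto_neg_atBot_atTop.comp Real.tendsto_log_nhdsGT_zero)
  refine h.congr' ?_
  filter_upwards [self_mem_nhdsWithin] with t ht using (p.Υ_eq a ht).symm

lemma tendsto_M_zero (a : Link) : Tendsto (p.M a) (𝓝[>] 0) (𝓝 0) := by
  have h1 : Tendsto (fun t => Q (p.Υ a t)) (𝓝[>] 0) (𝓝 0) :=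
    tendsto_Q_atTop.comp (p.tendsto_Υ_zero a)
  have h2 : Tendsto (fun t : ℝ => t ^ (2 / p.α a)) (𝓝[>] 0) (𝓝 0) := by
    have hpos : 0 < 2 / p.α a := div_pos two_pos (p.α_pos a)
    have : Tendsto (fun t : ℝ => t ^ (2 / p.α a)) (𝓝 0) (𝓝 ((0 : ℝ) ^ (2 / p.α a))) :=
      (Real.continuous_rpow_const hpos.le).tendsto 0
    rw [Real.zero_rpow hpos.ne'] at this
    exact this.mono_left nhdsWithin_le_nhds
  have hbd : ∀ g : ℝ → ℝ, (∀ t, 0 ≤ g t) → (∀ t, g t ≤ 1) →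
      Tendsto (fun t : ℝ => t ^ (2 / p.α a) * p.expConst a * g t) (𝓝[>] 0) (𝓝 0) := by
    intro g hg0 hg1
    have h3 : Tendsto (fun t : ℝ => t ^ (2 / p.α a) * p.expConst a) (𝓝[>] 0) (𝓝 0) := by
      simpa using h2.mul_const (p.expConst a)
    refine squeeze_zero' ?_ ?_ h3
    · filter_upwards [self_mem_nhdsWithin] with t ht
      have : 0 < p.expConst a := Real.exp_pos _
      have := hg0 t
      have : (0 : ℝ) < t := ht
      positivity
    · filter_upwards [self_mem_nhdsWithin] with t ht
      have : 0 < p.expConst a := Real.exp_pos _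
      have ht' : (0 : ℝ) < t := ht
      exact mul_le_of_le_one_right (by positivity) (hg1 t)
  cases a with
  | los =>
    have := ((h1.const_mul (p.D ^ 2)).add (hbd (p.tail .los) (p.tail_nonneg _)
      (p.tail_le_one _))).const_mul (Real.pi * p.pLOS)
    rw [mul_zero, add_zero, mul_zero] at this
    exact this.congr fun t => by simp only [M, tail]
  | nlos =>
    have := (h1.const_mul (-Real.pi * p.pLOS * p.D ^ 2)).add ((hbd
      (fun t => 1 - p.pLOS * p.tail .nlos t) (fun t => ?_) (fun t => ?_)).const_mul Real.pi)
    · rw [mul_zero, mul_zero, add_zero] at this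
      exact this.congr fun t => by simp only [M, tail]; ring
    · have := p.tail_le_one .nlos t
      have := p.tail_nonneg .nlos t
      have := p.pLOS_le_one
      have := p.pLOS_nonneg
      nlinarith
    · have := mul_nonneg p.pLOS_nonneg (p.tail_nonneg .nlos t)
      linarith

lemma measurable_Υ (a : Link) : Measurable (p.Υ a) := by
  unfold Υ
  fun_prop

lemma measurable_M (a : Link) : Measurable (p.M a) := by
  have := continuous_Q.measurable
  have := p.measurable_Υ a
  cases a <;> (unfold M; simp only; fun_prop)

lemma measurable_M' (a : Link) : Measurable (p.M' a) := by
  have := continuous_Q.measurable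
  have := p.measurable_Υ a
  cases a <;> (unfold M'; simp only; fun_prop)

lemma measurable_intensity (a : Link) : Measurable (p.intensity a) :=
  (p.measurable_M' a).const_mul _

lemma intensity_nonneg (a : Link) {t : ℝ} (ht : 0 < t) : 0 ≤ p.intensity a t :=
  mul_nonneg p.lam_nonneg (p.M'_nonneg a ht)

end Params

/-- Fundamental theorem of calculus for a nonnegative derivative on `(0, t]`. -/
lemma lintegral_Ioc_of_hasDerivAt {F F' : ℝ → ℝ} {c t : ℝ} (ht : 0 < t)
    (hd : ∀ u, 0 < u → HasDerivAt F (F' u) u) (h0 : ∀ u, 0 < u → 0 ≤ F' u)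
    (hc : Tendsto F (𝓝[>] 0) (𝓝 c)) :
    ∫⁻ u in Set.Ioc 0 t, ENNReal.ofReal (F' u) = ENNReal.ofReal (F t - c) := by
  -- The value `F 0` need not be the right limit at 0 (for `M` it stems from a division by zero), so
  -- it is replaced by that limit to get continuity on the closed interval.
  set g : ℝ → ℝ := Function.update F 0 c with hg
  have hgF : ∀ u, 0 < u → g u = F u := fun u hu => Function.update_of_ne hu.ne' _ _
  have hderiv : ∀ u ∈ Set.Ioo 0 t, HasDerivAt g (F' u) u := fun u hu => by
    refine (hd u hu.1).congr_of_eventuallyEq ?_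
    filter_upwards [Ioi_mem_nhds hu.1] with v hv using hgF v hv
  have hcont : ContinuousOn g (Set.Icc 0 t) := by
    intro u hu
    rcases hu.1.eq_or_lt with rfl | hu0
    · rw [hg, continuousWithinAt_update_same]
      refine hc.mono_left (nhdsWithin_mono _ fun v hv => ?_)
      exact lt_of_le_of_ne hv.1.1 (Ne.symm hv.2)
    · refine ContinuousAt.continuousWithinAt ?_
      refine (hd u hu0).continuousAt.congr ?_
      filter_upwards [Ioi_mem_nhds hu0] with v hv using (hgF v hv).symm
  have hpos : ∀ u ∈ Set.Ioo 0 t, 0 ≤ F' u := fun u hu => h0 u hu.1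
  have hint := intervalIntegral.integrableOn_deriv_of_nonneg hcont hderiv hpos
  have hI := intervalIntegral.integral_eq_sub_of_hasDerivAt_of_le ht.le hcont hderiv
    ((intervalIntegrable_iff_integrableOn_Ioc_of_le ht.le).2 hint)
  rw [intervalIntegral.integral_of_le ht.le, hgF t ht, hg, Function.update_self] at hI
  rw [← hI, ofReal_integral_eq_lintegral_ofReal hint]
  exact (ae_restrict_mem measurableSet_Ioc).mono fun u hu => h0 u hu.1

end

end MmWave

namespace MmWave

noncomputable section

open Filter Topology

/-! ### The intensity measure of the propagation losses -/

instance : MeasurableSpace Link := ⊤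

instance : DiscreteMeasurableSpace Link := ⟨fun _ => trivial⟩

instance : Finite Link :=
  Finite.of_surjective (fun b : Bool => if b then Link.los else Link.nlos) fun a => by
    cases a
    · exact ⟨true, rfl⟩
    · exact ⟨false, rfl⟩

/-- The marks of a BS that determine its propagation loss: whether it is LOS if it is near, and its
shadowing for both link types. -/
abbrev GeoMark : Type := Bool × ℝ × ℝ

namespace Params

variable (p : Params)

/-- The path loss of a link of type `a` and length `r`, with shadowing `s`. -/
def lossAt (a : Link) (r s : ℝ) : ℝ := (10 : ℝ) ^ ((p.β + 10 * p.α a * Real.logb 10 r + s) / 10)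

open Classical in
/-- The link type of a BS at `x`. -/
def linkOf (x : Plane) (b : Bool) : Link := if ‖x‖ ≤ p.D ∧ b = true then .los else .nlos

/-- The shadowing of a link of type `a`. -/
def _root_.MmWave.shadowOf (a : Link) (g : GeoMark) : ℝ :=
  match a with
  | .los => g.2.1
  | .nlos => g.2.2

/-- The path loss and the type of the link from a BS at `x` with marks `g`. -/
def lossLink (q : Plane × GeoMark) : ℝ × Link :=
  (p.lossAt (p.linkOf q.1 q.2.1) ‖q.1‖ (shadowOf (p.linkOf q.1 q.2.1) q.2), p.linkOf q.1 q.2.1)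

/-- The law of the LOS marks. -/
def losLaw : Measure Bool :=
  ENNReal.ofReal p.pLOS • Measure.dirac true + ENNReal.ofReal (1 - p.pLOS) • Measure.dirac false

instance : IsProbabilityMeasure p.losLaw := ⟨by
  have h0 := p.pLOS_nonneg
  have h1 := p.pLOS_le_one
  simp [losLaw, ← ENNReal.ofReal_add h0 (sub_nonneg.2 h1)]⟩

/-- The law of the shadowing. -/
def shadowLaw (a : Link) : Measure ℝ := gaussianReal 0 (p.ξ a ^ 2).toNNReal

instance (a : Link) : IsProbabilityMeasure (p.shadowLaw a) := by
  unfold shadowLaw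
  infer_instance

/-- The law of the marks of a BS that determine its propagation loss. -/
def geoLaw : Measure GeoMark := p.losLaw.prod ((p.shadowLaw .los).prod (p.shadowLaw .nlos))

instance : IsProbabilityMeasure p.geoLaw := by
  unfold geoLaw
  infer_instance

/-- The intensity measure of the BSs. -/
def spatial : Measure Plane := ENNReal.ofReal p.lamBS • volume

instance : SigmaFinite p.spatial := by
  change SigmaFinite (p.lamBS.toNNReal • (volume : Measure Plane))
  infer_instance

/-- The intensity measure of the path losses and link types. -/
def lossMeasure : Measure (ℝ × Link) := (p.spatial.prod p.geoLaw).map p.lossLink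

lemma measurable_linkOf : Measurable fun q : Plane × Bool => p.linkOf q.1 q.2 := by
  refine Measurable.ite (MeasurableSet.inter ?_ ?_) measurable_const measurable_const
  · exact measurableSet_le (measurable_norm.comp measurable_fst) measurable_const
  · exact measurable_snd (measurableSet_singleton true)

lemma measurable_lossAt (a : Link) : Measurable fun q : ℝ × ℝ => p.lossAt a q.1 q.2 := by
  have h : (fun q : ℝ × ℝ => p.lossAt a q.1 q.2) = fun q => Real.exp (Real.log 10 *
      ((p.β + 10 * p.α a * (Real.log q.1 / Real.log 10) + q.2) / 10)) := by
    ext q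
    rw [lossAt, Real.rpow_def_of_pos (by norm_num), Real.logb]
  rw [h]
  generalize p.β = b
  fun_prop

lemma _root_.MmWave.measurable_shadowOf (a : Link) : Measurable (shadowOf a) := by
  cases a
  · exact measurable_fst.comp measurable_snd
  · exact measurable_snd.comp measurable_snd

lemma measurable_linkOf_mark : Measurable fun q : Plane × GeoMark => p.linkOf q.1 q.2.1 := by
  have hf : Measurable fun q : Plane × GeoMark => (q.1, q.2.1) :=
    measurable_fst.prodMk (measurable_fst.comp measurable_snd)
  have h := p.measurable_linkOf.comp hf
  exact h

lemma measurable_lossAt_mark (a : Link) :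
    Measurable fun q : Plane × GeoMark => p.lossAt a ‖q.1‖ (shadowOf a q.2) := by
  have hf : Measurable fun q : Plane × GeoMark => (‖q.1‖, shadowOf a q.2) :=
    (measurable_norm.comp measurable_fst).prodMk ((measurable_shadowOf a).comp measurable_snd)
  have h := (p.measurable_lossAt a).comp hf
  exact h

/-- The loss depends on the random link type, which takes finitely many values, so measurability may
be checked type by type. -/
lemma measurable_lossLink : Measurable p.lossLink := by
  have h2 := measurable_from_prod_countable_left
    (f := fun r : (Plane × GeoMark) × Link => p.lossAt r.2 ‖r.1.1‖ (shadowOf r.2 r.1.2))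
    p.measurable_lossAt_mark
  have h3 := (h2.comp (measurable_id.prodMk p.measurable_linkOf_mark)).prodMk
    p.measurable_linkOf_mark
  exact h3

/-- The length of a link of type `a` with shadowing `s` and path loss `t`. -/
def radius (a : Link) (t s : ℝ) : ℝ :=
  (t * Real.exp (p.m - 0.1 * Real.log 10 * s)) ^ (1 / p.α a)

lemma lossAt_pos (a : Link) (r s : ℝ) : 0 < p.lossAt a r s := Real.rpow_pos_of_pos (by norm_num) _

lemma lossAt_le_iff (a : Link) {t r : ℝ} (ht : 0 < t) (hr : 0 < r) (s : ℝ) :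
    p.lossAt a r s ≤ t ↔ r ≤ p.radius a t s := by
  have hα := p.α_pos a
  have hl : Real.log 10 ≠ 0 := (Real.log_pos (by norm_num)).ne'
  have h1 : p.lossAt a r s = Real.exp (-p.m + 0.1 * Real.log 10 * s) * r ^ p.α a := by
    rw [lossAt, Real.rpow_def_of_pos (by norm_num), Real.rpow_def_of_pos hr, ← Real.exp_add,
      Real.logb, m]
    congr 1
    field_simp
    ring
  have h2 : (r : ℝ) ≤ p.radius a t s ↔
      r ^ p.α a ≤ t * Real.exp (p.m - 0.1 * Real.log 10 * s) := by
    rw [radius, one_div]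
    exact (Real.le_rpow_inv_iff_of_pos hr.le (by positivity) hα)
  have h3 : Real.exp (p.m - 0.1 * Real.log 10 * s) =
      (Real.exp (-p.m + 0.1 * Real.log 10 * s))⁻¹ := by
    rw [← Real.exp_neg]
    congr 1
    ring
  rw [h2, h1, h3, ← div_eq_mul_inv, le_div_iff₀ (Real.exp_pos _), mul_comm]

lemma radius_nonneg (a : Link) {t : ℝ} (ht : 0 < t) (s : ℝ) : 0 ≤ p.radius a t s :=
  Real.rpow_nonneg (by positivity) _

lemma radius_sq (a : Link) {t : ℝ} (ht : 0 < t) (s : ℝ) : p.radius a t s ^ 2 =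
    t ^ (2 / p.α a) * Real.exp (2 * p.m / p.α a) *
      Real.exp (-(0.2 * Real.log 10 / p.α a) * s) := by
  have hα := (p.α_pos a).ne'
  rw [radius, ← Real.rpow_natCast, ← Real.rpow_mul (by positivity), Real.mul_rpow ht.le
    (Real.exp_pos _).le, ← Real.exp_mul, mul_assoc (t ^ _), ← Real.exp_add]
  congr 2
  · push_cast; field_simp
  · push_cast; field_simp; ring

lemma ae_ne_zero_plane : ∀ᵐ x : Plane, x ≠ 0 := by
  rw [ae_iff]
  simp

lemma volume_loss_le (a : Link) {t : ℝ} (ht : 0 < t) (s : ℝ) :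
    volume {x : Plane | p.lossAt a ‖x‖ s ≤ t} =
      ENNReal.ofReal (Real.pi * p.radius a t s ^ 2) := by
  have : {x : Plane | p.lossAt a ‖x‖ s ≤ t} =ᵐ[volume] Metric.closedBall 0 (p.radius a t s) := by
    filter_upwards [ae_ne_zero_plane] with x hx
    refine propext ?_
    change p.lossAt a ‖x‖ s ≤ t ↔ x ∈ Metric.closedBall 0 _
    rw [p.lossAt_le_iff a ht (norm_pos_iff.2 hx), mem_closedBall_zero_iff]
  rw [measure_congr this, EuclideanSpace.volume_closedBall_fin_two,
    ← ENNReal.ofReal_pow (p.radius_nonneg a ht s), ← ENNReal.ofReal_mul (sq_nonneg _), mul_comm]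

lemma volume_near_loss_le (a : Link) {t : ℝ} (ht : 0 < t) (s : ℝ) :
    volume {x : Plane | ‖x‖ ≤ p.D ∧ p.lossAt a ‖x‖ s ≤ t} =
      ENNReal.ofReal (Real.pi * min (p.D ^ 2) (p.radius a t s ^ 2)) := by
  have h : {x : Plane | ‖x‖ ≤ p.D ∧ p.lossAt a ‖x‖ s ≤ t} =ᵐ[volume]
      Metric.closedBall 0 (min p.D (p.radius a t s)) := by
    filter_upwards [ae_ne_zero_plane] with x hx
    refine propext ?_
    change (‖x‖ ≤ p.D ∧ p.lossAt a ‖x‖ s ≤ t) ↔ x ∈ Metric.closedBall 0 _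
    rw [p.lossAt_le_iff a ht (norm_pos_iff.2 hx), mem_closedBall_zero_iff, le_min_iff]
  have h0 : 0 ≤ min p.D (p.radius a t s) := le_min p.D_pos.le (p.radius_nonneg a ht s)
  have h2 : min p.D (p.radius a t s) ^ 2 = min (p.D ^ 2) (p.radius a t s ^ 2) := by
    rcases le_total p.D (p.radius a t s) with hle | hle
    · rw [min_eq_left hle, min_eq_left (pow_le_pow_left₀ p.D_pos.le hle 2)]
    · rw [min_eq_right hle, min_eq_right (pow_le_pow_left₀ (p.radius_nonneg a ht s) hle 2)]
  rw [measure_congr h, EuclideanSpace.volume_closedBall_fin_two,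
    ← ENNReal.ofReal_pow h0, ← ENNReal.ofReal_mul (sq_nonneg _), mul_comm, h2]

/-- The second factor is the mean of the log-normal factor in `radius_sq`; this is the origin of
`expConst`. -/
lemma exp_shift (a : Link) : Real.exp (2 * p.m / p.α a) *
    Real.exp ((0.2 * Real.log 10 / p.α a) ^ 2 * p.ξ a ^ 2 / 2) = p.expConst a := by
  have hα := (p.α_pos a).ne'
  rw [expConst, ← Real.exp_add, σ]
  congr 1
  field_simp
  ring

/-- The expected area of the region where the path loss is at most `t`. -/
lemma lintegral_volume_loss_le (a : Link) {t : ℝ} (ht : 0 < t) :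
    ∫⁻ s, volume {x : Plane | p.lossAt a ‖x‖ s ≤ t} ∂(p.shadowLaw a) =
      ENNReal.ofReal (Real.pi * (t ^ (2 / p.α a) * p.expConst a)) := by
  have h := lintegral_exp_gaussianReal (p.ξ_pos a) (0.2 * Real.log 10 / p.α a) MeasurableSet.univ
  rw [Measure.restrict_univ, measure_univ, mul_one] at h
  calc ∫⁻ s, volume {x : Plane | p.lossAt a ‖x‖ s ≤ t} ∂(p.shadowLaw a)
      = ∫⁻ s, ENNReal.ofReal (Real.pi * (t ^ (2 / p.α a) * Real.exp (2 * p.m / p.α a))) *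
          ENNReal.ofReal (Real.exp (-(0.2 * Real.log 10 / p.α a) * s)) ∂(p.shadowLaw a) := by
        refine lintegral_congr fun s => ?_
        rw [p.volume_loss_le a ht, p.radius_sq a ht, ← ENNReal.ofReal_mul (by positivity)]
        congr 1
        ring
    _ = _ := by
        rw [lintegral_const_mul _ (by fun_prop), shadowLaw, h, ← ENNReal.ofReal_mul (by positivity),
          ← p.exp_shift a]
        congr 1
        ring

/-- Both squares are exponentials and the exponent of the right one is affine and decreasing in s.
This locates the shadowing at which the minimum in `volume_near_loss_le` changes branch. -/
lemma sq_le_radius_sq_iff (a : Link) {t : ℝ} (ht : 0 < t) (s : ℝ) :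
    p.D ^ 2 ≤ p.radius a t s ^ 2 ↔ s ≤ -(p.ξ a * p.Υ a t) := by
  have hD := p.D_pos
  have hα := p.α_pos a
  have hξ := p.ξ_pos a
  have hl : 0 < Real.log 10 := Real.log_pos (by norm_num)
  have h2 : p.D ^ 2 = Real.exp (2 * Real.log p.D) := by
    rw [two_mul, Real.exp_add, Real.exp_log hD, sq]
  rw [p.radius_sq a ht, h2, Real.rpow_def_of_pos ht, ← Real.exp_add, ← Real.exp_add,
    Real.exp_le_exp, p.Υ_eq a ht, σ]
  have e1 : Real.log t * (2 / p.α a) + 2 * p.m / p.α a + -(0.2 * Real.log 10 / p.α a) * s -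
      2 * Real.log p.D =
      (0.2 * Real.log 10 / p.α a) * (-(p.ξ a * ((p.α a * Real.log p.D - Real.log t - p.m) /
        (0.1 * p.ξ a * Real.log 10))) - s) := by
    field_simp
    ring
  have hpos : 0 < 0.2 * Real.log 10 / p.α a := by positivity
  rw [← sub_nonneg, e1, mul_nonneg_iff_of_pos_left hpos, sub_nonneg]

/-- The expected area of the part of the disk of radius `D` where the path loss is at most `t`. -/
lemma lintegral_volume_near_loss_le (a : Link) {t : ℝ} (ht : 0 < t) :
    ∫⁻ s, volume {x : Plane | ‖x‖ ≤ p.D ∧ p.lossAt a ‖x‖ s ≤ t} ∂(p.shadowLaw a) =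
      ENNReal.ofReal (Real.pi * (p.D ^ 2 * Q (p.Υ a t) +
        t ^ (2 / p.α a) * p.expConst a * p.tail a t)) := by
  have hξ := p.ξ_pos a
  have hα := p.α_pos a
  have hσ := p.σ_pos a
  have hl : 0 < Real.log 10 := Real.log_pos (by norm_num)
  -- For shadowing up to `s₀` the loss is at most t on almost all of the disk of radius D, which
  -- gives the first Gaussian tail. Beyond `s₀` the region is a smaller disk, and the tilted normal
  -- law gives the second one.
  set s₀ := -(p.ξ a * p.Υ a t) with hs₀
  have h := lintegral_exp_gaussianReal hξ (0.2 * Real.log 10 / p.α a)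
    (measurableSet_Ioi (a := s₀))
  have hQ : (s₀ - -(0.2 * Real.log 10 / p.α a) * p.ξ a ^ 2) / p.ξ a =
      2 * p.σ a ^ 2 / (p.α a * p.σ a) - p.Υ a t := by
    rw [hs₀]
    field_simp
    rw [σ]
    ring
  rw [gaussianReal_Ioi _ _ hξ, hQ] at h
  have hI := gaussianReal_Iic hξ s₀
  have hQ2 : -s₀ / p.ξ a = p.Υ a t := by
    rw [hs₀]
    field_simp
  rw [hQ2] at hI
  have h0 := Q_nonneg (p.Υ a t)
  have h0' := p.tail_nonneg a t
  have he : 0 < p.expConst a := Real.exp_pos _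
  rw [← lintegral_add_compl _ (measurableSet_Iic (a := s₀)), Set.compl_Iic, mul_add,
    ENNReal.ofReal_add (by positivity) (by positivity)]
  congr 1
  · calc ∫⁻ s in Set.Iic s₀, volume {x : Plane | ‖x‖ ≤ p.D ∧ p.lossAt a ‖x‖ s ≤ t} ∂(p.shadowLaw a)
        = ∫⁻ _ in Set.Iic s₀, ENNReal.ofReal (Real.pi * p.D ^ 2) ∂(p.shadowLaw a) := by
          refine setLIntegral_congr_fun measurableSet_Iic fun s hs => ?_
          simp only [p.volume_near_loss_le a ht]
          rw [min_eq_left ((p.sq_le_radius_sq_iff a ht s).2 hs)]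
      _ = _ := by
          rw [setLIntegral_const, shadowLaw, hI, ← ENNReal.ofReal_mul (by positivity)]
          congr 1
          ring
  · calc ∫⁻ s in Set.Ioi s₀, volume {x : Plane | ‖x‖ ≤ p.D ∧ p.lossAt a ‖x‖ s ≤ t} ∂(p.shadowLaw a)
        = ∫⁻ s in Set.Ioi s₀, ENNReal.ofReal (Real.pi * (t ^ (2 / p.α a) *
            Real.exp (2 * p.m / p.α a))) *
            ENNReal.ofReal (Real.exp (-(0.2 * Real.log 10 / p.α a) * s)) ∂(p.shadowLaw a) := by
          refine setLIntegral_congr_fun measurableSet_Ioi fun s hs => ?_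
          have hs' : ¬p.D ^ 2 ≤ p.radius a t s ^ 2 := fun hc =>
            not_lt.2 ((p.sq_le_radius_sq_iff a ht s).1 hc) hs
          simp only [p.volume_near_loss_le a ht]
          rw [min_eq_right (not_le.1 hs').le, p.radius_sq a ht, ← ENNReal.ofReal_mul (by positivity)]
          congr 1
          ring
      _ = _ := by
          rw [lintegral_const_mul _ (by fun_prop), shadowLaw, h,
            ← ENNReal.ofReal_mul (by positivity), ← ENNReal.ofReal_mul (by positivity),
            ← p.exp_shift a, tail]
          congr 1
          ring

lemma measurable_volume_loss (a : Link) (t : ℝ) {S : Set Plane} (hS : MeasurableSet S) :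
    Measurable fun s => volume {x : Plane | x ∈ S ∧ p.lossAt a ‖x‖ s ≤ t} := by
  have : MeasurableSet {q : ℝ × Plane | q.2 ∈ S ∧ p.lossAt a ‖q.2‖ q.1 ≤ t} :=
    (measurable_snd hS).inter (measurableSet_le
      ((p.measurable_lossAt a).comp ((measurable_norm.comp measurable_snd).prodMk measurable_fst))
      measurable_const)
  exact measurable_measure_prodMk_left this

lemma lintegral_geoLaw {h : GeoMark → ℝ≥0∞} (hh : Measurable h) :
    ∫⁻ g, h g ∂p.geoLaw =
      ENNReal.ofReal p.pLOS *
        ∫⁻ s, ∫⁻ s', h (true, s, s') ∂(p.shadowLaw .nlos) ∂(p.shadowLaw .los) +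
      ENNReal.ofReal (1 - p.pLOS) *
        ∫⁻ s, ∫⁻ s', h (false, s, s') ∂(p.shadowLaw .nlos) ∂(p.shadowLaw .los) := by
  rw [geoLaw, lintegral_prod _ hh.aemeasurable, losLaw, lintegral_add_measure,
    lintegral_smul_measure, lintegral_smul_measure, lintegral_dirac, lintegral_dirac]
  simp only [smul_eq_mul]
  rw [lintegral_prod (fun y => h (true, y)) (hh.comp measurable_prodMk_left).aemeasurable,
    lintegral_prod (fun y => h (false, y)) (hh.comp measurable_prodMk_left).aemeasurable]

lemma M_nonneg (a : Link) {t : ℝ} (ht : 0 < t) : 0 ≤ p.M a t := by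
  have h := lintegral_Ioc_of_hasDerivAt ht (fun u hu => p.hasDerivAt_M a hu)
    (fun u hu => p.M'_nonneg a hu) (p.tendsto_M_zero a)
  by_contra hneg
  have hmono : MonotoneOn (p.M a) (Set.Ioi 0) := by
    refine monotoneOn_of_deriv_nonneg (convex_Ioi 0)
      (fun u hu => (p.hasDerivAt_M a hu).continuousAt.continuousWithinAt) ?_ ?_
    · rw [interior_Ioi]
      exact fun u hu => (p.hasDerivAt_M a hu).differentiableAt.differentiableWithinAt
    · rw [interior_Ioi]
      intro u hu
      rw [(p.hasDerivAt_M a hu).deriv]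
      exact p.M'_nonneg a hu
  have : (0 : ℝ) ≤ p.M a t := by
    refine le_of_tendsto (p.tendsto_M_zero a) ?_
    filter_upwards [Ioo_mem_nhdsGT ht] with u hu
    exact hmono hu.1 ht hu.2.le
  exact hneg this

/-- By Fubini, an expected count is a mean area over the marks. LOS stations are the marked ones
within distance D. NLOS stations fill the whole plane if the mark is false, and only the outside of
the disk if it is true. -/
lemma lossMeasure_Iic (a : Link) {t : ℝ} (ht : 0 < t) :
    p.lossMeasure (Set.Iic t ×ˢ {a}) = ENNReal.ofReal (p.lamBS * p.M a t) := by
  have hms : MeasurableSet (Set.Iic t ×ˢ ({a} : Set Link)) :=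
    measurableSet_Iic.prod (MeasurableSet.of_discrete)
  have hlam := p.lam_nonneg
  have hp0 := p.pLOS_nonneg
  have hp1 : 0 ≤ 1 - p.pLOS := sub_nonneg.2 p.pLOS_le_one
  rw [lossMeasure, Measure.map_apply p.measurable_lossLink hms,
    Measure.prod_apply_symm (p.measurable_lossLink hms), spatial]
  simp only [Measure.smul_apply, smul_eq_mul]
  have hball : MeasurableSet {x : Plane | ‖x‖ ≤ p.D} := measurableSet_le measurable_norm
    measurable_const
  have hr1 : 0 ≤ Q (p.Υ a t) := Q_nonneg _
  have hr2 := p.tail_nonneg a t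
  have hr2' := p.tail_le_one a t
  have hr3 : 0 < p.expConst a := Real.exp_pos _
  cases a with
  | los =>
    have key : ∀ g : GeoMark,
        ENNReal.ofReal p.lamBS * volume ((fun x => (x, g)) ⁻¹' (p.lossLink ⁻¹'
          (Set.Iic t ×ˢ {Link.los}))) =
        (fun g : GeoMark => ENNReal.ofReal p.lamBS * (if g.1 = true then
          volume {x : Plane | ‖x‖ ≤ p.D ∧ p.lossAt .los ‖x‖ g.2.1 ≤ t} else 0)) g := by
      rintro ⟨b, s, s'⟩
      simp only
      congr 1
      cases b with
      | true =>
        rw [if_pos rfl]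
        congr 1
        ext x
        by_cases hx : ‖x‖ ≤ p.D <;> simp [lossLink, linkOf, hx, shadowOf]
      | false =>
        rw [if_neg (by simp), measure_eq_zero_iff_ae_notMem]
        refine ae_of_all _ fun x => ?_
        simp [lossLink, linkOf]
    rw [lintegral_congr key, p.lintegral_geoLaw]
    · simp only [if_true, lintegral_const, measure_univ, mul_one, Bool.false_eq_true, if_false,
        mul_zero, add_zero]
      have hm : Measurable fun s => volume {x : Plane | ‖x‖ ≤ p.D ∧ p.lossAt .los ‖x‖ s ≤ t} :=
        p.measurable_volume_loss .los t hball
      rw [lintegral_const_mul _ hm,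
        p.lintegral_volume_near_loss_le .los ht, ← ENNReal.ofReal_mul hlam,
        ← ENNReal.ofReal_mul hp0, M]
      congr 1
      rw [tail]
      ring
    · refine Measurable.const_mul (Measurable.ite (measurable_fst (measurableSet_singleton true))
        ?_ measurable_const) _
      exact (p.measurable_volume_loss .los t hball).comp (measurable_fst.comp measurable_snd)
  | nlos =>
    have key : ∀ g : GeoMark,
        ENNReal.ofReal p.lamBS * volume ((fun x => (x, g)) ⁻¹' (p.lossLink ⁻¹'
          (Set.Iic t ×ˢ {Link.nlos}))) =
        (fun g : GeoMark => ENNReal.ofReal p.lamBS * (if g.1 = true then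
          volume {x : Plane | x ∈ {x : Plane | ‖x‖ ≤ p.D}ᶜ ∧ p.lossAt .nlos ‖x‖ g.2.2 ≤ t} else
          volume {x : Plane | p.lossAt .nlos ‖x‖ g.2.2 ≤ t})) g := by
      rintro ⟨b, s, s'⟩
      simp only
      congr 1
      cases b with
      | true =>
        rw [if_pos rfl]
        congr 1
        ext x
        by_cases hx : ‖x‖ ≤ p.D <;> simp [lossLink, linkOf, hx, shadowOf, not_lt.2, not_le.1]
      | false =>
        rw [if_neg (by simp)]
        congr 1
        ext x
        simp [lossLink, linkOf, shadowOf]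
    have hm1 := p.measurable_volume_loss .nlos t hball.compl
    have hm1' := p.measurable_volume_loss .nlos t hball
    have hm2 : Measurable fun s => volume {x : Plane | p.lossAt .nlos ‖x‖ s ≤ t} := by
      simpa using p.measurable_volume_loss .nlos t MeasurableSet.univ
    have hV2 := p.lintegral_volume_loss_le .nlos ht
    have hV1 := p.lintegral_volume_near_loss_le .nlos ht
    -- The area outside the disk is the total area minus the area inside. Both are known and finite,
    -- so the subtraction in [0, ∞] is harmless.
    have hadd : ∫⁻ s, volume {x : Plane | p.lossAt .nlos ‖x‖ s ≤ t} ∂(p.shadowLaw .nlos) =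
        ∫⁻ s, volume {x : Plane | ‖x‖ ≤ p.D ∧ p.lossAt .nlos ‖x‖ s ≤ t} ∂(p.shadowLaw .nlos) +
        ∫⁻ s, volume {x : Plane | x ∈ {x : Plane | ‖x‖ ≤ p.D}ᶜ ∧ p.lossAt .nlos ‖x‖ s ≤ t}
          ∂(p.shadowLaw .nlos) := by
      rw [← lintegral_add_right _ hm1]
      refine lintegral_congr fun s => ?_
      rw [← measure_inter_add_sdiff {x : Plane | p.lossAt .nlos ‖x‖ s ≤ t} hball]
      congr 2
      · ext x; exact and_comm
      · ext x; exact and_comm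
    set A := Real.pi * (p.D ^ 2 * Q (p.Υ .nlos t) +
        t ^ (2 / p.α .nlos) * p.expConst .nlos * p.tail .nlos t) with hA
    set C := Real.pi * (t ^ (2 / p.α .nlos) * p.expConst .nlos) with hC
    have hA0 : 0 ≤ A := by positivity
    have hC0 : 0 ≤ C := by positivity
    have hV3 : ∫⁻ s, volume {x : Plane | x ∈ {x : Plane | ‖x‖ ≤ p.D}ᶜ ∧ p.lossAt .nlos ‖x‖ s ≤ t}
          ∂(p.shadowLaw .nlos) = ENNReal.ofReal (C - A) := by
      rw [hV2, hV1] at hadd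
      rw [ENNReal.ofReal_sub _ hA0, hadd, ENNReal.add_sub_cancel_left ENNReal.ofReal_ne_top]
    have hAC : A ≤ C := by
      rw [hV2, hV1] at hadd
      exact (ENNReal.ofReal_le_ofReal_iff hC0).1 (hadd ▸ le_self_add)
    rw [lintegral_congr key, p.lintegral_geoLaw]
    · simp only [if_true, lintegral_const, measure_univ, mul_one, Bool.false_eq_true, if_false]
      rw [lintegral_const_mul _ hm1, lintegral_const_mul _ hm2, hV3, hV2,
        ← ENNReal.ofReal_mul hlam, ← ENNReal.ofReal_mul hlam, ← ENNReal.ofReal_mul hp0,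
        ← ENNReal.ofReal_mul hp1, ← ENNReal.ofReal_add]
      · congr 1
        rw [hA, hC, M, tail]
        ring
      · exact mul_nonneg hp0 (mul_nonneg hlam (sub_nonneg.2 hAC))
      · positivity
    · refine Measurable.const_mul (Measurable.ite (measurable_fst (measurableSet_singleton true))
        ?_ ?_) _
      · exact hm1.comp (measurable_snd.comp measurable_snd)
      · exact hm2.comp (measurable_snd.comp measurable_snd)

end Params

end

end MmWave

namespace MmWave

noncomputable section

open Filter Topology

/-! ### The intensity of the losses as a density, and the law of the smallest loss. -/

lemma measure_ext_of_Iic_ne_top {μ ν : Measure ℝ} (hfin : ∀ t, μ (Set.Iic t) ≠ ∞)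
    (h : ∀ t, μ (Set.Iic t) = ν (Set.Iic t)) : μ = ν := by
  have : IsLocallyFiniteMeasure μ :=
    ⟨fun x => ⟨Set.Iic (x + 1), Iic_mem_nhds (by linarith), (hfin _).lt_top⟩⟩
  refine Measure.ext_of_Ioc μ ν fun a b hab => ?_
  rw [← Set.Iic_sdiff_Iic, measure_sdiff (Set.Iic_subset_Iic.2 hab.le)
    measurableSet_Iic.nullMeasurableSet (hfin a), measure_sdiff (Set.Iic_subset_Iic.2 hab.le)
    measurableSet_Iic.nullMeasurableSet (h a ▸ hfin a), h, h]

namespace Params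

variable (p : Params)

/-- The intensity measure of the propagation losses of type `a`. -/
def lossDensity (a : Link) : Measure ℝ :=
  (volume.restrict (Set.Ioi 0)).withDensity fun t => ENNReal.ofReal (p.intensity a t)

lemma lossDensity_Iic (a : Link) {t : ℝ} (ht : 0 < t) :
    p.lossDensity a (Set.Iic t) = ENNReal.ofReal (p.lamBS * p.M a t) := by
  rw [lossDensity, withDensity_apply _ measurableSet_Iic, Measure.restrict_restrict
    measurableSet_Iic, Set.inter_comm, Set.Ioi_inter_Iic]
  have h := lintegral_Ioc_of_hasDerivAt (F := fun t => p.lamBS * p.M a t) (F' := p.intensity a)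
    (c := p.lamBS * 0) ht (fun u hu => (p.hasDerivAt_M a hu).const_mul _)
    (fun u hu => p.intensity_nonneg a hu) ((p.tendsto_M_zero a).const_mul _)
  rw [mul_zero, sub_zero] at h
  exact h

lemma lossDensity_Iic_of_nonpos (a : Link) {t : ℝ} (ht : t ≤ 0) :
    p.lossDensity a (Set.Iic t) = 0 := by
  rw [lossDensity, withDensity_apply _ measurableSet_Iic, Measure.restrict_restrict
    measurableSet_Iic, Set.inter_comm, Set.Ioi_inter_Iic, Set.Ioc_eq_empty (not_lt.2 ht)]
  simp

lemma measurable_prodMk_link (a : Link) : Measurable fun t : ℝ => (t, a) := by fun_prop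

lemma measurableEmbedding_link (a : Link) : MeasurableEmbedding fun t : ℝ => (t, a) :=
  measurableEmbedding_prod_mk_right a

/-- Both measures are finite and equal on half-lines: for t > 0 they have the value λ M(t), the
second one by the fundamental theorem of calculus, and for t ≤ 0 they vanish because losses are
positive. -/
lemma lossMeasure_comap (a : Link) :
    p.lossMeasure.comap (fun t => (t, a)) = p.lossDensity a := by
  have hIic : ∀ t, p.lossMeasure.comap (fun t => (t, a)) (Set.Iic t) =
      p.lossDensity a (Set.Iic t) := fun t => by
    rw [(measurableEmbedding_link a).comap_apply]
    have himg : (fun t => (t, a)) '' Set.Iic t = Set.Iic t ×ˢ {a} := by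
      rw [Set.prod_singleton]
    rw [himg]
    rcases lt_or_ge 0 t with ht | ht
    · rw [p.lossMeasure_Iic a ht, p.lossDensity_Iic a ht]
    · rw [p.lossDensity_Iic_of_nonpos a ht, lossMeasure, Measure.map_apply p.measurable_lossLink
        (measurableSet_Iic.prod MeasurableSet.of_discrete)]
      have : p.lossLink ⁻¹' (Set.Iic t ×ˢ {a}) = ∅ := by
        ext q
        simp only [Set.mem_preimage, Set.mem_prod, Set.mem_Iic, Set.mem_empty_iff_false, iff_false,
          not_and]
        intro h
        exact absurd (p.lossAt_pos _ _ _) (not_lt.2 (h.trans ht))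
      rw [this, measure_empty]
  refine measure_ext_of_Iic_ne_top (fun t => ?_) hIic
  rw [hIic]
  rcases lt_or_ge 0 t with ht | ht
  · rw [p.lossDensity_Iic a ht]
    exact ENNReal.ofReal_ne_top
  · rw [p.lossDensity_Iic_of_nonpos a ht]
    exact ENNReal.zero_ne_top

lemma lossMeasure_eq : p.lossMeasure = (p.lossDensity .los).map (fun t => (t, Link.los)) +
    (p.lossDensity .nlos).map (fun t => (t, Link.nlos)) := by
  ext s hs
  rw [Measure.add_apply, Measure.map_apply (measurable_prodMk_link _) hs,
    Measure.map_apply (measurable_prodMk_link _) hs, ← lossMeasure_comap, ← lossMeasure_comap,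
    (measurableEmbedding_link _).comap_apply, (measurableEmbedding_link _).comap_apply,
    ← measure_union]
  · congr 1
    ext ⟨t, a⟩
    cases a <;> simp
  · rw [Set.disjoint_left]
    rintro ⟨t, a⟩ ⟨u, -, hu⟩ ⟨v, -, hv⟩
    simp only [Prod.mk.injEq] at hu hv
    exact Link.noConfusion (hu.2.trans hv.2.symm)
  · exact (measurableEmbedding_link _).measurableSet_image.2 (measurable_prodMk_link _ hs)

lemma lintegral_lossDensity (a : Link) {h : ℝ → ℝ≥0∞} (hh : Measurable h) :
    ∫⁻ t, h t ∂(p.lossDensity a) =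
      ∫⁻ t in Set.Ioi 0, ENNReal.ofReal (p.intensity a t) * h t := by
  rw [lossDensity, lintegral_withDensity_eq_lintegral_mul _
    (p.measurable_intensity a).ennreal_ofReal hh]
  rfl

lemma lintegral_lossMeasure {h : ℝ × Link → ℝ≥0∞} (hh : Measurable h) :
    ∫⁻ q, h q ∂p.lossMeasure =
      ∫⁻ t, h (t, .los) ∂(p.lossDensity .los) + ∫⁻ t, h (t, .nlos) ∂(p.lossDensity .nlos) := by
  rw [lossMeasure_eq, lintegral_add_measure, lintegral_map hh (measurable_prodMk_link _),
    lintegral_map hh (measurable_prodMk_link _)]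

instance : SFinite p.lossMeasure := by
  unfold lossMeasure
  infer_instance

/-- The expected number of BSs with propagation loss at most `t`. -/
def totalM (t : ℝ) : ℝ := p.lamBS * p.M .los t + p.lamBS * p.M .nlos t

lemma totalM_nonneg {t : ℝ} (ht : 0 < t) : 0 ≤ p.totalM t :=
  add_nonneg (mul_nonneg p.lam_nonneg (p.M_nonneg _ ht)) (mul_nonneg p.lam_nonneg (p.M_nonneg _ ht))

lemma measurable_totalM : Measurable p.totalM :=
  ((p.measurable_M _).const_mul _).add ((p.measurable_M _).const_mul _)

lemma lossMeasure_le (t : ℝ) : p.lossMeasure {q | q.1 ≤ t} =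
    p.lossDensity .los (Set.Iic t) + p.lossDensity .nlos (Set.Iic t) := by
  have hs : MeasurableSet {q : ℝ × Link | q.1 ≤ t} := measurable_fst measurableSet_Iic
  rw [lossMeasure_eq, Measure.add_apply, Measure.map_apply (measurable_prodMk_link _) hs,
    Measure.map_apply (measurable_prodMk_link _) hs]
  rfl

lemma lossMeasure_le_of_pos {t : ℝ} (ht : 0 < t) :
    p.lossMeasure {q | q.1 ≤ t} = ENNReal.ofReal (p.totalM t) := by
  rw [lossMeasure_le, p.lossDensity_Iic _ ht, p.lossDensity_Iic _ ht, totalM, ENNReal.ofReal_add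
    (mul_nonneg p.lam_nonneg (p.M_nonneg _ ht)) (mul_nonneg p.lam_nonneg (p.M_nonneg _ ht))]

lemma lossMeasure_le_of_nonpos {t : ℝ} (ht : t ≤ 0) : p.lossMeasure {q | q.1 ≤ t} = 0 := by
  rw [lossMeasure_le, p.lossDensity_Iic_of_nonpos _ ht, p.lossDensity_Iic_of_nonpos _ ht, add_zero]

lemma lossMeasure_le_ne_top (t : ℝ) : p.lossMeasure {q | q.1 ≤ t} ≠ ∞ := by
  rcases lt_or_ge 0 t with ht | ht
  · rw [p.lossMeasure_le_of_pos ht]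
    exact ENNReal.ofReal_ne_top
  · rw [p.lossMeasure_le_of_nonpos ht]
    exact ENNReal.zero_ne_top

lemma measurable_nexp_lossMeasure :
    Measurable fun t : ℝ => nexp (p.lossMeasure {q | q.1 ≤ t}) := by
  have hm : Monotone fun t : ℝ => p.lossMeasure {q | q.1 ≤ t} := fun s t hst =>
    measure_mono fun q hq => le_trans hq hst
  exact measurable_nexp.comp hm.measurable

/-- The probability that the smallest propagation loss is at most `b`, as an integral of its
density. -/
lemma lintegral_nexp_lossMeasure {b : ℝ} (hb : 0 < b) :
    ∫⁻ q in {q : ℝ × Link | q.1 ≤ b}, nexp (p.lossMeasure {x | x.1 ≤ q.1}) ∂p.lossMeasure =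
      1 - nexp (p.lossMeasure {q | q.1 ≤ b}) := by
  have hs : MeasurableSet {q : ℝ × Link | q.1 ≤ b} := measurable_fst measurableSet_Iic
  have hnm := p.measurable_nexp_lossMeasure
  have hm : Measurable ({q : ℝ × Link | q.1 ≤ b}.indicator
      fun q => nexp (p.lossMeasure {x | x.1 ≤ q.1})) := (hnm.comp measurable_fst).indicator hs
  have hdens : ∀ a, ∫⁻ t, {q : ℝ × Link | q.1 ≤ b}.indicator
      (fun q => nexp (p.lossMeasure {x | x.1 ≤ q.1})) (t, a) ∂(p.lossDensity a) =
      ∫⁻ t in Set.Ioc 0 b, ENNReal.ofReal (p.intensity a t * Real.exp (-p.totalM t)) := by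
    intro a
    rw [p.lintegral_lossDensity a (h := fun t => {q : ℝ × Link | q.1 ≤ b}.indicator
        (fun q => nexp (p.lossMeasure {x | x.1 ≤ q.1})) (t, a)) (hm.comp (measurable_prodMk_link a)),
      ← Set.Ioi_inter_Iic, Set.inter_comm, ← Measure.restrict_restrict measurableSet_Iic,
      ← lintegral_indicator measurableSet_Iic]
    refine setLIntegral_congr_fun measurableSet_Ioi fun t ht => ?_
    by_cases htb : t ≤ b
    · have h1 : (t, a) ∈ {q : ℝ × Link | q.1 ≤ b} := htb
      simp only [Set.indicator_of_mem h1, Set.indicator_of_mem (Set.mem_Iic.2 htb)]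
      rw [p.lossMeasure_le_of_pos ht, nexp_ofReal (p.totalM_nonneg ht),
        ← ENNReal.ofReal_mul (p.intensity_nonneg a ht)]
    · have h1 : (t, a) ∉ {q : ℝ × Link | q.1 ≤ b} := htb
      have h2 : t ∉ Set.Iic b := htb
      simp only [Set.indicator_of_notMem h1, Set.indicator_of_notMem h2, mul_zero]
  have hme : ∀ a, Measurable fun t => ENNReal.ofReal (p.intensity a t * Real.exp (-p.totalM t)) :=
    fun a => ((p.measurable_intensity a).mul p.measurable_totalM.neg.exp).ennreal_ofReal
  rw [← lintegral_indicator hs, p.lintegral_lossMeasure hm, hdens, hdens,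
    ← lintegral_add_left (hme _)]
  have hsum : ∫⁻ t in Set.Ioc 0 b, (ENNReal.ofReal (p.intensity .los t * Real.exp (-p.totalM t)) +
      ENNReal.ofReal (p.intensity .nlos t * Real.exp (-p.totalM t))) =
      ∫⁻ t in Set.Ioc 0 b, ENNReal.ofReal
        (Real.exp (-p.totalM t) * (p.intensity .los t + p.intensity .nlos t)) := by
    refine setLIntegral_congr_fun measurableSet_Ioc fun t ht => ?_
    have h1 := p.intensity_nonneg .los ht.1
    have h2 := p.intensity_nonneg .nlos ht.1
    rw [← ENNReal.ofReal_add (by positivity) (by positivity)]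
    congr 1
    ring
  -- The density of the smallest loss is the derivative of -exp(-`totalM`), which starts from -1 at
  -- 0.
  have hd : ∀ u, 0 < u → HasDerivAt (fun t => -Real.exp (-p.totalM t))
      (Real.exp (-p.totalM u) * (p.intensity .los u + p.intensity .nlos u)) u := fun u hu => by
    have h := ((((p.hasDerivAt_M .los hu).const_mul p.lamBS).add
      ((p.hasDerivAt_M .nlos hu).const_mul p.lamBS)).neg).exp.neg
    refine h.congr_deriv ?_
    simp only [intensity, totalM]
    simp
    ring
  have hlim : Tendsto (fun t => -Real.exp (-p.totalM t)) (𝓝[>] 0) (𝓝 (-1)) := by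
    have h := ((p.tendsto_M_zero .los).const_mul p.lamBS).add
      ((p.tendsto_M_zero .nlos).const_mul p.lamBS)
    rw [mul_zero, add_zero] at h
    have h2 : Tendsto (fun t => -Real.exp (-(p.lamBS * p.M .los t + p.lamBS * p.M .nlos t)))
        (𝓝[>] 0) (𝓝 (-Real.exp (-0))) := (Real.continuous_exp.tendsto _).comp h.neg |>.neg
    rw [neg_zero, Real.exp_zero] at h2
    exact h2
  rw [hsum, lintegral_Ioc_of_hasDerivAt hb hd (fun u hu => mul_nonneg (Real.exp_pos _).le
    (add_nonneg (p.intensity_nonneg _ hu) (p.intensity_nonneg _ hu))) hlim,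
    p.lossMeasure_le_of_pos hb, nexp_ofReal (p.totalM_nonneg hb), ← ENNReal.ofReal_one,
    ← ENNReal.ofReal_sub _ (Real.exp_pos _).le]
  congr 1
  ring

end Params

end

end MmWave

namespace MmWave

noncomputable section

open Filter Topology

/-! ### Uniqueness of the Laplace transform -/

open scoped BoundedContinuousFunction in
/-- The polynomial functions on the unit interval. -/
def polynomialSubalgebra : StarSubalgebra ℝ (unitInterval →ᵇ ℝ) where
  carrier := {g | ∃ q : Polynomial ℝ, ∀ x : unitInterval, g x = q.eval (x : ℝ)}
  mul_mem' := by
    rintro f g ⟨q, hq⟩ ⟨r, hr⟩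
    exact ⟨q * r, fun x => by simp [hq, hr]⟩
  add_mem' := by
    rintro f g ⟨q, hq⟩ ⟨r, hr⟩
    exact ⟨q + r, fun x => by simp [hq, hr]⟩
  algebraMap_mem' := fun c => ⟨Polynomial.C c, fun x => by
    rw [Polynomial.eval_C]
    rfl⟩
  star_mem' := by
    rintro f ⟨q, hq⟩
    exact ⟨q, fun x => by simp [hq]⟩

/-- A finite measure on a compact interval is determined by its moments, since polynomials form an
algebra that separates points. -/
lemma measure_unitInterval_ext {μ ν : Measure unitInterval} [IsFiniteMeasure μ] [IsFiniteMeasure ν]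
    (h : ∀ n : ℕ, ∫ x, (x : ℝ) ^ n ∂μ = ∫ x, (x : ℝ) ^ n ∂ν) : μ = ν := by
  refine ext_of_forall_mem_subalgebra_integral_eq_of_polish (𝕜 := ℝ)
    (A := polynomialSubalgebra) ?_ ?_
  · intro x y hxy
    refine ⟨fun x => (x : ℝ), ⟨⟨fun x => (x : ℝ), continuous_subtype_val⟩, ?_, rfl⟩,
      fun h => hxy (Subtype.ext h)⟩
    refine ⟨BoundedContinuousFunction.mkOfCompact ⟨fun x => (x : ℝ), continuous_subtype_val⟩,
      ⟨Polynomial.X, fun x => by simp⟩, ?_⟩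
    ext x
    rfl
  · rintro g ⟨q, hq⟩
    have hint : ∀ (ρ : Measure unitInterval) [IsFiniteMeasure ρ] (n : ℕ),
        Integrable (fun x : unitInterval => (x : ℝ) ^ n) ρ := fun ρ _ n => by
      refine Integrable.of_bound (C := 1) ?_ (ae_of_all _ fun x => ?_)
      · exact (continuous_subtype_val.pow n).aestronglyMeasurable
      · rw [Real.norm_eq_abs, abs_of_nonneg (pow_nonneg x.2.1 _)]
        exact pow_le_one₀ x.2.1 x.2.2
    have hexp : ∀ (ρ : Measure unitInterval) [IsFiniteMeasure ρ],
        ∫ x, g x ∂ρ = ∑ i ∈ Finset.range (q.natDegree + 1), q.coeff i * ∫ x, (x : ℝ) ^ i ∂ρ :=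
      fun ρ _ => by
        simp only [hq, Polynomial.eval_eq_sum_range]
        rw [integral_finsetSum _ fun i _ => (hint ρ i).const_mul _]
        simp only [integral_const_mul]
    rw [hexp, hexp]
    simp only [h]

lemma nexp_injective : Function.Injective nexp := by
  intro x y h
  by_cases hx : x = ∞
  · rw [hx, nexp_top] at h
    rw [hx, nexp_eq_zero.1 h.symm]
  · have hy : y ≠ ∞ := fun hy => hx (nexp_eq_zero.1 (by rw [h, hy, nexp_top]))
    rw [← ENNReal.ofReal_toReal hx, ← ENNReal.ofReal_toReal hy, nexp_ofReal ENNReal.toReal_nonneg,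
      nexp_ofReal ENNReal.toReal_nonneg, ENNReal.ofReal_eq_ofReal_iff (Real.exp_pos _).le
      (Real.exp_pos _).le, Real.exp_eq_exp, neg_inj] at h
    rw [← ENNReal.ofReal_toReal hx, h, ENNReal.ofReal_toReal hy]

/-- `x ↦ exp (-x)` as a map to the unit interval. -/
def negExpUnit (x : ℝ≥0∞) : unitInterval := ⟨negExp x, negExp_nonneg x, negExp_le_one x⟩

/-- An injective measurable map between standard Borel spaces is a measurable embedding, so no
measure is lost by pushing it to the unit interval. -/
lemma measurableEmbedding_negExpUnit : MeasurableEmbedding negExpUnit := by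
  refine Measurable.measurableEmbedding (continuous_negExp.measurable.subtype_mk) ?_
  intro x y h
  refine nexp_injective ?_
  rw [← ofReal_negExp, ← ofReal_negExp, show negExp x = negExp y from congrArg Subtype.val h]

/-- A finite measure on `[0, ∞]` is determined by its Laplace transform at the integers. -/
lemma measure_ext_of_laplace {μ ν : Measure ℝ≥0∞} [IsFiniteMeasure μ] [IsFiniteMeasure ν]
    (h : ∀ n : ℕ, ∫⁻ x, nexp (n * x) ∂μ = ∫⁻ x, nexp (n * x) ∂ν) : μ = ν := by
  have hemb := measurableEmbedding_negExpUnit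
  -- Under x ↦ exp(-x) the Laplace transform at n becomes the n-th moment. The point ∞ goes to 0 and
  -- needs no separate treatment.
  have hmap : μ.map negExpUnit = ν.map negExpUnit := by
    refine measure_unitInterval_ext fun n => ?_
    rw [hemb.integral_map, hemb.integral_map]
    have key : ∀ ρ : Measure ℝ≥0∞, ∫ x, (negExpUnit x : ℝ) ^ n ∂ρ =
        (∫⁻ x, nexp (n * x) ∂ρ).toReal := fun ρ => by
      rw [integral_eq_lintegral_of_nonneg_ae]
      · congr 1
        refine lintegral_congr fun x => ?_
        rw [nexp_nsmul, ← ofReal_negExp, ← ENNReal.ofReal_pow (negExp_nonneg x)]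
        rfl
      · exact ae_of_all _ fun x => pow_nonneg (negExp_nonneg x) n
      · exact (continuous_negExp.measurable.pow_const n).aestronglyMeasurable
    rw [key, key, h]
  rw [← hemb.comap_map μ, hmap, hemb.comap_map]

/-! ### The nearest point of a Poisson process and the sum over the other ones -/

section Nearest

variable {Ω E : Type*} [MeasurableSpace Ω] [MeasurableSpace E] {P : Measure Ω}
  {Λ : Measure E} {ξ : ℕ → Ω → E} {ℓ : E → ℝ}

lemma IsPoissonSeq.measurableSet_isStrictMin (h : IsPoissonSeq ξ Λ P) (hℓ : Measurable ℓ) (z : ℕ) :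
    MeasurableSet {ω | IsStrictMin ℓ (fun z => ξ z ω) z} := by
  have : {ω | IsStrictMin ℓ (fun z => ξ z ω) z} =
      ⋂ z', ⋂ (_ : z' ≠ z), {ω | ℓ (ξ z ω) < ℓ (ξ z' ω)} := by
    ext ω
    simp [IsStrictMin]
  rw [this]
  exact MeasurableSet.iInter fun z' => MeasurableSet.iInter fun _ =>
    measurableSet_lt (hℓ.comp (h.measurable z)) (hℓ.comp (h.measurable z'))

lemma IsPoissonSeq.measurable_outer (h : IsPoissonSeq ξ Λ P) (hℓ : Measurable ℓ) {I : E → ℝ≥0∞}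
    (hI : Measurable I) :
    Measurable fun q : ℝ × Ω => ∑' z, {y | q.1 < ℓ y}.indicator I (ξ z q.2) := by
  classical
  refine Measurable.tsum fun z => ?_
  simp only [Set.indicator_apply]
  refine Measurable.ite ?_ ?_ measurable_const
  · exact measurableSet_lt measurable_fst (hℓ.comp ((h.measurable z).comp measurable_snd))
  · exact hI.comp ((h.measurable z).comp measurable_snd)

lemma IsPoissonSeq.measurable_select (h : IsPoissonSeq ξ Λ P) {Z : Ω → ℕ} (hZ : Measurable Z) :
    Measurable fun ω => ξ (Z ω) ω := by
  have h1 : Measurable fun q : ℕ × Ω => ξ q.1 q.2 :=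
    measurable_from_prod_countable_right fun z => h.measurable z
  exact h1.comp (hZ.prodMk measurable_id)

lemma IsPoissonSeq.measurable_others (h : IsPoissonSeq ξ Λ P) {I : E → ℝ≥0∞} (hI : Measurable I)
    {Z : Ω → ℕ} (hZ : Measurable Z) :
    Measurable fun ω => ∑' z, if z = Z ω then 0 else I (ξ z ω) :=
  Measurable.tsum fun z => Measurable.ite (measurableSet_eq_fun measurable_const hZ)
    measurable_const (hI.comp (h.measurable z))

variable [IsProbabilityMeasure P]

/-- For the function that is infinite on A and zero elsewhere, exp(-∑) is the indicator of the event
that A contains no point. -/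
lemma IsPoissonSeq.measure_exists (h : IsPoissonSeq ξ Λ P) {A : Set E} (hA : MeasurableSet A) :
    P {ω | ∃ z, ξ z ω ∈ A} = 1 - nexp (Λ A) := by
  have hm : MeasurableSet {ω | ∃ z, ξ z ω ∈ A} := by
    rw [Set.ofPred_exists]
    exact MeasurableSet.iUnion fun z => h.measurable z hA
  have h1 := h.laplace (A.indicator fun _ => ∞) (measurable_const.indicator hA)
  have h2 : ∀ ω, nexp (∑' z, A.indicator (fun _ => ∞) (ξ z ω)) =
      {ω | ∃ z, ξ z ω ∈ A}ᶜ.indicator 1 ω := fun ω => by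
    by_cases hω : ∃ z, ξ z ω ∈ A
    · have h3 : ω ∉ {ω | ∃ z, ξ z ω ∈ A}ᶜ := fun hc => hc hω
      obtain ⟨z, hz⟩ := hω
      rw [Set.indicator_of_notMem h3, nexp_eq_zero, ENNReal.tsum_eq_top_of_eq_top ⟨z, by simp [hz]⟩]
    · have h3 : ω ∈ {ω | ∃ z, ξ z ω ∈ A}ᶜ := hω
      push Not at hω
      rw [Set.indicator_of_mem h3]
      simp [hω]
  have h4 : ∀ x, 1 - nexp (A.indicator (fun _ => ∞) x) = A.indicator 1 x := fun x => by
    by_cases hx : x ∈ A <;> simp [hx]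
  simp only [h2, h4, lintegral_indicator_one hA, lintegral_indicator_one hm.compl] at h1
  rw [← h1, prob_compl_eq_one_sub hm, ENNReal.sub_sub_cancel ENNReal.one_ne_top prob_le_one]

/-- If the integral of the density of the smallest value of `ℓ` is its distribution function, then
there is a unique point with the smallest value. -/
lemma IsPoissonSeq.ae_exists_isStrictMin (h : IsPoissonSeq ξ Λ P) (hℓ : Measurable ℓ)
    (hfin : ∀ b, Λ {y | ℓ y ≤ b} ≠ ∞)
    (hdist : ∀ b : ℕ, ∫⁻ y in {y | ℓ y ≤ (b + 1 : ℝ)}, nexp (Λ {x | ℓ x ≤ ℓ y}) ∂Λ =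
      1 - nexp (Λ {y | ℓ y ≤ (b + 1 : ℝ)})) :
    ∀ᵐ ω ∂P, ∃ z, IsStrictMin ℓ (fun z => ξ z ω) z := by
  have hkey : ∀ b : ℕ, ∀ᵐ ω ∂P, (∃ z, ξ z ω ∈ {y | ℓ y ≤ (b + 1 : ℝ)}) →
      ∃ z, IsStrictMin ℓ (fun z => ξ z ω) z := fun b => by
    have hA : MeasurableSet {y | ℓ y ≤ (b + 1 : ℝ)} := hℓ measurableSet_Iic
    -- For I = 0 the functional indicates that a strict minimum exists and lies below b + 1. By
    -- `hdist` this event is as likely as having any point there. One event contains the other, so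
    -- ties are null.
    have h1 := h.lintegral_nearestFunctional hℓ hfin (I := fun _ => 0) measurable_const hA
      (b := b + 1) subset_rfl
    simp only [Set.indicator_zero, tsum_zero, nexp_zero, lintegral_const, measure_univ, mul_one]
      at h1
    rw [hdist, ← h.measure_exists hA] at h1
    set S := {ω | ∃ z, ξ z ω ∈ {y | ℓ y ≤ (b + 1 : ℝ)}} with hS
    set R := {ω | ∃ z, ξ z ω ∈ {y | ℓ y ≤ (b + 1 : ℝ)} ∧ IsStrictMin ℓ (fun z => ξ z ω) z} with hR
    have hRm : MeasurableSet R := by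
      rw [hR, Set.ofPred_exists]
      exact MeasurableSet.iUnion fun z => (h.measurable z hA).inter
        (h.measurableSet_isStrictMin hℓ z)
    have hSm : MeasurableSet S := by
      rw [hS, Set.ofPred_exists]
      exact MeasurableSet.iUnion fun z => h.measurable z hA
    have h2 : ∀ ω, nearestFunctional ℓ (fun _ => 0) {y | ℓ y ≤ (b + 1 : ℝ)} (fun z => ξ z ω) =
        R.indicator 1 ω := fun ω => by
      by_cases hω : ω ∈ R
      · have hω' := hω
        obtain ⟨z, hz, hmin⟩ := hω'
        rw [nearestFunctional_of_isStrictMin hmin, Set.indicator_of_mem hω,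
          Set.indicator_of_mem hz]
        simp
      · rw [Set.indicator_of_notMem hω, nearestFunctional_of_not hω]
    simp only [h2, lintegral_indicator_one hRm] at h1
    have hsub : R ⊆ S := fun ω ⟨z, hz, _⟩ => ⟨z, hz⟩
    have h3 : P (S \ R) = 0 := by
      rw [measure_sdiff hsub hRm.nullMeasurableSet (measure_ne_top _ _), h1, tsub_self]
    filter_upwards [measure_eq_zero_iff_ae_notMem.1 h3] with ω hω hS'
    by_contra hc
    exact hω ⟨hS', fun ⟨z, _, hz⟩ => hc ⟨z, hz⟩⟩
  filter_upwards [ae_all_iff.2 hkey] with ω hω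
  -- The process is a sequence, so the point `ξ 0` always exists and some level is reached.
  obtain ⟨b, hb⟩ := exists_nat_ge (ℓ (ξ 0 ω))
  exact hω b ⟨0, le_trans hb (by simp)⟩

/-- The law of the sum of `I` over the points with `ℓ > l`. -/
def outerKernel (ξ : ℕ → Ω → E) (ℓ : E → ℝ) (I : E → ℝ≥0∞) (P : Measure Ω) : Kernel ℝ ℝ≥0∞ :=
  (Kernel.id ×ₖ Kernel.const ℝ P).map
    fun q : ℝ × Ω => ∑' z, {y | q.1 < ℓ y}.indicator I (ξ z q.2)

instance (ξ : ℕ → Ω → E) (ℓ : E → ℝ) (I : E → ℝ≥0∞) : IsFiniteKernel (outerKernel ξ ℓ I P) := by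
  unfold outerKernel
  infer_instance

lemma IsPoissonSeq.outerKernel_apply (h : IsPoissonSeq ξ Λ P) (hℓ : Measurable ℓ) {I : E → ℝ≥0∞}
    (hI : Measurable I) (l : ℝ) :
    outerKernel ξ ℓ I P l = P.map fun ω => ∑' z, {y | l < ℓ y}.indicator I (ξ z ω) := by
  have hm := h.measurable_outer hℓ hI
  rw [outerKernel, Kernel.map_apply _ hm, Kernel.prod_apply, Kernel.id_apply, Kernel.const_apply,
    Measure.dirac_prod, Measure.map_map hm measurable_prodMk_left]
  rfl

lemma IsPoissonSeq.lintegral_outerKernel (h : IsPoissonSeq ξ Λ P) (hℓ : Measurable ℓ)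
    {I : E → ℝ≥0∞} (hI : Measurable I) (l : ℝ) (s : ℝ≥0∞) :
    ∫⁻ i, nexp (s * i) ∂(outerKernel ξ ℓ I P l) =
      ∫⁻ ω, nexp (∑' z, {y | l < ℓ y}.indicator (fun y => s * I y) (ξ z ω)) ∂P := by
  have hm : Measurable fun ω => ∑' z, {y | l < ℓ y}.indicator I (ξ z ω) :=
    (h.measurable_outer hℓ hI).comp measurable_prodMk_left
  rw [h.outerKernel_apply hℓ hI, lintegral_map (f := fun i => nexp (s * i))
    (measurable_nexp.comp (measurable_id.const_mul s)) hm]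
  refine lintegral_congr fun ω => ?_
  simp only [← ENNReal.tsum_mul_left]
  congr 2
  ext z
  by_cases hz : l < ℓ (ξ z ω) <;> simp [hz]

lemma measurable_nexp_measure_le (hℓ : Measurable ℓ) :
    Measurable fun y => nexp (Λ {x | ℓ x ≤ ℓ y}) := by
  have hm : Monotone fun t : ℝ => Λ {x | ℓ x ≤ t} := fun s t hst =>
    measure_mono fun q hq => le_trans hq hst
  exact measurable_nexp.comp (hm.measurable.comp hℓ)

/-- The law of the nearest point, weighted by a Laplace transform of the sum over the others. -/
lemma IsPoissonSeq.map_withDensity_nearest (h : IsPoissonSeq ξ Λ P) (hℓ : Measurable ℓ)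
    (hfin : ∀ b, Λ {y | ℓ y ≤ b} ≠ ∞) {I : E → ℝ≥0∞} (hI : Measurable I) {Z : Ω → ℕ}
    (hZ : Measurable Z) (hmin : ∀ᵐ ω ∂P, IsStrictMin ℓ (fun z => ξ z ω) (Z ω)) [SFinite Λ]
    (s : ℝ≥0∞) :
    (P.withDensity fun ω => nexp (s * ∑' z, if z = Z ω then 0 else I (ξ z ω))).map
        (fun ω => ξ (Z ω) ω) =
      (Λ.withDensity fun y => nexp (Λ {x | ℓ x ≤ ℓ y})).withDensity
        fun y => ∫⁻ i, nexp (s * i) ∂(outerKernel ξ ℓ I P (ℓ y)) := by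
  have hW := h.measurable_select hZ
  have hφ := measurable_nexp_measure_le (Λ := Λ) hℓ
  have hK : Measurable fun y => ∫⁻ i, nexp (s * i) ∂(outerKernel ξ ℓ I P (ℓ y)) := by
    have h1 : Measurable fun l => ∫⁻ i, nexp (s * i) ∂(outerKernel ξ ℓ I P l) :=
      Measurable.lintegral_kernel (measurable_nexp.comp (measurable_id.const_mul s))
    exact h1.comp hℓ
  -- The law of the nearest point is available only for sets on which ℓ is bounded, so the two
  -- measures are compared on an exhausting sequence of such sets.
  have hU : ⋃ n : ℕ, {y | ℓ y ≤ n} = Set.univ := by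
    ext y
    simpa using exists_nat_ge (ℓ y)
  refine (Measure.ext_iff_of_iUnion_eq_univ hU).2 fun n => ?_
  ext T hT
  have hB : MeasurableSet {y | ℓ y ≤ (n : ℝ)} := hℓ measurableSet_Iic
  rw [Measure.restrict_apply hT, Measure.restrict_apply hT]
  have hT' := hT.inter hB
  have h1 := h.lintegral_nearestFunctional hℓ hfin (I := fun y => s * I y) (hI.const_mul s)
    hT' (b := n) Set.inter_subset_right
  rw [Measure.map_apply hW hT', withDensity_apply _ (hW hT'), withDensity_apply _ hT',
    restrict_withDensity hT', lintegral_withDensity_eq_lintegral_mul _ hφ hK,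
    ← lintegral_indicator (hW hT')]
  simp only [Pi.mul_apply, h.lintegral_outerKernel hℓ hI]
  rw [← h1]
  refine lintegral_congr_ae ?_
  filter_upwards [hmin] with ω hω
  rw [nearestFunctional_of_isStrictMin hω]
  have hs : s * (∑' z, if z = Z ω then 0 else I (ξ z ω)) =
      ∑' z, if z = Z ω then 0 else s * I (ξ z ω) := by
    rw [← ENNReal.tsum_mul_left]
    simp only [mul_ite, mul_zero]
  rw [← hs]
  rfl

/-- The joint law of the nearest point and of the sum of `I` over the other points. -/
lemma IsPoissonSeq.map_nearest (h : IsPoissonSeq ξ Λ P) (hℓ : Measurable ℓ)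
    (hfin : ∀ b, Λ {y | ℓ y ≤ b} ≠ ∞) {I : E → ℝ≥0∞} (hI : Measurable I) {Z : Ω → ℕ}
    (hZ : Measurable Z) (hmin : ∀ᵐ ω ∂P, IsStrictMin ℓ (fun z => ξ z ω) (Z ω)) [SFinite Λ] :
    P.map (fun ω => (ξ (Z ω) ω, ∑' z, if z = Z ω then 0 else I (ξ z ω))) =
      (Λ.withDensity fun y => nexp (Λ {x | ℓ x ≤ ℓ y})) ⊗ₘ
        (outerKernel ξ ℓ I P).comap ℓ hℓ := by
  have hW := h.measurable_select hZ
  have hJ := h.measurable_others hI hZ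
  have key := h.map_withDensity_nearest hℓ hfin hI hZ hmin
  have hone : ∀ y, ∫⁻ i, nexp (0 * i) ∂(outerKernel ξ ℓ I P (ℓ y)) = 1 := fun y => by
    rw [h.lintegral_outerKernel hℓ hI]
    simp
  -- At s = 0 the weighted identity says that this measure is the law of the nearest point.
  have hνfin : IsFiniteMeasure (Λ.withDensity fun y => nexp (Λ {x | ℓ x ≤ ℓ y})) := by
    have h1 := congrArg (fun μ => μ Set.univ) (key 0)
    simp only [hone] at h1
    simp only [zero_mul, nexp_zero] at h1
    rw [show (fun _ : E => (1 : ℝ≥0∞)) = 1 from rfl, show (fun _ : Ω => (1 : ℝ≥0∞)) = 1 from rfl,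
      withDensity_one, withDensity_one, Measure.map_apply hW MeasurableSet.univ] at h1
    exact ⟨h1 ▸ measure_lt_top _ _⟩
  have hpair : Measurable fun ω => (ξ (Z ω) ω, ∑' z, if z = Z ω then 0 else I (ξ z ω)) :=
    hW.prodMk hJ
  have hfinmap : IsFiniteMeasure (P.map fun ω => (ξ (Z ω) ω, ∑' z, if z = Z ω then 0
      else I (ξ z ω))) := Measure.isFiniteMeasure_map _ _
  refine Measure.ext_prod fun {T B} hT hB => ?_
  have hTu : MeasurableSet (T ×ˢ (Set.univ : Set ℝ≥0∞)) := hT.prod MeasurableSet.univ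
  have hn : ∀ n : ℕ, Measurable fun x : ℝ≥0∞ => nexp (n * x) := fun n =>
    measurable_nexp.comp (measurable_id.const_mul _)
  -- Fixing a set `T` for the nearest point leaves two finite measures on [0, ∞]. The weighted
  -- identity says that their Laplace transforms agree at all integers.
  have hslice : ((P.map (fun ω => (ξ (Z ω) ω, ∑' z, if z = Z ω then 0
      else I (ξ z ω)))).restrict (T ×ˢ Set.univ)).map Prod.snd =
      (((Λ.withDensity fun y => nexp (Λ {x | ℓ x ≤ ℓ y})) ⊗ₘ
        (outerKernel ξ ℓ I P).comap ℓ hℓ).restrict (T ×ˢ Set.univ)).map Prod.snd := by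
    refine measure_ext_of_laplace fun n => ?_
    have h2 : Measurable fun q : E × ℝ≥0∞ => nexp (n * q.2) := (hn n).comp measurable_snd
    rw [lintegral_map (hn n) measurable_snd, lintegral_map (hn n) measurable_snd,
      Measure.setLIntegral_compProd h2 hT MeasurableSet.univ, ← lintegral_indicator hTu,
      lintegral_map (h2.indicator hTu) hpair]
    have h3 := congrArg (fun μ => μ T) (key n)
    simp only [Measure.map_apply hW hT, withDensity_apply _ (hW hT),
      withDensity_apply (fun y => ∫⁻ i, nexp (n * i) ∂(outerKernel ξ ℓ I P (ℓ y))) hT] at h3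
    simp only [Measure.restrict_univ, Kernel.comap_apply]
    rw [← h3, ← lintegral_indicator (hW hT)]
    refine lintegral_congr fun ω => ?_
    by_cases hω : ξ (Z ω) ω ∈ T <;> simp [hω]
  have h4 := congrArg (fun μ => μ B) hslice
  simp only [Measure.map_apply measurable_snd hB, Measure.restrict_apply (measurable_snd hB)] at h4
  have h5 : Prod.snd ⁻¹' B ∩ T ×ˢ Set.univ = T ×ˢ B := by
    ext q
    simp [and_comm]
  rwa [h5] at h4

/-- The conditional law of the sum of `I` over all points but the nearest one, given the smallest
value of `ℓ`. -/
lemma IsPoissonSeq.condDistrib_nearest (h : IsPoissonSeq ξ Λ P) (hℓ : Measurable ℓ)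
    (hfin : ∀ b, Λ {y | ℓ y ≤ b} ≠ ∞) {I : E → ℝ≥0∞} (hI : Measurable I) {Z : Ω → ℕ}
    (hZ : Measurable Z) (hmin : ∀ᵐ ω ∂P, IsStrictMin ℓ (fun z => ξ z ω) (Z ω)) [SFinite Λ] :
    condDistrib (fun ω => ∑' z, if z = Z ω then 0 else I (ξ z ω)) (fun ω => ℓ (ξ (Z ω) ω)) P
      =ᵐ[P.map fun ω => ℓ (ξ (Z ω) ω)] outerKernel ξ ℓ I P := by
  have hW := h.measurable_select hZ
  have hJ := h.measurable_others hI hZ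
  have hjoint := h.map_nearest hℓ hfin hI hZ hmin
  refine condDistrib_ae_eq_of_measure_eq_compProd _ hJ.aemeasurable ?_
  have hfst : P.map (fun ω => ξ (Z ω) ω) = Λ.withDensity fun y => nexp (Λ {x | ℓ x ≤ ℓ y}) := by
    have h1 := h.map_withDensity_nearest hℓ hfin hI hZ hmin 0
    have hone : ∀ y, ∫⁻ i, nexp (0 * i) ∂(outerKernel ξ ℓ I P (ℓ y)) = 1 := fun y => by
      rw [h.lintegral_outerKernel hℓ hI]
      simp
    simp only [hone] at h1
    simp only [zero_mul, nexp_zero] at h1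
    rwa [show (fun _ : E => (1 : ℝ≥0∞)) = 1 from rfl, show (fun _ : Ω => (1 : ℝ≥0∞)) = 1 from rfl,
      withDensity_one, withDensity_one] at h1
  have hg : Measurable fun q : E × ℝ≥0∞ => (ℓ q.1, q.2) :=
    (hℓ.comp measurable_fst).prodMk measurable_snd
  have hmm : P.map (fun ω => (ℓ (ξ (Z ω) ω), ∑' z, if z = Z ω then 0 else I (ξ z ω))) =
      (P.map (fun ω => (ξ (Z ω) ω, ∑' z, if z = Z ω then 0 else I (ξ z ω)))).map
        fun q => (ℓ q.1, q.2) := by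
    rw [Measure.map_map hg (hW.prodMk hJ)]
    rfl
  have hmm2 : P.map (fun ω => ℓ (ξ (Z ω) ω)) = (P.map fun ω => ξ (Z ω) ω).map ℓ := by
    rw [Measure.map_map hℓ hW]
    rfl
  have hfinν : IsFiniteMeasure (P.map fun ω => ξ (Z ω) ω) := Measure.isFiniteMeasure_map _ _
  rw [hmm, hjoint, hmm2, ← hfst]
  ext s hs
  rw [Measure.map_apply hg hs, Measure.compProd_apply (hg hs), Measure.compProd_apply hs,
    lintegral_map (Kernel.measurable_kernel_prodMk_left hs) hℓ]
  rfl

end Nearest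

end

end MmWave

namespace MmWave

noncomputable section

open Filter Topology

/-! ### Laws of the quantized angles -/

lemma angleProb_nonneg {N i : ℕ} : 0 ≤ angleProb N i := by
  have hmono : ∀ j : ℕ, 0 ≤ (Real.arcsin (-1 + (2 * j + 1) / N) -
      Real.arcsin (-1 + (2 * j - 1) / N)) / Real.pi := fun j => by
    refine div_nonneg (sub_nonneg.2 (Real.monotone_arcsin ?_)) Real.pi_pos.le
    gcongr
    linarith
  unfold angleProb
  split_ifs with h
  -- The probabilities telescope, and arcsine takes values in an interval of length π, so the
  -- remaining mass for the last angle is nonnegative.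
  · have htel : ∀ n : ℕ, ∑ j ∈ Finset.Icc 1 n, (Real.arcsin (-1 + (2 * j + 1) / N) -
        Real.arcsin (-1 + (2 * j - 1) / N)) / Real.pi =
        (Real.arcsin (-1 + (2 * n + 1) / N) - Real.arcsin (-1 + 1 / N)) / Real.pi := fun n => by
      induction n with
      | zero => simp
      | succ n ih =>
        rw [Finset.sum_Icc_succ_top (by omega), ih]
        push_cast
        have : (2 * ((n : ℝ) + 1) - 1) = 2 * n + 1 := by ring
        rw [this]
        ring
    rw [htel, sub_nonneg, div_le_one Real.pi_pos]
    have h1 := Real.arcsin_le_pi_div_two (-1 + (2 * ((N - 1 : ℕ) : ℝ) + 1) / N)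
    have h2 := Real.neg_pi_div_two_le_arcsin (-1 + 1 / (N : ℝ))
    linarith
  · exact hmono i

lemma sum_angleProb {N : ℕ} (hN : 1 ≤ N) : ∑ i ∈ Finset.Icc 1 N, angleProb N i = 1 := by
  obtain ⟨n, rfl⟩ : ∃ n, N = n + 1 := ⟨N - 1, by omega⟩
  rw [Finset.sum_Icc_succ_top (by omega)]
  have h1 : angleProb (n + 1) (n + 1) = 1 - ∑ i ∈ Finset.Icc 1 n, angleProb (n + 1) i := by
    conv_lhs => unfold angleProb
    rw [if_pos rfl, Nat.add_sub_cancel]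
    congr 1
    refine Finset.sum_congr rfl fun i hi => ?_
    rw [angleProb, if_neg (by have := (Finset.mem_Icc.1 hi).2; omega)]
  rw [h1]
  ring

/-- The law of a quantized angle. -/
def angleLaw (N : ℕ) : Measure ℕ :=
  ∑ i ∈ Finset.Icc 1 N, ENNReal.ofReal (angleProb N i) • Measure.dirac i

lemma angleLaw_univ {N : ℕ} (hN : 1 ≤ N) : angleLaw N Set.univ = 1 := by
  rw [angleLaw, Measure.finsetSum_apply]
  simp only [Measure.smul_apply, measure_univ, smul_eq_mul, mul_one]
  rw [← ENNReal.ofReal_sum_of_nonneg fun i _ => angleProb_nonneg, sum_angleProb hN,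
    ENNReal.ofReal_one]

lemma lintegral_angleLaw (N : ℕ) (h : ℕ → ℝ≥0∞) :
    ∫⁻ i, h i ∂(angleLaw N) = ∑ i ∈ Finset.Icc 1 N, ENNReal.ofReal (angleProb N i) * h i := by
  rw [angleLaw, lintegral_finsetSum_measure]
  simp only [lintegral_smul_measure, lintegral_dirac, smul_eq_mul]

lemma angleLaw_singleton {N i : ℕ} (hi : i ∈ Finset.Icc 1 N) :
    angleLaw N {i} = ENNReal.ofReal (angleProb N i) := by
  rw [← lintegral_indicator_one (measurableSet_singleton i), lintegral_angleLaw,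
    Finset.sum_eq_single i]
  · simp
  · intro j _ hj
    simp [hj]
  · exact fun h => absurd hi h

/-- The model prescribes the masses of 1, …, N only. They already add up to one, so a probability
measure with these masses has no room for anything else. -/
lemma eq_angleLaw {N : ℕ} (hN : 1 ≤ N) {μ : Measure ℕ} [IsProbabilityMeasure μ]
    (h : ∀ i ∈ Finset.Icc 1 N, μ {i} = ENNReal.ofReal (angleProb N i)) : μ = angleLaw N := by
  have hle : angleLaw N ≤ μ := by
    refine Measure.le_iff.2 fun s hs => ?_
    rw [← lintegral_indicator_one hs, lintegral_angleLaw]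
    have h1 : ∀ i ∈ Finset.Icc 1 N, ENNReal.ofReal (angleProb N i) * s.indicator 1 i =
        (μ.restrict s) {i} := fun i hi => by
      rw [← h i hi, Measure.restrict_apply (measurableSet_singleton i)]
      by_cases his : i ∈ s
      · rw [Set.indicator_of_mem his, Pi.one_apply, mul_one,
          Set.inter_eq_left.2 (Set.singleton_subset_iff.2 his)]
      · rw [Set.indicator_of_notMem his, mul_zero, Set.singleton_inter_eq_empty.2 his,
          measure_empty]
    rw [Finset.sum_congr rfl h1, sum_measure_singleton]
    exact (measure_mono (Set.subset_univ _)).trans (by rw [Measure.restrict_apply_univ])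
  have : IsProbabilityMeasure (angleLaw N) := ⟨angleLaw_univ hN⟩
  exact (Measure.eq_of_le_of_measure_univ_eq hle (by simp)).symm

/-! ### Independence of groups of sources -/

section Groups

variable {Ω κ ι : Type*} [MeasurableSpace Ω] {P : Measure Ω}

/-- By induction on the finite index set: a new group is disjoint from the union of the earlier
ones, hence independent of everything they generate. -/
lemma iIndep_biSup {m : κ → MeasurableSpace Ω} (hle : ∀ k, m k ≤ ‹MeasurableSpace Ω›)
    (hind : iIndep m P) {S : ι → Set κ} (hS : Pairwise fun i j => Disjoint (S i) (S j)) :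
    iIndep (fun i => ⨆ k ∈ S i, m k) P := by
  classical
  have := hind.isProbabilityMeasure
  rw [iIndep_iff]
  intro s f hf
  induction s using Finset.induction_on with
  | empty => simp
  | insert i s hi ih =>
    rw [Finset.set_biInter_insert, Finset.prod_insert hi,
      ← ih fun j hj => hf j (Finset.mem_insert_of_mem hj)]
    have hd : Disjoint (S i) (⋃ j ∈ s, S j) := by
      rw [Set.disjoint_iUnion₂_right]
      exact fun j hj => hS (fun h => hi (h ▸ hj))
    refine (Indep_iff _ _ _).1 (indep_iSup_of_disjoint hle hind hd) _ _
      (hf i (Finset.mem_insert_self _ _)) ?_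
    refine MeasurableSet.biInter s.countable_toSet fun j hj => ?_
    refine (?_ : (⨆ k ∈ S j, m k) ≤ _) _ (hf j (Finset.mem_insert_of_mem hj))
    exact biSup_mono fun k hk => Set.mem_biUnion hj hk

end Groups

namespace Source

/-- The kind of a source. -/
def kind : Source → ℕ
  | .positions => 0
  | .losMark _ => 1
  | .shadowing .los _ => 2
  | .shadowing .nlos _ => 3
  | .load _ => 4
  | .combiner _ => 5
  | .aoa _ _ => 6
  | .aod _ _ => 7
  | .precoder _ _ => 8
  | .fading _ _ => 9
  | .servingLoad => 10
  | .penaltyMU _ _ => 11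
  | .penaltyZF _ _ => 12

/-- The number of the BS that a source belongs to. -/
def site : Source → ℕ
  | .positions => 0
  | .losMark y => y
  | .shadowing _ y => y
  | .load y => y
  | .combiner y => y
  | .aoa y _ => y
  | .aod y _ => y
  | .precoder y _ => y
  | .fading y _ => y
  | .servingLoad => 0
  | .penaltyMU _ _ => 0
  | .penaltyZF _ _ => 0

end Source

section Network

variable {Ω : Type*} [MeasurableSpace Ω] {P : Measure Ω} {p : Params}
  {X : (s : Source) → Ω → s.Space}

/-- The information in the sources in `S`. -/
@[reducible] def sourceSigma (X : (s : Source) → Ω → s.Space) (S : Set Source) : MeasurableSpace Ω :=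
  ⨆ s ∈ S, MeasurableSpace.comap (X s) inferInstance

lemma measurable_source {Ω : Type*} (X : (s : Source) → Ω → s.Space) {S : Set Source} {s : Source}
    (hs : s ∈ S) : Measurable[sourceSigma X S] (X s) := by
  intro A hA
  have h1 : MeasurableSpace.comap (X s) inferInstance ≤ sourceSigma X S :=
    le_iSup₂_of_le s hs le_rfl
  exact h1 _ ⟨A, hA, rfl⟩

lemma IsNetwork.sourceSigma_le (hX : IsNetwork p X P) (S : Set Source) :
    sourceSigma X S ≤ ‹MeasurableSpace Ω› :=
  iSup₂_le fun s _ => (hX.measurable s).comap_le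

/-- Reduces independence claims to disjointness of sets of sources. The sets are described by `kind`
and `site`, so that disjointness becomes arithmetic. -/
lemma IsNetwork.indepFun_of_disjoint (hX : IsNetwork p X P) {S T : Set Source} (hST : Disjoint S T)
    {A B : Type*} [MeasurableSpace A] [MeasurableSpace B] {f : Ω → A} {g : Ω → B}
    (hf : Measurable[sourceSigma X S] f) (hg : Measurable[sourceSigma X T] g) :
    IndepFun f g P := by
  have h := indep_iSup_of_disjoint (fun s => (hX.measurable s).comap_le)
    ((iIndepFun_iff_iIndep _ _ _).1 hX.indep) hST
  exact (IndepFun_iff_Indep _ _ _).2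
    (indep_of_indep_of_le_left (indep_of_indep_of_le_right h hg.comap_le) hf.comap_le)

lemma IsNetwork.iIndepFun_of_disjoint (hX : IsNetwork p X P) {ι : Type*} {S : ι → Set Source}
    (hS : Pairwise fun i j => Disjoint (S i) (S j))
    {A : ι → Type*} [∀ i, MeasurableSpace (A i)] {f : ∀ i, Ω → A i}
    (hf : ∀ i, Measurable[sourceSigma X (S i)] (f i)) : iIndepFun f P := by
  have h := iIndep_biSup (fun s => (hX.measurable s).comap_le)
    ((iIndepFun_iff_iIndep _ _ _).1 hX.indep) hS
  rw [iIndepFun_iff_iIndep]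
  rw [iIndep_iff] at h ⊢
  exact fun s f' hf' => h s fun i hi => (hf i).comap_le _ (hf' i hi)

lemma IsNetwork.isProbabilityMeasure (hX : IsNetwork p X P) : IsProbabilityMeasure P :=
  hX.indep.isProbabilityMeasure

end Network

/-- The load and the angles of a BS: load, combining angle, angles of arrival, angles of departure,
and precoding angles. -/
abbrev AngleMark : Type := ℕ × ℕ × (ℕ → ℕ) × (ℕ → ℕ) × (ℕ → ℕ)

/-- The marks of a BS that determine its interference, given its path loss. -/
abbrev RestMark : Type := AngleMark × (ℕ → ℂ)

instance : IsProbabilityMeasure complexNormal := by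
  have h := Complex.measurableEquivRealProd.symm.measurable
  exact Measure.isProbabilityMeasure_map h.aemeasurable

/-! ### The marks of a base station and their laws. -/

namespace Params

variable (p : Params)

instance : IsProbabilityMeasure (angleLaw p.NBS) := ⟨angleLaw_univ p.NBS_pos⟩

instance : IsProbabilityMeasure (angleLaw p.NUE) := ⟨angleLaw_univ p.NUE_pos⟩

/-- The law of the load and the angles, where `μ` is the law of the load. -/
def angleMarkLaw (μ : Measure ℕ) : Measure AngleMark :=
  μ.prod ((angleLaw p.NUE).prod ((Measure.infinitePi fun _ => angleLaw p.NUE).prod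
    ((Measure.infinitePi fun _ => angleLaw p.NBS).prod
      (Measure.infinitePi fun _ => angleLaw p.NBS))))

instance (μ : Measure ℕ) [IsProbabilityMeasure μ] : IsProbabilityMeasure (p.angleMarkLaw μ) := by
  unfold angleMarkLaw
  infer_instance

/-- The law of the marks that determine the interference, given the path loss. -/
def restLaw (μ : Measure ℕ) : Measure RestMark :=
  (p.angleMarkLaw μ).prod (Measure.infinitePi fun _ => complexNormal)

instance (μ : Measure ℕ) [IsProbabilityMeasure μ] : IsProbabilityMeasure (p.restLaw μ) := by
  unfold restLaw
  infer_instance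

end Params

section Network

variable {Ω : Type*} (p : Params) (X : (s : Source) → Ω → s.Space)

/-- The marks of BS `z` that determine its path loss. -/
def geo (z : ℕ) (ω : Ω) : GeoMark := (losMark X z ω, shadowing X .los z ω, shadowing X .nlos z ω)

/-- The load and the angles of BS `z`. -/
def angleMark (z : ℕ) (ω : Ω) : AngleMark :=
  (load X z ω, combiner X z ω, fun j => aoa X z j ω, fun j => aod X z j ω,
    fun w => precoder X z w ω)

/-- The marks of BS `z` that do not determine its path loss. -/
def rest (z : ℕ) (ω : Ω) : RestMark := (angleMark X z ω, fun j => fading X z j ω)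

/-- The path loss, the link type and the remaining marks of BS `z`. -/
def point (z : ℕ) (ω : Ω) : (ℝ × Link) × RestMark :=
  (p.lossLink (position X z ω, geo X z ω), rest X z ω)

variable {p X}

lemma measurable_seq {m : MeasurableSpace Ω} {A : Type*} [MeasurableSpace A] {f : ℕ → Ω → A}
    (h : ∀ j, Measurable[m] (f j)) : Measurable[m] fun ω j => f j ω :=
  measurable_pi_lambda _ h

lemma measurable_geo {S : Set Source} {z : ℕ} (h1 : .losMark z ∈ S)
    (h2 : ∀ a, .shadowing a z ∈ S) : Measurable[sourceSigma X S] (geo X z) :=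
  (measurable_source X h1).prodMk
    ((measurable_source X (h2 .los)).prodMk (measurable_source X (h2 .nlos)))

lemma measurable_angleMark {S : Set Source} {z : ℕ} (h1 : .load z ∈ S) (h2 : .combiner z ∈ S)
    (h3 : ∀ j, .aoa z j ∈ S) (h4 : ∀ j, .aod z j ∈ S) (h5 : ∀ w, .precoder z w ∈ S) :
    Measurable[sourceSigma X S] (angleMark X z) := by
  refine (measurable_source X h1).prodMk ((measurable_source X h2).prodMk ?_)
  refine Measurable.prodMk ?_ (Measurable.prodMk ?_ ?_)
  · exact measurable_seq fun j => measurable_source X (h3 j)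
  · exact measurable_seq fun j => measurable_source X (h4 j)
  · exact measurable_seq fun j => measurable_source X (h5 j)

lemma measurable_rest {S : Set Source} {z : ℕ} (h : ∀ s : Source, s.site = z → 4 ≤ s.kind →
    s.kind ≤ 9 → s ∈ S) : Measurable[sourceSigma X S] (rest X z) := by
  refine Measurable.prodMk ?_ ?_
  · refine measurable_angleMark ?_ ?_ ?_ ?_ ?_ <;> intros <;>
      exact h _ rfl (by simp [Source.kind]) (by simp [Source.kind])
  · exact measurable_seq fun j => measurable_source X
      (h (.fading z j) rfl (by simp [Source.kind]) (by simp [Source.kind]))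

lemma measurable_position {S : Set Source} (h : .positions ∈ S) (z : ℕ) :
    Measurable[sourceSigma X S] (position X z) :=
  (measurable_pi_apply z).comp (measurable_source X h)

lemma disjoint_setOf {A : Source → Prop} {B : Source → Prop} (h : ∀ s, A s → ¬B s) :
    Disjoint {s | A s} {s | B s} :=
  Set.disjoint_left.2 fun s hs => h s hs

variable [MeasurableSpace Ω] {P : Measure Ω}

lemma IsNetwork.measurable_of_sigma (hX : IsNetwork p X P) {S : Set Source} {A : Type*}
    [MeasurableSpace A] {f : Ω → A} (hf : Measurable[sourceSigma X S] f) : Measurable f :=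
  hf.mono (hX.sourceSigma_le S) le_rfl

lemma IsNetwork.map_losMark (hX : IsNetwork p X P) (z : ℕ) :
    P.map (losMark X z) = p.losLaw := by
  have := hX.isProbabilityMeasure
  have hm : Measurable (losMark X z) := hX.measurable (.losMark z)
  have := Measure.isProbabilityMeasure_map (μ := P) hm.aemeasurable
  have h1 : P.map (losMark X z) {true} = ENNReal.ofReal p.pLOS := by
    rw [Measure.map_apply hm (measurableSet_singleton _)]
    exact hX.losMark_law z
  have h2 : P.map (losMark X z) {false} = ENNReal.ofReal (1 - p.pLOS) := by
    have : ({false} : Set Bool) = {true}ᶜ := by ext b; simp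
    rw [this, prob_compl_eq_one_sub (measurableSet_singleton _), h1,
      ENNReal.ofReal_sub _ p.pLOS_nonneg, ENNReal.ofReal_one]
  refine Measure.ext_of_singleton fun b => ?_
  cases b
  · rw [h2]
    simp [Params.losLaw]
  · rw [h1]
    simp [Params.losLaw]

lemma IsNetwork.map_geo (hX : IsNetwork p X P) (z : ℕ) : P.map (geo X z) = p.geoLaw := by
  have := hX.isProbabilityMeasure
  have hl : Measurable (losMark X z) := hX.measurable (.losMark z)
  have hs : ∀ a, Measurable (shadowing X a z) := fun a => hX.measurable (.shadowing a z)
  have i1 : IndepFun (losMark X z) (fun ω => (shadowing X .los z ω, shadowing X .nlos z ω)) P := by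
    refine hX.indepFun_of_disjoint (S := {s | s.kind = 1}) (T := {s | s.kind = 2 ∨ s.kind = 3})
      (disjoint_setOf fun s => by omega) ?_ ?_
    · exact measurable_source X (s := .losMark z) rfl
    · exact (measurable_source X (s := .shadowing .los z) (Or.inl rfl)).prodMk
        (measurable_source X (s := .shadowing .nlos z) (Or.inr rfl))
  have i2 : IndepFun (shadowing X .los z) (shadowing X .nlos z) P := by
    refine hX.indepFun_of_disjoint (S := {s | s.kind = 2}) (T := {s | s.kind = 3})
      (disjoint_setOf fun s => by omega) ?_ ?_
    · exact measurable_source X (s := .shadowing .los z) rfl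
    · exact measurable_source X (s := .shadowing .nlos z) rfl
  have e2 := i2.map_prod_eq_prod_map_map (hs _).aemeasurable (hs _).aemeasurable
  have e1 := i1.map_prod_eq_prod_map_map hl.aemeasurable ((hs _).prodMk (hs _)).aemeasurable
  rw [e2, hX.map_losMark, hX.shadowing_law, hX.shadowing_law] at e1
  exact e1

lemma IsNetwork.map_nat_seq (hX : IsNetwork p X P) {A : Type} [MeasurableSpace A] {f : ℕ → Ω → A}
    (src : ℕ → Source) (hinj : Function.Injective src)
    (hf : ∀ j, Measurable[sourceSigma X {src j}] (f j)) {ν : Measure A}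
    (hν : ∀ j, P.map (f j) = ν) :
    P.map (fun ω j => f j ω) = Measure.infinitePi fun _ => ν := by
  have hi : iIndepFun f P := hX.iIndepFun_of_disjoint (S := fun j => {src j})
    (fun i j hij => Set.disjoint_singleton.2 (hinj.ne hij)) hf
  rw [hi.map_fun_eq_infinitePi_map fun j => hX.measurable_of_sigma (hf j)]
  simp only [hν]

lemma map_eq_angleLaw [IsProbabilityMeasure P] {f : Ω → ℕ} (hf : Measurable f) {N : ℕ}
    (hN : 1 ≤ N) (h : ∀ i ∈ Finset.Icc 1 N, P {ω | f ω = i} = ENNReal.ofReal (angleProb N i)) :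
    P.map f = angleLaw N := by
  have := Measure.isProbabilityMeasure_map (μ := P) hf.aemeasurable
  refine eq_angleLaw hN fun i hi => ?_
  rw [Measure.map_apply hf (measurableSet_singleton i), ← h i hi]
  rfl

/-- The law of the load of station 0 serves as the common law. It is a probability measure by
construction, so the series of the masses `κInterf` need not be summed. -/
lemma IsNetwork.map_load (hX : IsNetwork p X P) (z : ℕ) : P.map (load X z) = P.map (load X 0) := by
  have hm : ∀ z, Measurable (load X z) := fun z => hX.measurable (.load z)
  have hs : ∀ z n, P.map (load X z) {n} = ENNReal.ofReal (p.κInterf n) := fun z n => by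
    rw [Measure.map_apply (hm z) (measurableSet_singleton n), ← hX.load_law z n]
    rfl
  exact Measure.ext_of_singleton fun n => by rw [hs, hs]

/-- The five groups of sources have different kinds. They are split off one at a time from the
inside out, and each law becomes a product law with the next. -/
lemma IsNetwork.map_angleMark (hX : IsNetwork p X P) (z : ℕ) :
    P.map (angleMark X z) = p.angleMarkLaw (P.map (load X 0)) := by
  have := hX.isProbabilityMeasure
  have m1 : Measurable (load X z) := hX.measurable (.load z)
  have m2 : Measurable (combiner X z) := hX.measurable (.combiner z)
  have m3 : ∀ j, Measurable (aoa X z j) := fun j => hX.measurable (.aoa z j)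
  have m4 : ∀ j, Measurable (aod X z j) := fun j => hX.measurable (.aod z j)
  have m5 : ∀ j, Measurable (precoder X z j) := fun j => hX.measurable (.precoder z j)
  have n3 : Measurable fun ω j => aoa X z j ω := measurable_seq m3
  have n4 : Measurable fun ω j => aod X z j ω := measurable_seq m4
  have n5 : Measurable fun ω j => precoder X z j ω := measurable_seq m5
  have t3 : ∀ S : Set Source, (∀ j, .aoa z j ∈ S) →
      Measurable[sourceSigma X S] fun ω j => aoa X z j ω := fun S h =>
    measurable_seq fun j => measurable_source X (h j)
  have t4 : ∀ S : Set Source, (∀ j, .aod z j ∈ S) →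
      Measurable[sourceSigma X S] fun ω j => aod X z j ω := fun S h =>
    measurable_seq fun j => measurable_source X (h j)
  have t5 : ∀ S : Set Source, (∀ j, .precoder z j ∈ S) →
      Measurable[sourceSigma X S] fun ω j => precoder X z j ω := fun S h =>
    measurable_seq fun j => measurable_source X (h j)
  have i4 : IndepFun (fun ω j => aod X z j ω) (fun ω j => precoder X z j ω) P :=
    hX.indepFun_of_disjoint (S := {s | s.kind = 7}) (T := {s | s.kind = 8})
      (disjoint_setOf fun s => by omega) (t4 _ fun j => rfl) (t5 _ fun j => rfl)
  have i3 : IndepFun (fun ω j => aoa X z j ω)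
      (fun ω => ((fun j => aod X z j ω), fun j => precoder X z j ω)) P :=
    hX.indepFun_of_disjoint (S := {s | s.kind = 6}) (T := {s | 7 ≤ s.kind})
      (disjoint_setOf fun s => by omega) (t3 _ fun j => rfl)
      ((t4 _ fun j => by simp [Source.kind]).prodMk (t5 _ fun j => by simp [Source.kind]))
  have i2 : IndepFun (combiner X z) (fun ω => ((fun j => aoa X z j ω),
      (fun j => aod X z j ω), fun j => precoder X z j ω)) P :=
    hX.indepFun_of_disjoint (S := {s | s.kind = 5}) (T := {s | 6 ≤ s.kind})
      (disjoint_setOf fun s => by omega) (measurable_source X (s := .combiner z) rfl)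
      ((t3 _ fun j => by simp [Source.kind]).prodMk
      ((t4 _ fun j => by simp [Source.kind]).prodMk (t5 _ fun j => by simp [Source.kind])))
  have i1 : IndepFun (load X z) (fun ω => (combiner X z ω, (fun j => aoa X z j ω),
      (fun j => aod X z j ω), fun j => precoder X z j ω)) P :=
    hX.indepFun_of_disjoint (S := {s | s.kind = 4}) (T := {s | 5 ≤ s.kind})
      (disjoint_setOf fun s => by omega) (measurable_source X (s := .load z) rfl)
      ((measurable_source X (s := .combiner z) (by simp [Source.kind])).prodMk
      ((t3 _ fun j => by simp [Source.kind]).prodMk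
      ((t4 _ fun j => by simp [Source.kind]).prodMk (t5 _ fun j => by simp [Source.kind]))))
  have l2 : P.map (combiner X z) = angleLaw p.NUE := map_eq_angleLaw m2 p.NUE_pos
    (hX.combiner_law z)
  have l3 : P.map (fun ω j => aoa X z j ω) = Measure.infinitePi fun _ => angleLaw p.NUE :=
    hX.map_nat_seq (f := aoa X z) (fun j => .aoa z j)
    (fun i j h => (Source.aoa.inj h).2)
    (fun j => measurable_source X (s := .aoa z j) (Set.mem_singleton _))
    (fun j => map_eq_angleLaw (m3 j) p.NUE_pos (hX.aoa_law z j))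
  have l4 : P.map (fun ω j => aod X z j ω) = Measure.infinitePi fun _ => angleLaw p.NBS :=
    hX.map_nat_seq (f := aod X z) (fun j => .aod z j)
    (fun i j h => (Source.aod.inj h).2)
    (fun j => measurable_source X (s := .aod z j) (Set.mem_singleton _))
    (fun j => map_eq_angleLaw (m4 j) p.NBS_pos (hX.aod_law z j))
  have l5 : P.map (fun ω j => precoder X z j ω) = Measure.infinitePi fun _ => angleLaw p.NBS :=
    hX.map_nat_seq (f := precoder X z) (fun j => .precoder z j)
    (fun i j h => (Source.precoder.inj h).2)
    (fun j => measurable_source X (s := .precoder z j) (Set.mem_singleton _))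
    (fun j => map_eq_angleLaw (m5 j) p.NBS_pos (hX.precoder_law z j))
  have e4 := i4.map_prod_eq_prod_map_map n4.aemeasurable n5.aemeasurable
  have e3 := i3.map_prod_eq_prod_map_map n3.aemeasurable (n4.prodMk n5).aemeasurable
  have e2 := i2.map_prod_eq_prod_map_map m2.aemeasurable (n3.prodMk (n4.prodMk n5)).aemeasurable
  have e1 := i1.map_prod_eq_prod_map_map m1.aemeasurable
    (m2.prodMk (n3.prodMk (n4.prodMk n5))).aemeasurable
  rw [l4, l5] at e4
  rw [e4, l3] at e3
  rw [e3, l2] at e2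
  rw [e2, hX.map_load] at e1
  exact e1

lemma IsNetwork.map_rest (hX : IsNetwork p X P) (z : ℕ) :
    P.map (rest X z) = p.restLaw (P.map (load X 0)) := by
  have := hX.isProbabilityMeasure
  have t1 : Measurable[sourceSigma X {s | s.kind ≤ 8}] (angleMark X z) := by
    refine measurable_angleMark ?_ ?_ ?_ ?_ ?_ <;> intros <;> simp [Source.kind]
  have t2 : Measurable[sourceSigma X {s | s.kind = 9}] fun ω j => fading X z j ω :=
    measurable_seq fun j => measurable_source X (s := .fading z j) rfl
  have i := hX.indepFun_of_disjoint (disjoint_setOf fun s => by omega) t1 t2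
  have e := i.map_prod_eq_prod_map_map (hX.measurable_of_sigma t1).aemeasurable
    (hX.measurable_of_sigma t2).aemeasurable
  have l : P.map (fun ω j => fading X z j ω) = Measure.infinitePi fun _ => complexNormal :=
    hX.map_nat_seq (f := fading X z) (fun j => .fading z j)
    (fun i j h => (Source.fading.inj h).2)
    (fun j => measurable_source X (s := .fading z j) (Set.mem_singleton _))
    (fun j => hX.fading_law z j)
  rw [hX.map_angleMark, l] at e
  exact e

end Network

end

end MmWave

namespace MmWave

noncomputable section

open Filter Topology

/-! ### The base stations as a marked Poisson process of losses. -/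

section Network

variable {Ω : Type*} {p : Params} {X : (s : Source) → Ω → s.Space}

lemma measurable_position_seq : Measurable[sourceSigma X {s | s.kind = 0}]
    fun ω z => position X z ω :=
  measurable_seq fun z => measurable_position (S := {s | s.kind = 0}) rfl z

lemma measurable_geo_of_kind {S : Set Source} (hS : ∀ s : Source, 1 ≤ s.kind → s.kind ≤ 3 → s ∈ S)
    (z : ℕ) : Measurable[sourceSigma X S] (geo X z) :=
  measurable_geo (hS _ (by simp [Source.kind]) (by simp [Source.kind])) (fun a => by
    cases a <;> exact hS _ (by simp [Source.kind]) (by simp [Source.kind]))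

lemma measurable_lossLink_point {S : Set Source} (hS : ∀ s : Source, s.kind ≤ 3 → s ∈ S) (z : ℕ) :
    Measurable[sourceSigma X S] fun ω => p.lossLink (position X z ω, geo X z ω) := by
  have a1 : Measurable[sourceSigma X S] (position X z) :=
    measurable_position (hS _ (by simp [Source.kind])) z
  have a2 : Measurable[sourceSigma X S] (geo X z) := measurable_geo_of_kind (fun s _ h => hS s h) z
  have a3 := p.measurable_lossLink.comp (a1.prodMk a2)
  exact a3

lemma measurable_point {S : Set Source} (hS : ∀ s : Source, s.kind ≤ 9 → s ∈ S) (z : ℕ) :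
    Measurable[sourceSigma X S] (point p X z) :=
  (measurable_lossLink_point (fun s h => hS s (by omega)) z).prodMk
    (measurable_rest fun s _ _ h => hS s h)

variable [MeasurableSpace Ω] {P : Measure Ω}

lemma IsNetwork.isPoissonSeq_position (hX : IsNetwork p X P) :
    IsPoissonSeq (fun z ω => position X z ω) p.spatial P := by
  have := hX.isProbabilityMeasure
  have hpos : ∀ z, Measurable (position X z) := fun z =>
    hX.measurable_of_sigma (measurable_position (S := Set.univ) trivial z)
  exact IsPoissonProcess.isPoissonSeq (Λ := p.spatial) hX.positions_law hpos

lemma IsNetwork.iIndepFun_geo (hX : IsNetwork p X P) : iIndepFun (geo X) P :=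
  hX.iIndepFun_of_disjoint (S := fun z => {s | (1 ≤ s.kind ∧ s.kind ≤ 3) ∧ s.site = z})
    (fun i j hij => disjoint_setOf fun s => by omega) fun z =>
    measurable_geo (by simp [Source.kind, Source.site])
    (fun a => by cases a <;> simp [Source.kind, Source.site])

lemma IsNetwork.iIndepFun_rest (hX : IsNetwork p X P) : iIndepFun (rest X) P :=
  hX.iIndepFun_of_disjoint (S := fun z => {s | (4 ≤ s.kind ∧ s.kind ≤ 9) ∧ s.site = z})
    (fun i j hij => disjoint_setOf fun s => by omega) fun z =>
    measurable_rest fun s h4 h5 h6 => ⟨⟨h5, h6⟩, h4⟩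

lemma IsNetwork.indepFun_position_geo (hX : IsNetwork p X P) :
    IndepFun (fun ω z => position X z ω) (fun ω z => geo X z ω) P := by
  have h1 := measurable_seq fun z => measurable_geo_of_kind (X := X)
    (S := {s | 1 ≤ s.kind ∧ s.kind ≤ 3}) (fun s h1 h2 => ⟨h1, h2⟩) z
  exact hX.indepFun_of_disjoint (disjoint_setOf fun s => by omega) measurable_position_seq h1

/-- Positions are first marked by LOS variables and shadowings and then mapped to loss and link
type. The intensity becomes `lossMeasure` by its very definition. -/
lemma IsNetwork.isPoissonSeq_lossLink (hX : IsNetwork p X P) :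
    IsPoissonSeq (fun z ω => p.lossLink (position X z ω, geo X z ω)) p.lossMeasure P := by
  have := hX.isProbabilityMeasure
  have h2 := hX.isPoissonSeq_position.mark (m := geo X) (fun z => hX.measurable_of_sigma
    (measurable_geo_of_kind (S := Set.univ) (fun _ _ _ => trivial) z)) hX.map_geo hX.iIndepFun_geo
    hX.indepFun_position_geo
  have h3 := h2.map p.measurable_lossLink
  exact h3

lemma IsNetwork.indepFun_lossLink_rest (hX : IsNetwork p X P) :
    IndepFun (fun ω z => p.lossLink (position X z ω, geo X z ω)) (fun ω z => rest X z ω) P := by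
  have h1 := measurable_seq fun z => measurable_lossLink_point (X := X) (p := p)
    (S := {s | s.kind ≤ 3}) (fun s h => h) z
  have h2 := measurable_seq fun z => measurable_rest (X := X) (z := z)
    (S := {s | 4 ≤ s.kind ∧ s.kind ≤ 9}) fun s h4 h5 h6 => ⟨h5, h6⟩
  exact hX.indepFun_of_disjoint (disjoint_setOf fun s => by omega) h1 h2

/-- The path losses, link types and marks of the BSs form a Poisson process. -/
lemma IsNetwork.isPoissonSeq (hX : IsNetwork p X P) :
    IsPoissonSeq (point p X) (p.lossMeasure.prod (p.restLaw (P.map (load X 0)))) P := by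
  have := hX.isProbabilityMeasure
  have hprob := Measure.isProbabilityMeasure_map (μ := P)
    (hX.measurable (.load 0)).aemeasurable
  have h := hX.isPoissonSeq_lossLink.mark (m := rest X) (fun z => hX.measurable_of_sigma
    (measurable_rest (S := Set.univ) fun _ _ _ _ => trivial)) hX.map_rest hX.iIndepFun_rest
    hX.indepFun_lossLink_rest
  exact h

end Network

end

end MmWave

namespace MmWave

noncomputable section

open Filter Topology

/-! ### Small scale fading -/

lemma measurable_complex_mk : Measurable fun z : ℝ × ℝ => (⟨z.1, z.2⟩ : ℂ) :=
  Complex.measurableEquivRealProd.symm.measurable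

lemma lintegral_exp_sq_gaussianReal {c : ℝ} (hc : 0 ≤ c) :
    ∫⁻ x, ENNReal.ofReal (Real.exp (-(c * x ^ 2))) ∂(gaussianReal 0 (1 / 2)) =
      ENNReal.ofReal (√(1 + c))⁻¹ := by
  have hc1 : 0 < 1 + c := by linarith
  have hpdf : ∀ x, gaussianPDF 0 (1 / 2) x * ENNReal.ofReal (Real.exp (-(c * x ^ 2))) =
      ENNReal.ofReal ((√Real.pi)⁻¹ * Real.exp (-(1 + c) * x ^ 2)) := fun x => by
    rw [gaussianPDF, ← ENNReal.ofReal_mul (gaussianPDFReal_nonneg _ _ _), gaussianPDFReal]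
    congr 1
    rw [mul_assoc, ← Real.exp_add]
    have h2 : 2 * Real.pi * ((1 / 2 : NNReal) : ℝ) = Real.pi := by
      push_cast
      ring
    rw [h2]
    congr 2
    push_cast
    ring
  rw [gaussianReal_of_var_ne_zero _ (by norm_num), lintegral_withDensity_eq_lintegral_mul _
    (measurable_gaussianPDF _ _) (by fun_prop)]
  simp only [Pi.mul_apply, hpdf]
  rw [← ofReal_integral_eq_lintegral_ofReal ((integrable_exp_neg_mul_sq hc1).const_mul _)
    (ae_of_all _ fun x => by positivity), integral_const_mul, integral_gaussian,
    Real.sqrt_div Real.pi_pos.le]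
  congr 1
  have := Real.sqrt_pos.2 Real.pi_pos
  field_simp

lemma lintegral_complexNormal {f : ℂ → ℝ≥0∞} (hf : Measurable f) :
    ∫⁻ z, f z ∂complexNormal =
      ∫⁻ x, ∫⁻ y, f ⟨x, y⟩ ∂(gaussianReal 0 (1 / 2)) ∂(gaussianReal 0 (1 / 2)) := by
  rw [complexNormal, lintegral_map hf measurable_complex_mk,
    lintegral_prod (fun z : ℝ × ℝ => f ⟨z.1, z.2⟩) (hf.comp measurable_complex_mk).aemeasurable]

/-- The Laplace transform of the squared modulus of a complex normal variable. -/
lemma lintegral_nexp_complexNormal {c : ℝ} (hc : 0 ≤ c) :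
    ∫⁻ z, nexp (ENNReal.ofReal (c * ‖z‖ ^ 2)) ∂complexNormal = ENNReal.ofReal (1 + c)⁻¹ := by
  have hm : Measurable fun z : ℂ => nexp (ENNReal.ofReal (c * ‖z‖ ^ 2)) :=
    measurable_nexp.comp (by fun_prop)
  have hsplit : ∀ x y : ℝ, nexp (ENNReal.ofReal (c * ‖(⟨x, y⟩ : ℂ)‖ ^ 2)) =
      ENNReal.ofReal (Real.exp (-(c * x ^ 2))) * ENNReal.ofReal (Real.exp (-(c * y ^ 2))) :=
    fun x y => by
    rw [nexp_ofReal (by positivity), ← ENNReal.ofReal_mul (Real.exp_pos _).le, ← Real.exp_add,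
      Complex.sq_norm, Complex.normSq_mk]
    congr 2
    ring
  rw [lintegral_complexNormal hm]
  simp only [hsplit]
  simp_rw [lintegral_const_mul _
    (show Measurable fun y : ℝ => ENNReal.ofReal (Real.exp (-(c * y ^ 2))) by fun_prop)]
  rw [lintegral_mul_const _ (by fun_prop), lintegral_exp_sq_gaussianReal hc,
    ← ENNReal.ofReal_mul (by positivity)]
  congr 1
  rw [← mul_inv, Real.mul_self_sqrt (by linarith)]

/-- The characteristic function is an exponential of ‖t‖². Products over independent terms then add
the squared coefficients. -/
lemma charFun_complexNormal (t : ℂ) :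
    charFun complexNormal t = Complex.exp (-(‖t‖ ^ 2 : ℝ) / 4) := by
  rw [charFun_apply, complexNormal, integral_map measurable_complex_mk.aemeasurable
    (by fun_prop)]
  have h1 : ∀ z : ℝ × ℝ, Complex.exp ((inner ℝ (⟨z.1, z.2⟩ : ℂ) t : ℝ) * Complex.I) =
      Complex.exp (t.re * z.1 * Complex.I) * Complex.exp (t.im * z.2 * Complex.I) := fun z => by
    rw [← Complex.exp_add, Complex.inner]
    congr 1
    simp
    ring
  simp only [h1]
  rw [integral_prod_mul (fun x : ℝ => Complex.exp (t.re * x * Complex.I))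
    (fun y : ℝ => Complex.exp (t.im * y * Complex.I)), ← charFun_apply_real, ← charFun_apply_real,
    charFun_gaussianReal, charFun_gaussianReal, ← Complex.exp_add]
  congr 1
  rw [Complex.sq_norm, Complex.normSq_apply]
  push_cast
  ring

/-- A linear combination of independent complex normal variables is complex normal. -/
lemma map_sum_complexNormal (n : ℕ) (χ : ℕ → ℝ) :
    (Measure.infinitePi fun _ : ℕ => complexNormal).map
        (fun γ => ∑ j ∈ Finset.range n, γ j * (χ j : ℂ)) =
      complexNormal.map fun z => √(∑ j ∈ Finset.range n, χ j ^ 2) • z := by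
  set μ := Measure.infinitePi fun _ : ℕ => complexNormal with hμ
  have hm : ∀ j, Measurable fun γ : ℕ → ℂ => χ j • γ j := fun j => by fun_prop
  have hind : iIndepFun (fun j (γ : ℕ → ℂ) => χ j • γ j) μ :=
    iIndepFun_infinitePi (X := fun j z => χ j • z) fun j => by fun_prop
  have hfun : (fun γ : ℕ → ℂ => ∑ j ∈ Finset.range n, γ j * (χ j : ℂ)) =
      fun γ => ∑ j ∈ Finset.range n, χ j • γ j := by
    ext γ
    refine Finset.sum_congr rfl fun j _ => ?_
    rw [Complex.real_smul, mul_comm]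
  have hmap : ∀ j, μ.map (fun γ => χ j • γ j) = complexNormal.map fun z => χ j • z := fun j => by
    rw [← Measure.infinitePi_map_eval (fun _ : ℕ => complexNormal) j,
      Measure.map_map (by fun_prop) (by fun_prop)]
    rfl
  have h1 : IsProbabilityMeasure (μ.map fun γ => ∑ j ∈ Finset.range n, χ j • γ j) :=
    Measure.isProbabilityMeasure_map (Finset.measurable_sum _ fun j _ => hm j).aemeasurable
  have h2 : IsProbabilityMeasure (complexNormal.map fun z : ℂ =>
    √(∑ j ∈ Finset.range n, χ j ^ 2) • z) := Measure.isProbabilityMeasure_map (by fun_prop)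
  rw [hfun]
  -- Both characteristic functions are exp(-‖t‖² ∑ χ_j² / 4).
  refine Measure.ext_of_charFun ?_
  ext t
  rw [(hind.restrict (Finset.range n)).charFun_map_fun_finsetSum_eq_prod
    (X := fun j (γ : ℕ → ℂ) => χ j • γ j) fun j _ => (hm j).aemeasurable]
  simp only [Finset.prod_apply, hmap]
  rw [charFun_map_smul, charFun_complexNormal]
  simp only [charFun_map_smul, charFun_complexNormal]
  rw [← Complex.exp_sum]
  congr 1
  simp only [norm_smul, mul_pow, Real.norm_eq_abs, sq_abs]
  rw [Real.sq_sqrt (Finset.sum_nonneg fun j _ => sq_nonneg _), Finset.sum_mul]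
  push_cast
  rw [← Finset.sum_div, Finset.sum_neg_distrib]

lemma lintegral_nexp_sum_fading {c : ℝ} (hc : 0 ≤ c) (n : ℕ) (χ : ℕ → ℝ) :
    ∫⁻ γ, nexp (ENNReal.ofReal (c * ‖∑ j ∈ Finset.range n, γ j * (χ j : ℂ)‖ ^ 2))
        ∂(Measure.infinitePi fun _ : ℕ => complexNormal) =
      ENNReal.ofReal (1 + c * ∑ j ∈ Finset.range n, χ j ^ 2)⁻¹ := by
  have hS : 0 ≤ ∑ j ∈ Finset.range n, χ j ^ 2 := Finset.sum_nonneg fun j _ => sq_nonneg _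
  have hm : Measurable fun z : ℂ => nexp (ENNReal.ofReal (c * ‖z‖ ^ 2)) :=
    measurable_nexp.comp (by fun_prop)
  rw [← lintegral_map (f := fun z : ℂ => nexp (ENNReal.ofReal (c * ‖z‖ ^ 2)))
    (g := fun γ : ℕ → ℂ => ∑ j ∈ Finset.range n, γ j * (χ j : ℂ)) hm (by fun_prop),
    map_sum_complexNormal, lintegral_map hm (by fun_prop)]
  have h1 : ∀ z : ℂ, c * ‖√(∑ j ∈ Finset.range n, χ j ^ 2) • z‖ ^ 2 =
      (c * ∑ j ∈ Finset.range n, χ j ^ 2) * ‖z‖ ^ 2 := fun z => by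
    rw [norm_smul, mul_pow, Real.norm_eq_abs, sq_abs, Real.sq_sqrt hS, mul_assoc]
  simp only [h1]
  exact lintegral_nexp_complexNormal (mul_nonneg hc hS)

lemma lintegral_nexp_sum_sq_fading {c : ℝ} (hc : 0 ≤ c) (n : ℕ) :
    ∫⁻ γ, nexp (ENNReal.ofReal (c * ∑ j ∈ Finset.range n, ‖γ j‖ ^ 2))
        ∂(Measure.infinitePi fun _ : ℕ => complexNormal) =
      ENNReal.ofReal ((1 + c) ^ n)⁻¹ := by
  set μ := Measure.infinitePi fun _ : ℕ => complexNormal with hμ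
  have hmz : Measurable fun z : ℂ => nexp (ENNReal.ofReal (c * ‖z‖ ^ 2)) :=
    measurable_nexp.comp (by fun_prop)
  have hind : iIndepFun (fun j (γ : ℕ → ℂ) => nexp (ENNReal.ofReal (c * ‖γ j‖ ^ 2))) μ :=
    iIndepFun_infinitePi (X := fun j z => nexp (ENNReal.ofReal (c * ‖z‖ ^ 2))) fun j => hmz
  have h1 : ∀ γ : ℕ → ℂ, nexp (ENNReal.ofReal (c * ∑ j ∈ Finset.range n, ‖γ j‖ ^ 2)) =
      ∏ j ∈ Finset.range n, nexp (ENNReal.ofReal (c * ‖γ j‖ ^ 2)) := fun γ => by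
    rw [← nexp_sum, Finset.mul_sum, ENNReal.ofReal_sum_of_nonneg fun j _ => by positivity]
  have h2 : ∀ j, ∫⁻ γ, nexp (ENNReal.ofReal (c * ‖γ j‖ ^ 2)) ∂μ = ENNReal.ofReal (1 + c)⁻¹ :=
    fun j => by
    rw [← lintegral_nexp_complexNormal hc,
      ← Measure.infinitePi_map_eval (fun _ : ℕ => complexNormal) j,
      lintegral_map hmz (by fun_prop)]
  simp only [h1]
  rw [lintegral_prod_eq_prod_lintegral_of_indepFun _ _ hind fun j =>
    hmz.comp (measurable_pi_apply j)]
  simp only [h2, Finset.prod_const, Finset.card_range]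
  rw [← ENNReal.ofReal_pow (by positivity), inv_pow]

/-- The exponential distribution, on `[0, ∞]`. -/
def expLaw : Measure ℝ≥0∞ :=
  ((volume.restrict (Set.Ioi 0)).withDensity fun x => ENNReal.ofReal (Real.exp (-x))).map
    ENNReal.ofReal

lemma lintegral_expLaw {f : ℝ≥0∞ → ℝ≥0∞} (hf : Measurable f) :
    ∫⁻ x, f x ∂expLaw =
      ∫⁻ x in Set.Ioi 0, ENNReal.ofReal (Real.exp (-x)) * f (ENNReal.ofReal x) := by
  have h1 : Measurable fun x : ℝ => ENNReal.ofReal (Real.exp (-x)) := by fun_prop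
  have h2 : Measurable fun x : ℝ => f (ENNReal.ofReal x) := hf.comp ENNReal.measurable_ofReal
  rw [expLaw, lintegral_map hf ENNReal.measurable_ofReal,
    lintegral_withDensity_eq_lintegral_mul _ h1 h2]
  rfl

lemma lintegral_exp_Ioi {a : ℝ} (ha : 0 < a) (c : ℝ) :
    ∫⁻ x in Set.Ioi c, ENNReal.ofReal (Real.exp (-(a * x))) =
      ENNReal.ofReal (Real.exp (-(a * c)) / a) := by
  have ha' : -a < 0 := by linarith
  have h1 := integrableOn_exp_mul_Ioi ha' c
  have h2 := integral_exp_mul_Ioi ha' c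
  simp only [neg_mul] at h1 h2
  rw [← ofReal_integral_eq_lintegral_ofReal h1 (ae_of_all _ fun x => (Real.exp_pos _).le), h2,
    neg_div_neg_eq]

lemma lintegral_nexp_expLaw (n : ℕ) :
    ∫⁻ x, nexp (n * x) ∂expLaw = ENNReal.ofReal (1 + (n : ℝ))⁻¹ := by
  have hn : (0 : ℝ) < 1 + n := by positivity
  rw [lintegral_expLaw (f := fun x => nexp (n * x)) (measurable_nexp.comp (measurable_id.const_mul _)), ← one_div]
  have h := lintegral_exp_Ioi hn 0
  rw [mul_zero, neg_zero, Real.exp_zero] at h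
  rw [← h]
  refine setLIntegral_congr_fun measurableSet_Ioi fun x hx => ?_
  have hx' : 0 ≤ (n : ℝ) * x := mul_nonneg n.cast_nonneg (le_of_lt hx)
  rw [← ENNReal.ofReal_natCast, ← ENNReal.ofReal_mul n.cast_nonneg, nexp_ofReal hx',
    ← ENNReal.ofReal_mul (Real.exp_pos _).le, ← Real.exp_add]
  congr 2
  ring

/-- The squared modulus of a complex normal variable is exponentially distributed. -/
lemma map_normSq_complexNormal :
    complexNormal.map (fun z => ENNReal.ofReal (‖z‖ ^ 2)) = expLaw := by
  have hm : Measurable fun z : ℂ => ENNReal.ofReal (‖z‖ ^ 2) := by fun_prop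
  have h1 : IsFiniteMeasure (complexNormal.map fun z => ENNReal.ofReal (‖z‖ ^ 2)) :=
    Measure.isFiniteMeasure_map _ _
  have h2 : IsFiniteMeasure expLaw := ⟨by
    have h := lintegral_nexp_expLaw 0
    simp only [Nat.cast_zero, zero_mul, nexp_zero, lintegral_one] at h
    rw [h]
    exact ENNReal.ofReal_lt_top⟩
  refine measure_ext_of_laplace fun n => ?_
  rw [lintegral_map (f := fun x => nexp (n * x))
    (measurable_nexp.comp (measurable_id.const_mul _)) hm, lintegral_nexp_expLaw,
    ← lintegral_nexp_complexNormal n.cast_nonneg]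
  refine lintegral_congr fun z => ?_
  rw [ENNReal.ofReal_mul n.cast_nonneg, ENNReal.ofReal_natCast]

lemma complexNormal_normSq_gt {x : ℝ} (hx : 0 ≤ x) :
    complexNormal {z : ℂ | x < ‖z‖ ^ 2} = ENNReal.ofReal (Real.exp (-x)) := by
  have hm : Measurable fun z : ℂ => ENNReal.ofReal (‖z‖ ^ 2) := by fun_prop
  have h1 : {z : ℂ | x < ‖z‖ ^ 2} =
      (fun z : ℂ => ENNReal.ofReal (‖z‖ ^ 2)) ⁻¹' Set.Ioi (ENNReal.ofReal x) := by
    ext z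
    simp only [Set.mem_ofPred_eq, Set.mem_preimage, Set.mem_Ioi]
    rw [ENNReal.ofReal_lt_ofReal_iff_of_nonneg hx]
  rw [h1, ← Measure.map_apply hm measurableSet_Ioi, map_normSq_complexNormal,
    ← lintegral_indicator_one measurableSet_Ioi,
    lintegral_expLaw (f := (Set.Ioi (ENNReal.ofReal x)).indicator 1)
    ((measurable_const (a := (1 : ℝ≥0∞))).indicator measurableSet_Ioi)]
  have h2 := lintegral_exp_Ioi one_pos x
  simp only [one_mul, div_one] at h2
  rw [← h2, ← Set.inter_eq_right.2 (Set.Ioi_subset_Ioi hx), Set.inter_comm (Set.Ioi (0 : ℝ)),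
    ← Measure.restrict_restrict (measurableSet_Ioi (a := x)), ← lintegral_indicator (measurableSet_Ioi (a := x))]
  refine setLIntegral_congr_fun measurableSet_Ioi fun u hu => ?_
  by_cases hux : x < u
  · have h3 : ENNReal.ofReal u ∈ Set.Ioi (ENNReal.ofReal x) :=
      (ENNReal.ofReal_lt_ofReal_iff_of_nonneg hx).2 hux
    simp only [Set.indicator_of_mem h3, Set.indicator_of_mem (Set.mem_Ioi.2 hux), Pi.one_apply,
      mul_one]
  · have h3 : ENNReal.ofReal u ∉ Set.Ioi (ENNReal.ofReal x) := fun h =>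
      hux ((ENNReal.ofReal_lt_ofReal_iff_of_nonneg hx).1 h)
    have h4 : u ∉ Set.Ioi x := hux
    simp only [Set.indicator_of_notMem h3, Set.indicator_of_notMem h4, mul_zero]

/-- The distribution of the strongest of `n` complex normal variables. -/
lemma infinitePi_exists_normSq_gt (n : ℕ) {x : ℝ} (hx : 0 ≤ x) :
    (Measure.infinitePi fun _ : ℕ => complexNormal) {γ | ∃ j ∈ Finset.range n, x < ‖γ j‖ ^ 2} =
      ENNReal.ofReal (1 - (1 - Real.exp (-x)) ^ n) := by
  have hmz : MeasurableSet {z : ℂ | x < ‖z‖ ^ 2} :=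
    measurableSet_lt measurable_const (measurable_norm.pow_const 2)
  have h1 : {γ : ℕ → ℂ | ∃ j ∈ Finset.range n, x < ‖γ j‖ ^ 2} =
      (Set.pi (Finset.range n : Set ℕ) fun _ => {z : ℂ | x < ‖z‖ ^ 2}ᶜ)ᶜ := by
    ext γ
    simp [Set.mem_pi]
  have hm : MeasurableSet (Set.pi (Finset.range n : Set ℕ) fun _ => {z : ℂ | x < ‖z‖ ^ 2}ᶜ) :=
    MeasurableSet.pi (Finset.range n).countable_toSet fun _ _ => hmz.compl
  have he : Real.exp (-x) ≤ 1 := Real.exp_le_one_iff.2 (by linarith)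
  rw [h1, prob_compl_eq_one_sub hm, Measure.infinitePi_pi _ fun _ _ => hmz.compl]
  simp only [prob_compl_eq_one_sub hmz, complexNormal_normSq_gt hx, Finset.prod_const,
    Finset.card_range]
  rw [← ENNReal.ofReal_one, ← ENNReal.ofReal_sub _ (Real.exp_pos _).le,
    ← ENNReal.ofReal_pow (sub_nonneg.2 he), ← ENNReal.ofReal_sub _ (pow_nonneg (sub_nonneg.2 he) _)]

end

end MmWave

namespace MmWave

noncomputable section

open Filter Topology

/-! ### Expectations over finitely many discrete variables -/

/-- With countably many indices, measurability may be checked with the index frozen. This handles a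
random tagged station, a random number of beams and a random link type. -/
lemma measurable_select_countable {α ι β : Type*} {m : MeasurableSpace α} [MeasurableSpace ι]
    [MeasurableSpace β] [Countable ι] [MeasurableSingletonClass ι] {g : α → ι} (hg : Measurable g)
    {f : ι → α → β} (hf : ∀ i, Measurable (f i)) : Measurable fun x => f (g x) x := by
  have h : Measurable fun q : ι × α => f q.1 q.2 := measurable_from_prod_countable_right hf
  exact h.comp (hg.prodMk measurable_id)

lemma lintegral_eq_sum_of_ae_mem {α : Type*} [MeasurableSpace α] [MeasurableSingletonClass α]
    {μ : Measure α} {S : Finset α} (hS : ∀ᵐ x ∂μ, x ∈ S) (f : α → ℝ≥0∞) :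
    ∫⁻ x, f x ∂μ = ∑ x ∈ S, f x * μ {x} := by
  rw [← lintegral_finset, Measure.restrict_eq_self_of_ae_mem hS]

lemma ae_mem_angleLaw (N : ℕ) : ∀ᵐ i ∂(angleLaw N), i ∈ Finset.Icc 1 N := by
  rw [ae_iff, ← lintegral_indicator_one (Set.to_countable _).measurableSet, lintegral_angleLaw]
  refine Finset.sum_eq_zero fun i hi => ?_
  rw [Set.indicator_of_notMem, mul_zero]
  exact fun h => h hi

/-- The expectation of a function of finitely many independent angles. -/
lemma lintegral_infinitePi_angleLaw {N : ℕ} (hN : 1 ≤ N) (k : ℕ) (F : (Fin k → ℕ) → ℝ≥0∞) :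
    ∫⁻ θ, F (fun j => θ j) ∂(Measure.infinitePi fun _ : ℕ => angleLaw N) =
      ∑ x ∈ Fintype.piFinset (fun _ : Fin k => Finset.Icc 1 N),
        (∏ j, ENNReal.ofReal (angleProb N (x j))) * F x := by
  have hprob : IsProbabilityMeasure (angleLaw N) := ⟨angleLaw_univ hN⟩
  have hm : Measurable fun (θ : ℕ → ℕ) (j : Fin k) => θ j := by fun_prop
  have hmap : (Measure.infinitePi fun _ : ℕ => angleLaw N).map (fun θ (j : Fin k) => θ j) =
      Measure.infinitePi fun _ : Fin k => angleLaw N := by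
    have h : iIndepFun (fun (j : Fin k) (θ : ℕ → ℕ) => θ j)
        (Measure.infinitePi fun _ : ℕ => angleLaw N) :=
      (iIndepFun_infinitePi (P := fun _ : ℕ => angleLaw N) (X := fun _ x => x)
        fun _ => measurable_id).precomp Fin.val_injective
    rw [h.map_fun_eq_infinitePi_map fun j => measurable_pi_apply _]
    congr 1
    ext1 j
    exact Measure.infinitePi_map_eval (fun _ : ℕ => angleLaw N) j
  rw [← lintegral_map (f := F) (g := fun (θ : ℕ → ℕ) (j : Fin k) => θ j)
    (Measurable.of_discrete) hm, hmap, Measure.infinitePi_eq_pi]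
  have hae : ∀ᵐ x ∂(Measure.pi fun _ : Fin k => angleLaw N),
      x ∈ Fintype.piFinset fun _ : Fin k => Finset.Icc 1 N := by
    simp only [Fintype.mem_piFinset]
    rw [ae_all_iff]
    intro j
    exact (measurePreserving_eval (fun _ : Fin k => angleLaw N) j).quasiMeasurePreserving.ae
      (ae_mem_angleLaw N)
  rw [lintegral_eq_sum_of_ae_mem hae]
  refine Finset.sum_congr rfl fun x hx => ?_
  rw [Measure.pi_singleton, mul_comm]
  congr 1
  exact Finset.prod_congr rfl fun j _ => angleLaw_singleton (Fintype.mem_piFinset.1 hx j)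

namespace Params

variable (p : Params)

lemma κInterf_nonneg (n : ℕ) : 0 ≤ p.κInterf n := by
  have h0 : 0 ≤ p.load := div_nonneg p.lamUE_pos.le p.lamBS_pos.le
  have h1 : 0 < Real.Gamma (n + 3.5) := Real.Gamma_pos_of_pos (by positivity)
  have h2 : 0 < Real.Gamma 3.5 := Real.Gamma_pos_of_pos (by norm_num)
  unfold κInterf
  positivity

/-- `μ` is the law of the number of users of a BS other than the tagged one. -/
def IsLoadLaw (μ : Measure ℕ) : Prop := ∀ n, μ {n} = ENNReal.ofReal (p.κInterf n)

variable {p}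

lemma IsLoadLaw.map_min {μ : Measure ℕ} [IsProbabilityMeasure μ] (hμ : p.IsLoadLaw μ) (n : ℕ) :
    μ {m | min p.UM m = n} = ENNReal.ofReal (p.pTilde n) := by
  unfold pTilde
  split_ifs with h1 h2
  · rw [← hμ n]
    congr 1
    ext m
    simp only [Set.mem_ofPred_eq, Set.mem_singleton_iff]
    omega
  · have h3 : {m | min p.UM m = n} = ((Finset.range p.UM : Finset ℕ) : Set ℕ)ᶜ := by
      ext m
      simp only [Set.mem_ofPred_eq, Set.mem_compl_iff, Finset.coe_range, Set.mem_Iio]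
      omega
    rw [h3, prob_compl_eq_one_sub (Finset.measurableSet _), ← sum_measure_singleton]
    simp only [hμ _]
    rw [← ENNReal.ofReal_sum_of_nonneg fun i _ => p.κInterf_nonneg i,
      ENNReal.ofReal_sub _ (Finset.sum_nonneg fun i _ => p.κInterf_nonneg i), ENNReal.ofReal_one]
  · have h3 : {m | min p.UM m = n} = ∅ := by
      ext m
      simp only [Set.mem_ofPred_eq, Set.mem_empty_iff_false, iff_false]
      omega
    rw [h3, measure_empty, ENNReal.ofReal_zero]

/-- Only the mass at `UM` needs an argument: it is one minus masses of distinct points under a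
probability measure. -/
lemma IsLoadLaw.pTilde_nonneg {μ : Measure ℕ} [IsProbabilityMeasure μ] (hμ : p.IsLoadLaw μ)
    (n : ℕ) : 0 ≤ p.pTilde n := by
  unfold pTilde
  split_ifs
  · exact p.κInterf_nonneg n
  · rw [sub_nonneg, ← ENNReal.ofReal_le_ofReal_iff zero_le_one,
      ENNReal.ofReal_sum_of_nonneg fun i _ => p.κInterf_nonneg i]
    simp only [← hμ _]
    rw [sum_measure_singleton, ENNReal.ofReal_one]
    exact prob_le_one
  · exact le_rfl

lemma IsLoadLaw.lintegral {μ : Measure ℕ} [IsProbabilityMeasure μ] (hμ : p.IsLoadLaw μ)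
    (F : ℕ → ℝ≥0∞) : ∫⁻ m, F (min p.UM m) ∂μ =
      ∑ n ∈ Finset.range (p.UM + 1), ENNReal.ofReal (p.pTilde n) * F n := by
  have hm : Measurable fun m : ℕ => min p.UM m := Measurable.of_discrete
  rw [← lintegral_map (f := F) Measurable.of_discrete hm,
    lintegral_eq_sum_of_ae_mem (S := Finset.range (p.UM + 1))]
  · refine Finset.sum_congr rfl fun n _ => ?_
    rw [Measure.map_apply hm (measurableSet_singleton n), mul_comm]
    congr 1
    exact hμ.map_min n
  · refine (ae_map_iff hm.aemeasurable MeasurableSet.of_discrete).2 ?_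
    refine ae_of_all _ fun m => Finset.mem_range.2 ?_
    omega

lemma IsLoadLaw.sum_pTilde {μ : Measure ℕ} [IsProbabilityMeasure μ] (hμ : p.IsLoadLaw μ) :
    ∑ n ∈ Finset.range (p.UM + 1), p.pTilde n = 1 := by
  have h := hμ.lintegral fun _ => 1
  simp only [lintegral_const, measure_univ, mul_one] at h
  rw [← ENNReal.ofReal_sum_of_nonneg fun i _ => hμ.pTilde_nonneg i, eq_comm,
    ENNReal.ofReal_eq_one] at h
  exact h

/-! ### The interference from one BS -/

variable (p)

/-- The attenuation of the `j`-th path for the `w`-th beam. -/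
def gainOf (m : AngleMark) (j w : ℕ) : ℝ :=
  p.gain m.2.1 (m.2.2.1 j) (m.2.2.2.2 w) (m.2.2.2.1 j)

/-- The interference from a BS with given path loss, link type and marks. -/
def interf (q : (ℝ × Link) × RestMark) : ℝ :=
  p.G * q.1.1⁻¹ / (p.η q.1.2 * (min p.UM q.2.1.1 : ℕ)) *
    ∑ w ∈ Finset.range (min p.UM q.2.1.1),
      ‖∑ j ∈ Finset.range (p.η q.1.2), q.2.2 j * (p.gainOf q.2.1 j w : ℂ)‖ ^ 2

lemma measurable_gainOf (j w : ℕ) : Measurable fun m : AngleMark => p.gainOf m j w := by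
  have h : Measurable fun m : AngleMark => (m.2.1, m.2.2.1 j, m.2.2.2.2 w, m.2.2.2.1 j) := by
    fun_prop
  have h2 : Measurable fun r : ℕ × ℕ × ℕ × ℕ => p.gain r.1 r.2.1 r.2.2.1 r.2.2.2 :=
    Measurable.of_discrete
  exact h2.comp h

lemma measurable_interf : Measurable p.interf := by
  have hg : Measurable fun q : (ℝ × Link) × RestMark => (q.2.1.1, q.1.2) := by fun_prop
  have key : ∀ i : ℕ × Link, Measurable fun q : (ℝ × Link) × RestMark =>
      p.G * q.1.1⁻¹ / (p.η i.2 * (min p.UM i.1 : ℕ)) * ∑ w ∈ Finset.range (min p.UM i.1),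
      ‖∑ j ∈ Finset.range (p.η i.2), q.2.2 j * (p.gainOf q.2.1 j w : ℂ)‖ ^ 2 := fun i => by
    refine Measurable.mul (by fun_prop) (Finset.measurable_sum _ fun w _ => ?_)
    refine (Finset.measurable_sum _ fun j _ => ?_).norm.pow_const 2
    have h1 : Measurable fun q : (ℝ × Link) × RestMark => p.gainOf q.2.1 j w :=
      (p.measurable_gainOf j w).comp (by fun_prop)
    have h2 : Measurable fun q : (ℝ × Link) × RestMark => q.2.2 j := by fun_prop
    exact h2.mul (Complex.measurable_ofReal.comp h1)
  exact measurable_select_countable hg key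

lemma G_pos : 0 < p.G := by
  have h1 := p.power_pos
  have h2 : (0 : ℝ) < p.NBS := Nat.cast_pos.2 p.NBS_pos
  have h3 : (0 : ℝ) < p.NUE := Nat.cast_pos.2 p.NUE_pos
  unfold G
  positivity

/-- The law of the fading of a BS. -/
def _root_.MmWave.fadingLaw : Measure (ℕ → ℂ) := Measure.infinitePi fun _ => complexNormal

/-- The Laplace transform of the interference from a BS, given its path loss, link type and
angles. -/
def fadingMean (s t : ℝ) (a : Link) (m : AngleMark) : ℝ≥0∞ :=
  ∫⁻ γ, nexp (ENNReal.ofReal s * ENNReal.ofReal (p.interf ((t, a), (m, γ)))) ∂fadingLaw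

/-- The Laplace transform of the interference from a BS, given its path loss and link type. -/
def markMean (μ : Measure ℕ) (s t : ℝ) (a : Link) : ℝ≥0∞ :=
  ∫⁻ r, nexp (ENNReal.ofReal s * ENNReal.ofReal (p.interf ((t, a), r))) ∂(p.restLaw μ)

lemma measurable_nexp_interf (s : ℝ) : Measurable fun q : (ℝ × Link) × RestMark =>
    nexp (ENNReal.ofReal s * ENNReal.ofReal (p.interf q)) :=
  measurable_nexp.comp (p.measurable_interf.ennreal_ofReal.const_mul _)

lemma markMean_eq (μ : Measure ℕ) [IsProbabilityMeasure μ] (s t : ℝ) (a : Link) :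
    p.markMean μ s t a = ∫⁻ m, p.fadingMean s t a m ∂(p.angleMarkLaw μ) := by
  have h := p.measurable_nexp_interf s
  rw [markMean, restLaw, lintegral_prod (fun r : RestMark =>
    nexp (ENNReal.ofReal s * ENNReal.ofReal (p.interf ((t, a), r))))
    (h.comp measurable_prodMk_left).aemeasurable]
  rfl

/-- The total attenuation of all paths and beams. -/
def gainSum (a : Link) (m : AngleMark) : ℝ :=
  ∑ w ∈ Finset.range (min p.UM m.1), ∑ j ∈ Finset.range (p.η a), p.gainOf m j w ^ 2

lemma gainSum_nonneg (a : Link) (m : AngleMark) : 0 ≤ p.gainSum a m :=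
  Finset.sum_nonneg fun _ _ => Finset.sum_nonneg fun _ _ => sq_nonneg _

/-- The factor of the interference that does not depend on the fading. -/
def gainCoef (s t : ℝ) (a : Link) (m : AngleMark) : ℝ :=
  s * p.G / (t * p.η a * (min p.UM m.1 : ℕ))

lemma gainCoef_nonneg {s t : ℝ} (hs : 0 ≤ s) (ht : 0 < t) (a : Link) (m : AngleMark) :
    0 ≤ p.gainCoef s t a m := by
  have := p.G_pos
  unfold gainCoef
  positivity

lemma fadingMean_eq {s : ℝ} (hs : 0 ≤ s) (t : ℝ) (a : Link) (m : AngleMark) :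
    p.fadingMean s t a m = ∫⁻ γ, nexp (ENNReal.ofReal (p.gainCoef s t a m *
      ∑ w ∈ Finset.range (min p.UM m.1),
        ‖∑ j ∈ Finset.range (p.η a), γ j * (p.gainOf m j w : ℂ)‖ ^ 2)) ∂fadingLaw := by
  refine lintegral_congr fun γ => ?_
  rw [← ENNReal.ofReal_mul hs, interf, gainCoef]
  congr 2
  simp only [div_eq_mul_inv, mul_inv]
  ring

/-- Cauchy–Schwarz bounds each beam by ∑ χ² times ∑ |γ|². The latter sum is common to all beams and
is a sum of η independent exponential variables, whence the power η. -/
lemma le_fadingMean {s t : ℝ} (hs : 0 ≤ s) (ht : 0 < t) (a : Link) (m : AngleMark) :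
    ENNReal.ofReal ((1 + p.gainCoef s t a m * p.gainSum a m) ^ p.η a)⁻¹ ≤
      p.fadingMean s t a m := by
  have hc := p.gainCoef_nonneg hs ht a m
  rw [p.fadingMean_eq hs, ← lintegral_nexp_sum_sq_fading (mul_nonneg hc (p.gainSum_nonneg a m))]
  refine lintegral_mono fun γ => nexp_antitone (ENNReal.ofReal_le_ofReal ?_)
  rw [mul_assoc]
  refine mul_le_mul_of_nonneg_left ?_ hc
  rw [gainSum, Finset.sum_mul]
  refine Finset.sum_le_sum fun w _ => ?_
  calc ‖∑ j ∈ Finset.range (p.η a), γ j * (p.gainOf m j w : ℂ)‖ ^ 2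
      ≤ (∑ j ∈ Finset.range (p.η a), |p.gainOf m j w| * ‖γ j‖) ^ 2 := by
        refine pow_le_pow_left₀ (norm_nonneg _) ((norm_sum_le _ _).trans_eq ?_) 2
        refine Finset.sum_congr rfl fun j _ => ?_
        rw [norm_mul, Complex.norm_real, Real.norm_eq_abs, mul_comm]
    _ ≤ (∑ j ∈ Finset.range (p.η a), |p.gainOf m j w| ^ 2) *
          ∑ j ∈ Finset.range (p.η a), ‖γ j‖ ^ 2 := Finset.sum_mul_sq_le_sq_mul_sq _ _ _
    _ = _ := by simp only [sq_abs]

/-- With one path the Cauchy–Schwarz bound in `le_fadingMean` is an equality: all beams see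
multiples of the same |γ|². -/
lemma fadingMean_of_single {s t : ℝ} (hs : 0 ≤ s) (ht : 0 < t) {a : Link} (ha : p.η a = 1)
    (m : AngleMark) :
    p.fadingMean s t a m = ENNReal.ofReal (1 + p.gainCoef s t a m * p.gainSum a m)⁻¹ := by
  have hc := p.gainCoef_nonneg hs ht a m
  have h := lintegral_nexp_sum_sq_fading (mul_nonneg hc (p.gainSum_nonneg a m)) 1
  rw [pow_one] at h
  rw [p.fadingMean_eq hs, ← h]
  refine lintegral_congr fun γ => ?_
  rw [ha, gainSum, ha]
  simp only [Finset.sum_range_one, norm_mul, mul_pow, Complex.norm_real, Real.norm_eq_abs, sq_abs]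
  rw [mul_assoc, Finset.sum_mul]
  simp only [mul_comm]

lemma sq_gainOf_ge (m : AngleMark) (j w : ℕ) : p.rhoBS ^ 2 * p.rhoUE ^ 2 ≤ p.gainOf m j w ^ 2 := by
  have h1 := p.rhoBS_nonneg
  have h2 := p.rhoBS_lt_one.le
  have h3 := p.rhoUE_nonneg
  have h4 := p.rhoUE_lt_one.le
  rw [← mul_pow]
  refine pow_le_pow_left₀ (mul_nonneg h1 h3) ?_ 2
  rw [gainOf, gain, mul_comm]
  refine mul_le_mul ?_ ?_ h1 ?_
  · split_ifs <;> simp [h4]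
  · split_ifs <;> simp [h2]
  · split_ifs <;> simp [h3]

/-- The beams share the fading and are not independent, so the exponential of their average is
bounded by the average of exponentials. Each beam is then a single complex normal variable whose
variance is at least η ρ_BS² ρ_UE². At least one beam is needed for the average. -/
lemma fadingMean_le {s t : ℝ} (hs : 0 ≤ s) (ht : 0 < t) (a : Link) {m : AngleMark}
    (hm : min p.UM m.1 ≠ 0) :
    p.fadingMean s t a m ≤
      ENNReal.ofReal (1 + s * p.G * (p.rhoBS ^ 2 * p.rhoUE ^ 2) / t)⁻¹ := by
  set u := min p.UM m.1 with hu
  have hu0 : (0 : ℝ) < u := Nat.cast_pos.2 (Nat.pos_of_ne_zero hm)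
  have hη : (0 : ℝ) < p.η a := Nat.cast_pos.2 (p.η_pos a)
  have hG := p.G_pos
  set c := s * p.G / (t * p.η a) with hc
  have hc0 : 0 ≤ c := by positivity
  have hcoef : p.gainCoef s t a m = (u : ℝ)⁻¹ * c := by
    rw [gainCoef, ← hu, hc]
    field_simp
  set Y : ℕ → (ℕ → ℂ) → ℝ := fun w γ =>
    c * ‖∑ j ∈ Finset.range (p.η a), γ j * (p.gainOf m j w : ℂ)‖ ^ 2 with hY
  have hY0 : ∀ w γ, 0 ≤ Y w γ := fun w γ => by positivity
  -- Jensen's inequality for exp with equal weights 1/u over the u beams.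
  have hconv : ∀ γ, nexp (ENNReal.ofReal (p.gainCoef s t a m * ∑ w ∈ Finset.range u,
      ‖∑ j ∈ Finset.range (p.η a), γ j * (p.gainOf m j w : ℂ)‖ ^ 2)) ≤
      ENNReal.ofReal (u : ℝ)⁻¹ * ∑ w ∈ Finset.range u, nexp (ENNReal.ofReal (Y w γ)) := fun γ => by
    have h1 := convexOn_exp.map_sum_le (t := Finset.range u) (w := fun _ => (u : ℝ)⁻¹)
      (p := fun w => -Y w γ) (fun _ _ => by positivity) (by simp [hu0.ne'])
      (fun _ _ => Set.mem_univ _)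
    simp only [smul_eq_mul] at h1
    have h2 : p.gainCoef s t a m * ∑ w ∈ Finset.range u,
        ‖∑ j ∈ Finset.range (p.η a), γ j * (p.gainOf m j w : ℂ)‖ ^ 2 =
        -∑ w ∈ Finset.range u, (u : ℝ)⁻¹ * -Y w γ := by
      rw [hcoef, Finset.mul_sum, ← Finset.sum_neg_distrib]
      refine Finset.sum_congr rfl fun w _ => ?_
      rw [hY]
      ring
    have h3 : 0 ≤ p.gainCoef s t a m * ∑ w ∈ Finset.range u,
        ‖∑ j ∈ Finset.range (p.η a), γ j * (p.gainOf m j w : ℂ)‖ ^ 2 :=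
      mul_nonneg (p.gainCoef_nonneg hs ht a m) (Finset.sum_nonneg fun _ _ => by positivity)
    rw [nexp_ofReal h3, h2, neg_neg]
    simp only [nexp_ofReal (hY0 _ γ)]
    rw [← ENNReal.ofReal_sum_of_nonneg fun w _ => (Real.exp_pos _).le,
      ← ENNReal.ofReal_mul (by positivity), Finset.mul_sum]
    exact ENNReal.ofReal_le_ofReal h1
  have hYm : ∀ w, Measurable fun γ => nexp (ENNReal.ofReal (Y w γ)) := fun w => by
    refine measurable_nexp.comp (Measurable.ennreal_ofReal ?_)
    refine Measurable.const_mul (Measurable.pow_const (Measurable.norm ?_) 2) _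
    exact Finset.measurable_sum _ fun j _ => by fun_prop
  have hbound : ∀ w, ∫⁻ γ, nexp (ENNReal.ofReal (Y w γ)) ∂fadingLaw ≤
      ENNReal.ofReal (1 + s * p.G * (p.rhoBS ^ 2 * p.rhoUE ^ 2) / t)⁻¹ := fun w => by
    refine (lintegral_nexp_sum_fading hc0 (p.η a) fun j => p.gainOf m j w).trans_le
      (ENNReal.ofReal_le_ofReal ?_)
    have h4 : (p.η a : ℝ) * (p.rhoBS ^ 2 * p.rhoUE ^ 2) ≤
        ∑ j ∈ Finset.range (p.η a), p.gainOf m j w ^ 2 := by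
      have h5 := Finset.card_nsmul_le_sum (Finset.range (p.η a)) (fun j => p.gainOf m j w ^ 2)
        (p.rhoBS ^ 2 * p.rhoUE ^ 2) fun j _ => p.sq_gainOf_ge m j w
      simpa using h5
    refine inv_anti₀ (by positivity) ?_
    have h6 : s * p.G * (p.rhoBS ^ 2 * p.rhoUE ^ 2) / t =
        c * ((p.η a : ℝ) * (p.rhoBS ^ 2 * p.rhoUE ^ 2)) := by
      rw [hc]
      field_simp
    rw [h6]
    gcongr
  rw [p.fadingMean_eq hs]
  refine (lintegral_mono hconv).trans ?_
  rw [lintegral_const_mul _ (Finset.measurable_sum _ fun w _ => hYm w),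
    lintegral_finsetSum _ fun w _ => hYm w]
  refine (mul_le_mul_right (Finset.sum_le_sum fun w _ => hbound w) _).trans_eq ?_
  rw [Finset.sum_const, Finset.card_range, nsmul_eq_mul, ← mul_assoc, ← ENNReal.ofReal_natCast,
    ← ENNReal.ofReal_mul (by positivity), inv_mul_cancel₀ hu0.ne', ENNReal.ofReal_one, one_mul]

end Params

end

end MmWave

namespace MmWave

noncomputable section

open Filter Topology

/-! ### Averages over the angles -/

lemma sum_erase_angleProb {N i : ℕ} (hi : i ∈ Finset.Icc 1 N) :
    ∑ j ∈ (Finset.Icc 1 N).erase i, ENNReal.ofReal (angleProb N j) =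
      ENNReal.ofReal (1 - angleProb N i) := by
  have hN : 1 ≤ N := (Finset.mem_Icc.1 hi).1.trans (Finset.mem_Icc.1 hi).2
  rw [← ENNReal.ofReal_sum_of_nonneg fun _ _ => angleProb_nonneg,
    Finset.sum_erase_eq_sub hi, sum_angleProb hN]

lemma angleProb_le_one {N i : ℕ} (hi : i ∈ Finset.Icc 1 N) : angleProb N i ≤ 1 := by
  have hN : 1 ≤ N := (Finset.mem_Icc.1 hi).1.trans (Finset.mem_Icc.1 hi).2
  rw [← sum_angleProb hN]
  exact Finset.single_le_sum (f := fun j => angleProb N j) (fun _ _ => angleProb_nonneg) hi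

/-- The number of precoding angles that agree with a given angle is binomial. -/
lemma sum_piFinset_card {N i : ℕ} (hi : i ∈ Finset.Icc 1 N) (n : ℕ) (F : ℕ → ℝ≥0∞) :
    ∑ b ∈ Fintype.piFinset (fun _ : Fin n => Finset.Icc 1 N),
        (∏ w, ENNReal.ofReal (angleProb N (b w))) * F (Finset.univ.filter fun w => b w = i).card =
      ∑ k ∈ Finset.range (n + 1), ENNReal.ofReal
        ((n.choose k : ℝ) * (angleProb N i ^ k * (1 - angleProb N i) ^ (n - k))) * F k := by
  classical
  set q := ENNReal.ofReal (angleProb N i) with hq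
  set r := ENNReal.ofReal (1 - angleProb N i) with hr
  -- Sort the precoding vectors by the set `A` of beams that agree with `i`. On each class the
  -- weights factor into a product over beams and depend on `A` only through its cardinality.
  have hfib : ∀ A : Finset (Fin n),
      ∑ b ∈ (Fintype.piFinset fun _ : Fin n => Finset.Icc 1 N).filter
        (fun b => (Finset.univ.filter fun w => b w = i) = A),
        (∏ w, ENNReal.ofReal (angleProb N (b w))) * F (Finset.univ.filter fun w => b w = i).card =
      q ^ A.card * r ^ (n - A.card) * F A.card := fun A => by
    have h1 : (Fintype.piFinset fun _ : Fin n => Finset.Icc 1 N).filter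
        (fun b => (Finset.univ.filter fun w => b w = i) = A) =
        Fintype.piFinset fun w => if w ∈ A then {i} else (Finset.Icc 1 N).erase i := by
      ext b
      simp only [Finset.mem_filter, Fintype.mem_piFinset]
      constructor
      · rintro ⟨hb, rfl⟩ w
        by_cases hw : b w = i
        · simp [hw]
        · simp [hw, Finset.mem_Icc.1 (hb w)]
      · intro hb
        have hA : ∀ w, w ∈ A ↔ b w = i := fun w => by
          have := hb w
          by_cases hw : w ∈ A
          · simpa [hw] using this
          · simp only [hw, if_false, Finset.mem_erase] at this
            simp [hw, this.1]
        refine ⟨fun w => ?_, ?_⟩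
        · have := hb w
          by_cases hw : w ∈ A
          · rw [(hA w).1 hw]
            exact hi
          · simp only [hw, if_false, Finset.mem_erase] at this
            exact this.2
        · ext w
          simp [hA w]
    have h2 : ∀ b ∈ (Fintype.piFinset fun _ : Fin n => Finset.Icc 1 N).filter
        (fun b => (Finset.univ.filter fun w => b w = i) = A),
        (∏ w, ENNReal.ofReal (angleProb N (b w))) * F (Finset.univ.filter fun w => b w = i).card =
        (∏ w, ENNReal.ofReal (angleProb N (b w))) * F A.card := fun b hb => by
      rw [(Finset.mem_filter.1 hb).2]
    rw [Finset.sum_congr rfl h2, ← Finset.sum_mul, h1,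
      ← Finset.prod_univ_sum (fun w => if w ∈ A then {i} else (Finset.Icc 1 N).erase i)
        (fun _ x => ENNReal.ofReal (angleProb N x))]
    congr 1
    have h3 : ∀ w, ∑ x ∈ (if w ∈ A then {i} else (Finset.Icc 1 N).erase i),
        ENNReal.ofReal (angleProb N x) = if w ∈ A then q else r := fun w => by
      by_cases hw : w ∈ A
      · simp only [hw, if_true, Finset.sum_singleton, hq]
      · simp only [hw, if_false, sum_erase_angleProb hi, hr]
    simp only [h3]
    rw [Finset.prod_ite, Finset.prod_const, Finset.prod_const]
    have h4 : (Finset.univ.filter fun w => w ∉ A) = Aᶜ := by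
      ext w
      simp
    have h5 : (Finset.univ.filter fun w => w ∈ A) = A := by
      ext w
      simp
    rw [h4, h5, Finset.card_compl, Fintype.card_fin]
  rw [← Finset.sum_fiberwise_of_maps_to (s := Fintype.piFinset fun _ : Fin n => Finset.Icc 1 N)
    (t := Finset.univ.powerset) (g := fun b => Finset.univ.filter fun w => b w = i)
    (fun b _ => by simp), Finset.sum_congr rfl fun A _ => hfib A,
    Finset.sum_powerset_apply_card (fun k => q ^ k * r ^ (n - k) * F k), Finset.card_univ,
    Fintype.card_fin]
  refine Finset.sum_congr rfl fun k _ => ?_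
  have h0 := angleProb_nonneg (N := N) (i := i)
  have h1 := sub_nonneg.2 (angleProb_le_one hi)
  rw [ENNReal.ofReal_mul (Nat.cast_nonneg _), ENNReal.ofReal_mul (pow_nonneg h0 _),
    ENNReal.ofReal_pow h0, ENNReal.ofReal_pow h1, ENNReal.ofReal_natCast, nsmul_eq_mul]
  ring

namespace Params

variable (p : Params)

lemma lintegral_angleMarkLaw (μ : Measure ℕ) [IsProbabilityMeasure μ] {f : AngleMark → ℝ≥0∞}
    (hf : Measurable f) : ∫⁻ m, f m ∂(p.angleMarkLaw μ) =
      ∫⁻ n, ∫⁻ c, ∫⁻ φ, ∫⁻ θ, ∫⁻ b, f (n, c, φ, θ, b)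
        ∂(Measure.infinitePi fun _ : ℕ => angleLaw p.NBS)
        ∂(Measure.infinitePi fun _ : ℕ => angleLaw p.NBS)
        ∂(Measure.infinitePi fun _ : ℕ => angleLaw p.NUE) ∂(angleLaw p.NUE) ∂μ := by
  rw [angleMarkLaw, lintegral_prod _ hf.aemeasurable]
  refine lintegral_congr fun n => ?_
  have h1 := hf.comp (measurable_prodMk_left (x := n))
  rw [lintegral_prod (fun m => f (n, m)) h1.aemeasurable]
  refine lintegral_congr fun c => ?_
  have h2 := h1.comp (measurable_prodMk_left (x := c))
  rw [lintegral_prod (fun m => f (n, c, m)) h2.aemeasurable]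
  refine lintegral_congr fun φ => ?_
  have h3 := h2.comp (measurable_prodMk_left (x := φ))
  rw [lintegral_prod (fun m => f (n, c, φ, m)) h3.aemeasurable]

/-- The expectation of a function of the number of served users and of the angles of finitely many
paths. -/
lemma lintegral_angleMarkLaw_fin {μ : Measure ℕ} [IsProbabilityMeasure μ] (hμ : p.IsLoadLaw μ)
    (k : ℕ) (F : (n : ℕ) → ℕ → (Fin k → ℕ) → (Fin k → ℕ) → (Fin n → ℕ) → ℝ≥0∞) :
    ∫⁻ m, F (min p.UM m.1) m.2.1 (fun j => m.2.2.1 j) (fun j => m.2.2.2.1 j)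
        (fun w => m.2.2.2.2 w) ∂(p.angleMarkLaw μ) =
      ∑ n ∈ Finset.range (p.UM + 1), ENNReal.ofReal (p.pTilde n) *
        ∑ c ∈ Finset.Icc 1 p.NUE, ENNReal.ofReal (p.qUE c) *
          ∑ φ ∈ Fintype.piFinset (fun _ : Fin k => Finset.Icc 1 p.NUE),
            (∏ j, ENNReal.ofReal (p.qUE (φ j))) *
            ∑ θ ∈ Fintype.piFinset (fun _ : Fin k => Finset.Icc 1 p.NBS),
              (∏ j, ENNReal.ofReal (p.qBS (θ j))) *
              ∑ b ∈ Fintype.piFinset (fun _ : Fin n => Finset.Icc 1 p.NBS),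
                (∏ w, ENNReal.ofReal (p.qBS (b w))) * F n c φ θ b := by
  have hm : Measurable fun m : AngleMark => F (min p.UM m.1) m.2.1 (fun j => m.2.2.1 j)
      (fun j => m.2.2.2.1 j) (fun w => m.2.2.2.2 w) := by
    have hg : Measurable fun m : AngleMark => m.1 := measurable_fst
    have key : ∀ n : ℕ, Measurable fun m : AngleMark => F (min p.UM n) m.2.1 (fun j => m.2.2.1 j)
        (fun j => m.2.2.2.1 j) (fun w => m.2.2.2.2 w) := fun n => by
      have h1 : Measurable fun m : AngleMark => (m.2.1, (fun j : Fin k => m.2.2.1 j),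
          (fun j : Fin k => m.2.2.2.1 j), (fun w : Fin (min p.UM n) => m.2.2.2.2 w)) := by
        fun_prop
      have h2 : Measurable fun r : ℕ × (Fin k → ℕ) × (Fin k → ℕ) × (Fin (min p.UM n) → ℕ) =>
          F (min p.UM n) r.1 r.2.1 r.2.2.1 r.2.2.2 := Measurable.of_discrete
      exact h2.comp h1
    exact measurable_select_countable hg key
  rw [p.lintegral_angleMarkLaw μ hm, ← hμ.lintegral]
  refine lintegral_congr fun n => ?_
  rw [lintegral_angleLaw]
  refine Finset.sum_congr rfl fun c _ => ?_
  congr 1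
  have h2 : ∀ φ θ : Fin k → ℕ, ∫⁻ b, F (min p.UM n) c φ θ (fun w => b w)
      ∂(Measure.infinitePi fun _ : ℕ => angleLaw p.NBS) =
      ∑ b ∈ Fintype.piFinset (fun _ : Fin (min p.UM n) => Finset.Icc 1 p.NBS),
        (∏ w, ENNReal.ofReal (angleProb p.NBS (b w))) * F (min p.UM n) c φ θ b := fun φ θ =>
    lintegral_infinitePi_angleLaw p.NBS_pos _ _
  have h3 : ∀ φ : Fin k → ℕ, ∫⁻ θ, ∫⁻ b, F (min p.UM n) c φ (fun j => θ j) (fun w => b w)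
      ∂(Measure.infinitePi fun _ : ℕ => angleLaw p.NBS)
      ∂(Measure.infinitePi fun _ : ℕ => angleLaw p.NBS) =
      ∑ θ ∈ Fintype.piFinset (fun _ : Fin k => Finset.Icc 1 p.NBS),
        (∏ j, ENNReal.ofReal (angleProb p.NBS (θ j))) *
        ∑ b ∈ Fintype.piFinset (fun _ : Fin (min p.UM n) => Finset.Icc 1 p.NBS),
          (∏ w, ENNReal.ofReal (angleProb p.NBS (b w))) * F (min p.UM n) c φ θ b := fun φ => by
    refine (lintegral_congr fun θ : ℕ → ℕ => h2 φ fun j => θ j).trans ?_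
    exact lintegral_infinitePi_angleLaw p.NBS_pos k fun θ =>
      ∑ b ∈ Fintype.piFinset (fun _ : Fin (min p.UM n) => Finset.Icc 1 p.NBS),
        (∏ w, ENNReal.ofReal (angleProb p.NBS (b w))) * F (min p.UM n) c φ θ b
  refine (lintegral_congr fun φ : ℕ → ℕ => h3 fun j => φ j).trans ?_
  exact lintegral_infinitePi_angleLaw p.NUE_pos k fun φ =>
    ∑ θ ∈ Fintype.piFinset (fun _ : Fin k => Finset.Icc 1 p.NBS),
      (∏ j, ENNReal.ofReal (angleProb p.NBS (θ j))) *
      ∑ b ∈ Fintype.piFinset (fun _ : Fin (min p.UM n) => Finset.Icc 1 p.NBS),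
        (∏ w, ENNReal.ofReal (angleProb p.NBS (b w))) * F (min p.UM n) c φ θ b

variable {p}

/-- Rewrites the finite sums in `Ψ` as an integral over the marks, so that `le_fadingMean` can be
integrated. With no users both expressions equal 1, as the sum over beams is empty. -/
lemma IsLoadLaw.ofReal_Ψ {μ : Measure ℕ} [IsProbabilityMeasure μ] (hμ : p.IsLoadLaw μ)
    {s t : ℝ} (hs : 0 ≤ s) (ht : 0 < t) (a : Link) :
    ENNReal.ofReal (p.Ψ a s t) = ∫⁻ m, ENNReal.ofReal
      ((1 + p.gainCoef s t a m * p.gainSum a m) ^ p.η a)⁻¹ ∂(p.angleMarkLaw μ) := by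
  have hG := p.G_pos
  have h := p.lintegral_angleMarkLaw_fin hμ (p.η a) fun n c φ θ b => ENNReal.ofReal
    ((1 + s * p.G / (t * p.η a * n) *
      ∑ w, ∑ j, p.gain c (φ j) (b w) (θ j) ^ 2) ^ p.η a)⁻¹
  have hR : ∀ (n c : ℕ) (φ θ : Fin (p.η a) → ℕ) (b : Fin n → ℕ), 0 ≤
      ((1 + s * p.G / (t * p.η a * n) *
        ∑ w, ∑ j, p.gain c (φ j) (b w) (θ j) ^ 2) ^ p.η a)⁻¹ := fun n c φ θ b => by positivity
  have hU : ∀ i, 0 ≤ p.qUE i := fun i => angleProb_nonneg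
  have hB : ∀ i, 0 ≤ p.qBS i := fun i => angleProb_nonneg
  have hprodU : ∀ φ : Fin (p.η a) → ℕ, 0 ≤ ∏ j, p.qUE (φ j) := fun φ =>
    Finset.prod_nonneg fun j _ => hU _
  have hprodB : ∀ {n : ℕ} (φ : Fin n → ℕ), 0 ≤ ∏ j, p.qBS (φ j) := fun φ =>
    Finset.prod_nonneg fun j _ => hB _
  have hcong : ∀ m : AngleMark, ENNReal.ofReal
      ((1 + p.gainCoef s t a m * p.gainSum a m) ^ p.η a)⁻¹ = ENNReal.ofReal
      ((1 + s * p.G / (t * p.η a * (min p.UM m.1 : ℕ)) * ∑ w : Fin (min p.UM m.1),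
        ∑ j : Fin (p.η a), p.gain m.2.1 (m.2.2.1 j) (m.2.2.2.2 w) (m.2.2.2.1 j) ^ 2) ^ p.η a)⁻¹ :=
    fun m => by
    rw [gainCoef, gainSum, Finset.sum_range]
    simp only [Finset.sum_range, gainOf]
  rw [lintegral_congr hcong, h, Ψ, ENNReal.ofReal_sum_of_nonneg]
  swap
  · exact fun n _ => mul_nonneg (hμ.pTilde_nonneg n) (Finset.sum_nonneg fun c _ =>
      Finset.sum_nonneg fun φ _ => Finset.sum_nonneg fun θ _ => Finset.sum_nonneg fun b _ =>
      mul_nonneg (mul_nonneg (mul_nonneg (mul_nonneg (hU _) (hprodU _)) (hprodB _)) (hprodB _))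
        (hR _ _ _ _ _))
  refine Finset.sum_congr rfl fun n _ => ?_
  rw [ENNReal.ofReal_mul (hμ.pTilde_nonneg n)]
  congr 1
  rw [ΨGiven]
  have hterm : ∀ c (φ θ : Fin (p.η a) → ℕ) (b : Fin n → ℕ), 0 ≤ (p.qUE c * (∏ j, p.qUE (φ j)) * (∏ j, p.qBS (θ j)) *
      ∏ w, p.qBS (b w)) * ((1 + s * p.G / (t * p.η a * n) *
        ∑ w, ∑ j : Fin (p.η a), p.gain c (φ j) (b w) (θ j) ^ 2) ^ p.η a)⁻¹ := fun c φ θ b =>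
    mul_nonneg (mul_nonneg (mul_nonneg (mul_nonneg (hU _) (hprodU _)) (hprodB _)) (hprodB _))
        (hR _ _ _ _ _)
  rw [ENNReal.ofReal_sum_of_nonneg fun c _ => Finset.sum_nonneg fun φ _ =>
    Finset.sum_nonneg fun θ _ => Finset.sum_nonneg fun b _ => hterm c φ θ b]
  refine Finset.sum_congr rfl fun c _ => ?_
  rw [ENNReal.ofReal_sum_of_nonneg fun φ _ => Finset.sum_nonneg fun θ _ =>
    Finset.sum_nonneg fun b _ => hterm c φ θ b, Finset.mul_sum]
  refine Finset.sum_congr rfl fun φ _ => ?_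
  rw [ENNReal.ofReal_sum_of_nonneg fun θ _ => Finset.sum_nonneg fun b _ => hterm c φ θ b,
    Finset.mul_sum, Finset.mul_sum]
  refine Finset.sum_congr rfl fun θ _ => ?_
  rw [ENNReal.ofReal_sum_of_nonneg fun b _ => hterm c φ θ b, Finset.mul_sum, Finset.mul_sum,
    Finset.mul_sum]
  refine Finset.sum_congr rfl fun b _ => ?_
  rw [ENNReal.ofReal_mul (mul_nonneg (mul_nonneg (mul_nonneg (hU _) (hprodU _)) (hprodB _))
      (hprodB _)), ENNReal.ofReal_mul (mul_nonneg (mul_nonneg (hU _) (hprodU _)) (hprodB _)),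
    ENNReal.ofReal_mul (mul_nonneg (hU _) (hprodU _)), ENNReal.ofReal_mul (hU _),
    ENNReal.ofReal_prod_of_nonneg fun j _ => hU _, ENNReal.ofReal_prod_of_nonneg fun j _ => hB _,
    ENNReal.ofReal_prod_of_nonneg fun j _ => hB _]
  ring

end Params

end

end MmWave

namespace MmWave

noncomputable section

open Filter Topology

/-! ### The mean effect of one station: bounds, and its value for a single path. -/

namespace Params

variable (p : Params)

/-- Two independent angles of the user agree with probability `matchUE`. -/
lemma sum_sum_qUE (g : Bool → ℝ≥0∞) :
    ∑ c ∈ Finset.Icc 1 p.NUE, ENNReal.ofReal (p.qUE c) *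
        ∑ φ ∈ Finset.Icc 1 p.NUE, ENNReal.ofReal (p.qUE φ) * g (decide (c = φ)) =
      ENNReal.ofReal p.matchUE * g true + ENNReal.ofReal (1 - p.matchUE) * g false := by
  have hU : ∀ i, 0 ≤ p.qUE i := fun i => angleProb_nonneg
  have hU1 : ∀ i ∈ Finset.Icc 1 p.NUE, 0 ≤ 1 - p.qUE i := fun i hi =>
    sub_nonneg.2 (angleProb_le_one hi)
  have h1 : ∀ c ∈ Finset.Icc 1 p.NUE, ENNReal.ofReal (p.qUE c) *
      ∑ φ ∈ Finset.Icc 1 p.NUE, ENNReal.ofReal (p.qUE φ) * g (decide (c = φ)) =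
      ENNReal.ofReal (p.qUE c ^ 2) * g true +
        ENNReal.ofReal (p.qUE c * (1 - p.qUE c)) * g false := fun c hc => by
    rw [← Finset.add_sum_erase _ _ hc]
    have h2 : ∑ φ ∈ (Finset.Icc 1 p.NUE).erase c, ENNReal.ofReal (p.qUE φ) * g (decide (c = φ)) =
        ENNReal.ofReal (1 - p.qUE c) * g false := by
      rw [qUE, ← sum_erase_angleProb hc, Finset.sum_mul]
      refine Finset.sum_congr rfl fun φ hφ => ?_
      rw [decide_eq_false (Finset.ne_of_mem_erase hφ).symm]
      rfl
    rw [h2, decide_eq_true rfl, mul_add, sq, ENNReal.ofReal_mul (hU c), ENNReal.ofReal_mul (hU c)]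
    ring
  rw [Finset.sum_congr rfl h1, Finset.sum_add_distrib, ← Finset.sum_mul, ← Finset.sum_mul,
    ← ENNReal.ofReal_sum_of_nonneg fun _ _ => sq_nonneg _,
    ← ENNReal.ofReal_sum_of_nonneg fun i hi => mul_nonneg (hU i) (hU1 i hi)]
  congr 3
  have h3 : ∑ i ∈ Finset.Icc 1 p.NUE, p.qUE i = 1 := sum_angleProb p.NUE_pos
  refine Eq.trans ?_ (congrArg (· - p.matchUE) h3)
  rw [matchUE, ← Finset.sum_sub_distrib]
  exact Finset.sum_congr rfl fun i _ => by ring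

/-- The probability that the angle of departure agrees with `k` of `n` precoding angles. -/
def agreeProb (n k : ℕ) : ℝ≥0∞ := ENNReal.ofReal ((n.choose k : ℝ) *
  ∑ i ∈ Finset.Icc 1 p.NBS, p.qBS i ^ (k + 1) * (1 - p.qBS i) ^ (n - k))

lemma sum_agreeProb (n : ℕ) (F : ℕ → ℝ≥0∞) :
    ∑ θ ∈ Finset.Icc 1 p.NBS, ENNReal.ofReal (p.qBS θ) *
        ∑ b ∈ Fintype.piFinset (fun _ : Fin n => Finset.Icc 1 p.NBS),
          (∏ w, ENNReal.ofReal (p.qBS (b w))) * F (Finset.univ.filter fun w => b w = θ).card =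
      ∑ k ∈ Finset.range (n + 1), p.agreeProb n k * F k := by
  have hB : ∀ i, 0 ≤ p.qBS i := fun i => angleProb_nonneg
  have hB1 : ∀ i ∈ Finset.Icc 1 p.NBS, 0 ≤ 1 - p.qBS i := fun i hi =>
    sub_nonneg.2 (angleProb_le_one hi)
  have h1 : ∀ θ ∈ Finset.Icc 1 p.NBS, ENNReal.ofReal (p.qBS θ) *
        ∑ b ∈ Fintype.piFinset (fun _ : Fin n => Finset.Icc 1 p.NBS),
          (∏ w, ENNReal.ofReal (p.qBS (b w))) * F (Finset.univ.filter fun w => b w = θ).card =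
      ∑ k ∈ Finset.range (n + 1), ENNReal.ofReal ((n.choose k : ℝ) *
        (p.qBS θ ^ (k + 1) * (1 - p.qBS θ) ^ (n - k))) * F k := fun θ hθ => by
    have h2 := sum_piFinset_card hθ n F
    simp only [qBS]
    rw [h2, Finset.mul_sum]
    refine Finset.sum_congr rfl fun k _ => ?_
    rw [← mul_assoc, ← ENNReal.ofReal_mul angleProb_nonneg]
    congr 2
    ring
  rw [Finset.sum_congr rfl h1, Finset.sum_comm]
  refine Finset.sum_congr rfl fun k _ => ?_
  rw [← Finset.sum_mul, ← ENNReal.ofReal_sum_of_nonneg fun i hi => mul_nonneg (Nat.cast_nonneg _)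
    (mul_nonneg (pow_nonneg (hB i) _) (pow_nonneg (hB1 i hi) _)),
    ← Finset.mul_sum, agreeProb]

/-- The angles of a single path: only the numbers of agreements with the angles of the beams
matter. -/
lemma lintegral_agree {μ : Measure ℕ} [IsProbabilityMeasure μ] (hμ : p.IsLoadLaw μ)
    (F : ℕ → Bool → ℕ → ℝ≥0∞) :
    ∫⁻ m, F (min p.UM m.1) (decide (m.2.1 = m.2.2.1 0))
        (Finset.univ.filter fun w : Fin (min p.UM m.1) => m.2.2.2.2 w = m.2.2.2.1 0).card
        ∂(p.angleMarkLaw μ) =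
      ∑ n ∈ Finset.range (p.UM + 1), ENNReal.ofReal (p.pTilde n) *
        ∑ k ∈ Finset.range (n + 1), p.agreeProb n k *
          (ENNReal.ofReal p.matchUE * F n true k + ENNReal.ofReal (1 - p.matchUE) * F n false k) := by
  have h := p.lintegral_angleMarkLaw_fin hμ 1 fun n c φ θ b => F n (decide (c = φ 0))
    (Finset.univ.filter fun w : Fin n => b w = θ 0).card
  have hsum : ∀ (N : ℕ) (g : ℕ → ℝ≥0∞) (f : ℕ → ℝ≥0∞),
      ∑ φ ∈ Fintype.piFinset (fun _ : Fin 1 => Finset.Icc 1 N), (∏ j, g (φ j)) * f (φ 0) =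
      ∑ i ∈ Finset.Icc 1 N, g i * f i := fun N g f => by
    refine Finset.sum_bij' (fun φ _ => φ 0) (fun i _ => fun _ => i) ?_ ?_ ?_ ?_ ?_
    · intro φ hφ
      exact Fintype.mem_piFinset.1 hφ 0
    · intro i hi
      exact Fintype.mem_piFinset.2 fun _ => hi
    · intro φ _
      ext j
      rw [Subsingleton.elim j 0]
    · intro i _
      rfl
    · intro φ _
      simp
  refine h.trans ?_
  refine Finset.sum_congr rfl fun n _ => ?_
  congr 1
  have h1 : ∀ c, ∑ φ ∈ Fintype.piFinset (fun _ : Fin 1 => Finset.Icc 1 p.NUE),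
      (∏ j, ENNReal.ofReal (p.qUE (φ j))) *
        ∑ θ ∈ Fintype.piFinset (fun _ : Fin 1 => Finset.Icc 1 p.NBS),
          (∏ j, ENNReal.ofReal (p.qBS (θ j))) *
          ∑ b ∈ Fintype.piFinset (fun _ : Fin n => Finset.Icc 1 p.NBS),
            (∏ w, ENNReal.ofReal (p.qBS (b w))) * F n (decide (c = φ 0))
              (Finset.univ.filter fun w : Fin n => b w = θ 0).card =
      ∑ φ ∈ Finset.Icc 1 p.NUE, ENNReal.ofReal (p.qUE φ) *
        ∑ k ∈ Finset.range (n + 1), p.agreeProb n k * F n (decide (c = φ)) k := fun c => by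
    rw [← hsum p.NUE (fun i => ENNReal.ofReal (p.qUE i))
      fun φ => ∑ k ∈ Finset.range (n + 1), p.agreeProb n k * F n (decide (c = φ)) k]
    refine Finset.sum_congr rfl fun φ _ => ?_
    congr 1
    rw [← p.sum_agreeProb n fun k => F n (decide (c = φ 0)) k,
      ← hsum p.NBS (fun i => ENNReal.ofReal (p.qBS i)) fun θ =>
        ∑ b ∈ Fintype.piFinset (fun _ : Fin n => Finset.Icc 1 p.NBS),
            (∏ w, ENNReal.ofReal (p.qBS (b w))) * F n (decide (c = φ 0))
              (Finset.univ.filter fun w : Fin n => b w = θ).card]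
  simp only [h1]
  rw [p.sum_sum_qUE fun e => ∑ k ∈ Finset.range (n + 1), p.agreeProb n k * F n e k,
    Finset.mul_sum, Finset.mul_sum, ← Finset.sum_add_distrib]
  exact Finset.sum_congr rfl fun k _ => by ring

/-- `z / (1 + z)` for `z = s G g / t`. -/
def thinning (s t g : ℝ) : ℝ := (s * p.G * g / t) / (1 + s * p.G * g / t)

lemma one_sub_ofReal_inv {x : ℝ} (hx : 0 ≤ x) :
    1 - ENNReal.ofReal (1 + x)⁻¹ = ENNReal.ofReal (x / (1 + x)) := by
  have h : 0 < 1 + x := by linarith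
  rw [← ENNReal.ofReal_one, ← ENNReal.ofReal_sub _ (inv_nonneg.2 h.le)]
  congr 1
  field_simp
  ring

lemma _root_.MmWave.instProbFading : IsProbabilityMeasure fadingLaw := by
  unfold fadingLaw
  infer_instance

lemma measurable_fadingMean (s t : ℝ) (a : Link) : Measurable (p.fadingMean s t a) := by
  have h := p.measurable_nexp_interf s
  have hf : Measurable fun q : AngleMark × (ℕ → ℂ) => ((t, a), q) := by fun_prop
  have h2 := h.comp hf
  have := instProbFading
  have h3 := h2.lintegral_prod_right' (ν := fadingLaw)
  exact h3

lemma fadingMean_le_one (s t : ℝ) (a : Link) (m : AngleMark) : p.fadingMean s t a m ≤ 1 := by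
  have := instProbFading
  refine (lintegral_mono fun γ => nexp_le_one _).trans ?_
  simp

lemma one_sub_markMean (μ : Measure ℕ) [IsProbabilityMeasure μ] (s t : ℝ) (a : Link) :
    1 - p.markMean μ s t a = ∫⁻ m, (1 - p.fadingMean s t a m) ∂(p.angleMarkLaw μ) := by
  have h1 : ∫⁻ m, p.fadingMean s t a m ∂(p.angleMarkLaw μ) ≠ ∞ := by
    refine ne_top_of_le_ne_top ENNReal.one_ne_top
      ((lintegral_mono fun m => p.fadingMean_le_one s t a m).trans ?_)
    simp
  rw [lintegral_sub (p.measurable_fadingMean s t a) h1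
    (ae_of_all _ fun m => p.fadingMean_le_one s t a m), p.markMean_eq]
  simp

lemma one_sub_markMean_le {μ : Measure ℕ} [IsProbabilityMeasure μ] (hμ : p.IsLoadLaw μ) {s t : ℝ}
    (hs : 0 ≤ s) (ht : 0 < t) (a : Link) :
    1 - p.markMean μ s t a ≤ ENNReal.ofReal (1 - p.Ψ a s t) := by
  -- The sign of `Ψ` is not needed: for a negative value the right side would exceed 1, while the
  -- left side is at most 1.
  have h0 : 0 ≤ p.Ψ a s t ∨ p.Ψ a s t < 0 := le_or_gt _ _
  have h1 : ENNReal.ofReal (p.Ψ a s t) ≤ p.markMean μ s t a := by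
    rw [hμ.ofReal_Ψ hs ht, p.markMean_eq]
    exact lintegral_mono fun m => p.le_fadingMean hs ht a m
  rcases h0 with h0 | h0
  · rw [ENNReal.ofReal_sub _ h0, ENNReal.ofReal_one]
    exact tsub_le_tsub_left h1 _
  · refine tsub_le_self.trans ?_
    rw [← ENNReal.ofReal_one]
    exact ENNReal.ofReal_le_ofReal (by linarith)

/-- An idle station contributes nothing, and an active one at least the sidelobe term of
`fadingMean_le`. The probability of being active is one minus the mass of `pTilde` at 0. -/
lemma le_one_sub_markMean {μ : Measure ℕ} [IsProbabilityMeasure μ] (hμ : p.IsLoadLaw μ) {s t : ℝ}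
    (hs : 0 ≤ s) (ht : 0 < t) (a : Link) :
    ENNReal.ofReal (1 - p.pTilde 0) *
        ENNReal.ofReal (p.thinning s t (p.rhoBS ^ 2 * p.rhoUE ^ 2)) ≤
      1 - p.markMean μ s t a := by
  have hG := p.G_pos
  set R := ENNReal.ofReal (p.thinning s t (p.rhoBS ^ 2 * p.rhoUE ^ 2)) with hR
  have h1 : ∀ m : AngleMark, (if min p.UM m.1 = 0 then 0 else R) ≤ 1 - p.fadingMean s t a m :=
    fun m => by
    split_ifs with hm
    · exact bot_le
    · rw [hR, thinning, ← one_sub_ofReal_inv (by positivity)]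
      exact tsub_le_tsub_left (p.fadingMean_le hs ht a hm) _
  rw [p.one_sub_markMean]
  refine le_trans (le_of_eq ?_) (lintegral_mono h1)
  obtain ⟨F, hF⟩ : ∃ F : ℕ → ℝ≥0∞, F = fun n => if n = 0 then 0 else R := ⟨_, rfl⟩
  have h2 := p.lintegral_angleMarkLaw μ (f := fun m => F (min p.UM m.1))
    ((Measurable.of_discrete (f := fun n : ℕ => F (min p.UM n))).comp measurable_fst)
  simp only [lintegral_const, measure_univ, mul_one] at h2
  have h3 : ∀ m : AngleMark, (if min p.UM m.1 = 0 then 0 else R) = F (min p.UM m.1) := fun m => by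
    rw [hF]
  simp only [h3]
  rw [h2, hμ.lintegral F, hF]
  rw [Finset.sum_range_succ']
  simp only [Nat.add_eq_zero_iff, one_ne_zero, and_false, if_false, if_true, mul_zero, add_zero]
  rw [← Finset.sum_mul, ← ENNReal.ofReal_sum_of_nonneg fun i _ => hμ.pTilde_nonneg _]
  have h4 := hμ.sum_pTilde
  rw [Finset.sum_range_succ'] at h4
  congr 2
  linarith

/-- For one path the factor at the user is common to all beams. At the station a beam contributes 1
if it agrees with the angle of departure and ρ_BS² otherwise, so only the number of agreements
matters. -/
lemma gainSum_of_single {a : Link} (ha : p.η a = 1) (m : AngleMark) :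
    p.gainSum a m = (if decide (m.2.1 = m.2.2.1 0) = true then 1 else p.rhoUE ^ 2) *
      ((Finset.univ.filter fun w : Fin (min p.UM m.1) => m.2.2.2.2 w = m.2.2.2.1 0).card +
        (((min p.UM m.1 : ℕ) : ℝ) -
          (Finset.univ.filter fun w : Fin (min p.UM m.1) => m.2.2.2.2 w = m.2.2.2.1 0).card) *
        p.rhoBS ^ 2) := by
  rw [gainSum, ha, Finset.sum_range]
  simp only [Finset.sum_range_one, gainOf, gain, mul_pow, ite_pow, one_pow]
  rw [← Finset.mul_sum, Finset.sum_ite, Finset.sum_const, Finset.sum_const]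
  have h := Finset.card_filter_add_card_filter_not (s := Finset.univ)
    (fun w : Fin (min p.UM m.1) => m.2.2.2.2 w = m.2.2.2.1 0)
  rw [Finset.card_univ, Fintype.card_fin] at h
  have h2 : ((Finset.univ.filter fun w : Fin (min p.UM m.1) =>
      ¬m.2.2.2.2 w = m.2.2.2.1 0).card : ℝ) = ((min p.UM m.1 : ℕ) : ℝ) -
      (Finset.univ.filter fun w : Fin (min p.UM m.1) => m.2.2.2.2 w = m.2.2.2.1 0).card := by
    have h3 := congrArg (Nat.cast : ℕ → ℝ) h
    push_cast at h3
    push_cast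
    linarith
  rw [nsmul_eq_mul, nsmul_eq_mul, h2]
  simp

lemma one_sub_markMean_of_single {μ : Measure ℕ} [IsProbabilityMeasure μ] (hμ : p.IsLoadLaw μ)
    {s t : ℝ} (hs : 0 ≤ s) (ht : 0 < t) {a : Link} (ha : p.η a = 1) :
    1 - p.markMean μ s t a =
      ∑ n ∈ Finset.Icc 1 p.UM, ENNReal.ofReal (p.pTilde n) *
        ∑ k ∈ Finset.range (n + 1), p.agreeProb n k *
          (ENNReal.ofReal p.matchUE *
              ENNReal.ofReal (p.thinning s t ((k + (n - k) * p.rhoBS ^ 2) / n)) +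
            ENNReal.ofReal (1 - p.matchUE) * ENNReal.ofReal
              (p.thinning s t (p.rhoUE ^ 2 * (k + (n - k) * p.rhoBS ^ 2) / n))) := by
  have hη : ((p.η a : ℕ) : ℝ) = 1 := by rw [ha, Nat.cast_one]
  let F : ℕ → Bool → ℕ → ℝ≥0∞ := fun n e k => ENNReal.ofReal (p.thinning s t
    ((if e = true then 1 else p.rhoUE ^ 2) * (k + (n - k) * p.rhoBS ^ 2) / n))
  have h1 : ∀ m : AngleMark, 1 - p.fadingMean s t a m =
      F (min p.UM m.1) (decide (m.2.1 = m.2.2.1 0))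
      (Finset.univ.filter fun w : Fin (min p.UM m.1) => m.2.2.2.2 w = m.2.2.2.1 0).card :=
    fun m => by
    rw [p.fadingMean_of_single hs ht ha, one_sub_ofReal_inv (mul_nonneg
      (p.gainCoef_nonneg hs ht a m) (p.gainSum_nonneg a m)), p.gainSum_of_single ha, gainCoef, hη]
    simp only [thinning, F]
    congr 1
    have h2 : ∀ x : ℝ, s * p.G / (t * 1 * (min p.UM m.1 : ℕ)) * x =
        s * p.G * (x / (min p.UM m.1 : ℕ)) / t := fun x => by
      simp only [div_eq_mul_inv, mul_inv, mul_one]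
      ring
    rw [h2]
  rw [p.one_sub_markMean]
  refine (lintegral_congr h1).trans ((p.lintegral_agree hμ F).trans ?_)
  -- For n = 0 the division by n returns 0, hence no thinning. Idle stations drop out and the sum
  -- can start at n = 1.
  have h0 : ∀ e k, F 0 e k = 0 := fun e k => by simp [F, thinning]
  rw [Finset.range_eq_Ico, Finset.sum_eq_sum_Ico_succ_bot (Nat.succ_pos _)]
  simp only [h0, mul_zero, add_zero, Finset.sum_const_zero, zero_add]
  refine Finset.sum_congr rfl fun n _ => ?_
  simp [F]

end Params

end

end MmWave

namespace MmWave

noncomputable section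

open Filter Topology

/-! ### The Laplace transform of the interference, given the tagged loss. -/

namespace Params

variable (p : Params) (μ : Measure ℕ)

/-- The intensity measure of the BSs with their path losses, link types and marks. -/
def pointMeasure : Measure ((ℝ × Link) × RestMark) := p.lossMeasure.prod (p.restLaw μ)

instance [IsProbabilityMeasure μ] : SFinite (p.pointMeasure μ) := by
  unfold pointMeasure
  infer_instance

lemma measurable_loss : Measurable fun q : (ℝ × Link) × RestMark => q.1.1 :=
  measurable_fst.comp measurable_fst

lemma measurable_ofReal_interf : Measurable fun q => ENNReal.ofReal (p.interf q) :=
  p.measurable_interf.ennreal_ofReal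

variable [IsProbabilityMeasure μ]

lemma pointMeasure_le (b : ℝ) :
    p.pointMeasure μ {q | q.1.1 ≤ b} = p.lossMeasure {q | q.1 ≤ b} := by
  have h : {q : (ℝ × Link) × RestMark | q.1.1 ≤ b} = {q : ℝ × Link | q.1 ≤ b} ×ˢ Set.univ := by
    ext q
    simp
  rw [h, pointMeasure, Measure.prod_prod, measure_univ, mul_one]

lemma pointMeasure_le_ne_top (b : ℝ) : p.pointMeasure μ {q | q.1.1 ≤ b} ≠ ∞ := by
  rw [pointMeasure_le]
  exact p.lossMeasure_le_ne_top b

/-- The remaining marks have total mass one and do not affect the loss, so the statement reduces to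
`lossMeasure`. It is the condition that rules out ties for the tagged station. -/
lemma lintegral_nexp_pointMeasure {b : ℝ} (hb : 0 < b) :
    ∫⁻ y in {y | y.1.1 ≤ b}, nexp (p.pointMeasure μ {x | x.1.1 ≤ y.1.1}) ∂(p.pointMeasure μ) =
      1 - nexp (p.pointMeasure μ {y | y.1.1 ≤ b}) := by
  simp only [pointMeasure_le]
  rw [← p.lintegral_nexp_lossMeasure hb]
  have h : {q : (ℝ × Link) × RestMark | q.1.1 ≤ b} = {q : ℝ × Link | q.1 ≤ b} ×ˢ Set.univ := by
    ext q
    simp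
  have hm : Measurable fun q : ℝ × Link => nexp (p.lossMeasure {x | x.1 ≤ q.1}) :=
    measurable_nexp_measure_le measurable_fst
  rw [h, pointMeasure, ← Measure.prod_restrict, Measure.restrict_univ,
    lintegral_prod (fun y : (ℝ × Link) × RestMark => nexp (p.lossMeasure {q | q.1 ≤ y.1.1}))
      (hm.comp measurable_fst).aemeasurable]
  simp

end Params

section Network

variable {Ω : Type*} {p : Params} {X : (s : Source) → Ω → s.Space}

lemma point_fst (z : ℕ) (ω : Ω) : (point p X z ω).1 = (pathLoss p X z ω, linkType p X z ω) := by
  have h1 : p.linkOf (position X z ω) (geo X z ω).1 = linkType p X z ω := rfl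
  have h2 : ∀ a, shadowOf a (geo X z ω) = shadowing X a z ω := fun a => by
    cases a <;> rfl
  rw [point, Params.lossLink, h1, h2]
  rfl

lemma interf_point (z : ℕ) (ω : Ω) : p.interf (point p X z ω) = interferenceFrom p X z ω := by
  rw [Params.interf, point_fst]
  rfl

lemma pathLoss_pos (z : ℕ) (ω : Ω) : 0 < pathLoss p X z ω := Real.rpow_pos_of_pos (by norm_num) _

lemma measurable_pathLoss {S : Set Source} (hS : ∀ s : Source, s.kind ≤ 3 → s ∈ S) (z : ℕ) :
    Measurable[sourceSigma X S] (pathLoss p X z) := by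
  have h := measurable_lossLink_point (p := p) (X := X) hS z
  have h2 := measurable_fst.comp h
  have h3 : pathLoss p X z = Prod.fst ∘ fun ω => p.lossLink (position X z ω, geo X z ω) := by
    funext ω
    exact (congrArg Prod.fst (point_fst (p := p) (X := X) z ω)).symm
  rw [h3]
  exact h2

open Classical in
lemma measurable_tagged {S : Set Source} (hS : ∀ s : Source, s.kind ≤ 3 → s ∈ S) :
    Measurable[sourceSigma X S] (tagged p X) := by
  let m : MeasurableSpace Ω := sourceSigma X S
  have hloss : ∀ z, Measurable (pathLoss p X z) := fun z => measurable_pathLoss hS z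
  -- The alternative "no minimum exists" makes the search succeed for every outcome. In that case it
  -- stops at 0, the default value of `tagged`.
  let R : Ω → ℕ → Prop := fun ω y => (∀ z, pathLoss p X y ω ≤ pathLoss p X z ω) ∨
    ¬∃ y, ∀ z, pathLoss p X y ω ≤ pathLoss p X z ω
  have hR : ∀ ω, ∃ y, R ω y := fun ω => by
    by_cases h : ∃ y, ∀ z, pathLoss p X y ω ≤ pathLoss p X z ω
    · obtain ⟨y, hy⟩ := h
      exact ⟨y, Or.inl hy⟩
    · exact ⟨0, Or.inr h⟩
  have hmin : ∀ y, MeasurableSet {ω | ∀ z, pathLoss p X y ω ≤ pathLoss p X z ω} := fun y => by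
    rw [Set.ofPred_forall]
    exact MeasurableSet.iInter fun z => measurableSet_le (hloss y) (hloss z)
  have hex : MeasurableSet {ω | ∃ y, ∀ z, pathLoss p X y ω ≤ pathLoss p X z ω} := by
    rw [Set.ofPred_exists]
    exact MeasurableSet.iUnion hmin
  have hm : Measurable fun ω => Nat.find (hR ω) :=
    measurable_find hR fun k => (hmin k).union hex.compl
  convert hm using 1
  funext ω
  unfold tagged
  split_ifs with h
  · refine Nat.find_congr' ?_
    intro n
    exact ⟨Or.inl, fun h' => h'.resolve_right (not_not.2 h)⟩
  · refine ((Nat.find_eq_zero _).2 (Or.inr h)).symm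

lemma isStrictMin_tagged {z : ℕ} {ω : Ω}
    (h : IsStrictMin (fun q : (ℝ × Link) × RestMark => q.1.1) (fun z => point p X z ω) z) :
    tagged p X ω = z := by
  classical
  have h' : ∀ z', z' ≠ z → pathLoss p X z ω < pathLoss p X z' ω := fun z' hz' => by
    have := h z' hz'
    simpa only [point_fst] using this
  have hex : ∃ y, ∀ z, pathLoss p X y ω ≤ pathLoss p X z ω := ⟨z, fun z' => by
    rcases eq_or_ne z' z with rfl | hz
    · exact le_rfl
    · exact (h' z' hz).le⟩
  unfold tagged
  rw [dif_pos hex]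
  by_contra hne
  exact absurd (Nat.find_spec hex z) (not_le.2 (h' _ hne))

lemma servingLoss_eq : servingLoss p X = fun ω => (point p X (tagged p X ω) ω).1.1 := by
  funext ω
  rw [point_fst]
  rfl

lemma interference_eq : interference p X = fun ω =>
    ∑' z, if z = tagged p X ω then 0 else ENNReal.ofReal (p.interf (point p X z ω)) := by
  funext ω
  simp only [interf_point]
  rfl

variable [MeasurableSpace Ω] {P : Measure Ω}

lemma IsNetwork.isProbabilityMeasure_load (hX : IsNetwork p X P) :
    IsProbabilityMeasure (P.map (load X 0)) :=
  have := hX.isProbabilityMeasure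
  Measure.isProbabilityMeasure_map (Measurable.aemeasurable (hX.measurable (.load 0)))

lemma IsNetwork.isLoadLaw (hX : IsNetwork p X P) : p.IsLoadLaw (P.map (load X 0)) := fun n => by
  have hm : Measurable (load X 0) := hX.measurable (.load 0)
  rw [Measure.map_apply hm (measurableSet_singleton n), ← hX.load_law 0 n]
  rfl

lemma IsNetwork.measurable_tagged (hX : IsNetwork p X P) : Measurable (tagged p X) :=
  hX.measurable_of_sigma (S := Set.univ) (MmWave.measurable_tagged fun _ _ => Set.mem_univ _)

lemma IsNetwork.ae_isStrictMin (hX : IsNetwork p X P) : ∀ᵐ ω ∂P,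
    IsStrictMin (fun q : (ℝ × Link) × RestMark => q.1.1) (fun z => point p X z ω)
      (tagged p X ω) := by
  have := hX.isProbabilityMeasure
  have := hX.isProbabilityMeasure_load
  have h := hX.isPoissonSeq.ae_exists_isStrictMin Params.measurable_loss
    (p.pointMeasure_le_ne_top _) fun b => p.lintegral_nexp_pointMeasure _ (by positivity)
  filter_upwards [h] with ω hω
  obtain ⟨z, hz⟩ := hω
  rw [isStrictMin_tagged hz]
  exact hz

/-- The interference, conditionally on the path loss `l` from the tagged BS, is that of the BSs
with path loss above `l`. -/
lemma IsNetwork.condDistrib_interference [IsFiniteMeasure P] (hX : IsNetwork p X P) :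
    condDistrib (interference p X) (servingLoss p X) P =ᵐ[P.map (servingLoss p X)]
      outerKernel (point p X) (fun q => q.1.1) (fun q => ENNReal.ofReal (p.interf q)) P := by
  have := hX.isProbabilityMeasure
  have := hX.isProbabilityMeasure_load
  have h := hX.isPoissonSeq.condDistrib_nearest Params.measurable_loss
    (p.pointMeasure_le_ne_top _) p.measurable_ofReal_interf hX.measurable_tagged hX.ae_isStrictMin
  rw [servingLoss_eq, interference_eq]
  exact h

/-- The exponent of the Laplace transform of the interference from BSs with path loss above `l`. -/
def _root_.MmWave.Params.exponent (p : Params) (μ : Measure ℕ) (s l : ℝ) : ℝ≥0∞ :=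
  (∫⁻ t in Set.Ici l, ENNReal.ofReal (p.intensity .los t) * (1 - p.markMean μ s t .los)) +
    ∫⁻ t in Set.Ici l, ENNReal.ofReal (p.intensity .nlos t) * (1 - p.markMean μ s t .nlos)

/-- The marks are integrated out first, then the link types are separated. The endpoint l is a null
set. Since l ≥ 0, the restriction of the densities to positive losses is not felt above l. -/
lemma _root_.MmWave.Params.lintegral_pointMeasure_exponent (p : Params) (μ : Measure ℕ)
    [IsProbabilityMeasure μ] (s : ℝ) {l : ℝ} (hl : 0 ≤ l) :
    ∫⁻ q, (1 - nexp ({q | l < q.1.1}.indicator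
      (fun q => ENNReal.ofReal s * ENNReal.ofReal (p.interf q)) q)) ∂(p.pointMeasure μ) =
      p.exponent μ s l := by
  have hI := p.measurable_nexp_interf s
  have hset : MeasurableSet {q : (ℝ × Link) × RestMark | l < q.1.1} :=
    Params.measurable_loss measurableSet_Ioi
  have h1 : ∀ q : (ℝ × Link) × RestMark, 1 - nexp ({q | l < q.1.1}.indicator
      (fun q => ENNReal.ofReal s * ENNReal.ofReal (p.interf q)) q) =
      {q | l < q.1.1}.indicator
        (fun q => 1 - nexp (ENNReal.ofReal s * ENNReal.ofReal (p.interf q))) q := fun q => by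
    by_cases hq : q ∈ {q : (ℝ × Link) × RestMark | l < q.1.1}
    · simp only [Set.indicator_of_mem hq]
    · simp only [Set.indicator_of_notMem hq, nexp_zero, tsub_self]
  have hm : Measurable ({q : (ℝ × Link) × RestMark | l < q.1.1}.indicator
      (fun q => 1 - nexp (ENNReal.ofReal s * ENNReal.ofReal (p.interf q)))) :=
    (measurable_const.sub hI).indicator hset
  have h2 : ∀ x : ℝ × Link, ∫⁻ r, {q : (ℝ × Link) × RestMark | l < q.1.1}.indicator
      (fun q => 1 - nexp (ENNReal.ofReal s * ENNReal.ofReal (p.interf q))) (x, r)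
      ∂(p.restLaw μ) = (Set.Ioi l).indicator (fun t => 1 - p.markMean μ s t x.2) x.1 := fun x => by
    by_cases hx : l < x.1
    · have hx' : x.1 ∈ Set.Ioi l := hx
      have h3 : ∀ r : RestMark, (x, r) ∈ {q : (ℝ × Link) × RestMark | l < q.1.1} := fun r => hx
      have hmx : Measurable fun r : RestMark =>
          nexp (ENNReal.ofReal s * ENNReal.ofReal (p.interf (x, r))) :=
        hI.comp measurable_prodMk_left
      simp only [Set.indicator_of_mem hx', Set.indicator_of_mem (h3 _)]
      rw [lintegral_sub hmx _ (ae_of_all _ fun r => nexp_le_one _)]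
      · simp [Params.markMean]
      · refine ne_top_of_le_ne_top ENNReal.one_ne_top
          ((lintegral_mono fun r => nexp_le_one _).trans ?_)
        simp
    · have hx' : x.1 ∉ Set.Ioi l := hx
      have h3 : ∀ r : RestMark, (x, r) ∉ {q : (ℝ × Link) × RestMark | l < q.1.1} := fun r => hx
      simp only [Set.indicator_of_notMem hx', Set.indicator_of_notMem (h3 _), lintegral_zero]
  have hm2 : Measurable fun x : ℝ × Link =>
      (Set.Ioi l).indicator (fun t => 1 - p.markMean μ s t x.2) x.1 := by
    have h3 := hm.lintegral_prod_right' (ν := p.restLaw μ)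
    simpa only [h2] using h3
  have hm3 : ∀ a, Measurable fun t => (Set.Ioi l).indicator (fun t => 1 - p.markMean μ s t a) t :=
    fun a => hm2.comp (measurable_id.prodMk measurable_const)
  have h4 : ∀ a, ∫⁻ t, (Set.Ioi l).indicator (fun t => 1 - p.markMean μ s t a) t ∂(p.lossDensity a)
      = ∫⁻ t in Set.Ici l, ENNReal.ofReal (p.intensity a t) * (1 - p.markMean μ s t a) := fun a => by
    rw [p.lintegral_lossDensity a (hm3 a), setLIntegral_congr (Ioi_ae_eq_Ici (a := l)).symm,
      ← lintegral_indicator measurableSet_Ioi, ← lintegral_indicator measurableSet_Ioi]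
    refine lintegral_congr fun t => ?_
    by_cases ht : t ∈ Set.Ioi l
    · have ht0 : t ∈ Set.Ioi (0 : ℝ) := lt_of_le_of_lt hl ht
      simp only [Set.indicator_of_mem ht, Set.indicator_of_mem ht0]
    · by_cases ht0 : t ∈ Set.Ioi (0 : ℝ)
      · simp only [Set.indicator_of_mem ht0, Set.indicator_of_notMem ht, mul_zero]
      · simp only [Set.indicator_of_notMem ht0, Set.indicator_of_notMem ht]
  simp only [h1]
  rw [Params.pointMeasure, lintegral_prod _ hm.aemeasurable]
  simp only [h2]
  rw [p.lintegral_lossMeasure hm2, h4, h4, Params.exponent]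

lemma IsNetwork.lintegral_outerKernel_point (hX : IsNetwork p X P) (s : ℝ) {l : ℝ} (hl : 0 ≤ l) :
    ∫⁻ i, nexp (ENNReal.ofReal s * i) ∂(outerKernel (point p X) (fun q => q.1.1)
      (fun q => ENNReal.ofReal (p.interf q)) P l) = nexp (p.exponent (P.map (load X 0)) s l) := by
  have := hX.isProbabilityMeasure
  have := hX.isProbabilityMeasure_load
  have hset : MeasurableSet {q : (ℝ × Link) × RestMark | l < q.1.1} :=
    Params.measurable_loss measurableSet_Ioi
  rw [hX.isPoissonSeq.lintegral_outerKernel Params.measurable_loss p.measurable_ofReal_interf,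
    ← p.lintegral_pointMeasure_exponent _ s hl]
  exact hX.isPoissonSeq.laplace _ ((p.measurable_ofReal_interf.const_mul _).indicator hset)

/-- The Laplace transform of the interference. -/
lemma IsNetwork.ae_laplace_eq [IsFiniteMeasure P] (hX : IsNetwork p X P) :
    ∀ᵐ l ∂(P.map (servingLoss p X)), 0 < l ∧ ∀ s : ℝ,
      laplace p X P s l = negExp (p.exponent (P.map (load X 0)) s l) := by
  have hm : Measurable (servingLoss p X) := by
    rw [servingLoss_eq]
    have := hX.isPoissonSeq.measurable_select hX.measurable_tagged
    exact Params.measurable_loss.comp this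
  have hpos : ∀ᵐ l ∂(P.map (servingLoss p X)), 0 < l :=
    (ae_map_iff hm.aemeasurable measurableSet_Ioi).2 (ae_of_all _ fun ω => pathLoss_pos _ ω)
  -- For almost every l the conditional law coincides with the kernel as a measure, so one null set
  -- serves all s.
  filter_upwards [hX.condDistrib_interference, hpos] with l hl hl0
  refine ⟨hl0, fun s => ?_⟩
  have hm2 : Measurable fun i : ℝ≥0∞ => nexp (ENNReal.ofReal s * i) :=
    measurable_nexp.comp (measurable_id.const_mul _)
  rw [laplace, hl, negExp_eq_toReal, ← hX.lintegral_outerKernel_point s hl0.le]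
  simp only [negExp_eq_toReal]
  exact integral_toReal hm2.aemeasurable (ae_of_all _ fun i => (nexp_ne_top _).lt_top)

end Network

end

end MmWave

namespace MmWave

noncomputable section

open Filter Topology

/-! ### From the mean of one station to the formula and the bounds for the Laplace transform. -/

namespace Params

variable (p : Params) {μ : Measure ℕ} [IsProbabilityMeasure μ]

lemma thinning_nonneg {s t g : ℝ} (hs : 0 ≤ s) (ht : 0 < t) (hg : 0 ≤ g) : 0 ≤ p.thinning s t g := by
  have := p.G_pos
  unfold thinning
  positivity

lemma measurable_thinning (s g : ℝ) : Measurable fun t => p.thinning s t g := by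
  unfold thinning
  fun_prop

/-- The intensity measure of the path losses, for both types of links. -/
def lossIntensity (l : ℝ) : Measure ℝ := (volume.restrict (Set.Ici l)).withDensity fun t =>
  ENNReal.ofReal (p.intensity .los t) + ENNReal.ofReal (p.intensity .nlos t)

lemma measurable_ofReal_intensity (a : Link) :
    Measurable fun t => ENNReal.ofReal (p.intensity a t) := (p.measurable_intensity a).ennreal_ofReal

lemma lintegral_lossIntensity (l : ℝ) {h : ℝ → ℝ≥0∞} (hh : Measurable h) :
    ∫⁻ t, h t ∂(p.lossIntensity l) =
      (∫⁻ t in Set.Ici l, ENNReal.ofReal (p.intensity .los t) * h t) +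
        ∫⁻ t in Set.Ici l, ENNReal.ofReal (p.intensity .nlos t) * h t := by
  have m1 := p.measurable_ofReal_intensity .los
  have m2 := p.measurable_ofReal_intensity .nlos
  have m3 : Measurable fun t => ENNReal.ofReal (p.intensity .los t) * h t := m1.mul hh
  have m4 : Measurable fun t =>
    ENNReal.ofReal (p.intensity .los t) + ENNReal.ofReal (p.intensity .nlos t) := m1.add m2
  rw [lossIntensity, lintegral_withDensity_eq_lintegral_mul _ m4 hh, ← lintegral_add_left m3]
  refine lintegral_congr fun t => ?_
  simp only [Pi.mul_apply, add_mul]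

lemma lossIntegral_eq {s l g : ℝ} (hs : 0 ≤ s) (hl : 0 < l) (hg : 0 ≤ g) :
    p.lossIntegral s l g = ∫⁻ t, ENNReal.ofReal (p.thinning s t g) ∂(p.lossIntensity l) := by
  have m3 : Measurable fun t => ENNReal.ofReal (p.thinning s t g) :=
    (p.measurable_thinning s g).ennreal_ofReal
  have m1 := p.measurable_ofReal_intensity .los
  have m4 : Measurable fun t => ENNReal.ofReal (p.intensity .los t) *
    ENNReal.ofReal (p.thinning s t g) := m1.mul m3
  rw [p.lintegral_lossIntensity l m3, lossIntegral, ← lintegral_add_left m4]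
  refine setLIntegral_congr_fun measurableSet_Ici fun t ht => ?_
  have ht0 : 0 < t := lt_of_lt_of_le hl ht
  have h1 := p.intensity_nonneg .los ht0
  have h2 := p.intensity_nonneg .nlos ht0
  have h3 := p.thinning_nonneg hs ht0 hg
  rw [← add_mul, ← ENNReal.ofReal_add h1 h2, ← ENNReal.ofReal_mul (add_nonneg h1 h2)]
  rfl

lemma laplaceLower_le (hμ : p.IsLoadLaw μ) {s l : ℝ} (hs : 0 ≤ s) (hl : 0 < l) :
    p.laplaceLower s l ≤ negExp (p.exponent μ s l) := by
  rw [laplaceLower, ← negExp_add, exponent]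
  have h : ∀ a, ∫⁻ t in Set.Ici l, ENNReal.ofReal (p.intensity a t) * (1 - p.markMean μ s t a) ≤
      ∫⁻ t in Set.Ici l, ENNReal.ofReal ((1 - p.Ψ a s t) * p.intensity a t) := fun a => by
    refine setLIntegral_mono' measurableSet_Ici fun t ht => ?_
    have ht0 : 0 < t := lt_of_lt_of_le hl ht
    rw [ENNReal.ofReal_mul' (p.intensity_nonneg a ht0), mul_comm]
    gcongr
    exact p.one_sub_markMean_le hμ hs ht0 a
  exact negExp_antitone (add_le_add (h .los) (h .nlos))

lemma le_laplaceUpper (hμ : p.IsLoadLaw μ) {s l : ℝ} (hs : 0 ≤ s) (hl : 0 < l) :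
    negExp (p.exponent μ s l) ≤ p.laplaceUpper s l := by
  have m3 : Measurable fun t =>
      ENNReal.ofReal (p.thinning s t (p.rhoBS ^ 2 * p.rhoUE ^ 2)) :=
    (p.measurable_thinning s _).ennreal_ofReal
  rw [laplaceUpper]
  refine negExp_antitone ?_
  rw [p.lossIntegral_eq hs hl (by positivity), ← lintegral_const_mul _ m3,
    p.lintegral_lossIntensity l (m3.const_mul _), exponent]
  have h : ∀ a, ∫⁻ t in Set.Ici l, ENNReal.ofReal (p.intensity a t) *
      (ENNReal.ofReal (1 - p.pTilde 0) *
        ENNReal.ofReal (p.thinning s t (p.rhoBS ^ 2 * p.rhoUE ^ 2))) ≤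
      ∫⁻ t in Set.Ici l, ENNReal.ofReal (p.intensity a t) * (1 - p.markMean μ s t a) := fun a => by
    refine setLIntegral_mono' measurableSet_Ici fun t ht => ?_
    have ht0 : 0 < t := lt_of_lt_of_le hl ht
    gcongr
    exact p.le_one_sub_markMean hμ hs ht0 a
  exact add_le_add (h .los) (h .nlos)

/-- For a single path `1 - markMean` is the same finite combination of thinning factors for both
link types. Integrating it term by term against the total intensity gives the sums of
`lossIntegral`. -/
lemma laplaceSinglePath_eq (hμ : p.IsLoadLaw μ) (hη : ∀ a, p.η a = 1) {s l : ℝ} (hs : 0 ≤ s)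
    (hl : 0 < l) : negExp (p.exponent μ s l) = p.laplaceSinglePath s l := by
  have m3 : ∀ g, Measurable fun t => ENNReal.ofReal (p.thinning s t g) := fun g =>
    (p.measurable_thinning s g).ennreal_ofReal
  have m4 : ∀ c : ℝ≥0∞, ∀ g, Measurable fun t => c * ENNReal.ofReal (p.thinning s t g) :=
    fun c g => (m3 g).const_mul c
  let T : ℕ → ℕ → ℝ → ℝ≥0∞ := fun n k t => ENNReal.ofReal p.matchUE *
      ENNReal.ofReal (p.thinning s t ((k + (n - k) * p.rhoBS ^ 2) / n)) +
    ENNReal.ofReal (1 - p.matchUE) * ENNReal.ofReal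
      (p.thinning s t (p.rhoUE ^ 2 * (k + (n - k) * p.rhoBS ^ 2) / n))
  have mT : ∀ n k, Measurable (T n k) := fun n k => (m4 _ _).add (m4 _ _)
  let H : ℝ → ℝ≥0∞ := fun t => ∑ n ∈ Finset.Icc 1 p.UM, ENNReal.ofReal (p.pTilde n) *
        ∑ k ∈ Finset.range (n + 1), p.agreeProb n k * T n k t
  have mH1 : ∀ n, Measurable fun t => ∑ k ∈ Finset.range (n + 1), p.agreeProb n k * T n k t :=
    fun n => Finset.measurable_fun_sum _ fun k _ => (mT n k).const_mul _
  have mH : Measurable H := Finset.measurable_fun_sum _ fun n _ => (mH1 n).const_mul _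
  have h1 : p.exponent μ s l = ∫⁻ t, H t ∂(p.lossIntensity l) := by
    rw [p.lintegral_lossIntensity l mH, exponent]
    have h : ∀ a, ∫⁻ t in Set.Ici l, ENNReal.ofReal (p.intensity a t) * (1 - p.markMean μ s t a) =
        ∫⁻ t in Set.Ici l, ENNReal.ofReal (p.intensity a t) * H t := fun a =>
      setLIntegral_congr_fun measurableSet_Ici fun t ht => by
        rw [p.one_sub_markMean_of_single hμ hs (lt_of_lt_of_le hl ht) (hη a)]
    rw [h, h]
  rw [h1, laplaceSinglePath]
  congr 1
  rw [lintegral_finsetSum _ fun n _ => (mH1 n).const_mul _]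
  refine Finset.sum_congr rfl fun n _ => ?_
  rw [lintegral_const_mul _ (mH1 n), lintegral_finsetSum _ fun k _ => (mT n k).const_mul _]
  congr 1
  refine Finset.sum_congr rfl fun k hk => ?_
  have hk' : (k : ℝ) ≤ n := by
    exact_mod_cast Nat.lt_succ_iff.1 (Finset.mem_range.1 hk)
  have hg : 0 ≤ (k + (n - k) * p.rhoBS ^ 2 : ℝ) :=
    add_nonneg (Nat.cast_nonneg _) (mul_nonneg (sub_nonneg.2 hk') (sq_nonneg _))
  rw [lintegral_const_mul _ (mT n k), lintegral_add_left (m4 _ _), lintegral_const_mul _ (m3 _),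
    lintegral_const_mul _ (m3 _), p.lossIntegral_eq hs hl (by positivity),
    p.lossIntegral_eq hs hl (by positivity), agreeProb]

end Params

end

end MmWave

namespace MmWave

noncomputable section

open Filter Topology

/-! ### Coverage given the tagged loss and the interference. -/

/-- The binomial theorem without its constant term. For y = exp(-x) it is inclusion–exclusion for
the maximum of k exponential variables, and the source of the alternating sum in the coverage
formula. -/
lemma one_sub_one_sub_pow (y : ℝ) (k : ℕ) :
    1 - (1 - y) ^ k = ∑ n ∈ Finset.Icc 1 k, (-1) ^ (n + 1) * (k.choose n : ℝ) * y ^ n := by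
  have h := add_pow (-y) 1 k
  have h1 : ∀ n, (-y) ^ n * 1 ^ (k - n) * (k.choose n : ℝ) =
      -((-1) ^ (n + 1) * (k.choose n : ℝ) * y ^ n) := fun n => by
    rw [neg_pow, one_pow, pow_succ]
    ring
  simp only [h1] at h
  rw [Finset.range_eq_Ico, Finset.sum_eq_sum_Ico_succ_bot (Nat.succ_pos _)] at h
  have h2 : Finset.Icc 1 k = Finset.Ico (0 + 1) (k + 1) := rfl
  rw [h2, sub_eq_neg_add 1 y, h, Finset.sum_neg_distrib]
  simp

lemma negExp_ofReal {x : ℝ} (hx : 0 ≤ x) : negExp (ENNReal.ofReal x) = Real.exp (-x) := by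
  rw [negExp, if_neg ENNReal.ofReal_ne_top, ENNReal.toReal_ofReal hx]

lemma negExp_pow (x : ℝ≥0∞) (n : ℕ) : negExp x ^ n = negExp (n * x) := by
  rw [negExp_eq_toReal, negExp_eq_toReal, nexp_nsmul, ENNReal.toReal_pow]

lemma integrable_negExp (ν : Measure ℝ≥0∞) [IsFiniteMeasure ν] (a : ℝ≥0∞) :
    Integrable (fun i => negExp (a * i)) ν := by
  have hm : Measurable fun i => negExp (a * i) :=
    continuous_negExp.measurable.comp (measurable_id.const_mul a)
  refine Integrable.of_bound hm.aestronglyMeasurable 1 (ae_of_all _ fun i => ?_)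
  rw [Real.norm_eq_abs, abs_of_nonneg (negExp_nonneg _)]
  exact negExp_le_one _

lemma one_sub_one_sub_negExp_pow_nonneg (x : ℝ≥0∞) (k : ℕ) : 0 ≤ 1 - (1 - negExp x) ^ k := by
  have h3 := negExp_nonneg x
  have h4 := negExp_le_one x
  exact sub_nonneg.2 (pow_le_one₀ (by linarith) (by linarith))

lemma one_sub_one_sub_negExp_pow {a N : ℝ} (ha : 0 ≤ a) (hN : 0 ≤ N) (k : ℕ) (i : ℝ≥0∞) :
    1 - (1 - negExp (ENNReal.ofReal a * (ENNReal.ofReal N + i))) ^ k =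
      ∑ n ∈ Finset.Icc 1 k, (-1) ^ (n + 1) * (k.choose n : ℝ) *
        (Real.exp (-(n * a * N)) * negExp (ENNReal.ofReal (n * a) * i)) := by
  rw [one_sub_one_sub_pow]
  refine Finset.sum_congr rfl fun n _ => ?_
  rw [negExp_pow, ← mul_assoc, ← ENNReal.ofReal_natCast, ← ENNReal.ofReal_mul (Nat.cast_nonneg n),
    mul_add, negExp_add, ← ENNReal.ofReal_mul (by positivity), negExp_ofReal (by positivity)]

lemma integrable_one_sub_one_sub_negExp_pow (ν : Measure ℝ≥0∞) [IsFiniteMeasure ν] {a N : ℝ}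
    (ha : 0 ≤ a) (hN : 0 ≤ N) (k : ℕ) :
    Integrable (fun i => 1 - (1 - negExp (ENNReal.ofReal a * (ENNReal.ofReal N + i))) ^ k) ν := by
  simp only [one_sub_one_sub_negExp_pow ha hN]
  exact integrable_finsetSum _ fun n _ => ((integrable_negExp ν _).const_mul _).const_mul _

/-- The probability that the maximum of exponential variables exceeds a random level. -/
lemma integral_one_sub_one_sub_negExp_pow (ν : Measure ℝ≥0∞) [IsFiniteMeasure ν] {a N : ℝ}
    (ha : 0 ≤ a) (hN : 0 ≤ N) (k : ℕ) :
    ∫ i, (1 - (1 - negExp (ENNReal.ofReal a * (ENNReal.ofReal N + i))) ^ k) ∂ν =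
      ∑ n ∈ Finset.Icc 1 k, (-1) ^ (n + 1) * (k.choose n : ℝ) *
        (Real.exp (-(n * a * N)) * ∫ i, negExp (ENNReal.ofReal (n * a) * i) ∂ν) := by
  simp only [one_sub_one_sub_negExp_pow ha hN]
  rw [integral_finsetSum _ fun n _ => ((integrable_negExp ν _).const_mul _).const_mul _]
  simp only [integral_const_mul]

namespace Params

variable (p : Params)

/-- The received power from the tagged BS, if it serves `U` users over a link of type `a`. -/
def receivedPower (a : Link) (U : ℕ) (w : (ℝ × Link) × RestMark) (z : ℝ) : ℝ :=
  p.G / (p.η a * U) * (⨆ j : Fin (p.η a), ‖w.2.2 j‖ ^ 2) * (w.1.1)⁻¹ * z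

/-- The event that a user is covered whose tagged BS serves `U` users over a link of type `a`. Here
the first two coordinates stand for the tagged BS and the interference, and the last one for the
penalty. -/
def coverSet (τ : ℝ) (a : Link) (U : ℕ) : Set ((((ℝ × Link) × RestMark) × ℝ≥0∞) × ℝ) :=
  {y | y.1.1.1.2 = a ∧
    ENNReal.ofReal τ < ENNReal.ofReal (p.receivedPower a U y.1.1 y.2) / (ENNReal.ofReal p.noise + y.1.2)}

lemma measurable_receivedPower (a : Link) (U : ℕ) :
    Measurable fun y : ((ℝ × Link) × RestMark) × ℝ => p.receivedPower a U y.1 y.2 := by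
  have h1 : Measurable fun y : ((ℝ × Link) × RestMark) × ℝ =>
      ⨆ j : Fin (p.η a), ‖y.1.2.2 j‖ ^ 2 := by
    refine Measurable.iSup fun j => ?_
    fun_prop
  unfold receivedPower
  fun_prop

lemma measurableSet_coverSet (τ : ℝ) (a : Link) (U : ℕ) : MeasurableSet (p.coverSet τ a U) := by
  have h1 : Measurable fun y : (((ℝ × Link) × RestMark) × ℝ≥0∞) × ℝ => (y.1.1, y.2) := by fun_prop
  have h2 := (p.measurable_receivedPower a U).comp h1
  have h3 : Measurable fun y : (((ℝ × Link) × RestMark) × ℝ≥0∞) × ℝ => y.1.1.1.2 := by fun_prop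
  have h4 : Measurable fun y : (((ℝ × Link) × RestMark) × ℝ≥0∞) × ℝ =>
      ENNReal.ofReal p.noise + y.1.2 := by fun_prop
  exact (h3 (measurableSet_singleton a)).inter
    (measurableSet_lt measurable_const (h2.ennreal_ofReal.div h4))

/-- A supremum over a finite nonempty set of paths exceeds a level exactly when one path does.
Solving for the fading power collects all other constants into the level. -/
lemma receivedPower_one_lt_iff {τ : ℝ} (hτ : 0 < τ) (a : Link) {U : ℕ} (hU : 1 ≤ U)
    {w : (ℝ × Link) × RestMark} (hw : 0 < w.1.1) {b : ℝ} (hb : 0 < b) :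
    ENNReal.ofReal τ < ENNReal.ofReal (p.receivedPower a U w 1) / ENNReal.ofReal b ↔
      ∃ j ∈ Finset.range (p.η a), p.η a * τ * U * w.1.1 / p.G * b < ‖w.2.2 j‖ ^ 2 := by
  have hG := p.G_pos
  have hη : (0 : ℝ) < p.η a := by exact_mod_cast p.η_pos a
  have hU' : (0 : ℝ) < U := by exact_mod_cast hU
  have : Nonempty (Fin (p.η a)) := ⟨⟨0, p.η_pos a⟩⟩
  have hbdd : BddAbove (Set.range fun j : Fin (p.η a) => ‖w.2.2 j‖ ^ 2) := Set.finite_range _ |>.bddAbove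
  rw [← ENNReal.ofReal_div_of_pos hb, ENNReal.ofReal_lt_ofReal_iff_of_nonneg hτ.le, lt_div_iff₀ hb,
    receivedPower]
  have h1 : τ * b < p.G / (p.η a * U) * (⨆ j : Fin (p.η a), ‖w.2.2 j‖ ^ 2) * (w.1.1)⁻¹ * 1 ↔
      p.η a * τ * U * w.1.1 / p.G * b < ⨆ j : Fin (p.η a), ‖w.2.2 j‖ ^ 2 := by
    have h2 : p.η a * τ * U * w.1.1 / p.G * b = (τ * b) * (p.η a * U * w.1.1 / p.G) := by ring
    have h3 : p.G / (p.η a * U) * (⨆ j : Fin (p.η a), ‖w.2.2 j‖ ^ 2) * (w.1.1)⁻¹ * 1 =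
        (⨆ j : Fin (p.η a), ‖w.2.2 j‖ ^ 2) / (p.η a * U * w.1.1 / p.G) := by
      field_simp
    rw [h2, h3, lt_div_iff₀ (by positivity)]
  rw [h1, lt_ciSup_iff hbdd]
  constructor
  · rintro ⟨j, hj⟩
    exact ⟨j, Finset.mem_range.2 j.2, hj⟩
  · rintro ⟨j, hj, h⟩
    exact ⟨⟨j, Finset.mem_range.1 hj⟩, h⟩

variable {μ : Measure ℕ} [IsProbabilityMeasure μ]

/-- The probability of coverage, given the path loss, the link type and the interference. -/
lemma restLaw_coverSet {τ : ℝ} (hτ : 0 < τ) (a : Link) {U : ℕ} (hU : 1 ≤ U) {l : ℝ} (hl : 0 < l)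
    (i : ℝ≥0∞) :
    p.restLaw μ {r | ((((l, a), r), i), (1 : ℝ)) ∈ p.coverSet τ a U} =
      ENNReal.ofReal (1 - (1 - negExp (ENNReal.ofReal (p.η a * τ * U * l / p.G) *
        (ENNReal.ofReal p.noise + i))) ^ p.η a) := by
  have hG := p.G_pos
  have hη : (0 : ℝ) < p.η a := by exact_mod_cast p.η_pos a
  have hU' : (0 : ℝ) < U := by exact_mod_cast hU
  have hN := p.noise_pos
  have hc : 0 < p.η a * τ * U * l / p.G := by positivity
  -- With infinite interference the ratio is 0 and nobody is covered; on the right `negExp` vanishes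
  -- and 1 - 1^η = 0, where η ≥ 1 plays no further role.
  by_cases hi : i = ∞
  · have h1 : {r : RestMark | ((((l, a), r), i), (1 : ℝ)) ∈ p.coverSet τ a U} = ∅ := by
      ext r
      simp [coverSet, hi]
    have hη0 : p.η a ≠ 0 := Nat.one_le_iff_ne_zero.1 (p.η_pos a)
    rw [h1, measure_empty, hi, add_top, ENNReal.mul_top (ENNReal.ofReal_pos.2 hc).ne']
    simp [negExp]
  · have hb : 0 < p.noise + i.toReal := add_pos_of_pos_of_nonneg hN ENNReal.toReal_nonneg
    have hi' : ENNReal.ofReal p.noise + i = ENNReal.ofReal (p.noise + i.toReal) := by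
      rw [ENNReal.ofReal_add hN.le ENNReal.toReal_nonneg, ENNReal.ofReal_toReal hi]
    have h1 : {r : RestMark | ((((l, a), r), i), (1 : ℝ)) ∈ p.coverSet τ a U} =
        Set.univ ×ˢ {γ | ∃ j ∈ Finset.range (p.η a),
          p.η a * τ * U * l / p.G * (p.noise + i.toReal) < ‖γ j‖ ^ 2} := by
      ext r
      have h2 := p.receivedPower_one_lt_iff hτ a hU (w := ((l, a), r)) hl hb
      simp only [coverSet, Set.mem_ofPred_eq, Set.mem_prod, Set.mem_univ, true_and, hi']
      exact h2
    rw [h1, restLaw, Measure.prod_prod, measure_univ, one_mul,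
      infinitePi_exists_normSq_gt _ (by positivity), hi', ← ENNReal.ofReal_mul hc.le,
      negExp_ofReal (by positivity)]

end Params

end

end MmWave

namespace MmWave

noncomputable section

open Filter Topology

/-! ### Integration over the loss of the tagged station. -/

/-- The Laplace transform of a kernel. -/
def kernelLaplace (κ : Kernel ℝ ℝ≥0∞) (s l : ℝ) : ℝ := ∫ i, negExp (ENNReal.ofReal s * i) ∂(κ l)

lemma kernelLaplace_eq (κ : Kernel ℝ ℝ≥0∞) (s l : ℝ) :
    kernelLaplace κ s l = (∫⁻ i, nexp (ENNReal.ofReal s * i) ∂(κ l)).toReal := by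
  have hm2 : Measurable fun i : ℝ≥0∞ => nexp (ENNReal.ofReal s * i) :=
    measurable_nexp.comp (measurable_id.const_mul _)
  rw [kernelLaplace]
  simp only [negExp_eq_toReal]
  exact integral_toReal hm2.aemeasurable (ae_of_all _ fun i => (nexp_ne_top _).lt_top)

lemma kernelLaplace_nonneg (κ : Kernel ℝ ℝ≥0∞) (s l : ℝ) : 0 ≤ kernelLaplace κ s l :=
  integral_nonneg fun _ => negExp_nonneg _

lemma kernelLaplace_le_one (κ : Kernel ℝ ℝ≥0∞) [IsMarkovKernel κ] (s l : ℝ) :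
    kernelLaplace κ s l ≤ 1 := by
  have h := integral_mono (integrable_negExp (κ l) (ENNReal.ofReal s)) (integrable_const 1)
    fun i => negExp_le_one _
  rw [integral_const, probReal_univ, one_smul] at h
  exact h

lemma measurable_kernelLaplace (κ : Kernel ℝ ℝ≥0∞) [IsMarkovKernel κ] {s : ℝ → ℝ}
    (hs : Measurable s) : Measurable fun l => kernelLaplace κ (s l) l := by
  simp only [kernelLaplace_eq]
  have h1 : Measurable fun q : ℝ × ℝ≥0∞ => nexp (ENNReal.ofReal (s q.1) * q.2) :=
    measurable_nexp.comp (((hs.comp measurable_fst).ennreal_ofReal).mul measurable_snd)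
  exact (h1.lintegral_kernel_prod_right' (κ := κ)).ennreal_toReal

namespace Params

variable (p : Params)

/-- The integral over losses up to b is a distribution function, hence at most 1, and b increases to
infinity. This bound gives the integrability of the coverage integrands. -/
lemma lintegral_nexp_lossMeasure_le_one :
    ∫⁻ q, nexp (p.lossMeasure {x | x.1 ≤ q.1}) ∂p.lossMeasure ≤ 1 := by
  have hmono : Monotone fun b : ℕ => {q : ℝ × Link | q.1 ≤ (b + 1 : ℝ)} := fun b c hbc q hq => by
    have h : (b : ℝ) ≤ c := by exact_mod_cast hbc
    exact le_trans (show q.1 ≤ b + 1 from hq) (by linarith)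
  have huniv : ⋃ b : ℕ, {q : ℝ × Link | q.1 ≤ (b + 1 : ℝ)} = Set.univ := by
    refine Set.eq_univ_of_forall fun q => Set.mem_iUnion.2 ?_
    obtain ⟨n, hn⟩ := exists_nat_ge q.1
    exact ⟨n, hn.trans (by linarith)⟩
  rw [← setLIntegral_univ, ← huniv, setLIntegral_iUnion_of_directed _ hmono.directed_le]
  refine iSup_le fun b => ?_
  rw [p.lintegral_nexp_lossMeasure (by positivity)]
  exact tsub_le_self

/-- The density of the path loss of the tagged BS, for links of type `a`. -/
def servingDensity (a : Link) (l : ℝ) : ℝ := p.intensity a l * Real.exp (-p.totalM l)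

lemma servingDensity_nonneg (a : Link) {l : ℝ} (hl : 0 < l) : 0 ≤ p.servingDensity a l :=
  mul_nonneg (p.intensity_nonneg a hl) (Real.exp_pos _).le

lemma measurable_servingDensity (a : Link) : Measurable (p.servingDensity a) :=
  (p.measurable_intensity a).mul p.measurable_totalM.neg.exp

lemma ofReal_servingDensity (a : Link) {l : ℝ} (hl : 0 < l) :
    ENNReal.ofReal (p.servingDensity a l) =
      ENNReal.ofReal (p.intensity a l) * nexp (p.lossMeasure {x | x.1 ≤ l}) := by
  rw [servingDensity, ENNReal.ofReal_mul (p.intensity_nonneg a hl), p.lossMeasure_le_of_pos hl,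
    nexp_ofReal (p.totalM_nonneg hl)]

lemma integrableOn_servingDensity (a : Link) :
    IntegrableOn (p.servingDensity a) (Set.Ioi 0) := by
  refine ⟨(p.measurable_servingDensity a).aestronglyMeasurable, ?_⟩
  have hm : Measurable fun q : ℝ × Link => nexp (p.lossMeasure {x | x.1 ≤ q.1}) :=
    measurable_nexp_measure_le measurable_fst
  have hm2 : Measurable fun l : ℝ => nexp (p.lossMeasure {x | x.1 ≤ l}) :=
    hm.comp (measurable_id.prodMk (measurable_const (a := Link.los)))
  have h1 : ∫⁻ l in Set.Ioi 0, ENNReal.ofReal (p.servingDensity a l) =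
      ∫⁻ t, nexp (p.lossMeasure {x | x.1 ≤ t}) ∂(p.lossDensity a) := by
    rw [p.lintegral_lossDensity a hm2]
    exact setLIntegral_congr_fun measurableSet_Ioi fun l hl => p.ofReal_servingDensity a hl
  have h2 := p.lintegral_nexp_lossMeasure_le_one
  rw [p.lintegral_lossMeasure hm] at h2
  have h3 : ∫⁻ l in Set.Ioi 0, ENNReal.ofReal (p.servingDensity a l) ≤ 1 := by
    rw [h1]
    refine le_trans ?_ h2
    cases a
    · exact le_self_add
    · exact le_add_self
  rw [hasFiniteIntegral_iff_ofReal]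
  · exact h3.trans_lt ENNReal.one_lt_top
  · exact (ae_restrict_iff' measurableSet_Ioi).2 (ae_of_all _ fun l hl => p.servingDensity_nonneg a hl)

/-- The normalization in `f` cancels. If `Bprob` vanishes, then p_LOS = 0 and the intensity vanishes
too, so the value 0 of the division by zero is the right one. -/
lemma Bprob_mul_f (a : Link) {l : ℝ} :
    p.Bprob a * p.f a l = p.intensity a l * Real.exp (-p.lamBS * p.M a l) := by
  by_cases hB : p.Bprob a = 0
  · have h1 : p.intensity a l = 0 := by
      cases a
      · have h2 : -p.lamBS * Real.pi * p.pLOS * p.D ^ 2 = 0 := by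
          have h3 : Real.exp (-p.lamBS * Real.pi * p.pLOS * p.D ^ 2) = 1 := by
            have : 1 - Real.exp (-p.lamBS * Real.pi * p.pLOS * p.D ^ 2) = 0 := hB
            linarith
          exact Real.exp_eq_one_iff _ |>.1 h3
        have h4 : p.pLOS = 0 := by
          have := p.lamBS_pos.ne'
          have := p.D_pos.ne'
          have := Real.pi_ne_zero
          simpa [*] using h2
        simp [intensity, M', h4]
      · exact absurd hB one_ne_zero
    rw [hB, h1]
    ring
  · rw [f, intensity, mul_div_cancel₀ _ hB]
    ring

/-- The tagged loss has density intensity times exp(-`totalM`). The factor exp(-λ M_a) comes from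
`f`, and the factor for the other link type from the integrand. -/
lemma Bprob_mul_coverageIntegrand (L : ℝ → ℝ → ℝ) (τ : ℝ) (U : ℕ) (a : Link) (n : ℕ) (l : ℝ) :
    p.Bprob a * p.coverageIntegrand L τ U a n l = p.servingDensity a l *
      (Real.exp (-(n * (p.η a * τ * U * l / p.G) * p.noise)) *
        L (n * (p.η a * τ * U * l / p.G)) l) := by
  have h1 : p.η a * τ * n * U * l * p.noise / p.G = n * (p.η a * τ * U * l / p.G) * p.noise := by ring
  have h2 : p.η a * τ * n * U * l / p.G = n * (p.η a * τ * U * l / p.G) := by ring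
  have h3 := p.Bprob_mul_f a (l := l)
  have h4 : Real.exp (-p.totalM l) =
      Real.exp (-p.lamBS * p.M a l) * Real.exp (-(p.lamBS * p.M a.other l)) := by
    rw [← Real.exp_add, totalM]
    congr 1
    cases a <;> simp only [Link.other] <;> ring
  rw [coverageIntegrand, h1, h2, servingDensity, h4, sub_eq_add_neg, Real.exp_add]
  linear_combination (Real.exp (-(n * (p.η a * τ * U * l / p.G) * p.noise)) *
    Real.exp (-(p.lamBS * p.M a.other l)) * L (n * (p.η a * τ * U * l / p.G)) l) * h3

variable (κ : Kernel ℝ ℝ≥0∞) [IsMarkovKernel κ]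

lemma integrableOn_servingDensity_mul {τ : ℝ} (hτ : 0 < τ) (U : ℕ) (a : Link) (n : ℕ) :
    IntegrableOn (fun l => p.servingDensity a l *
      (Real.exp (-(n * (p.η a * τ * U * l / p.G) * p.noise)) *
        kernelLaplace κ (n * (p.η a * τ * U * l / p.G)) l)) (Set.Ioi 0) := by
  have hs : Measurable fun l : ℝ => n * (p.η a * τ * U * l / p.G) := by fun_prop
  have hm := measurable_kernelLaplace κ hs
  have hm2 : Measurable fun l : ℝ => Real.exp (-(n * (p.η a * τ * U * l / p.G) * p.noise)) := by
    fun_prop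
  refine Integrable.mono' (p.integrableOn_servingDensity a)
    ((p.measurable_servingDensity a).mul (hm2.mul hm)).aestronglyMeasurable
    ((ae_restrict_iff' measurableSet_Ioi).2 (ae_of_all _ fun l hl => ?_))
  have hl0 : 0 < l := hl
  have hG := p.G_pos
  have hN := p.noise_pos
  have h1 := p.servingDensity_nonneg a hl0
  have h2 := kernelLaplace_nonneg κ (n * (p.η a * τ * U * l / p.G)) l
  have h3 := kernelLaplace_le_one κ (n * (p.η a * τ * U * l / p.G)) l
  have h4 : Real.exp (-(n * (p.η a * τ * U * l / p.G) * p.noise)) ≤ 1 :=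
    Real.exp_le_one_iff.2 (neg_nonpos.2 (by positivity))
  have h5 := (Real.exp_pos (-(n * (p.η a * τ * U * l / p.G) * p.noise))).le
  rw [Real.norm_eq_abs, abs_of_nonneg (by positivity)]
  exact mul_le_of_le_one_right h1 (mul_le_one₀ h4 h2 h3)

lemma integrableOn_coverageIntegrand {τ : ℝ} (hτ : 0 < τ) (U : ℕ) (a : Link) (n : ℕ) :
    IntegrableOn (p.coverageIntegrand (kernelLaplace κ) τ U a n) (Set.Ioi 0) := by
  by_cases hB : p.Bprob a = 0
  · have h : p.coverageIntegrand (kernelLaplace κ) τ U a n = fun _ => 0 := by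
      funext l
      simp [coverageIntegrand, f, hB]
    rw [h]
    exact integrableOn_zero
  · have h : p.coverageIntegrand (kernelLaplace κ) τ U a n = fun l => (p.Bprob a)⁻¹ *
        (p.servingDensity a l * (Real.exp (-(n * (p.η a * τ * U * l / p.G) * p.noise)) *
        kernelLaplace κ (n * (p.η a * τ * U * l / p.G)) l)) := by
      funext l
      rw [← p.Bprob_mul_coverageIntegrand, inv_mul_cancel_left₀ hB]
    rw [h]
    exact (p.integrableOn_servingDensity_mul κ hτ U a n).const_mul _

/-- The probability of coverage, given the path loss from the tagged BS, without penalty. -/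
def coverFactor (τ : ℝ) (U : ℕ) (a : Link) (l : ℝ) : ℝ :=
  ∑ n ∈ Finset.Icc 1 (p.η a), (-1) ^ (n + 1) * ((p.η a).choose n : ℝ) *
    (Real.exp (-(n * (p.η a * τ * U * l / p.G) * p.noise)) *
      kernelLaplace κ (n * (p.η a * τ * U * l / p.G)) l)

lemma coverFactor_eq {τ : ℝ} (hτ : 0 < τ) (U : ℕ) (a : Link) {l : ℝ} (hl : 0 < l) :
    p.coverFactor κ τ U a l = ∫ i, (1 - (1 - negExp (ENNReal.ofReal (p.η a * τ * U * l / p.G) *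
        (ENNReal.ofReal p.noise + i))) ^ p.η a) ∂(κ l) := by
  have hG := p.G_pos
  rw [integral_one_sub_one_sub_negExp_pow (κ l) (by positivity) p.noise_pos.le]
  rfl

lemma coverFactor_nonneg {τ : ℝ} (hτ : 0 < τ) (U : ℕ) (a : Link) {l : ℝ} (hl : 0 < l) :
    0 ≤ p.coverFactor κ τ U a l := by
  rw [p.coverFactor_eq κ hτ U a hl]
  exact integral_nonneg fun i => one_sub_one_sub_negExp_pow_nonneg _ _

variable {μ : Measure ℕ} [IsProbabilityMeasure μ]

/-- Given the loss, the marks of the tagged station are independent of the other stations. Fubini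
lets the fading be integrated first at a fixed interference level, which is `restLaw_coverSet`. -/
lemma lintegral_coverSet {τ : ℝ} (hτ : 0 < τ) (a : Link) {U : ℕ} (hU : 1 ≤ U) {l : ℝ} (hl : 0 < l) :
    ∫⁻ r, κ l {i | ((((l, a), r), i), (1 : ℝ)) ∈ p.coverSet τ a U} ∂(p.restLaw μ) =
      ENNReal.ofReal (p.coverFactor κ τ U a l) := by
  have hG := p.G_pos
  have hm : Measurable fun y : RestMark × ℝ≥0∞ => ((((l, a), y.1), y.2), (1 : ℝ)) := by fun_prop
  have hs : MeasurableSet {y : RestMark × ℝ≥0∞ | ((((l, a), y.1), y.2), (1 : ℝ)) ∈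
      p.coverSet τ a U} := hm (p.measurableSet_coverSet τ a U)
  have h1 := Measure.prod_apply (μ := p.restLaw μ) (ν := κ l) hs
  have h2 := Measure.prod_apply_symm (μ := p.restLaw μ) (ν := κ l) hs
  rw [h1] at h2
  refine h2.trans ?_
  rw [p.coverFactor_eq κ hτ U a hl, ofReal_integral_eq_lintegral_ofReal
    (integrable_one_sub_one_sub_negExp_pow (κ l) (by positivity) p.noise_pos.le _)
    (ae_of_all _ fun i => one_sub_one_sub_negExp_pow_nonneg _ _)]
  exact lintegral_congr fun i => p.restLaw_coverSet hτ a hU hl i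

open Classical in
/-- The probability of coverage without penalty by a BS of type `a`. -/
lemma compProd_coverSet {τ : ℝ} (hτ : 0 < τ) (a : Link) {U : ℕ} (hU : 1 ≤ U) :
    (((p.pointMeasure μ).withDensity fun y => nexp (p.pointMeasure μ {x | x.1.1 ≤ y.1.1})) ⊗ₘ
      κ.comap (fun q : (ℝ × Link) × RestMark => q.1.1) measurable_loss)
        {y | (y, (1 : ℝ)) ∈ p.coverSet τ a U} =
      ∫⁻ l in Set.Ioi 0, ENNReal.ofReal (p.servingDensity a l * p.coverFactor κ τ U a l) := by
  have hmk : Measurable fun y : ((ℝ × Link) × RestMark) × ℝ≥0∞ => (y, (1 : ℝ)) := by fun_prop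
  have hs : MeasurableSet {y : ((ℝ × Link) × RestMark) × ℝ≥0∞ | (y, (1 : ℝ)) ∈ p.coverSet τ a U} :=
    hmk (p.measurableSet_coverSet τ a U)
  have hφ : Measurable fun y : (ℝ × Link) × RestMark => nexp (p.lossMeasure {x | x.1 ≤ y.1.1}) := by
    have := measurable_nexp_measure_le (Λ := p.lossMeasure) measurable_fst
    exact this.comp measurable_fst
  have hκ := Kernel.measurable_kernel_prodMk_left
    (κ := κ.comap (fun q : (ℝ × Link) × RestMark => q.1.1) measurable_loss) hs
  simp only [pointMeasure_le]
  rw [Measure.compProd_apply hs, lintegral_withDensity_eq_lintegral_mul _ hφ hκ, pointMeasure,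
    lintegral_prod _ (hφ.mul hκ).aemeasurable]
  obtain ⟨R, hR⟩ : ∃ R : ℝ × Link → ℝ≥0∞, R = fun x => ∫⁻ r, ((fun y : (ℝ × Link) × RestMark =>
      nexp (p.lossMeasure {x | x.1 ≤ y.1.1})) * fun y =>
        κ.comap (fun q : (ℝ × Link) × RestMark => q.1.1) measurable_loss y
          (Prod.mk y ⁻¹' {y | (y, (1 : ℝ)) ∈ p.coverSet τ a U})) (x, r) ∂(p.restLaw μ) := ⟨_, rfl⟩
  have hRm : Measurable R := by
    rw [hR]
    exact (hφ.mul hκ).lintegral_prod_right'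
  -- The set asks for type `a`, so the other type contributes nothing; the factor exp(-Λ) does not
  -- depend on the marks and comes out of the integral.
  have h1 : ∀ l b, 0 < l → R (l, b) = nexp (p.lossMeasure {y | y.1 ≤ l}) *
      if b = a then ENNReal.ofReal (p.coverFactor κ τ U a l) else 0 := fun l b hl => by
    rw [hR]
    simp only [Pi.mul_apply]
    rw [lintegral_const_mul' _ _ (nexp_ne_top _)]
    congr 1
    split_ifs with hb
    · obtain rfl : b = a := hb
      exact p.lintegral_coverSet κ hτ b hU hl
    · have h2 : ∀ r : RestMark, Prod.mk ((l, b), r) ⁻¹'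
          {y : ((ℝ × Link) × RestMark) × ℝ≥0∞ | (y, (1 : ℝ)) ∈ p.coverSet τ a U} = ∅ := fun r => by
        ext i
        simp only [coverSet, Set.mem_preimage, Set.mem_ofPred_eq, Set.mem_empty_iff_false, iff_false]
        exact fun h => hb h.1
      simp only [h2, measure_empty, lintegral_zero]
  have h3 : ∀ b, ∫⁻ t, R (t, b) ∂(p.lossDensity b) =
      if b = a then ∫⁻ l in Set.Ioi 0, ENNReal.ofReal
        (p.servingDensity a l * p.coverFactor κ τ U a l) else 0 := fun b => by
    rw [p.lintegral_lossDensity b (h := fun t => R (t, b)) (hRm.comp measurable_prodMk_right)]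
    split_ifs with hb
    · obtain rfl : b = a := hb
      refine setLIntegral_congr_fun measurableSet_Ioi fun t ht => ?_
      have ht0 : 0 < t := ht
      simp only [h1 t b ht0, if_true]
      rw [ENNReal.ofReal_mul (p.servingDensity_nonneg b ht0), p.ofReal_servingDensity b ht0, mul_assoc]
    · refine (setLIntegral_congr_fun (g := fun _ => 0) measurableSet_Ioi fun t ht => ?_).trans
        lintegral_zero
      have ht0 : 0 < t := ht
      simp only [h1 t b ht0, if_neg hb, mul_zero]
  refine Eq.trans ?_ ((p.lintegral_lossMeasure hRm).trans ?_)
  · rw [hR]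
  · rw [h3, h3]
    cases a <;> simp

/-- The product is nonnegative although the terms of its alternating sum are not. Passing to the
Bochner integral, where each term is integrable, permits exchanging sum and integral. -/
lemma toReal_lintegral_coverFactor {τ : ℝ} (hτ : 0 < τ) (U : ℕ) (a : Link) :
    (∫⁻ l in Set.Ioi 0, ENNReal.ofReal (p.servingDensity a l * p.coverFactor κ τ U a l)).toReal =
      p.Bprob a * ∑ n ∈ Finset.Icc 1 (p.η a), (-1) ^ (n + 1) * ((p.η a).choose n : ℝ) *
        ∫ l in Set.Ioi 0, p.coverageIntegrand (kernelLaplace κ) τ U a n l := by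
  have h1 : ∀ l, p.servingDensity a l * p.coverFactor κ τ U a l =
      ∑ n ∈ Finset.Icc 1 (p.η a), (-1) ^ (n + 1) * ((p.η a).choose n : ℝ) *
        (p.servingDensity a l * (Real.exp (-(n * (p.η a * τ * U * l / p.G) * p.noise)) *
        kernelLaplace κ (n * (p.η a * τ * U * l / p.G)) l)) := fun l => by
    rw [coverFactor, Finset.mul_sum]
    exact Finset.sum_congr rfl fun n _ => by ring
  have h2 : ∀ n ∈ Finset.Icc 1 (p.η a), IntegrableOn (fun l => (-1) ^ (n + 1) *
      ((p.η a).choose n : ℝ) * (p.servingDensity a l *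
        (Real.exp (-(n * (p.η a * τ * U * l / p.G) * p.noise)) *
        kernelLaplace κ (n * (p.η a * τ * U * l / p.G)) l))) (Set.Ioi 0) := fun n _ =>
    (p.integrableOn_servingDensity_mul κ hτ U a n).const_mul _
  have h3 : IntegrableOn (fun l => p.servingDensity a l * p.coverFactor κ τ U a l) (Set.Ioi 0) := by
    simp only [h1]
    exact integrable_finsetSum _ h2
  have h4 := integral_eq_lintegral_of_nonneg_ae ((ae_restrict_iff' measurableSet_Ioi).2
    (ae_of_all _ fun l (hl : 0 < l) => mul_nonneg (p.servingDensity_nonneg a hl)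
      (p.coverFactor_nonneg κ hτ U a hl))) h3.aestronglyMeasurable
  rw [← h4]
  simp only [h1]
  rw [integral_finsetSum _ h2, Finset.mul_sum]
  refine Finset.sum_congr rfl fun n _ => ?_
  simp only [← p.Bprob_mul_coverageIntegrand]
  rw [integral_const_mul, integral_const_mul]
  ring

end Params

end

end MmWave

namespace MmWave

noncomputable section

open Filter Topology

/-! ### The penalty -/

/-- Both masses are truncated at 0 by `ENNReal.ofReal`, but as probabilities they are at most 1, and
that alone gives both bounds. The formula for ζ is never inspected. -/
lemma bernoulli_nonneg_le_one {ν : Measure ℝ} [IsProbabilityMeasure ν] {ζ : ℝ}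
    (h1 : ν {1} = ENNReal.ofReal ζ) (h0 : ν {0} = ENNReal.ofReal (1 - ζ)) : 0 ≤ ζ ∧ ζ ≤ 1 := by
  constructor
  · have h : ENNReal.ofReal (1 - ζ) ≤ ENNReal.ofReal 1 := by
      rw [← h0, ENNReal.ofReal_one]
      exact prob_le_one
    have := (ENNReal.ofReal_le_ofReal_iff zero_le_one).1 h
    linarith
  · have h : ENNReal.ofReal ζ ≤ ENNReal.ofReal 1 := by
      rw [← h1, ENNReal.ofReal_one]
      exact prob_le_one
    exact (ENNReal.ofReal_le_ofReal_iff zero_le_one).1 h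

lemma bernoulli_compl_zero {ν : Measure ℝ} [IsProbabilityMeasure ν] {ζ : ℝ}
    (h1 : ν {1} = ENNReal.ofReal ζ) (h0 : ν {0} = ENNReal.ofReal (1 - ζ)) :
    ν {0}ᶜ = ENNReal.ofReal ζ := by
  obtain ⟨hζ0, hζ1⟩ := bernoulli_nonneg_le_one h1 h0
  rw [prob_compl_eq_one_sub (measurableSet_singleton _), h0, ← ENNReal.ofReal_one,
    ← ENNReal.ofReal_sub _ (by linarith)]
  congr 1
  ring

lemma bernoulli_compl_pair {ν : Measure ℝ} [IsProbabilityMeasure ν] {ζ : ℝ}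
    (h1 : ν {1} = ENNReal.ofReal ζ) (h0 : ν {0} = ENNReal.ofReal (1 - ζ)) :
    ν {z | z ≠ 0 ∧ z ≠ 1} = 0 := by
  have h2 := bernoulli_compl_zero h1 h0
  have h3 : ({0}ᶜ : Set ℝ) = {1} ∪ {z | z ≠ 0 ∧ z ≠ 1} := by
    ext z
    by_cases hz : z = 1 <;> simp [hz]
  have h4 : Disjoint ({1} : Set ℝ) {z | z ≠ 0 ∧ z ≠ 1} :=
    Set.disjoint_singleton_left.2 fun h => h.2 rfl
  rw [h3, measure_union' h4 (measurableSet_singleton _), h1] at h2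
  exact (ENNReal.add_right_inj ENNReal.ofReal_ne_top).1 (h2.trans (add_zero _).symm)

namespace Params

variable (p : Params)

lemma coverSet_zero {τ : ℝ} {a : Link} {U : ℕ} {y : ((ℝ × Link) × RestMark) × ℝ≥0∞} :
    (y, (0 : ℝ)) ∉ p.coverSet τ a U := fun h => by
  have h2 := h.2
  simp [receivedPower] at h2

/-- If the user is covered without penalty, then it is covered with penalties slightly below `1`. -/
lemma exists_Ioi_subset_coverSet {τ : ℝ} {a : Link} {U : ℕ} {y : ((ℝ × Link) × RestMark) × ℝ≥0∞}
    (h : (y, (1 : ℝ)) ∈ p.coverSet τ a U) :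
    ∃ t < (1 : ℝ), Set.Ioi t ⊆ {z | (y, z) ∈ p.coverSet τ a U} := by
  have hN := p.noise_pos
  obtain ⟨h1, h2⟩ := h
  have h2' : ENNReal.ofReal τ < ENNReal.ofReal (p.receivedPower a U y.1 1) / (ENNReal.ofReal p.noise + y.2) :=
    h2
  by_cases hi : y.2 = ∞
  · simp [hi] at h2'
  · have hb : 0 < p.noise + y.2.toReal := add_pos_of_pos_of_nonneg hN ENNReal.toReal_nonneg
    have hi' : ENNReal.ofReal p.noise + y.2 = ENNReal.ofReal (p.noise + y.2.toReal) := by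
      rw [ENNReal.ofReal_add hN.le ENNReal.toReal_nonneg, ENNReal.ofReal_toReal hi]
    have hz : ∀ z, p.receivedPower a U y.1 z = p.receivedPower a U y.1 1 * z := fun z => by
      simp only [receivedPower]
      ring
    rw [hi', ← ENNReal.ofReal_div_of_pos hb, ENNReal.ofReal_lt_ofReal_iff'] at h2'
    obtain ⟨h3, h4⟩ := h2'
    have hc : 0 < p.receivedPower a U y.1 1 := by
      by_contra hneg
      exact absurd h4 (not_lt.2 (div_nonpos_of_nonpos_of_nonneg (not_lt.1 hneg) hb.le))
    rw [lt_div_iff₀ hb] at h3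
    refine ⟨max 0 (τ * (p.noise + y.2.toReal) / p.receivedPower a U y.1 1),
      max_lt one_pos ((div_lt_one hc).2 h3), fun z hz' => ?_⟩
    have hz0 : 0 < z := lt_of_le_of_lt (le_max_left _ _) hz'
    have hz1 : τ * (p.noise + y.2.toReal) / p.receivedPower a U y.1 1 < z :=
      lt_of_le_of_lt (le_max_right _ _) hz'
    refine ⟨h1, ?_⟩
    change _ < ENNReal.ofReal (p.receivedPower a U y.1 z) / (ENNReal.ofReal p.noise + y.2)
    rw [hi', ← ENNReal.ofReal_div_of_pos hb, ENNReal.ofReal_lt_ofReal_iff', hz, lt_div_iff₀ hb]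
    refine ⟨?_, by positivity⟩
    rw [div_lt_iff₀ hc] at hz1
    linarith

/-- Coverage with a Bernoulli penalty. -/
lemma prod_coverSet_bernoulli (ρ : Measure (((ℝ × Link) × RestMark) × ℝ≥0∞)) [IsFiniteMeasure ρ]
    {ν : Measure ℝ} [IsProbabilityMeasure ν] {ζ : ℝ} (h1 : ν {1} = ENNReal.ofReal ζ)
    (h0 : ν {0} = ENNReal.ofReal (1 - ζ)) (τ : ℝ) (a : Link) (U : ℕ) :
    (ρ.prod ν) (p.coverSet τ a U) = ENNReal.ofReal ζ * ρ {y | (y, (1 : ℝ)) ∈ p.coverSet τ a U} := by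
  have hmk : Measurable fun y : ((ℝ × Link) × RestMark) × ℝ≥0∞ => (y, (1 : ℝ)) := by fun_prop
  have hs : MeasurableSet {y : ((ℝ × Link) × RestMark) × ℝ≥0∞ | (y, (1 : ℝ)) ∈ p.coverSet τ a U} :=
    hmk (p.measurableSet_coverSet τ a U)
  rw [Measure.prod_apply (p.measurableSet_coverSet τ a U), ← lintegral_indicator_const hs]
  refine lintegral_congr fun y => ?_
  by_cases hy : y ∈ {y : ((ℝ × Link) × RestMark) × ℝ≥0∞ | (y, (1 : ℝ)) ∈ p.coverSet τ a U}
  · rw [Set.indicator_of_mem hy]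
    refine le_antisymm ?_ ?_
    · rw [← bernoulli_compl_zero h1 h0]
      refine measure_mono fun z hz hz0 => ?_
      obtain rfl : z = 0 := hz0
      exact p.coverSet_zero hz
    · rw [← h1]
      exact measure_mono (Set.singleton_subset_iff.2 hy)
  · rw [Set.indicator_of_notMem hy]
    have hsub : Prod.mk y ⁻¹' p.coverSet τ a U ⊆ {z | z ≠ 0 ∧ z ≠ 1} := fun z hz => by
      refine ⟨?_, ?_⟩
      · rintro rfl
        exact p.coverSet_zero hz
      · rintro rfl
        exact hy hz
    exact measure_mono_null hsub (bernoulli_compl_pair h1 h0)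

/-- Coverage with a penalty that dominates a Bernoulli penalty. -/
lemma le_prod_coverSet (ρ : Measure (((ℝ × Link) × RestMark) × ℝ≥0∞)) [IsFiniteMeasure ρ]
    {ν ν' : Measure ℝ} [IsProbabilityMeasure ν'] {ζ : ℝ} (h1 : ν {1} = ENNReal.ofReal ζ)
    (hdom : ∀ z, ν (Set.Ioi z) ≤ ν' (Set.Ioi z)) (τ : ℝ) (a : Link) (U : ℕ) :
    ENNReal.ofReal ζ * ρ {y | (y, (1 : ℝ)) ∈ p.coverSet τ a U} ≤ (ρ.prod ν') (p.coverSet τ a U) := by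
  have hmk : Measurable fun y : ((ℝ × Link) × RestMark) × ℝ≥0∞ => (y, (1 : ℝ)) := by fun_prop
  have hs : MeasurableSet {y : ((ℝ × Link) × RestMark) × ℝ≥0∞ | (y, (1 : ℝ)) ∈ p.coverSet τ a U} :=
    hmk (p.measurableSet_coverSet τ a U)
  rw [Measure.prod_apply (p.measurableSet_coverSet τ a U), ← lintegral_indicator_const hs]
  refine lintegral_mono fun y => ?_
  by_cases hy : y ∈ {y : ((ℝ × Link) × RestMark) × ℝ≥0∞ | (y, (1 : ℝ)) ∈ p.coverSet τ a U}
  · rw [Set.indicator_of_mem hy]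
    -- Penalties above some t < 1 still give coverage. On the half-line above t the dominance
    -- hypothesis applies, and it contains the atom of the Bernoulli variable at 1.
    obtain ⟨t, ht, hsub⟩ := p.exists_Ioi_subset_coverSet hy
    calc ENNReal.ofReal ζ = ν {1} := h1.symm
      _ ≤ ν (Set.Ioi t) := measure_mono (Set.singleton_subset_iff.2 ht)
      _ ≤ ν' (Set.Ioi t) := hdom t
      _ ≤ _ := measure_mono hsub
  · rw [Set.indicator_of_notMem hy]
    exact bot_le

end Params

/-! ### Coverage as an event of independent ingredients. -/

section Network

variable {Ω : Type*} {p : Params} {X : (s : Source) → Ω → s.Space}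

/-- The tagged BS, with its path loss, link type and marks. -/
def taggedPoint (p : Params) (X : (s : Source) → Ω → s.Space) (ω : Ω) : (ℝ × Link) × RestMark :=
  point p X (tagged p X ω) ω

lemma measurable_taggedPoint {S : Set Source} (hS : ∀ s : Source, s.kind ≤ 9 → s ∈ S) :
    Measurable[sourceSigma X S] (taggedPoint p X) := by
  have hZ : Measurable[sourceSigma X S] (tagged p X) := measurable_tagged fun s h => hS s (by omega)
  have hξ : ∀ z, Measurable[sourceSigma X S] (point p X z) := fun z => measurable_point hS z
  exact measurable_select_countable hZ hξ

lemma measurable_interference {S : Set Source} (hS : ∀ s : Source, s.kind ≤ 9 → s ∈ S) :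
    Measurable[sourceSigma X S] (interference p X) := by
  let m : MeasurableSpace Ω := sourceSigma X S
  have hZ : Measurable (tagged p X) := measurable_tagged fun s h => hS s (by omega)
  rw [interference_eq]
  exact Measurable.tsum fun z => Measurable.ite (measurableSet_eq_fun measurable_const hZ)
    measurable_const (p.measurable_ofReal_interf.comp (measurable_point hS z))

/-- The tagged BS, the interference, and the penalty for `U` served users. -/
def coverData (p : Params) (X : (s : Source) → Ω → s.Space) (pen : Link → ℕ → Ω → ℝ) (a : Link)
    (U : ℕ) (ω : Ω) : (((ℝ × Link) × RestMark) × ℝ≥0∞) × ℝ :=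
  ((taggedPoint p X ω, interference p X ω), pen a U ω)

lemma mem_covered_iff {pen : Link → ℕ → Ω → ℝ} {τ : ℝ} {U : ℕ} {ω : Ω}
    (hU : servedUsers p X ω = U) : ω ∈ covered p X pen τ ↔
      ∃ a, coverData p X pen a U ω ∈ p.coverSet τ a U := by
  have h1 : (taggedPoint p X ω).1 = (servingLoss p X ω, linkType p X (tagged p X ω) ω) :=
    point_fst _ ω
  have h2 : sinr p X pen ω = ENNReal.ofReal (p.receivedPower (linkType p X (tagged p X ω) ω) U
      (taggedPoint p X ω) (pen (linkType p X (tagged p X ω) ω) U ω)) /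
      (ENNReal.ofReal p.noise + interference p X ω) := by
    rw [sinr, signal, hU, Params.receivedPower, h1]
    rfl
  constructor
  · intro h
    refine ⟨linkType p X (tagged p X ω) ω, congrArg Prod.snd h1, ?_⟩
    have h3 : ENNReal.ofReal τ < sinr p X pen ω := h
    rw [h2] at h3
    exact h3
  · rintro ⟨a, ha, h⟩
    have h4 : linkType p X (tagged p X ω) ω = a := (congrArg Prod.snd h1).symm.trans ha
    change ENNReal.ofReal τ < sinr p X pen ω
    rw [h2, h4]
    exact h

lemma inter_covered (pen : Link → ℕ → Ω → ℝ) (τ : ℝ) (U : ℕ) :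
    {ω | servedUsers p X ω = U} ∩ covered p X pen τ = {ω | servedUsers p X ω = U} ∩
      (coverData p X pen .los U ⁻¹' p.coverSet τ .los U ∪
        coverData p X pen .nlos U ⁻¹' p.coverSet τ .nlos U) := by
  ext ω
  refine and_congr_right fun h => ?_
  rw [mem_covered_iff h]
  constructor
  · rintro ⟨a, ha⟩
    cases a
    · exact Or.inl ha
    · exact Or.inr ha
  · rintro (h | h)
    · exact ⟨_, h⟩
    · exact ⟨_, h⟩

lemma measurable_coverData {pen : Link → ℕ → Ω → ℝ} {S : Set Source}
    (hS : ∀ s : Source, s.kind ≤ 9 → s ∈ S) {a : Link} {U : ℕ}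
    (hpen : Measurable[sourceSigma X S] (pen a U)) :
    Measurable[sourceSigma X S] (coverData p X pen a U) :=
  ((measurable_taggedPoint hS).prodMk (measurable_interference hS)).prodMk hpen

lemma measurable_servedUsers : Measurable[sourceSigma X {s | s.kind = 10}] (servedUsers p X) := by
  have h : Measurable[sourceSigma X {s | s.kind = 10}] (servingLoad X) :=
    measurable_source X (s := .servingLoad) rfl
  exact (Measurable.of_discrete (f := fun n : ℕ => min p.UM n)).comp h

variable [MeasurableSpace Ω] {P : Measure Ω}

/-- The law of the tagged BS and of the interference. -/
def coverLaw (p : Params) (X : (s : Source) → Ω → s.Space) (P : Measure Ω) :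
    Measure (((ℝ × Link) × RestMark) × ℝ≥0∞) :=
  P.map fun ω => (taggedPoint p X ω, interference p X ω)

/-- The tagged point and the interference use sources of kind at most 9, and the penalty uses
sources of kind at least 11, so their joint law is a product. -/
lemma IsNetwork.measure_coverData (hX : IsNetwork p X P) {pen : Link → ℕ → Ω → ℝ} {a : Link} {U : ℕ}
    (hpen : Measurable[sourceSigma X {s | 11 ≤ s.kind}] (pen a U)) (τ : ℝ) :
    P (coverData p X pen a U ⁻¹' p.coverSet τ a U) =
      ((coverLaw p X P).prod (P.map (pen a U))) (p.coverSet τ a U) := by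
  have := hX.isProbabilityMeasure
  have t1 : Measurable[sourceSigma X {s | s.kind ≤ 9}]
      fun ω => (taggedPoint p X ω, interference p X ω) :=
    (measurable_taggedPoint fun _ h => h).prodMk (measurable_interference fun _ h => h)
  have hi := hX.indepFun_of_disjoint (disjoint_setOf fun s => by omega) t1 hpen
  have m1 := hX.measurable_of_sigma t1
  have m2 := hX.measurable_of_sigma hpen
  have h := (indepFun_iff_map_prod_eq_prod_map_map m1.aemeasurable m2.aemeasurable).1 hi
  rw [coverLaw, ← h, Measure.map_apply (m1.prodMk m2) (p.measurableSet_coverSet τ a U)]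
  rfl

lemma IsNetwork.measurableSet_inter_covered (hX : IsNetwork p X P) {pen : Link → ℕ → Ω → ℝ} {U : ℕ}
    (hpen : ∀ a, Measurable[sourceSigma X {s | 11 ≤ s.kind}] (pen a U)) (τ : ℝ) :
    MeasurableSet ({ω | servedUsers p X ω = U} ∩ covered p X pen τ) := by
  have hd : ∀ a, Measurable (coverData p X pen a U) := fun a =>
    hX.measurable_of_sigma (S := Set.univ) (measurable_coverData (fun _ _ => Set.mem_univ _)
      ((hpen a).mono (biSup_mono fun _ _ => Set.mem_univ _) le_rfl))
  rw [inter_covered]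
  exact (hX.measurable_of_sigma measurable_servedUsers (measurableSet_singleton U)).inter
    ((hd _ (p.measurableSet_coverSet τ _ U)).union (hd _ (p.measurableSet_coverSet τ _ U)))

/-- The number of served users is independent of all else. -/
lemma IsNetwork.measure_inter_covered (hX : IsNetwork p X P) {pen : Link → ℕ → Ω → ℝ} {U : ℕ}
    (hpen : ∀ a, Measurable[sourceSigma X {s | 11 ≤ s.kind}] (pen a U)) (τ : ℝ) :
    P ({ω | servedUsers p X ω = U} ∩ covered p X pen τ) = P {ω | servedUsers p X ω = U} *
      (((coverLaw p X P).prod (P.map (pen .los U))) (p.coverSet τ .los U) +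
        ((coverLaw p X P).prod (P.map (pen .nlos U))) (p.coverSet τ .nlos U)) := by
  have := hX.isProbabilityMeasure
  let S : Set Source := {s | s.kind ≠ 10}
  have hle : sourceSigma X {s | 11 ≤ s.kind} ≤ sourceSigma X S :=
    biSup_mono fun s (hs : 11 ≤ s.kind) => show s.kind ≠ 10 by omega
  have t : ∀ a, Measurable[sourceSigma X S] (coverData p X pen a U) := fun a =>
    measurable_coverData (fun s h => show s.kind ≠ 10 by omega) ((hpen a).mono hle le_rfl)
  have hi := hX.indepFun_of_disjoint (S := {s | s.kind = 10}) (T := S)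
    (disjoint_setOf fun s hs hs' => hs' hs) (measurable_servedUsers (p := p)) ((t .los).prodMk (t .nlos))
  have hd : ∀ a, MeasurableSet (coverData p X pen a U ⁻¹' p.coverSet τ a U) := fun a =>
    hX.measurable_of_sigma (t a) (p.measurableSet_coverSet τ a U)
  have hdisj : Disjoint (coverData p X pen .los U ⁻¹' p.coverSet τ .los U)
      (coverData p X pen .nlos U ⁻¹' p.coverSet τ .nlos U) :=
    Set.disjoint_left.2 fun ω h1 h2 => by
      have h3 : Link.los = Link.nlos := h1.1.symm.trans h2.1
      cases h3
  rw [inter_covered, ← hX.measure_coverData (hpen _), ← hX.measure_coverData (hpen _),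
    ← measure_union hdisj (hd _)]
  exact hi.measure_inter_preimage_eq_mul {U}
    {y | y.1 ∈ p.coverSet τ .los U ∨ y.2 ∈ p.coverSet τ .nlos U} (measurableSet_singleton U)
    ((measurable_fst (p.measurableSet_coverSet τ _ U)).union
      (measurable_snd (p.measurableSet_coverSet τ _ U)))

end Network

end

end MmWave

namespace MmWave

noncomputable section

open Filter Topology

/-! ### From almost every tagged loss to Lebesgue almost every loss, and total probability. -/

namespace Params

variable (p : Params) {μ : Measure ℕ} [IsProbabilityMeasure μ]

lemma lossDensity_le_map (a : Link) :
    p.lossDensity a ≤ (p.pointMeasure μ).map fun q => q.1.1 := by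
  refine Measure.le_iff.2 fun B hB => ?_
  have h1 : (fun q : (ℝ × Link) × RestMark => q.1.1) ⁻¹' B = (Prod.fst ⁻¹' B) ×ˢ Set.univ := by
    ext q
    simp
  have hB' : MeasurableSet (Prod.fst ⁻¹' B : Set (ℝ × Link)) := measurable_fst hB
  have h3 : ∀ b, ∫⁻ t, (Prod.fst ⁻¹' B : Set (ℝ × Link)).indicator 1 (t, b) ∂(p.lossDensity b) =
      p.lossDensity b B := fun b => by
    rw [← lintegral_indicator_one hB]
    rfl
  rw [Measure.map_apply measurable_loss hB, h1, pointMeasure, Measure.prod_prod, measure_univ,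
    mul_one, ← lintegral_indicator_one hB', p.lintegral_lossMeasure (measurable_one.indicator hB'),
    h3, h3]
  cases a
  · exact le_self_add
  · exact le_add_self

/-- A set that is null for the intensity can have positive Lebesgue measure only where the density
vanishes, and there `f` vanishes as well. -/
lemma ae_of_ae_lossDensity {a : Link} {R : ℝ → Prop} (h : ∀ᵐ l ∂(p.lossDensity a), R l) :
    ∀ᵐ l ∂(volume.restrict (Set.Ioi 0)), p.f a l = 0 ∨ R l := by
  rw [lossDensity, ae_withDensity_iff (p.measurable_ofReal_intensity a)] at h
  filter_upwards [h, ae_restrict_mem measurableSet_Ioi] with l hl hl0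
  by_cases h1 : p.f a l = 0
  · exact Or.inl h1
  · refine Or.inr (hl fun h2 => h1 ?_)
    have h3 := ENNReal.ofReal_eq_zero.1 h2
    have h4 : p.intensity a l = 0 := le_antisymm h3 (p.intensity_nonneg a hl0)
    have h5 : p.M' a l = 0 := (mul_eq_zero.1 h4).resolve_left p.lamBS_pos.ne'
    rw [f, h5]
    simp

lemma κServing_pos {n : ℕ} (hn : 1 ≤ n) : 0 < p.κServing n := by
  have h1 : 0 < p.load := div_pos p.lamUE_pos p.lamBS_pos
  have h2 : 0 < Real.Gamma (n + 3.5) := Real.Gamma_pos_of_pos (by positivity)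
  have h3 : 0 < Real.Gamma 3.5 := Real.Gamma_pos_of_pos (by norm_num)
  rw [κServing, if_neg (by omega)]
  positivity

end Params

section Network

variable {Ω : Type*} {p : Params} {X : (s : Source) → Ω → s.Space}

lemma measurable_penaltyMU (a : Link) (U : ℕ) :
    Measurable[sourceSigma X {s | 11 ≤ s.kind}] (penaltyMU X a U) :=
  measurable_source X (s := .penaltyMU a U) (le_refl 11)

lemma measurable_penaltyZF (a : Link) (U : ℕ) :
    Measurable[sourceSigma X {s | 11 ≤ s.kind}] (penaltyZF X a U) :=
  measurable_source X (s := .penaltyZF a U) (Nat.le_succ 11)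

variable [MeasurableSpace Ω] {P : Measure Ω}

lemma IsNetwork.measurableSet_servedUsers (hX : IsNetwork p X P) (U : ℕ) :
    MeasurableSet {ω | servedUsers p X ω = U} :=
  hX.measurable_of_sigma measurable_servedUsers (measurableSet_singleton U)

lemma IsNetwork.ae_servedUsers_mem (hX : IsNetwork p X P) :
    ∀ᵐ ω ∂P, servedUsers p X ω ∈ Finset.Icc 1 p.UM := by
  have h1 : ∀ᵐ ω ∂P, servingLoad X ω ≠ 0 := by
    rw [ae_iff]
    simp only [not_not]
    rw [hX.servingLoad_law]
    simp [Params.κServing]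
  filter_upwards [h1] with ω hω
  have h2 := p.UM_pos
  rw [Finset.mem_Icc]
  change 1 ≤ min p.UM (servingLoad X ω) ∧ min p.UM (servingLoad X ω) ≤ p.UM
  omega

/-- The law of the interference from the BSs with path loss above `l`. -/
def interferenceKernel (p : Params) (X : (s : Source) → Ω → s.Space) (P : Measure Ω)
    [IsProbabilityMeasure P] : Kernel ℝ ℝ≥0∞ :=
  outerKernel (point p X) (fun q => q.1.1) (fun q => ENNReal.ofReal (p.interf q)) P

variable [IsProbabilityMeasure P]

lemma IsNetwork.isMarkovKernel (hX : IsNetwork p X P) :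
    IsMarkovKernel (interferenceKernel p X P) := by
  refine ⟨fun l => ?_⟩
  have h := hX.isPoissonSeq
  rw [interferenceKernel, h.outerKernel_apply Params.measurable_loss p.measurable_ofReal_interf]
  exact Measure.isProbabilityMeasure_map ((h.measurable_outer Params.measurable_loss
    p.measurable_ofReal_interf).comp measurable_prodMk_left).aemeasurable

lemma IsNetwork.coverLaw_eq (hX : IsNetwork p X P) :
    coverLaw p X P = ((p.pointMeasure (P.map (load X 0))).withDensity fun y =>
      nexp (p.pointMeasure (P.map (load X 0)) {x | x.1.1 ≤ y.1.1})) ⊗ₘ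
      (interferenceKernel p X P).comap (fun q : (ℝ × Link) × RestMark => q.1.1)
        Params.measurable_loss := by
  have := hX.isProbabilityMeasure_load
  have h := hX.isPoissonSeq.map_nearest Params.measurable_loss
    (p.pointMeasure_le_ne_top _) p.measurable_ofReal_interf hX.measurable_tagged hX.ae_isStrictMin
  rw [coverLaw, interference_eq]
  exact h

/-- The tagged point has the strictly positive density exp(-Λ) with respect to the intensity. A
conditional law is fixed only up to null sets of the tagged loss; these are therefore null for the
intensity, and the choice does not affect the integrals in `S`. -/
lemma IsNetwork.lossDensity_absolutelyContinuous (hX : IsNetwork p X P) (a : Link) :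
    p.lossDensity a ≪ P.map (servingLoss p X) := by
  have := hX.isProbabilityMeasure_load
  have := hX.isMarkovKernel
  have m1 : Measurable (taggedPoint p X) :=
    hX.measurable_of_sigma (S := Set.univ) (measurable_taggedPoint fun _ _ => Set.mem_univ _)
  have m2 : Measurable (interference p X) :=
    hX.measurable_of_sigma (S := Set.univ) (measurable_interference fun _ _ => Set.mem_univ _)
  have h1 : P.map (taggedPoint p X) = (p.pointMeasure (P.map (load X 0))).withDensity fun y =>
      nexp (p.pointMeasure (P.map (load X 0)) {x | x.1.1 ≤ y.1.1}) := by
    have h2 := congrArg Measure.fst hX.coverLaw_eq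
    rw [Measure.fst_compProd, coverLaw, Measure.fst_map_prodMk m2] at h2
    exact h2
  have h3 : P.map (servingLoss p X) = (P.map (taggedPoint p X)).map fun q => q.1.1 := by
    rw [Measure.map_map Params.measurable_loss m1, servingLoss_eq]
    rfl
  have h4 : p.pointMeasure (P.map (load X 0)) ≪ P.map (taggedPoint p X) := by
    rw [h1]
    refine withDensity_absolutelyContinuous' (measurable_nexp_measure_le
      Params.measurable_loss).aemeasurable (ae_of_all _ fun y => ?_)
    exact fun h => p.pointMeasure_le_ne_top _ _ (nexp_eq_zero.1 h)
  rw [h3]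
  exact (Measure.absolutelyContinuous_of_le (p.lossDensity_le_map a)).trans
    (h4.map Params.measurable_loss)

lemma IsNetwork.coverageIntegrand_ae_eq (hX : IsNetwork p X P) (τ : ℝ) (U : ℕ) (a : Link) (n : ℕ) :
    p.coverageIntegrand (laplace p X P) τ U a n =ᵐ[volume.restrict (Set.Ioi 0)]
      p.coverageIntegrand (kernelLaplace (interferenceKernel p X P)) τ U a n := by
  have h := p.ae_of_ae_lossDensity
    ((hX.lossDensity_absolutelyContinuous a).ae_le hX.condDistrib_interference)
  filter_upwards [h] with l hl
  rcases hl with hl | hl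
  · simp [Params.coverageIntegrand, hl]
  · have h2 : ∀ s, laplace p X P s l = kernelLaplace (interferenceKernel p X P) s l := fun s => by
      rw [laplace, hl]
      rfl
    rw [Params.coverageIntegrand, h2]
    rfl

lemma IsNetwork.integrableOn_coverageIntegrand (hX : IsNetwork p X P) {τ : ℝ} (hτ : 0 < τ) (U : ℕ)
    (a : Link) (n : ℕ) :
    IntegrableOn (p.coverageIntegrand (laplace p X P) τ U a n) (Set.Ioi 0) :=
  have := hX.isMarkovKernel
  (p.integrableOn_coverageIntegrand (interferenceKernel p X P) hτ U a n).congr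
    (hX.coverageIntegrand_ae_eq τ U a n).symm

lemma IsNetwork.ζ_nonneg (hX : IsNetwork p X P) (a : Link) {U : ℕ} (hU : 1 ≤ U) :
    0 ≤ p.ζ (p.η a) U := by
  have h : ENNReal.ofReal (1 - p.ζ (p.η a) U) ≤ ENNReal.ofReal 1 := by
    rw [← hX.penaltyMU_law_zero a U hU, ENNReal.ofReal_one]
    exact prob_le_one
  have := (ENNReal.ofReal_le_ofReal_iff zero_le_one).1 h
  linarith

lemma IsNetwork.coverageTerm_eq (hX : IsNetwork p X P) {τ : ℝ} (hτ : 0 < τ) {U : ℕ} (hU : 1 ≤ U)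
    (a : Link) : p.coverageTerm (laplace p X P) τ U a = (ENNReal.ofReal (p.ζ (p.η a) U) *
      coverLaw p X P {y | (y, (1 : ℝ)) ∈ p.coverSet τ a U}).toReal := by
  have := hX.isProbabilityMeasure_load
  have := hX.isMarkovKernel
  rw [hX.coverLaw_eq, p.compProd_coverSet (interferenceKernel p X P) hτ a hU, ENNReal.toReal_mul,
    ENNReal.toReal_ofReal (hX.ζ_nonneg a hU), p.toReal_lintegral_coverFactor _ hτ, Params.coverageTerm]
  simp only [integral_congr_ae (hX.coverageIntegrand_ae_eq τ U a _)]
  ring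

instance : IsFiniteMeasure (coverLaw p X P) := by
  unfold coverLaw
  infer_instance

lemma IsNetwork.S_eq (hX : IsNetwork p X P) {τ : ℝ} (hτ : 0 < τ) {U : ℕ} (hU : 1 ≤ U) :
    p.S (laplace p X P) τ U =
      (ENNReal.ofReal (p.ζ (p.η .los) U) *
          coverLaw p X P {y | (y, (1 : ℝ)) ∈ p.coverSet τ .los U} +
        ENNReal.ofReal (p.ζ (p.η .nlos) U) *
          coverLaw p X P {y | (y, (1 : ℝ)) ∈ p.coverSet τ .nlos U}).toReal := by
  rw [Params.S, hX.coverageTerm_eq hτ hU, hX.coverageTerm_eq hτ hU, ENNReal.toReal_add]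
  · exact ENNReal.mul_ne_top ENNReal.ofReal_ne_top (measure_ne_top _ _)
  · exact ENNReal.mul_ne_top ENNReal.ofReal_ne_top (measure_ne_top _ _)

lemma IsNetwork.real_inter_covered_MU (hX : IsNetwork p X P) {τ : ℝ} (hτ : 0 < τ) {U : ℕ}
    (hU : 1 ≤ U) : P.real ({ω | servedUsers p X ω = U} ∩ covered p X (penaltyMU X) τ) =
      P.real {ω | servedUsers p X ω = U} * p.S (laplace p X P) τ U := by
  have hm : ∀ a, Measurable (penaltyMU X a U) := fun a => hX.measurable (.penaltyMU a U)
  have h : ∀ a, ((coverLaw p X P).prod (P.map (penaltyMU X a U))) (p.coverSet τ a U) =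
      ENNReal.ofReal (p.ζ (p.η a) U) * coverLaw p X P {y | (y, (1 : ℝ)) ∈ p.coverSet τ a U} :=
    fun a => by
    have := Measure.isProbabilityMeasure_map (μ := P) (hm a).aemeasurable
    refine p.prod_coverSet_bernoulli _ ?_ ?_ τ a U
    · rw [Measure.map_apply (hm a) (measurableSet_singleton _)]
      exact hX.penaltyMU_law_one a U hU
    · rw [Measure.map_apply (hm a) (measurableSet_singleton _)]
      exact hX.penaltyMU_law_zero a U hU
  rw [measureReal_def, hX.measure_inter_covered (fun a => measurable_penaltyMU a U), h, h,
    ENNReal.toReal_mul, ← hX.S_eq hτ hU]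
  rfl

lemma IsNetwork.le_real_inter_covered_ZF (hX : IsNetwork p X P) {τ : ℝ} (hτ : 0 < τ) {U : ℕ}
    (hU : 1 ≤ U) : P.real {ω | servedUsers p X ω = U} * p.S (laplace p X P) τ U ≤
      P.real ({ω | servedUsers p X ω = U} ∩ covered p X (penaltyZF X) τ) := by
  have hm : ∀ a, Measurable (penaltyMU X a U) := fun a => hX.measurable (.penaltyMU a U)
  have hm' : ∀ a, Measurable (penaltyZF X a U) := fun a => hX.measurable (.penaltyZF a U)
  have h : ∀ a, ENNReal.ofReal (p.ζ (p.η a) U) *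
      coverLaw p X P {y | (y, (1 : ℝ)) ∈ p.coverSet τ a U} ≤
        ((coverLaw p X P).prod (P.map (penaltyZF X a U))) (p.coverSet τ a U) := fun a => by
    have := Measure.isProbabilityMeasure_map (μ := P) (hm' a).aemeasurable
    refine p.le_prod_coverSet _ (ν := P.map (penaltyMU X a U)) ?_ (fun z => ?_) τ a U
    · rw [Measure.map_apply (hm a) (measurableSet_singleton _)]
      exact hX.penaltyMU_law_one a U hU
    · rw [Measure.map_apply (hm a) measurableSet_Ioi, Measure.map_apply (hm' a) measurableSet_Ioi]
      exact hX.penaltyZF_dominates a U hU z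
  rw [measureReal_def, measureReal_def, hX.S_eq hτ hU, ← ENNReal.toReal_mul]
  refine ENNReal.toReal_mono (measure_ne_top _ _) ?_
  rw [hX.measure_inter_covered fun a => measurable_penaltyZF a U]
  gcongr
  · exact h _
  · exact h _

/-- Conditioning on U served users is meaningful since the tagged station has exactly U users with
positive probability, and U ≤ `UM` then leaves this number unchanged. -/
lemma IsNetwork.servedUsers_pos (hX : IsNetwork p X P) {U : ℕ} (hU : 1 ≤ U) (hUM : U ≤ p.UM) :
    0 < P.real {ω | servedUsers p X ω = U} := by
  refine ENNReal.toReal_pos ?_ (measure_ne_top _ _)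
  have h1 : P {ω | servingLoad X ω = U} ≤ P {ω | servedUsers p X ω = U} :=
    measure_mono fun ω hω => by
      have h2 : servingLoad X ω = U := hω
      change min p.UM (servingLoad X ω) = U
      omega
  rw [hX.servingLoad_law] at h1
  exact (lt_of_lt_of_le (ENNReal.ofReal_pos.2 (p.κServing_pos hU)) h1).ne'

lemma IsNetwork.real_covered (hX : IsNetwork p X P) {pen : Link → ℕ → Ω → ℝ}
    (hpen : ∀ a U, Measurable[sourceSigma X {s | 11 ≤ s.kind}] (pen a U)) (τ : ℝ) :
    P.real (covered p X pen τ) =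
      ∑ U ∈ Finset.Icc 1 p.UM, P.real ({ω | servedUsers p X ω = U} ∩ covered p X pen τ) := by
  have h1 : covered p X pen τ =ᵐ[P] ⋃ U ∈ Finset.Icc 1 p.UM,
      ({ω | servedUsers p X ω = U} ∩ covered p X pen τ) := by
    rw [Filter.eventuallyEq_set]
    filter_upwards [hX.ae_servedUsers_mem] with ω hω
    simp only [Set.mem_iUnion]
    constructor
    · intro h
      exact ⟨_, hω, rfl, h⟩
    · rintro ⟨U, _, _, h⟩
      exact h
  rw [measureReal_congr h1, measureReal_biUnion_finset]
  · intro U _ V _ hUV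
    exact Set.disjoint_left.2 fun ω h2 h3 => hUV (h2.1.symm.trans h3.1)
  · exact fun U _ => hX.measurableSet_inter_covered (fun a => hpen a U) τ

lemma IsNetwork.integral_servedUsers (hX : IsNetwork p X P) (g : ℕ → ℝ) :
    ∫ ω, g (servedUsers p X ω) ∂P =
      ∑ U ∈ Finset.Icc 1 p.UM, P.real {ω | servedUsers p X ω = U} * g U := by
  have h1 : (fun ω => g (servedUsers p X ω)) =ᵐ[P] fun ω =>
      ∑ U ∈ Finset.Icc 1 p.UM, {ω | servedUsers p X ω = U}.indicator (fun _ => g U) ω := by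
    filter_upwards [hX.ae_servedUsers_mem] with ω hω
    simp only [Set.indicator_apply, Set.mem_ofPred_eq]
    rw [Finset.sum_ite_eq, if_pos hω]
  rw [integral_congr_ae h1, integral_finsetSum _ fun U _ =>
    (integrable_const _).indicator (hX.measurableSet_servedUsers U)]
  refine Finset.sum_congr rfl fun U _ => ?_
  rw [integral_indicator_const _ (hX.measurableSet_servedUsers U), smul_eq_mul]

end Network

end

end MmWave

theorem theorem3 {Ω : Type*} [MeasurableSpace Ω] (P : Measure Ω) [IsProbabilityMeasure P]
    (p : MmWave.Params) (X : (s : MmWave.Source) → Ω → s.Space)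
    (hX : MmWave.IsNetwork p X P) :
    -- coverage with the Bernoulli zero forcing penalty, given the number of served users
    (∀ τ : ℝ, 0 < τ → ∀ U : ℕ, 1 ≤ U → U ≤ p.UM →
      (∀ a n, 1 ≤ n → n ≤ p.η a →
        IntegrableOn (p.coverageIntegrand (MmWave.laplace p X P) τ U a n) (Set.Ioi 0)) ∧
      P[|{ω | MmWave.servedUsers p X ω = U}].real
          (MmWave.covered p X (MmWave.penaltyMU X) τ) =
        p.S (MmWave.laplace p X P) τ U ∧
      p.S (MmWave.laplace p X P) τ U ≤
        P[|{ω | MmWave.servedUsers p X ω = U}].real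
          (MmWave.covered p X (MmWave.penaltyZF X) τ)) ∧
    -- coverage
    (∀ τ : ℝ, 0 < τ →
      P.real (MmWave.covered p X (MmWave.penaltyMU X) τ) =
        ∫ ω, p.S (MmWave.laplace p X P) τ (MmWave.servedUsers p X ω) ∂P ∧
      ∫ ω, p.S (MmWave.laplace p X P) τ (MmWave.servedUsers p X ω) ∂P ≤
        P.real (MmWave.covered p X (MmWave.penaltyZF X) τ)) ∧
    -- single path: the Laplace transform of the interference in closed form
    ((∀ a, p.η a = 1) → ∀ᵐ l ∂(P.map (MmWave.servingLoss p X)), ∀ s : ℝ, 0 ≤ s →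
      MmWave.laplace p X P s l = p.laplaceSinglePath s l) ∧
    -- any number of paths: lower and upper bounds
    (∀ᵐ l ∂(P.map (MmWave.servingLoss p X)), ∀ s : ℝ, 0 ≤ s →
      p.laplaceLower s l ≤ MmWave.laplace p X P s l ∧
        MmWave.laplace p X P s l ≤ p.laplaceUpper s l) := by
  have hcond : ∀ (U : ℕ) (A : Set Ω), P[|{ω | MmWave.servedUsers p X ω = U}].real A =
      (P.real {ω | MmWave.servedUsers p X ω = U})⁻¹ * P.real ({ω | MmWave.servedUsers p X ω = U} ∩ A) :=
    fun U A => by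
    rw [measureReal_def, cond_apply (hX.measurableSet_servedUsers U), ENNReal.toReal_mul,
      ENNReal.toReal_inv]
    rfl
  refine ⟨fun τ hτ U hU hUM => ⟨fun a n _ _ => hX.integrableOn_coverageIntegrand hτ U a n, ?_, ?_⟩,
    fun τ hτ => ⟨?_, ?_⟩, fun hη => ?_, ?_⟩
  · rw [hcond, hX.real_inter_covered_MU hτ hU,
      inv_mul_cancel_left₀ (hX.servedUsers_pos hU hUM).ne']
  · rw [hcond, le_inv_mul_iff₀ (hX.servedUsers_pos hU hUM)]
    exact hX.le_real_inter_covered_ZF hτ hU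
  · rw [hX.real_covered (fun a U => MmWave.measurable_penaltyMU a U),
      hX.integral_servedUsers fun U => p.S (MmWave.laplace p X P) τ U]
    exact Finset.sum_congr rfl fun U hU => hX.real_inter_covered_MU hτ (Finset.mem_Icc.1 hU).1
  · rw [hX.real_covered (fun a U => MmWave.measurable_penaltyZF a U),
      hX.integral_servedUsers fun U => p.S (MmWave.laplace p X P) τ U]
    exact Finset.sum_le_sum fun U hU => hX.le_real_inter_covered_ZF hτ (Finset.mem_Icc.1 hU).1
  · have := hX.isProbabilityMeasure_load
    filter_upwards [hX.ae_laplace_eq] with l hl s hs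
    rw [hl.2 s, p.laplaceSinglePath_eq hX.isLoadLaw hη hs hl.1]
  · have := hX.isProbabilityMeasure_load
    filter_upwards [hX.ae_laplace_eq] with l hl s hs
    rw [hl.2 s]
    exact ⟨p.laplaceLower_le hX.isLoadLaw hs hl.1, p.le_laplaceUpper hX.isLoadLaw hs hl.1⟩
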